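/- **Setting.** *Algorithms.* Values are the integers together with two errors $\varepsilon_{\mathrm{rdom}}<\varepsilon_{\mathrm{mem}}$; the operators ($+,-,\times$, floor division and modulo with $a/0=a\bmod 0=0$, comparisons, logical operators, $\mathrm{select}$, $\min$, $\max$) are strict and return the greatest error among their arguments. An algorithm $P$ is a list of func definitions, the last of which is the output, with integer parameters. A func $f$ of arity $n$ has a pure stage $f[x_1,\dots,x_n]=e$ (stage $0$) followed by update stages $\mathbf{rdom}(r_1=I_1,\dots,r_k=I_k)\ \mathbf{in}\ (\vec e\,)\leftarrow e_b\ \mathbf{if}\ e_p$ with intervals $I_i=(e_i^{\min},e_i^{\mathrm{len}})$. A single point update shadows the definition $f$ before it, so that its value at $\vec x$ is $\mathrm{select}(\vec e=\vec x\wedge e_p,\,e_b,\,f[\vec x])$, and a stage is the sequence of the point updates of its rdom in lexicographic order ($r_1$ innermost); if some rdom length is negative, all points are $\varepsilon_{\mathrm{rdom}}$. $P$ is *valid* if names are distinct and in scope, rdom bounds are *startup expressions* (no func accesses, no variables but parameters), the pure stage refers to earlier funcs only, update stages to earlier funcs and to $f$, always with the right arity, and *syntactic separation* holds: if $x_d$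 occurs in a stage of $f$, then its left-hand side has $x_d$ in position $d$, and so does every access to $f$ in it. An input $z$ consists of the values of the parameters and of an output window $R(z)$, a box with nonnegative side lengths; $P(z)$ is the restriction of the output func to $R(z)$. *Target programs* $T$ are built from no-ops, assertions, sequencing, allocations of buffers, assignments to buffer points, conditionals, $\mathbf{let}$, serial and parallel $\mathbf{for}$ loops, and labels. Reads and writes outside of the allocated bounds fail, as do loops of negative length; freshly allocated points hold $\varepsilon_{\mathrm{mem}}$; the steps of the iterations of a parallel loop are interleaved arbitrarily. $T$ may contain *holes*: the allocation bounds $?^{\mathrm{mem}}f$ of each func $f$ and the compute bounds $?^{\mathrm{cpu}}f^{i,j}$ of each stage $i$ in each specialization $j$ of $f$ (the last stage has the same compute bounds in all specializations). Each of them is a box given by a minimum and a length in each dimension. *Lowering* $\mathcal L(P)$ emits for each func in order an allocation with bounds $?^{\mathrm{mem}}f$ and then, for each stage $i$, serial loops over those $x_d$ that the left-hand side of the stage has in position $d$, ranging over $?^{\mathrm{cpu}}f^i$ in dimension $d$ ($x_1$ innermost), around serial loops over the rdom ($r_1$ innermost), around $\mathbf{if}\ e_p\ \mathbf{then}\ f^i[\vec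 e\,]\leftarrow e_b$. The former loops are the *pure loops*, the latter the *reduction loops*. *Bounds.* A *hole substitution* $\Gamma$ fills every hole by a startup expression, which may also use the bounds of the output window. The *bounds query* $\mathcal B(T)$ holds for $\Gamma$ at $z$ if, with the holes evaluated at $z$ and for arbitrary integer values of the funcs: all compute bounds have nonnegative lengths; $R(z)\subseteq{?^{\mathrm{cpu}}}$ of the last stage of the output func; asserted conditions hold; every loop that is reached has nonnegative length; every point read or written is in the allocation bounds of its func; every access that occurs in a branch condition, in a $\mathbf{let}$ or in an index is in the compute bounds of the accessed func and version, and so are all accesses on the right-hand side of every assignment to a point in the compute bounds of the version it writes; inside a stage of $f$ with a nonempty list of rdom variables, those of these accesses that go to $f$ lie in the compute bounds of that stage as well; and the compute bounds of each update stage that is reached are contained in those of the previous stage. $\mathrm{BI}(T)$ is the set of all completions $\Gamma T$ for which the query holds at every input. *Confluence.* $T$ is *confluent* with $P$ if for all $Q\in\mathrm{BI}(T)$ and all inputs $z$: some value of $P(z)$ is an error, or $Q$ may fail an assertion on $z$, or $Q$ can run to completion on $z$, every execution of $Q$ on $z$ completes, and then the output buffer agrees with $P(z)$ on $R(z)$.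 *Schedules.* A specialization of $f$ by startup expressions $e_1,\dots,e_m$ replaces the code $s$ of $f$ by $\mathbf{if}\ e_1\ \mathbf{then}\ s_1\ \mathbf{else\ if}\ e_2\ \mathbf{then}\ s_2\cdots\mathbf{else}\ s_0$, where $s_j$ is $s$ with its stages attached to specialization $j$. Loop directives act on a loop $\ell$, named by func, stage, specialization and variable: - $\mathrm{split}(\ell,x_o,x_i,e^{\mathrm{fac}},\varphi)$ replaces $\mathbf{for}\ x\ \mathbf{in}\ [m,n]\ \mathbf{do}\ s$ (where $[m,n]$ has minimum $m$ and length $n$) by serial loops $\mathbf{for}\ x_o\ \mathbf{in}\ [0,\lceil n/e^{\mathrm{fac}}\rceil]\ \mathbf{do\ for}\ x_i\ \mathbf{in}\ [0,e^{\mathrm{fac}}]\ \mathbf{do}\ s'$. Here $s'$ is $s$ in which, below all loops directly nested and all $\mathbf{let}$s not using $x$, one inserts: for the *guard* strategy, $\mathbf{let}\ x=m+x_i+e^{\mathrm{fac}}x_o$ around the conditional $x<m+n$; for *shift*, $\mathbf{let}\ x=m+x_i+\min(e^{\mathrm{fac}}x_o,\max(0,n-e^{\mathrm{fac}}))$; for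 *round*, $\mathbf{let}\ x=m+x_i+e^{\mathrm{fac}}x_o$. Side conditions: $e^{\mathrm{fac}}$ is a startup expression (it may use the window) whose value is positive on every input; shift and round are applied to stage $0$ only. - $\mathrm{fuse}(\ell,y)$ replaces $\mathbf{for}\ x_1\ \mathbf{in}\ [m_1,n_1]\ \mathbf{do\ for}\ x_2\ \mathbf{in}\ [m_2,n_2]\ \mathbf{do}\ s$ by the serial loop $\mathbf{for}\ y\ \mathbf{in}\ [0,n_1n_2]\ \mathbf{do}\ s'$ with $x_1=m_1+\lfloor y/n_2\rfloor$ and $x_2=m_2+(y\bmod n_2)$ bound in $s'$ in the same way; both loops must be pure, or both reduction loops. - $\mathrm{swap}(\ell)$ interchanges $\ell$ with the loop directly inside it; at least one of the two must be pure. - $\mathrm{traverse}(\ell,\tau)$ makes the pure loop $\ell$ serial or parallel, according to $\tau$. New variables must not occur in the stage, and a loop that replaces pure loops is pure, one that replaces reduction loops is a reduction loop. **Lemma (Loop phase is sound).** Let $P$ be a valid algorithm, let $T$ be the result of lowering $P$ and applying any valid sequence of specializations (at most one per func) followed by any sequence of valid loop directives, and let $s$ be a loop directive that is valid for $T$. Put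 $T'=\mathcal S(s,T)$. 1. $T'$ is confluent with $P$. 2. Let $s$ be a split of a loop $\ell$ and let $\Gamma$ be a hole substitution. At every input $z$ at which the length of $\ell$ (filled by $\Gamma$) is nonnegative, $\mathcal B(T')$ implies $\mathcal B(T)$. If the strategy is guard, then at every input at which $\mathcal B(T)$ holds for $\Gamma$, $\mathcal B(T')$ holds too, and the execution traces (sequences of store actions) of $\Gamma T'$ are traces of $\Gamma T$; the two have the same set of traces if $\ell$ is serial in $T$. 3. Let $s$ be a fuse of a loop $\ell$ with the loop directly inside it and let $\Gamma$ be a hole substitution. At every input at which the lengths of both loops are nonnegative, $\mathcal B(T')$ implies $\mathcal B(T)$. At every input at which $\mathcal B(T)$ holds for $\Gamma$, $\mathcal B(T')$ holds too, and the traces of $\Gamma T'$ are traces of $\Gamma T$; the two have the same set of traces if both loops are serial in $T$. 4. Let $\ell$ be a pure loop of a stage of $f$ no loop of which has been split by shift or round in $T$. In every $Q\in\mathrm{BI}(T)$, on every input, whenever $\ell$ is executed, a point of $f$ that is written by one iteration of $\ell$ is neither read nor written by any other iteration. -/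

import Mathlib

namespace Halide

/-! ## Values, operators, expressions -/

/-- Values: the integers together with the error values `ε_rdom < ε_mem`. -/
inductive Val
  | int (i : ℤ)
  | errRdom
  | errMem
  deriving DecidableEq

def Val.IsErr (v : Val) : Prop := v = .errRdom ∨ v = .errMem

def Val.toInt : Val → ℤ
  | .int i => i
  | _ => 0

inductive Op
  | add | sub | mul | div | mod
  | or | and | not | lt | gt | eq
  | select | min | max
  deriving DecidableEq

def Op.arity : Op → ℕ
  | .not => 1
  | .select => 3
  | _ => 2

/-- The operators on integers. All of them are total: division and modulo by zero are zero. Logical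
operators read zero as false and every other integer as true, and return `1` for true. -/
def Op.apply : (o : Op) → (Fin o.arity → ℤ) → ℤ
  | .add, a => a (0 : Fin 2) + a (1 : Fin 2)
  | .sub, a => a (0 : Fin 2) - a (1 : Fin 2)
  | .mul, a => a (0 : Fin 2) * a (1 : Fin 2)
  | .div, a => if a (1 : Fin 2) = 0 then 0 else Int.fdiv (a (0 : Fin 2)) (a (1 : Fin 2))
  | .mod, a => if a (1 : Fin 2) = 0 then 0 else Int.fmod (a (0 : Fin 2)) (a (1 : Fin 2))
  | .or, a => if a (0 : Fin 2) ≠ 0 ∨ a (1 : Fin 2) ≠ 0 then 1 else 0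
  | .and, a => if a (0 : Fin 2) ≠ 0 ∧ a (1 : Fin 2) ≠ 0 then 1 else 0
  | .not, a => if a (0 : Fin 1) = 0 then 1 else 0
  | .lt, a => if a (0 : Fin 2) < a (1 : Fin 2) then 1 else 0
  | .gt, a => if a (1 : Fin 2) < a (0 : Fin 2) then 1 else 0
  | .eq, a => if a (0 : Fin 2) = a (1 : Fin 2) then 1 else 0
  | .select, a => if a (0 : Fin 3) ≠ 0 then a (1 : Fin 3) else a (2 : Fin 3)
  | .min, a => Min.min (a (0 : Fin 2)) (a (1 : Fin 2))
  | .max, a => Max.max (a (0 : Fin 2)) (a (1 : Fin 2))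

/-- An operation with an error among its arguments returns the greatest of these errors. -/
def Op.eval (o : Op) (a : Fin o.arity → Val) : Val :=
  if ∃ i, a i = .errMem then .errMem
  else if ∃ i, a i = .errRdom then .errRdom
  else .int (o.apply fun i => (a i).toInt)

/-- Variables, distinguished by their definition sites: parameters of the pipeline, the variables
`x_d^min` and `x_d^len` of the output window, pure variables, and reduction variables. The variables
of the loops of a target program are pure (for the pure loops) or reduction variables (for all other
loops). -/
inductive Var
  | par (k : ℕ)
  | wmin (d : ℕ)
  | wlen (d : ℕ)
  | pure (x : ℕ)
  | red (r : ℕ)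
  deriving DecidableEq

def Var.IsPure : Var → Prop
  | .pure _ => True
  | _ => False

def Var.IsRed : Var → Prop
  | .red _ => True
  | _ => False

/-- Expressions whose func accesses carry labels from `L` and whose holes are named by `H`. -/
inductive Expr (L H : Type) : Type
  | const (c : ℤ)
  | var (v : Var)
  | acc (f : ℕ) (l : L) (n : ℕ) (args : Fin n → Expr L H)
  | op (o : Op) (args : Fin o.arity → Expr L H)
  | hole (h : H)

abbrev Env := Var → Val

/-- The value of an expression, where `A` gives the values of the funcs and `η` those of the holes. -/
def Expr.eval {L H : Type} (ρ : Env) (A : ℕ → List Val → Val) (η : H → Val) : Expr L H → Val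
  | .const c => .int c
  | .var v => ρ v
  | .acc f _ _ args => A f (List.ofFn fun i => (args i).eval ρ A η)
  | .op o args => o.eval fun i => (args i).eval ρ A η
  | .hole h => η h

/-- The variables that occur in an expression. -/
def Expr.vars {L H : Type} : Expr L H → List Var
  | .var v => [v]
  | .acc _ _ _ args => (List.ofFn fun i => (args i).vars).flatten
  | .op _ args => (List.ofFn fun i => (args i).vars).flatten
  | _ => []

/-- `t.Sub e`: the expression `t` occurs in the expression `e`. -/
def Expr.Sub {L H : Type} (t : Expr L H) : Expr L H → Prop
  | .const c => t = .const c
  | .var v => t = .var v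
  | .acc f l n args => t = .acc f l n args ∨ ∃ i, t.Sub (args i)
  | .op o args => t = .op o args ∨ ∃ i, t.Sub (args i)
  | .hole h => t = .hole h

/-- Startup expressions: no func accesses, and no variables but the `m` parameters and the bounds of
the `n`-dimensional output window (in the algorithm language, where there is no window, `n = 0`). -/
def Expr.Startup {L H : Type} (m n : ℕ) (e : Expr L H) : Prop :=
  (∀ f l k args, ¬ (Expr.acc f l k args).Sub e) ∧
  ∀ v ∈ e.vars, (∃ k < m, v = .par k) ∨ ∃ d < n, v = .wmin d ∨ v = .wlen d

/-! ## Algorithms -/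

abbrev AExpr := Expr Unit Empty

/-- An update stage `rdom(r_1 = I_1, …) in (lhs) ← rhs if pred` of an `n`-dimensional func. The rdom
lists `(r, e^min, e^len)`; its first variable is the innermost one. -/
structure Update (n : ℕ) where
  rdom : List (ℕ × AExpr × AExpr)
  lhs : Fin n → AExpr
  rhs : AExpr
  pred : AExpr

/-- The expressions of a stage, apart from the bounds of its rdom. -/
def Update.exprs {n : ℕ} (U : Update n) : List AExpr := U.rhs :: U.pred :: List.ofFn U.lhs

structure Func where
  name : ℕ
  arity : ℕ
  vars : Fin arity → ℕ
  body : AExpr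
  updates : List (Update arity)

/-- All stages; the pure stage `e` is `rdom() in (x_1, …, x_n) ← e if 1`. -/
def Func.stages (F : Func) : List (Update F.arity) :=
  ⟨[], fun d => .var (.pure (F.vars d)), F.body, .const 1⟩ :: F.updates

/-- A pipeline with `nparams` parameters; the output func is the last one defined. -/
structure Alg where
  nparams : ℕ
  defs : List Func
  out : Func

def Alg.funcs (P : Alg) : List Func := P.defs ++ [P.out]

/-- The syntactic separation restriction for one stage. -/
def Func.Separated (F : Func) (U : Update F.arity) : Prop :=
  ∀ d : Fin F.arity, (∃ e ∈ U.exprs, Var.pure (F.vars d) ∈ e.vars) →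
    U.lhs d = .var (.pure (F.vars d)) ∧
    ∀ e ∈ U.exprs, ∀ l n args, (Expr.acc F.name l n args).Sub e →
      ∀ h : (d : ℕ) < n, args ⟨d, h⟩ = .var (.pure (F.vars d))

structure Alg.Valid (P : Alg) : Prop where
  func_names : (P.funcs.map Func.name).Nodup
  pure_names : ∀ F ∈ P.funcs, Function.Injective F.vars
  red_names : ∀ F ∈ P.funcs, ∀ U ∈ F.updates, (U.rdom.map Prod.fst).Nodup
  rdom_startup : ∀ F ∈ P.funcs, ∀ U ∈ F.updates, ∀ b ∈ U.rdom,
    b.2.1.Startup P.nparams 0 ∧ b.2.2.Startup P.nparams 0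
  separated : ∀ F ∈ P.funcs, ∀ U ∈ F.stages, F.Separated U
  /-- Every variable is in scope. -/
  in_scope : ∀ F ∈ P.funcs, ∀ U ∈ F.stages, ∀ e ∈ U.exprs, ∀ v ∈ e.vars,
    (∃ k < P.nparams, v = .par k) ∨ (∃ d, v = .pure (F.vars d)) ∨ ∃ b ∈ U.rdom, v = .red b.1
  /-- The pure stage refers to earlier funcs only, with the right number of arguments. -/
  body_refs : ∀ pre F post, P.funcs = pre ++ F :: post →
    ∀ g l n args, (Expr.acc g l n args).Sub F.body → ∃ G ∈ pre, G.name = g ∧ G.arity = n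
  /-- Update stages refer to earlier funcs and to the func itself. -/
  update_refs : ∀ pre F post, P.funcs = pre ++ F :: post →
    ∀ U ∈ F.updates, ∀ e ∈ U.exprs, ∀ g l n args, (Expr.acc g l n args).Sub e →
      ∃ G ∈ pre ++ [F], G.name = g ∧ G.arity = n

/-- An input: the values of `m` parameters and an `n`-dimensional output window. -/
structure Input (m n : ℕ) where
  params : Fin m → ℤ
  lo : Fin n → ℤ
  len : Fin n → ℕ

/-- The points of the output window `R(z)`. -/
def Input.Window {m n : ℕ} (z : Input m n) (p : Fin n → ℤ) : Prop :=
  ∀ d, z.lo d ≤ p d ∧ p d < z.lo d + z.len d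

/-- The initial environment. Variables that are not bound read as an error. -/
def Input.env {m n : ℕ} (z : Input m n) : Env
  | .par k => if h : k < m then .int (z.params ⟨k, h⟩) else .errMem
  | .wmin d => if h : d < n then .int (z.lo ⟨d, h⟩) else .errMem
  | .wlen d => if h : d < n then .int (z.len ⟨d, h⟩) else .errMem
  | _ => .errMem

/-! ## Semantics of algorithms

A func denotes a function from points to values. Since index expressions may evaluate to errors,
points are lists of values. -/

abbrev FunVal := List Val → Val

/-- The environment in which a stage of `F` is evaluated at the point `c`. -/
def Func.env (F : Func) (ρ : Env) (R : ℕ → Val) (c : List Val) : Env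
  | .pure x =>
    match (List.finRange F.arity).find? (fun d => F.vars d = x) with
    | some d => c.getD d .errMem
    | none => .errMem
  | .red r => R r
  | v => ρ v

/-- A single point update shadows the previous definition `prev` of the func:
its value at `c` is that of `select(lhs = c ∧ pred, rhs, prev[c])`. -/
def Func.pointUpdate (F : Func) (U : Update F.arity) (ρ : Env) (G : ℕ → FunVal)
    (R : ℕ → Val) (prev : FunVal) : FunVal := fun c =>
  let ev : AExpr → Val := Expr.eval (F.env ρ R c) (fun g => if g = F.name then prev else G g) Empty.elim
  let cond := (List.finRange F.arity).foldr
    (fun d b => Op.and.eval ![Op.eq.eval ![ev (U.lhs d), c.getD d .errMem], b]) (ev U.pred)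
  Op.select.eval ![cond, ev U.rhs, prev c]

/-- Unroll a reduction domain, given by `(r, min, len)` from the outermost to the innermost variable. -/
def unroll (step : (ℕ → Val) → FunVal → FunVal) :
    List (ℕ × ℤ × ℤ) → (ℕ → Val) → FunVal → FunVal
  | [], R, prev => step R prev
  | (r, lo, len) :: rest, R, prev =>
    (List.range len.toNat).foldl
      (fun g t => unroll step rest (Function.update R r (.int (lo + t))) g) prev

def Func.update (F : Func) (ρ : Env) (G : ℕ → FunVal) (prev : FunVal) (U : Update F.arity) : FunVal :=
  let bound : AExpr → ℤ := fun e => (e.eval ρ G Empty.elim).toInt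
  let dom := U.rdom.map fun b => (b.1, bound b.2.1, bound b.2.2)
  if ∃ b ∈ dom, b.2.2 < 0 then fun _ => .errRdom
  else unroll (F.pointUpdate U ρ G) dom.reverse (fun _ => .errMem) prev

/-- The func denoted by `F`, given the funcs `G` defined before. -/
def Func.val (F : Func) (ρ : Env) (G : ℕ → FunVal) : FunVal :=
  F.updates.foldl (F.update ρ G)
    fun c => F.body.eval (F.env ρ (fun _ => .errMem) c) G Empty.elim

/-- `P(z)(p)`. -/
def Alg.run (P : Alg) (z : Input P.nparams P.out.arity) (p : Fin P.out.arity → ℤ) : Val :=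
  P.funcs.foldl (fun G F => Function.update G F.name (F.val z.env G)) (fun _ _ => .errMem)
    P.out.name (List.ofFn fun d => .int (p d))

/-! ## The target language -/

/-- The version of a func after one of its stages: after the last stage (a version that is common to
all specializations), or after an earlier stage `i` in specialization `j`. -/
inductive Ver
  | mid (i j : ℕ)
  | last
  deriving DecidableEq

inductive Side
  | min
  | len
  deriving DecidableEq

/-- Bounds holes: minimum and length of the allocation bounds `?^mem f_d` and of the compute bounds
`?^cpu f_d` (for a version of `f`) in dimension `d`. -/
inductive Hole
  | mem (f d : ℕ) (s : Side)
  | cpu (f : ℕ) (v : Ver) (d : ℕ) (s : Side)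
  deriving DecidableEq

inductive Order
  | serial
  | parallel
  deriving DecidableEq

/-- The label of the code of a stage: the func and its arity, the indices of the stage and of the
specialization, the version that the stage produces, and whether it has a reduction domain. -/
structure Stage where
  func : ℕ
  arity : ℕ
  idx : ℕ
  spec : ℕ
  ver : Ver
  reductive : Bool

inductive Label
  | func (f : ℕ)
  | spec (f j : ℕ)
  | stage (st : Stage)

/-- Statements; every loop and every allocation has bounds `(e^min, e^len)`. -/
inductive Stmt (H : Type) : Type
  | nop
  | assert (e : Expr Ver H)
  | seq (s₁ s₂ : Stmt H)
  | alloc (f n : ℕ) (I : Fin n → Expr Ver H × Expr Ver H)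
  | assign (f : ℕ) (v : Ver) (n : ℕ) (args : Fin n → Expr Ver H) (e : Expr Ver H)
  | ite (e : Expr Ver H) (s₁ s₂ : Stmt H)
  | loop (τ : Order) (x : Var) (lo len : Expr Ver H) (s : Stmt H)
  | letIn (x : Var) (e : Expr Ver H) (s : Stmt H)
  | label (l : Label) (s : Stmt H)

/-- Target programs with `m` parameters and an `n`-dimensional output func. With `H = Hole` these are
the programs with holes, with `H = Empty` those without. -/
structure Prog (H : Type) (m n : ℕ) where
  out : ℕ
  body : Stmt H

def Expr.fill (Γ : Hole → Expr Ver Empty) : Expr Ver Hole → Expr Ver Empty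
  | .const c => .const c
  | .var v => .var v
  | .acc f v n args => .acc f v n fun i => (args i).fill Γ
  | .op o args => .op o fun i => (args i).fill Γ
  | .hole h => Γ h

def Stmt.fill (Γ : Hole → Expr Ver Empty) : Stmt Hole → Stmt Empty
  | .nop => .nop
  | .assert e => .assert (e.fill Γ)
  | .seq s₁ s₂ => .seq (s₁.fill Γ) (s₂.fill Γ)
  | .alloc f n I => .alloc f n fun d => ((I d).1.fill Γ, (I d).2.fill Γ)
  | .assign f v n args e => .assign f v n (fun i => (args i).fill Γ) (e.fill Γ)
  | .ite e s₁ s₂ => .ite (e.fill Γ) (s₁.fill Γ) (s₂.fill Γ)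
  | .loop τ x lo len s => .loop τ x (lo.fill Γ) (len.fill Γ) (s.fill Γ)
  | .letIn x e s => .letIn x (e.fill Γ) (s.fill Γ)
  | .label l s => .label l (s.fill Γ)

def Prog.fill {m n : ℕ} (T : Prog Hole m n) (Γ : Hole → Expr Ver Empty) : Prog Empty m n :=
  ⟨T.out, T.body.fill Γ⟩

/-- `t.Sub s`: the statement `t` occurs in the statement `s`. -/
def Stmt.Sub {H : Type} (t : Stmt H) : Stmt H → Prop
  | .seq s₁ s₂ => t = .seq s₁ s₂ ∨ t.Sub s₁ ∨ t.Sub s₂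
  | .ite e s₁ s₂ => t = .ite e s₁ s₂ ∨ t.Sub s₁ ∨ t.Sub s₂
  | .loop τ x lo len s => t = .loop τ x lo len s ∨ t.Sub s
  | .letIn x e s => t = .letIn x e s ∨ t.Sub s
  | .label l s => t = .label l s ∨ t.Sub s
  | s => t = s

/-- The variable `v` occurs in the statement, free or bound. -/
def Stmt.Mentions {H : Type} (v : Var) : Stmt H → Prop
  | .nop => False
  | .assert e => v ∈ e.vars
  | .seq s₁ s₂ => s₁.Mentions v ∨ s₂.Mentions v
  | .alloc _ _ I => ∃ d, v ∈ (I d).1.vars ∨ v ∈ (I d).2.vars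
  | .assign _ _ _ args e => v ∈ e.vars ∨ ∃ i, v ∈ (args i).vars
  | .ite e s₁ s₂ => v ∈ e.vars ∨ s₁.Mentions v ∨ s₂.Mentions v
  | .loop _ x lo len s => v = x ∨ v ∈ lo.vars ∨ v ∈ len.vars ∨ s.Mentions v
  | .letIn x e s => v = x ∨ v ∈ e.vars ∨ s.Mentions v
  | .label _ s => s.Mentions v

/-! ## Semantics of target programs

A statement, in an environment, has a set of traces, that is, of sequences of actions on the store.
The values that a trace reads are arbitrary; `Run` keeps the traces whose reads agree with the store.
The actions of the iterations of a parallel loop are interleaved in an arbitrary way. -/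

inductive Failure
  | assertion
  | rdom
  | mem
  | stuck

inductive Act
  | read (f : ℕ) (p : List Val) (v : Val)
  | write (f : ℕ) (p : List Val) (v : Val)
  | alloc (f : ℕ) (I : List (Val × Val))
  | fail (k : Failure)

/-- Evaluation of an expression: its reads, from left to right, and its value. -/
inductive Expr.Tr (ρ : Env) : Expr Ver Empty → List Act → Val → Prop
  | const (c : ℤ) : Tr ρ (.const c) [] (.int c)
  | var (v : Var) : Tr ρ (.var v) [] (ρ v)
  | acc (f : ℕ) (l : Ver) (n : ℕ) (args : Fin n → Expr Ver Empty) (ts : Fin n → List Act)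
      (vs : Fin n → Val) (v : Val) (h : ∀ i, Tr ρ (args i) (ts i) (vs i)) :
      Tr ρ (.acc f l n args) ((List.ofFn ts).flatten ++ [.read f (List.ofFn vs) v]) v
  | op (o : Op) (args : Fin o.arity → Expr Ver Empty) (ts : Fin o.arity → List Act)
      (vs : Fin o.arity → Val) (h : ∀ i, Tr ρ (args i) (ts i) (vs i)) :
      Tr ρ (.op o args) (List.ofFn ts).flatten (o.eval vs)

/-- The list is an interleaving of the lists of the family. -/
inductive Interleave {n : ℕ} : (Fin n → List Act) → List Act → Prop
  | nil : Interleave (fun _ => []) []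
  | cons (ts : Fin n → List Act) (k : Fin n) (a : Act) (t l : List Act) (hk : ts k = a :: t)
      (h : Interleave (Function.update ts k t) l) : Interleave ts (a :: l)

/-- The traces of a statement. What follows a failure in a trace is never executed. -/
inductive Stmt.Tr : Env → Stmt Empty → List Act → Prop
  | nop (ρ : Env) : Tr ρ .nop []
  | assertTrue (ρ : Env) (e : Expr Ver Empty) (t : List Act) (v : Val)
      (he : e.Tr ρ t v) (hv : v ≠ .int 0) : Tr ρ (.assert e) t
  | assertFalse (ρ : Env) (e : Expr Ver Empty) (t : List Act) (he : e.Tr ρ t (.int 0)) :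
      Tr ρ (.assert e) (t ++ [.fail .assertion])
  | seq (ρ : Env) (s₁ s₂ : Stmt Empty) (t₁ t₂ : List Act) (h₁ : Tr ρ s₁ t₁) (h₂ : Tr ρ s₂ t₂) :
      Tr ρ (.seq s₁ s₂) (t₁ ++ t₂)
  | alloc (ρ : Env) (f n : ℕ) (I : Fin n → Expr Ver Empty × Expr Ver Empty)
      (t₁ t₂ : Fin n → List Act) (lo len : Fin n → Val)
      (h₁ : ∀ d, (I d).1.Tr ρ (t₁ d) (lo d)) (h₂ : ∀ d, (I d).2.Tr ρ (t₂ d) (len d)) :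
      Tr ρ (.alloc f n I) ((List.ofFn fun d => t₁ d ++ t₂ d).flatten ++
        [.alloc f (List.ofFn fun d => (lo d, len d))])
  | assign (ρ : Env) (f : ℕ) (l : Ver) (n : ℕ) (args : Fin n → Expr Ver Empty) (e : Expr Ver Empty)
      (ts : Fin n → List Act) (vs : Fin n → Val) (t : List Act) (v : Val)
      (he : e.Tr ρ t v) (ha : ∀ i, (args i).Tr ρ (ts i) (vs i)) :
      Tr ρ (.assign f l n args e) (t ++ (List.ofFn ts).flatten ++ [.write f (List.ofFn vs) v])
  | iteTrue (ρ : Env) (e : Expr Ver Empty) (s₁ s₂ : Stmt Empty) (t t' : List Act) (v : Val)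
      (he : e.Tr ρ t v) (hv : v ≠ .int 0) (hs : Tr ρ s₁ t') : Tr ρ (.ite e s₁ s₂) (t ++ t')
  | iteFalse (ρ : Env) (e : Expr Ver Empty) (s₁ s₂ : Stmt Empty) (t t' : List Act)
      (he : e.Tr ρ t (.int 0)) (hs : Tr ρ s₂ t') : Tr ρ (.ite e s₁ s₂) (t ++ t')
  | letIn (ρ : Env) (x : Var) (e : Expr Ver Empty) (s : Stmt Empty) (t t' : List Act) (v : Val)
      (he : e.Tr ρ t v) (hs : Tr (Function.update ρ x v) s t') : Tr ρ (.letIn x e s) (t ++ t')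
  | label (ρ : Env) (l : Label) (s : Stmt Empty) (t : List Act) (h : Tr ρ s t) :
      Tr ρ (.label l s) t
  | loopSerial (ρ : Env) (x : Var) (lo len : Expr Ver Empty) (s : Stmt Empty) (t₁ t₂ : List Act)
      (a : ℤ) (k : ℕ) (ts : Fin k → List Act) (h₁ : lo.Tr ρ t₁ (.int a)) (h₂ : len.Tr ρ t₂ (.int k))
      (hs : ∀ i : Fin k, Tr (Function.update ρ x (.int (a + (i : ℕ)))) s (ts i)) :
      Tr ρ (.loop .serial x lo len s) (t₁ ++ t₂ ++ (List.ofFn ts).flatten)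
  | loopParallel (ρ : Env) (x : Var) (lo len : Expr Ver Empty) (s : Stmt Empty) (t₁ t₂ : List Act)
      (a : ℤ) (k : ℕ) (ts : Fin k → List Act) (t : List Act)
      (h₁ : lo.Tr ρ t₁ (.int a)) (h₂ : len.Tr ρ t₂ (.int k))
      (hs : ∀ i : Fin k, Tr (Function.update ρ x (.int (a + (i : ℕ)))) s (ts i))
      (ht : Interleave ts t) : Tr ρ (.loop .parallel x lo len s) (t₁ ++ t₂ ++ t)
  | loopNeg (ρ : Env) (τ : Order) (x : Var) (lo len : Expr Ver Empty) (s : Stmt Empty)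
      (t₁ t₂ : List Act) (a k : ℤ) (hk : k < 0) (h₁ : lo.Tr ρ t₁ (.int a)) (h₂ : len.Tr ρ t₂ (.int k)) :
      Tr ρ (.loop τ x lo len s) (t₁ ++ t₂ ++ [.fail .rdom])
  | loopErr (ρ : Env) (τ : Order) (x : Var) (lo len : Expr Ver Empty) (s : Stmt Empty)
      (t₁ t₂ : List Act) (a k : Val) (herr : a.IsErr ∨ k.IsErr) (h₁ : lo.Tr ρ t₁ a)
      (h₂ : len.Tr ρ t₂ k) : Tr ρ (.loop τ x lo len s) (t₁ ++ t₂ ++ [.fail .stuck])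

/-- A buffer: the bounds `(min, len)` it was allocated with, and its contents. -/
structure Buffer where
  bounds : List (Val × Val)
  val : List Val → Val

abbrev Store := ℕ → Option Buffer

def Buffer.InBounds (b : Buffer) (p : List Val) : Prop :=
  List.Forall₂ (fun v I => ∃ t lo len : ℤ, v = .int t ∧ I = (.int lo, .int len) ∧
    lo ≤ t ∧ t < lo + len) p b.bounds

open Classical in
def Buffer.set (b : Buffer) (p : List Val) (v : Val) : Buffer :=
  ⟨b.bounds, fun q => if q = p then v else b.val q⟩

inductive Outcome
  | done (σ : Store)
  | failed (k : Failure)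

/-- Execution of a trace on a store. -/
inductive Run : Store → List Act → Outcome → Prop
  | nil (σ : Store) : Run σ [] (.done σ)
  | read (σ : Store) (f : ℕ) (p : List Val) (b : Buffer) (t : List Act) (o : Outcome)
      (hb : σ f = some b) (hp : b.InBounds p) (h : Run σ t o) : Run σ (.read f p (b.val p) :: t) o
  | write (σ : Store) (f : ℕ) (p : List Val) (v : Val) (b : Buffer) (t : List Act) (o : Outcome)
      (hb : σ f = some b) (hp : b.InBounds p) (h : Run (Function.update σ f (some (b.set p v))) t o) :
      Run σ (.write f p v :: t) o
  | alloc (σ : Store) (f : ℕ) (I : List (Val × Val)) (t : List Act) (o : Outcome)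
      (h : Run (Function.update σ f (some ⟨I, fun _ => .errMem⟩)) t o) : Run σ (.alloc f I :: t) o
  | readErr (σ : Store) (f : ℕ) (p : List Val) (v : Val) (t : List Act)
      (h : ¬ ∃ b, σ f = some b ∧ b.InBounds p) : Run σ (.read f p v :: t) (.failed .mem)
  | writeErr (σ : Store) (f : ℕ) (p : List Val) (v : Val) (t : List Act)
      (h : ¬ ∃ b, σ f = some b ∧ b.InBounds p) : Run σ (.write f p v :: t) (.failed .mem)
  | fail (σ : Store) (k : Failure) (t : List Act) : Run σ (.fail k :: t) (.failed k)

/-- The traces of a program on an input. They list its statement instances, in order. -/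
def Prog.traces {m n : ℕ} (Q : Prog Empty m n) (z : Input m n) : Set (List Act) :=
  {t | Q.body.Tr z.env t}

/-- Some execution of `Q` on `z` has the outcome `o`. -/
def Prog.Exec {m n : ℕ} (Q : Prog Empty m n) (z : Input m n) (o : Outcome) : Prop :=
  ∃ t ∈ Q.traces z, Run (fun _ => none) t o

/-! ## Lowering -/

abbrev TExpr := Expr Ver Hole

/-- Label the accesses: `self` stands for the version `v`, every other func for its last version. -/
def Expr.lower (self : ℕ) (v : Ver) : AExpr → TExpr
  | .const c => .const c
  | .var x => .var x
  | .acc g _ n args => .acc g (if g = self then v else .last) n fun i => (args i).lower self v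
  | .op o args => .op o fun i => (args i).lower self v
  | .hole h => h.elim

def Expr.isVar {L H : Type} (v : Var) : Expr L H → Bool
  | .var w => w = v
  | _ => false

def seqs {H : Type} (l : List (Stmt H)) : Stmt H := l.foldr .seq .nop

/-- The loop nest of stage `i`: loops over the pure dimensions of the stage, which range over its
compute bounds, around the loops of the rdom, around a guarded assignment. -/
def Func.lowerStage (F : Func) (i : ℕ) (U : Update F.arity) : Stmt Hole :=
  let v : Ver := if i = F.updates.length then .last else .mid i 0
  let lw : AExpr → TExpr := Expr.lower F.name (.mid (i - 1) 0)
  let core : Stmt Hole :=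
    .ite (lw U.pred) (.assign F.name v F.arity (fun d => lw (U.lhs d)) (lw U.rhs)) .nop
  let inner := U.rdom.foldl (fun s b => .loop .serial (.red b.1) (lw b.2.1) (lw b.2.2) s) core
  let nest := (List.finRange F.arity).foldl
    (fun s d =>
      if (U.lhs d).isVar (.pure (F.vars d)) then
        .loop .serial (.pure (F.vars d)) (.hole (.cpu F.name v d .min)) (.hole (.cpu F.name v d .len)) s
      else s)
    inner
  .label (.stage ⟨F.name, F.arity, i, 0, v, !U.rdom.isEmpty⟩) nest

def Func.lower (F : Func) : Stmt Hole :=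
  .seq
    (.alloc F.name F.arity fun d => (.hole (.mem F.name d .min), .hole (.mem F.name d .len)))
    (.label (.func F.name) (seqs (F.stages.zipIdx.map fun U => F.lowerStage U.2 U.1)))

def Alg.lower (P : Alg) : Prog Hole P.nparams P.out.arity :=
  ⟨P.out.name, seqs (P.funcs.map Func.lower)⟩

/-! ## Bounds inference -/

/-- Membership in the box whose bounds in dimension `d` are the holes `h d .min`, `h d .len`. -/
def InBox (η : Hole → ℤ) (h : ℕ → Side → Hole) (p : List Val) : Prop :=
  ∀ (d : ℕ) (hd : d < p.length), ∃ t : ℤ, p[d] = .int t ∧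
    η (h d .min) ≤ t ∧ t < η (h d .min) + η (h d .len)

/-- The value of an expression in the bounds query: func values are given by `φ`, holes by `η`. -/
def Expr.qval (η : Hole → ℤ) (φ : ℕ → List Val → ℤ) (ρ : Env) (e : TExpr) : Val :=
  e.eval ρ (fun g a => .int (φ g a)) fun h => .int (η h)

/-- All accesses in the expression are within the compute and the allocation bounds of their funcs.
Inside a stage `st` with a reduction domain, an access to the func of `st` itself may see a value
that this stage has written, so that it must be within the compute bounds of `st` as well. -/
def Expr.queryCpu (η : Hole → ℤ) (φ : ℕ → List Val → ℤ) (ρ : Env) (st : Option Stage) : TExpr → Prop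
  | .acc f v _ args =>
    (∀ i, (args i).queryCpu η φ ρ st) ∧
    InBox η (.mem f) (List.ofFn fun i => (args i).qval η φ ρ) ∧
    InBox η (.cpu f v) (List.ofFn fun i => (args i).qval η φ ρ) ∧
    ∀ st' ∈ st, st'.func = f → st'.reductive = true →
      InBox η (.cpu f st'.ver) (List.ofFn fun i => (args i).qval η φ ρ)
  | .op _ args => ∀ i, (args i).queryCpu η φ ρ st
  | _ => True

/-- All accesses in the expression are within the allocation bounds of their funcs; those in index
positions are within the compute bounds as well. -/
def Expr.queryMem (η : Hole → ℤ) (φ : ℕ → List Val → ℤ) (ρ : Env) (st : Option Stage) : TExpr → Prop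
  | .acc f _ _ args =>
    (∀ i, (args i).queryCpu η φ ρ st) ∧ InBox η (.mem f) (List.ofFn fun i => (args i).qval η φ ρ)
  | .op _ args => ∀ i, (args i).queryMem η φ ρ st
  | _ => True

/-- The bounds query of a statement; `st` is the stage to which it belongs, if any. At the label of
an update stage the query asks that the compute bounds of the stage are contained in those of the
previous stage (the stage need not write all of its points). -/
def Stmt.query (η : Hole → ℤ) (φ : ℕ → List Val → ℤ) : Stmt Hole → Option Stage → Env → Prop
  | .nop, _, _ => True
  | .assert e, _, ρ => e.qval η φ ρ ≠ .int 0
  | .seq s₁ s₂, st, ρ => s₁.query η φ st ρ ∧ s₂.query η φ st ρ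
  | .alloc _ _ _, _, _ => True
  | .assign f v _ args e, st, ρ =>
    InBox η (.mem f) (List.ofFn fun i => (args i).qval η φ ρ) ∧
    (∀ i, (args i).queryCpu η φ ρ st) ∧
    e.queryMem η φ ρ st ∧
    (InBox η (.cpu f v) (List.ofFn fun i => (args i).qval η φ ρ) → e.queryCpu η φ ρ st)
  | .ite e s₁ s₂, st, ρ =>
    e.queryCpu η φ ρ st ∧ (e.qval η φ ρ ≠ .int 0 → s₁.query η φ st ρ) ∧
    (e.qval η φ ρ = .int 0 → s₂.query η φ st ρ)
  | .loop _ x lo len s, st, ρ =>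
    0 ≤ (len.qval η φ ρ).toInt ∧
    ∀ t : ℤ, (lo.qval η φ ρ).toInt ≤ t → t < (lo.qval η φ ρ).toInt + (len.qval η φ ρ).toInt →
      s.query η φ st (Function.update ρ x (.int t))
  | .letIn x e s, st, ρ =>
    e.queryCpu η φ ρ st ∧ s.query η φ st (Function.update ρ x (e.qval η φ ρ))
  | .label (.stage st) s, _, ρ =>
    (∀ i, st.idx = i + 1 → ∀ p : Fin st.arity → ℤ,
      InBox η (.cpu st.func st.ver) (List.ofFn fun d => .int (p d)) →
      InBox η (.cpu st.func (.mid i st.spec)) (List.ofFn fun d => .int (p d))) ∧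
    s.query η φ (some st) ρ
  | .label _ s, st, ρ => s.query η φ st ρ

/-- A hole substitution is compatible with a program all of whose holes are quantified outside of its
loops if it fills every hole by an expression in the parameters and in the bounds of the window. -/
def Compatible (m n : ℕ) (Γ : Hole → Expr Ver Empty) : Prop := ∀ h, (Γ h).Startup m n

/-- The values of the holes on an input. -/
def holeVal {m n : ℕ} (Γ : Hole → Expr Ver Empty) (z : Input m n) (h : Hole) : ℤ :=
  ((Γ h).eval z.env (fun _ _ => .errMem) Empty.elim).toInt

/-- The substitution satisfies the bounds query of `T` at the input `z`: compute bounds are intervals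
of nonnegative length, they contain the window in the case of the output func, and the query of the
body holds, whatever the values of the funcs are. -/
def Prog.QueryAt {m n : ℕ} (T : Prog Hole m n) (Γ : Hole → Expr Ver Empty) (z : Input m n) : Prop :=
  (∀ f v d, 0 ≤ holeVal Γ z (.cpu f v d .len)) ∧
  (∀ φ : ℕ → List Val → ℤ, T.body.query (holeVal Γ z) φ none z.env) ∧
  ∀ p, z.Window p → InBox (holeVal Γ z) (.cpu T.out .last) (List.ofFn fun d => .int (p d))

/-- The completions of `T`. -/
def Prog.BI {m n : ℕ} (T : Prog Hole m n) : Set (Prog Empty m n) :=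
  {Q | ∃ Γ, Compatible m n Γ ∧ (∀ z, T.QueryAt Γ z) ∧ Q = T.fill Γ}

/-! ## Confluence -/

/-- Output equivalence `P ≃_z Q`: `Q` runs to completion on `z`, and then its output buffer agrees with
`P(z)` on the window. -/
def OutputEquiv (P : Alg) (Q : Prog Empty P.nparams P.out.arity) (z : Input P.nparams P.out.arity) :
    Prop :=
  (∃ o, Q.Exec z o) ∧
  ∀ o, Q.Exec z o → ∃ σ b, o = .done σ ∧ σ Q.out = some b ∧
    ∀ p, z.Window p → b.val (List.ofFn fun d => .int (p d)) = P.run z p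

def Confluent (P : Alg) (T : Prog Hole P.nparams P.out.arity) : Prop :=
  ∀ Q ∈ T.BI, ∀ z, (∃ p, z.Window p ∧ (P.run z p).IsErr) ∨ Q.Exec z (.failed .assertion) ∨
    OutputEquiv P Q z

/-! ## Scheduling: specialization -/

def Ver.respec (j : ℕ) : Ver → Ver
  | .mid i _ => .mid i j
  | .last => .last

def Expr.respec (f j : ℕ) : TExpr → TExpr
  | .acc g v n args => .acc g (if g = f then v.respec j else v) n fun i => (args i).respec f j
  | .op o args => .op o fun i => (args i).respec f j
  | .hole (.cpu g v d s) => .hole (.cpu g (if g = f then v.respec j else v) d s)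
  | e => e

/-- `[f^{i,j}/f^i] s`: attach the specialization `j` to all stages of `f` but the last. -/
def Stmt.respec (f j : ℕ) : Stmt Hole → Stmt Hole
  | .nop => .nop
  | .assert e => .assert (e.respec f j)
  | .seq s₁ s₂ => .seq (s₁.respec f j) (s₂.respec f j)
  | .alloc g n I => .alloc g n fun d => ((I d).1.respec f j, (I d).2.respec f j)
  | .assign g v n args e =>
    .assign g (if g = f then v.respec j else v) n (fun i => (args i).respec f j) (e.respec f j)
  | .ite e s₁ s₂ => .ite (e.respec f j) (s₁.respec f j) (s₂.respec f j)
  | .loop τ x lo len s => .loop τ x (lo.respec f j) (len.respec f j) (s.respec f j)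
  | .letIn x e s => .letIn x (e.respec f j) (s.respec f j)
  | .label (.stage st) s =>
    .label (.stage (if st.func = f then { st with spec := j, ver := st.ver.respec j } else st))
      (s.respec f j)
  | .label l s => .label l (s.respec f j)

/-- A startup expression as an expression of the target language. -/
def Expr.toTgt (e : AExpr) : TExpr := e.lower 0 .last

/-- `if e_1 then label z_1 : … else if e_2 then … else label z_0 : …`. -/
def Stmt.branches (f : ℕ) (s : Stmt Hole) : List AExpr → ℕ → Stmt Hole
  | [], _ => .label (.spec f 0) (s.respec f 0)
  | e :: es, j => .ite e.toTgt (.label (.spec f j) (s.respec f j)) (s.branches f es (j + 1))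

def Stmt.specialize (f : ℕ) (es : List AExpr) : Stmt Hole → Stmt Hole
  | .seq s₁ s₂ => .seq (s₁.specialize f es) (s₂.specialize f es)
  | .ite e s₁ s₂ => .ite e (s₁.specialize f es) (s₂.specialize f es)
  | .loop τ x lo len s => .loop τ x lo len (s.specialize f es)
  | .letIn x e s => .letIn x e (s.specialize f es)
  | .label (.func g) s =>
    if g = f then .label (.func g) (s.branches f es 1) else .label (.func g) (s.specialize f es)
  | .label l s => .label l (s.specialize f es)
  | s => s

/-! ## Scheduling: loops -/

/-- Loop names: func, stage, specialization (0 if the func is not specialized), loop variable. -/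
structure LoopName where
  func : ℕ
  idx : ℕ
  spec : ℕ
  var : Var

inductive Tail
  | guard
  | shift
  | round

inductive LoopDir
  | split (l : LoopName) (xo xi : Var) (fac : AExpr) (φ : Tail)
  | fuse (l : LoopName) (y : Var)
  | swap (l : LoopName)
  | traverse (l : LoopName) (τ : Order)

def bin (o : Op) (h : o.arity = 2) (a b : TExpr) : TExpr := .op o fun i => ![a, b] (i.cast h)

def Expr.plus (a b : TExpr) : TExpr := bin .add rfl a b
def Expr.minus (a b : TExpr) : TExpr := bin .sub rfl a b
def Expr.times (a b : TExpr) : TExpr := bin .mul rfl a b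

/-- `⌈a / b⌉`, for positive `b`. -/
def Expr.ceilDiv (a b : TExpr) : TExpr := bin .div rfl (a.plus (b.minus (.const 1))) b

/-- Move `φ`, which binds the variables `xs`, below loops, and below those `let`s that do not use `xs`. -/
def Stmt.pushDown (xs : List Var) (φ : Stmt Hole → Stmt Hole) : Stmt Hole → Stmt Hole
  | .loop τ x lo len s => .loop τ x lo len (s.pushDown xs φ)
  | .letIn x e s =>
    if ∃ v ∈ xs, v ∈ e.vars then φ (.letIn x e s) else .letIn x e (s.pushDown xs φ)
  | s => φ s

def Tail.wrap (x xo xi : Var) (lo len fac : TExpr) : Tail → Stmt Hole → Stmt Hole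
  | .guard, s =>
    .letIn x ((lo.plus (.var xi)).plus (fac.times (.var xo)))
      (.ite (bin .lt rfl (.var x) (lo.plus len)) s .nop)
  | .shift, s =>
    .letIn x ((lo.plus (.var xi)).plus
      (bin .min rfl (fac.times (.var xo)) (bin .max rfl (.const 0) (len.minus fac)))) s
  | .round, s => .letIn x ((lo.plus (.var xi)).plus (fac.times (.var xo))) s

def Stmt.split (xo xi : Var) (fac : TExpr) (φ : Tail) : Stmt Hole → Stmt Hole
  | .loop _ x lo len s =>
    .loop .serial xo (.const 0) (len.ceilDiv fac)
      (.loop .serial xi (.const 0) fac (s.pushDown [x] (φ.wrap x xo xi lo len fac)))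
  | s => s

def Stmt.fuse (y : Var) : Stmt Hole → Stmt Hole
  | .loop _ x₁ lo₁ len₁ (.loop _ x₂ lo₂ len₂ s) =>
    .loop .serial y (.const 0) (len₁.times len₂)
      (s.pushDown [x₁, x₂] fun s' =>
        .letIn x₁ (lo₁.plus (bin .div rfl (.var y) len₂))
          (.letIn x₂ (lo₂.plus (bin .mod rfl (.var y) len₂)) s'))
  | s => s

def Stmt.swap : Stmt Hole → Stmt Hole
  | .loop τ x lo len (.loop τ' x' lo' len' s) => .loop τ' x' lo' len' (.loop τ x lo len s)
  | s => s

def Stmt.traverse (τ : Order) : Stmt Hole → Stmt Hole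
  | .loop _ x lo len s => .loop τ x lo len s
  | s => s

/-- Transform the loops over `v`. -/
def Stmt.modLoop (v : Var) (g : Stmt Hole → Stmt Hole) : Stmt Hole → Stmt Hole
  | .seq s₁ s₂ => .seq (s₁.modLoop v g) (s₂.modLoop v g)
  | .ite e s₁ s₂ => .ite e (s₁.modLoop v g) (s₂.modLoop v g)
  | .loop τ x lo len s =>
    if x = v then g (.loop τ x lo len s) else .loop τ x lo len (s.modLoop v g)
  | .letIn x e s => .letIn x e (s.modLoop v g)
  | .label l s => .label l (s.modLoop v g)
  | s => s

/-- Transform the code of one stage. -/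
def Stmt.modStage (l : LoopName) (g : Stmt Hole → Stmt Hole) : Stmt Hole → Stmt Hole
  | .seq s₁ s₂ => .seq (s₁.modStage l g) (s₂.modStage l g)
  | .ite e s₁ s₂ => .ite e (s₁.modStage l g) (s₂.modStage l g)
  | .loop τ x lo len s => .loop τ x lo len (s.modStage l g)
  | .letIn x e s => .letIn x e (s.modStage l g)
  | .label (.stage st) s =>
    if st.func = l.func ∧ st.idx = l.idx ∧ st.spec = l.spec then .label (.stage st) (g s)
    else .label (.stage st) (s.modStage l g)
  | .label lb s => .label lb (s.modStage l g)
  | s => s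

def LoopDir.loopName : LoopDir → LoopName
  | .split l _ _ _ _ => l
  | .fuse l _ => l
  | .swap l => l
  | .traverse l _ => l

/-- What a directive does with the loop it names. -/
def LoopDir.rewrite : LoopDir → Stmt Hole → Stmt Hole
  | .split _ xo xi fac φ => Stmt.split xo xi fac.toTgt φ
  | .fuse _ y => Stmt.fuse y
  | .swap _ => Stmt.swap
  | .traverse _ τ => Stmt.traverse τ

/-- `𝒮(s, T)`. -/
def LoopDir.apply {m n : ℕ} (s : LoopDir) (T : Prog Hole m n) : Prog Hole m n :=
  ⟨T.out, T.body.modStage s.loopName (Stmt.modLoop s.loopName.var s.rewrite)⟩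

/-- `body` is the code in `T` of the stage in which the loop `l` is. -/
def Prog.StageAt {H : Type} {m n : ℕ} (T : Prog H m n) (l : LoopName) (body : Stmt H) : Prop :=
  ∃ st : Stage, (Stmt.label (.stage st) body).Sub T.body ∧
    st.func = l.func ∧ st.idx = l.idx ∧ st.spec = l.spec

/-- The loop named `l` in `T`. -/
def Prog.LoopAt {m n : ℕ} (T : Prog Hole m n) (l : LoopName) (τ : Order) (lo len : TExpr)
    (s : Stmt Hole) : Prop :=
  ∃ body, T.StageAt l body ∧ (Stmt.loop τ l.var lo len s).Sub body

/-- `y` may name a loop that replaces the loop `l`: it is new in the stage, and it is a pure variable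
if and only if `l` is a pure loop. -/
def Prog.NewVar {m n : ℕ} (T : Prog Hole m n) (l : LoopName) (y : Var) : Prop :=
  (∀ body, T.StageAt l body → ¬ body.Mentions y) ∧
  ((l.var.IsPure ∧ y.IsPure) ∨ (l.var.IsRed ∧ y.IsRed))

/-- The side conditions of the loop directives. -/
def LoopDir.Valid {m n : ℕ} (T : Prog Hole m n) : LoopDir → Prop
  | .split l xo xi fac φ =>
    (∃ τ lo len s, T.LoopAt l τ lo len s) ∧
    xo ≠ xi ∧ T.NewVar l xo ∧ T.NewVar l xi ∧
    fac.Startup m n ∧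
    (∀ z : Input m n, ∃ k : ℤ, 0 < k ∧ fac.eval z.env (fun _ _ => .errMem) Empty.elim = .int k) ∧
    (φ = .shift ∨ φ = .round → l.idx = 0)
  | .fuse l y =>
    (∃ τ lo len τ' x' lo' len' s, T.LoopAt l τ lo len (.loop τ' x' lo' len' s) ∧
      ((l.var.IsPure ∧ x'.IsPure) ∨ (l.var.IsRed ∧ x'.IsRed))) ∧
    T.NewVar l y
  | .swap l =>
    ∃ τ lo len τ' x' lo' len' s, T.LoopAt l τ lo len (.loop τ' x' lo' len' s) ∧
      (l.var.IsPure ∨ x'.IsPure)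
  | .traverse l _ => (∃ τ lo len s, T.LoopAt l τ lo len s) ∧ l.var.IsPure

/-- A schedule up through the loop phase: specializations `(f, e_1, …, e_n)`, then loop directives. -/
structure Schedule where
  specs : List (ℕ × List AExpr)
  loops : List LoopDir

def applySpecs {m n : ℕ} (specs : List (ℕ × List AExpr)) (T : Prog Hole m n) : Prog Hole m n :=
  specs.foldl (fun T s => ⟨T.out, T.body.specialize s.1 s.2⟩) T

def applyLoops {m n : ℕ} (loops : List LoopDir) (T : Prog Hole m n) : Prog Hole m n :=
  loops.foldl (fun T s => s.apply T) T

/-- `𝒮(S, ℒ(P))`. -/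
def Schedule.apply (S : Schedule) (P : Alg) : Prog Hole P.nparams P.out.arity :=
  applyLoops S.loops (applySpecs S.specs P.lower)

structure Schedule.Valid (S : Schedule) (P : Alg) : Prop where
  /-- At most one specialization per func. -/
  spec_once : (S.specs.map Prod.fst).Nodup
  spec_func : ∀ s ∈ S.specs, ∃ F ∈ P.funcs, F.name = s.1
  spec_startup : ∀ s ∈ S.specs, ∀ e ∈ s.2, e.Startup P.nparams P.out.arity
  loops_valid : ∀ pre s post, S.loops = pre ++ s :: post →
    s.Valid (applyLoops pre (applySpecs S.specs P.lower))

/-! ## Iterations of loops -/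

/-- `Reach ρ s ρ' s'`: an execution of `s` in the environment `ρ` may come to the statement `s'` that
occurs in `s`, and then its environment is `ρ'`. -/
inductive Stmt.Reach : Env → Stmt Empty → Env → Stmt Empty → Prop
  | refl (ρ : Env) (s : Stmt Empty) : Reach ρ s ρ s
  | seqLeft (ρ ρ' : Env) (s₁ s₂ s' : Stmt Empty) (h : Reach ρ s₁ ρ' s') : Reach ρ (.seq s₁ s₂) ρ' s'
  | seqRight (ρ ρ' : Env) (s₁ s₂ s' : Stmt Empty) (h : Reach ρ s₂ ρ' s') : Reach ρ (.seq s₁ s₂) ρ' s'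
  | iteTrue (ρ ρ' : Env) (e : Expr Ver Empty) (s₁ s₂ s' : Stmt Empty) (t : List Act) (v : Val)
      (he : e.Tr ρ t v) (hv : v ≠ .int 0) (h : Reach ρ s₁ ρ' s') : Reach ρ (.ite e s₁ s₂) ρ' s'
  | iteFalse (ρ ρ' : Env) (e : Expr Ver Empty) (s₁ s₂ s' : Stmt Empty) (t : List Act)
      (he : e.Tr ρ t (.int 0)) (h : Reach ρ s₂ ρ' s') : Reach ρ (.ite e s₁ s₂) ρ' s'
  | loop (ρ ρ' : Env) (τ : Order) (x : Var) (lo len : Expr Ver Empty) (s s' : Stmt Empty)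
      (t₁ t₂ : List Act) (a : ℤ) (k i : ℕ) (h₁ : lo.Tr ρ t₁ (.int a)) (h₂ : len.Tr ρ t₂ (.int k))
      (hi : i < k) (h : Reach (Function.update ρ x (.int (a + i))) s ρ' s') :
      Reach ρ (.loop τ x lo len s) ρ' s'
  | letIn (ρ ρ' : Env) (x : Var) (e : Expr Ver Empty) (s s' : Stmt Empty) (t : List Act) (v : Val)
      (he : e.Tr ρ t v) (h : Reach (Function.update ρ x v) s ρ' s') : Reach ρ (.letIn x e s) ρ' s'
  | label (ρ ρ' : Env) (l : Label) (s s' : Stmt Empty) (h : Reach ρ s ρ' s') :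
      Reach ρ (.label l s) ρ' s'

/-- Whenever the loop `l` is executed by `Q` on `z`, the points of the func of `l` that one iteration
writes are neither read nor written by any other iteration. -/
def Prog.DisjointIterations {m n : ℕ} (Q : Prog Empty m n) (l : LoopName) (z : Input m n) : Prop :=
  ∀ (st : Stage) (body : Stmt Empty) (ρ₀ ρ : Env) (τ : Order) (lo len : Expr Ver Empty)
    (s : Stmt Empty) (t₁ t₂ : List Act) (a : ℤ) (k i j : ℕ) (t t' : List Act) (p : List Val) (v : Val),
    Q.body.Reach z.env ρ₀ (.label (.stage st) body) →
    st.func = l.func → st.idx = l.idx → st.spec = l.spec →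
    body.Reach ρ₀ ρ (.loop τ l.var lo len s) →
    lo.Tr ρ t₁ (.int a) → len.Tr ρ t₂ (.int k) → i < k → j < k → i ≠ j →
    s.Tr (Function.update ρ l.var (.int (a + i))) t →
    s.Tr (Function.update ρ l.var (.int (a + j))) t' →
    .write l.func p v ∈ t → ∀ w, .write l.func p w ∉ t' ∧ .read l.func p w ∉ t'

/-- No directive of `S` splits a loop of the stage of `l` by shifting or rounding. -/
def Schedule.OnlyGuards (S : Schedule) (l : LoopName) : Prop :=
  ∀ l' xo xi fac φ, LoopDir.split l' xo xi fac φ ∈ S.loops →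
    l'.func = l.func → l'.idx = l.idx → l'.spec = l.spec → φ = .guard

end Halide

open Halide

/-! A schedule never changes what a single point update does. It changes only in which order, and
how often, the iterations of a stage execute it. Every scheduled stage is a loop nest around `let`s
and guards around the conditional assignment that lowering emitted (`core`), and there is a partial
decoding of the iterations of this nest into those of the lowered nest: the code below the loops
acts in an iteration like `core` in the decoded one, and like a no-op if there is none (`Sem`). A
split or fuse replaces a segment of the nest (`Seg`, `Repl`). Since division with remainder
enumerates a range lexicographically, guarded splits and fuses preserve the sequence of decoded
iterations, whereas shift and round only cover it. A swap keeps the order of the reduction loops,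
and a traversal order does not affect the set of iterations. By induction on the directives
(`StageOK.apply`, `Scheduled.apply`), for fixed values of the pure variables the reduction
iterations are the original ones in the original order, every original pure iteration is covered,
and without shift and round the decoding of pure iterations is injective with values in the original
box.

The claims on split and fuse compare one nest before and after the replacement (`Repl.query_of_new`,
`Repl.query_new`, `Repl.tr_sub`). They lift to programs because stages sit below sequences, labels
and closed branch conditions only (`Scheduled.modStage`).

For confluence, a trace of a stage is an interleaving of threads, one for each pure iteration, and
each thread runs through its reduction iterations in order (`nest_tr_inter`, `StageOK.threads`). In
an update stage, syntactic separation confines a thread to a slice of its func. Slices of different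
threads are disjoint, so every thread behaves as if it were alone (`Inter.run_disjoint`), and it
performs the point updates of the algorithm one by one (`Func.foldl_core_run`). In the pure stage
threads may be redundant, but they never read the func, and within the compute bounds all of them
write correct values (`Inter.run_writes`). The disjointness of the iterations of pure loops is the
same slice argument (`Scheduled.disjointIterations`).

Values are compared in an order in which errors lie below everything; strict operators are monotone
for it. The invariant is that, within the compute bounds, the store holds integers that refine the
values of the algorithm. The bounds query is asked for all integer values of the funcs, hence for
the present contents of the store, and then the points it speaks of are those that are accessed at
run time (`Expr.lower_run`). Induction over point updates, stages and funcs gives `Scheduled.run`.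
On the window, a value that is not an error is then hit exactly, and an execution always exists
(`Stmt.exists_run`). -/

namespace Halide

/-! ## Access-free and closed expressions -/

/-- The expression contains no func accesses. -/
def Expr.AccFree {L H : Type} : Expr L H → Prop
  | .acc _ _ _ _ => False
  | .op _ args => ∀ i, (args i).AccFree
  | _ => True

/-- Variables that loops and `let`s may bind. -/
def Var.IsLoop : Var → Prop
  | .pure _ => True
  | .red _ => True
  | _ => False

theorem Var.isLoop_iff {v : Var} : v.IsLoop ↔ v.IsPure ∨ v.IsRed := by
  cases v <;> simp [Var.IsLoop, Var.IsPure, Var.IsRed]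

/-- Access-free expressions in the parameters and the bounds of the window; holes are allowed. -/
def Expr.Closed {L H : Type} (m n : ℕ) (e : Expr L H) : Prop :=
  e.AccFree ∧ ∀ v ∈ e.vars, (∃ k < m, v = .par k) ∨ ∃ d < n, v = .wmin d ∨ v = .wlen d

theorem Expr.accFree_of_not_sub {L H : Type} (e : Expr L H)
    (h : ∀ f l k args, ¬ (Expr.acc f l k args).Sub e) : e.AccFree := by
  induction e with
  | acc f l k args ih => exact h f l k args (Or.inl rfl)
  | op o args ih =>
    intro i
    exact ih i fun f l k a hs => h f l k a (Or.inr ⟨i, hs⟩)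
  | _ => trivial

theorem Expr.Startup.closed {L H : Type} {m n : ℕ} {e : Expr L H} (h : e.Startup m n) :
    e.Closed m n := ⟨e.accFree_of_not_sub h.1, h.2⟩

theorem Expr.Closed.not_loop {L H : Type} {m n : ℕ} {e : Expr L H} (h : e.Closed m n) :
    ∀ v ∈ e.vars, ¬ v.IsLoop := by
  intro v hv
  rcases h.2 v hv with ⟨k, _, rfl⟩ | ⟨d, _, rfl | rfl⟩ <;> simp [Var.IsLoop]

theorem Expr.mem_vars_op {L H : Type} {o : Op} {args : Fin o.arity → Expr L H} {v : Var} :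
    v ∈ (Expr.op o args).vars ↔ ∃ i, v ∈ (args i).vars := by
  simp only [Expr.vars, List.mem_flatten, List.mem_ofFn]
  constructor
  · rintro ⟨l, ⟨i, rfl⟩, h⟩; exact ⟨i, h⟩
  · rintro ⟨i, h⟩; exact ⟨_, ⟨i, rfl⟩, h⟩

theorem Expr.mem_vars_acc {L H : Type} {f : ℕ} {l : L} {n : ℕ} {args : Fin n → Expr L H} {v : Var} :
    v ∈ (Expr.acc (H := H) f l n args).vars ↔ ∃ i, v ∈ (args i).vars := by
  simp only [Expr.vars, List.mem_flatten, List.mem_ofFn]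
  constructor
  · rintro ⟨l, ⟨i, rfl⟩, h⟩; exact ⟨i, h⟩
  · rintro ⟨i, h⟩; exact ⟨_, ⟨i, rfl⟩, h⟩

theorem Op.eval_int {o : Op} {a : Fin o.arity → Val} {k : Fin o.arity → ℤ}
    (h : ∀ i, a i = .int (k i)) : o.eval a = .int (o.apply k) := by
  have h1 : ¬ ∃ i, a i = .errMem := by rintro ⟨i, hi⟩; simp [h i] at hi
  have h2 : ¬ ∃ i, a i = .errRdom := by rintro ⟨i, hi⟩; simp [h i] at hi
  simp only [Op.eval, h1, h2, if_false]
  congr 2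
  funext i
  simp [h i, Val.toInt]

theorem Expr.eval_congr {L H : Type} {ρ ρ' : Env} {A : ℕ → List Val → Val} {η : H → Val}
    (e : Expr L H) (h : ∀ v ∈ e.vars, ρ v = ρ' v) : e.eval ρ A η = e.eval ρ' A η := by
  induction e with
  | const c => rfl
  | var v => exact h v (by simp [Expr.vars])
  | acc f l k args ih =>
    simp only [Expr.eval]
    congr 2
    funext i
    exact ih i fun v hv => h v (Expr.mem_vars_acc.2 ⟨i, hv⟩)
  | op o args ih =>
    simp only [Expr.eval]
    congr 1
    funext i
    exact ih i fun v hv => h v (Expr.mem_vars_op.2 ⟨i, hv⟩)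
  | hole h => rfl

theorem Expr.AccFree.eval_eq {L H : Type} {ρ : Env} {A A' : ℕ → List Val → Val} {η : H → Val}
    {e : Expr L H} (h : e.AccFree) : e.eval ρ A η = e.eval ρ A' η := by
  induction e with
  | acc f l k args ih => exact h.elim
  | op o args ih =>
    simp only [Expr.eval]
    congr 1
    funext i
    exact ih i (h i)
  | _ => rfl

/-! ### Lowered expressions -/

section Lower

theorem Expr.lower_vars (f : ℕ) (v : Ver) (e : AExpr) : (e.lower f v).vars = e.vars := by
  induction e with
  | acc g l k args ih => simp [Expr.lower, Expr.vars, ih]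
  | op o args ih => simp [Expr.lower, Expr.vars, ih]
  | hole x => exact x.elim
  | _ => rfl

theorem Expr.AccFree.lower {f : ℕ} {v : Ver} {e : AExpr} (h : e.AccFree) :
    (e.lower f v).AccFree := by
  induction e with
  | acc g l k args ih => exact h.elim
  | op o args ih => exact fun i => ih i (h i)
  | hole x => exact x.elim
  | _ => trivial

theorem Expr.Closed.lower {m n f : ℕ} {v : Ver} {e : AExpr} (h : e.Closed m n) :
    (e.lower f v).Closed m n := ⟨h.1.lower, by rw [Expr.lower_vars]; exact h.2⟩

/-- Without accesses neither version labels nor func values matter, so rdom bounds and split factors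
mean the same in the algorithm and in the target program. -/
theorem Expr.AccFree.eval_lower {f : ℕ} {v : Ver} {ρ : Env} {A A' : ℕ → List Val → Val}
    {η : Hole → Val} {η' : Empty → Val} {e : AExpr} (h : e.AccFree) :
    (e.lower f v).eval ρ A η = e.eval ρ A' η' := by
  induction e with
  | acc g l k args ih => exact h.elim
  | op o args ih =>
    simp only [Expr.lower, Expr.eval]
    congr 1
    funext i
    exact ih i (h i)
  | hole x => exact x.elim
  | _ => rfl

theorem Expr.Closed.mono_window {L H : Type} {m n : ℕ} {e : Expr L H} (h : e.Closed m 0) :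
    e.Closed m n :=
  ⟨h.1, fun v hv => (h.2 v hv).imp_right fun ⟨d, hd, _⟩ => absurd hd (Nat.not_lt_zero d)⟩

end Lower

/-! ## Environments -/

variable {m n : ℕ}

/-- The environment binds parameters and window bounds as the input does. -/
def Base (z : Input m n) (ρ : Env) : Prop := ∀ v : Var, ¬ v.IsLoop → ρ v = z.env v

theorem Base.refl (z : Input m n) : Base z z.env := fun _ _ => rfl

theorem Base.update {z : Input m n} {ρ : Env} (h : Base z ρ) {x : Var} (hx : x.IsLoop) (v : Val) :
    Base z (Function.update ρ x v) := by
  intro w hw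
  rw [Function.update_of_ne (by rintro rfl; exact hw hx)]
  exact h w hw

theorem Input.env_loop (z : Input m n) {v : Var} (h : v.IsLoop) : z.env v = .errMem := by
  cases v <;> simp_all [Var.IsLoop, Input.env]

/-- All operators are total on integers, and parameters, window bounds and holes are integers, so no
error can arise. Loops with closed bounds therefore never get stuck. -/
theorem Expr.Closed.eval_int {L H : Type} {z : Input m n} {ρ : Env} {A : ℕ → List Val → Val}
    {η : H → Val} {e : Expr L H} (h : e.Closed m n) (hρ : Base z ρ)
    (hη : ∀ h, ∃ k : ℤ, η h = .int k) : ∃ k : ℤ, e.eval ρ A η = .int k := by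
  obtain ⟨h1, h2⟩ := h
  induction e with
  | const c => exact ⟨c, rfl⟩
  | var v =>
    rcases h2 v (by simp [Expr.vars]) with ⟨k, hk, rfl⟩ | ⟨d, hd, rfl | rfl⟩
    · exact ⟨z.params ⟨k, hk⟩, by simp [Expr.eval, hρ (.par k) (by simp [Var.IsLoop]), Input.env, hk]⟩
    · exact ⟨z.lo ⟨d, hd⟩, by simp [Expr.eval, hρ (.wmin d) (by simp [Var.IsLoop]), Input.env, hd]⟩
    · exact ⟨z.len ⟨d, hd⟩, by simp [Expr.eval, hρ (.wlen d) (by simp [Var.IsLoop]), Input.env, hd]⟩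
  | acc f l k args ih => exact h1.elim
  | op o args ih =>
    have := fun i => ih i (h1 i) fun v hv => h2 v (Expr.mem_vars_op.2 ⟨i, hv⟩)
    choose k hk using this
    exact ⟨o.apply k, Op.eval_int hk⟩
  | hole x => exact hη x

theorem Expr.Closed.eval_base {L H : Type} {z : Input m n} {ρ : Env} {A A' : ℕ → List Val → Val}
    {η : H → Val} {e : Expr L H} (h : e.Closed m n) (hρ : Base z ρ) :
    e.eval ρ A η = e.eval z.env A' η := by
  rw [h.1.eval_eq (A' := A')]
  exact e.eval_congr fun v hv => hρ v (h.not_loop v hv)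

/-! ## The value of access-free expressions -/

/-- The value of an access-free expression, where `η` gives the values of the holes. -/
def Expr.tval (η : Hole → ℤ) (ρ : Env) (e : TExpr) : Val :=
  e.eval ρ (fun _ _ => .errMem) fun h => .int (η h)

/-- The integer that a closed expression denotes. -/
def Expr.num (η : Hole → ℤ) (z : Input m n) (e : TExpr) : ℤ := (e.tval η z.env).toInt

theorem Expr.Closed.tval_eq {η : Hole → ℤ} {z : Input m n} {ρ : Env} {e : TExpr}
    (h : e.Closed m n) (hρ : Base z ρ) : e.tval η ρ = .int (e.num η z) := by
  obtain ⟨k, hk⟩ := h.eval_int (A := fun _ _ => .errMem) (η := fun h => .int (η h)) (Base.refl z)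
    fun h => ⟨_, rfl⟩
  unfold Expr.num Expr.tval
  rw [h.eval_base hρ (A' := fun _ _ => .errMem), hk, Val.toInt]

theorem Expr.tval_congr {η : Hole → ℤ} {ρ ρ' : Env} {e : TExpr} (h : ∀ v ∈ e.vars, ρ v = ρ' v) :
    e.tval η ρ = e.tval η ρ' := e.eval_congr h

theorem Expr.tval_update {η : Hole → ℤ} {ρ : Env} {e : TExpr} {x : Var} {v : Val} (h : x ∉ e.vars) :
    e.tval η (Function.update ρ x v) = e.tval η ρ :=
  Expr.tval_congr fun w hw => Function.update_of_ne (by rintro rfl; exact h hw) _ _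

theorem Expr.AccFree.qval_eq {η : Hole → ℤ} {φ : ℕ → List Val → ℤ} {ρ : Env} {e : TExpr}
    (h : e.AccFree) : e.qval η φ ρ = e.tval η ρ := h.eval_eq

theorem Expr.AccFree.queryCpu {η : Hole → ℤ} {φ : ℕ → List Val → ℤ} {ρ : Env} {st : Option Stage}
    {e : TExpr} (h : e.AccFree) : e.queryCpu η φ ρ st := by
  induction e with
  | acc f l k args ih => exact h.elim
  | op o args ih => exact fun i => ih i (h i)
  | _ => trivial

theorem List.flatten_ofFn_nil {α : Type} (k : ℕ) :
    (List.ofFn fun _ : Fin k => ([] : List α)).flatten = [] := by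
  simp

/-! ## Inversion of expression traces -/

theorem Expr.tr_const {ρ : Env} {c : ℤ} {t : List Act} {v : Val} :
    (Expr.const c).Tr ρ t v ↔ t = [] ∧ v = .int c := by
  constructor
  · intro h; cases h; exact ⟨rfl, rfl⟩
  · rintro ⟨rfl, rfl⟩; exact .const c

theorem Expr.tr_var {ρ : Env} {x : Var} {t : List Act} {v : Val} :
    (Expr.var x).Tr ρ t v ↔ t = [] ∧ v = ρ x := by
  constructor
  · intro h; cases h; exact ⟨rfl, rfl⟩
  · rintro ⟨rfl, rfl⟩; exact .var x

theorem Expr.tr_op {ρ : Env} {o : Op} {args : Fin o.arity → Expr Ver Empty} {t : List Act} {v : Val} :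
    (Expr.op o args).Tr ρ t v ↔ ∃ ts vs, (∀ i, (args i).Tr ρ (ts i) (vs i)) ∧
      t = (List.ofFn ts).flatten ∧ v = o.eval vs := by
  constructor
  · intro h; cases h with | op _ _ ts vs h => exact ⟨ts, vs, h, rfl, rfl⟩
  · rintro ⟨ts, vs, h, rfl, rfl⟩; exact .op o args ts vs h

theorem Expr.tr_acc {ρ : Env} {f : ℕ} {l : Ver} {k : ℕ} {args : Fin k → Expr Ver Empty}
    {t : List Act} {v : Val} :
    (Expr.acc f l k args).Tr ρ t v ↔ ∃ ts vs, (∀ i, (args i).Tr ρ (ts i) (vs i)) ∧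
      t = (List.ofFn ts).flatten ++ [.read f (List.ofFn vs) v] := by
  constructor
  · intro h; cases h with | acc _ _ _ _ ts vs _ h => exact ⟨ts, vs, h, rfl⟩
  · rintro ⟨ts, vs, h, rfl⟩; exact .acc f l k args ts vs v h

/-- Only accesses act on the store, and only their values are left open by the trace semantics. -/
theorem Expr.AccFree.tr_iff {ρ : Env} {e : Expr Ver Empty} (h : e.AccFree) {t : List Act} {v : Val}
    {A : ℕ → List Val → Val} {η : Empty → Val} :
    e.Tr ρ t v ↔ t = [] ∧ v = e.eval ρ A η := by
  induction e generalizing t v with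
  | const c => exact Expr.tr_const
  | var x => exact Expr.tr_var
  | acc f l k args ih => exact h.elim
  | op o args ih =>
    rw [Expr.tr_op]
    constructor
    · rintro ⟨ts, vs, hs, rfl, rfl⟩
      have h1 : ts = fun _ => [] := funext fun i => ((ih i (h i)).1 (hs i)).1
      have h2 : vs = fun i => (args i).eval ρ A η := funext fun i => ((ih i (h i)).1 (hs i)).2
      subst h1 h2
      exact ⟨List.flatten_ofFn_nil _, rfl⟩
    · rintro ⟨rfl, rfl⟩
      exact ⟨fun _ => [], fun i => (args i).eval ρ A η, fun i => (ih i (h i)).2 ⟨rfl, rfl⟩,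
        (List.flatten_ofFn_nil _).symm, rfl⟩
  | hole x => exact x.elim

/-! ## Filled expressions -/

variable {Γ : Hole → Expr Ver Empty} {z : Input m n}

/-- Compatible fillings are closed. Hence `Val.toInt` in `holeVal` discards nothing, and the value
does not depend on the loop variables in scope at the place where the hole is filled. -/
theorem holeVal_spec (hΓ : Compatible m n Γ) {ρ : Env} (hρ : Base z ρ) (h : Hole)
    {A : ℕ → List Val → Val} {η : Empty → Val} :
    (Γ h).eval ρ A η = .int (holeVal Γ z h) := by
  obtain ⟨k, hk⟩ := (hΓ h).closed.eval_int (A := fun _ _ => .errMem) (η := Empty.elim) (Base.refl z)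
    fun h => h.elim
  have hη : η = Empty.elim := funext fun x => x.elim
  subst hη
  rw [(hΓ h).closed.eval_base hρ (A' := fun _ _ => .errMem), holeVal, hk, Val.toInt]

theorem Expr.AccFree.fill (hΓ : Compatible m n Γ) {e : TExpr} (h : e.AccFree) :
    (e.fill Γ).AccFree := by
  induction e with
  | acc f l k args ih => exact h.elim
  | op o args ih => exact fun i => ih i (h i)
  | hole x => exact (hΓ x).closed.1
  | _ => trivial

theorem Expr.AccFree.eval_fill (hΓ : Compatible m n Γ) {ρ : Env} (hρ : Base z ρ) {e : TExpr}
    (h : e.AccFree) {A : ℕ → List Val → Val} {η : Empty → Val} :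
    (e.fill Γ).eval ρ A η = e.tval (holeVal Γ z) ρ := by
  induction e with
  | acc f l k args ih => exact h.elim
  | op o args ih =>
    simp only [Expr.fill, Expr.tval, Expr.eval]
    congr 1
    funext i
    exact ih i (h i)
  | hole x => exact holeVal_spec hΓ hρ x
  | _ => rfl

theorem Expr.AccFree.tr_fill (hΓ : Compatible m n Γ) {ρ : Env} (hρ : Base z ρ) {e : TExpr}
    (h : e.AccFree) {t : List Act} {v : Val} :
    (e.fill Γ).Tr ρ t v ↔ t = [] ∧ v = e.tval (holeVal Γ z) ρ := by
  rw [(h.fill hΓ).tr_iff (A := fun _ _ => .errMem) (η := Empty.elim), h.eval_fill hΓ hρ]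

theorem Expr.Closed.tr_fill (hΓ : Compatible m n Γ) {ρ : Env} (hρ : Base z ρ) {e : TExpr}
    (h : e.Closed m n) {t : List Act} {v : Val} :
    (e.fill Γ).Tr ρ t v ↔ t = [] ∧ v = .int (e.num (holeVal Γ z) z) := by
  rw [h.1.tr_fill hΓ hρ, h.tval_eq hρ]

theorem Expr.Closed.qval_eq {η : Hole → ℤ} {φ : ℕ → List Val → ℤ} {ρ : Env} (hρ : Base z ρ)
    {e : TExpr} (h : e.Closed m n) : e.qval η φ ρ = .int (e.num η z) := by
  rw [h.1.qval_eq, h.tval_eq hρ]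

/-- Traces of filled expressions depend only on the variables that occur. -/
theorem Expr.tr_fill_congr (hΓ : Compatible m n Γ) {ρ ρ' : Env} (hρ : Base z ρ) (hρ' : Base z ρ')
    {e : TExpr} (h : ∀ v ∈ e.vars, ρ v = ρ' v) {t : List Act} {v : Val} :
    (e.fill Γ).Tr ρ t v → (e.fill Γ).Tr ρ' t v := by
  induction e generalizing t v with
  | const c => simp only [Expr.fill, Expr.tr_const]; exact id
  | var x => simp only [Expr.fill, Expr.tr_var, h x (by simp [Expr.vars])]; exact id
  | acc f l k args ih =>
    simp only [Expr.fill, Expr.tr_acc]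
    rintro ⟨ts, vs, hs, rfl⟩
    exact ⟨ts, vs, fun i => ih i (fun v hv => h v (Expr.mem_vars_acc.2 ⟨i, hv⟩)) (hs i), rfl⟩
  | op o args ih =>
    simp only [Expr.fill, Expr.tr_op]
    rintro ⟨ts, vs, hs, rfl, rfl⟩
    exact ⟨ts, vs, fun i => ih i (fun v hv => h v (Expr.mem_vars_op.2 ⟨i, hv⟩)) (hs i), rfl, rfl⟩
  | hole x =>
    -- The filling may contain variables that `Expr.vars` of the hole does not list. They are
    -- parameters and window bounds, on which both environments agree by `Base`.
    have hx : (Expr.hole x : TExpr).AccFree := trivial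
    rw [hx.tr_fill hΓ hρ, hx.tr_fill hΓ hρ']
    exact id

theorem Expr.qval_congr {η : Hole → ℤ} {φ : ℕ → List Val → ℤ} {ρ ρ' : Env} {e : TExpr}
    (h : ∀ v ∈ e.vars, ρ v = ρ' v) : e.qval η φ ρ = e.qval η φ ρ' := e.eval_congr h

theorem Expr.queryCpu_congr {η : Hole → ℤ} {φ : ℕ → List Val → ℤ} {ρ ρ' : Env} {st : Option Stage}
    {e : TExpr} (h : ∀ v ∈ e.vars, ρ v = ρ' v) :
    e.queryCpu η φ ρ st ↔ e.queryCpu η φ ρ' st := by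
  induction e with
  | acc f l k args ih =>
    have h' := fun i v hv => h v (Expr.mem_vars_acc.2 ⟨i, hv⟩)
    have e1 : (List.ofFn fun i => (args i).qval η φ ρ) = List.ofFn fun i => (args i).qval η φ ρ' := by
      congr 1; funext i; exact Expr.qval_congr (h' i)
    simp only [Expr.queryCpu, e1, fun i => ih i (h' i)]
  | op o args ih =>
    simp only [Expr.queryCpu]
    exact forall_congr' fun i => ih i fun v hv => h v (Expr.mem_vars_op.2 ⟨i, hv⟩)
  | _ => rfl

theorem Expr.queryMem_congr {η : Hole → ℤ} {φ : ℕ → List Val → ℤ} {ρ ρ' : Env} {st : Option Stage}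
    {e : TExpr} (h : ∀ v ∈ e.vars, ρ v = ρ' v) :
    e.queryMem η φ ρ st ↔ e.queryMem η φ ρ' st := by
  induction e with
  | acc f l k args ih =>
    have h' := fun i v hv => h v (Expr.mem_vars_acc.2 ⟨i, hv⟩)
    have e1 : (List.ofFn fun i => (args i).qval η φ ρ) = List.ofFn fun i => (args i).qval η φ ρ' := by
      congr 1; funext i; exact Expr.qval_congr (h' i)
    simp only [Expr.queryMem, e1]
    exact and_congr_left' (forall_congr' fun i => Expr.queryCpu_congr (h' i))
  | op o args ih =>
    simp only [Expr.queryMem]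
    exact forall_congr' fun i => ih i fun v hv => h v (Expr.mem_vars_op.2 ⟨i, hv⟩)
  | _ => rfl

/-! ## Inversion of statement traces -/

theorem Stmt.tr_nop {ρ : Env} {t : List Act} : (Stmt.nop : Stmt Empty).Tr ρ t ↔ t = [] := by
  constructor
  · intro h; cases h; rfl
  · rintro rfl; exact .nop ρ

theorem Stmt.tr_seq {ρ : Env} {s₁ s₂ : Stmt Empty} {t : List Act} :
    (Stmt.seq s₁ s₂).Tr ρ t ↔ ∃ t₁ t₂, s₁.Tr ρ t₁ ∧ s₂.Tr ρ t₂ ∧ t = t₁ ++ t₂ := by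
  constructor
  · intro h; cases h with | seq _ _ _ t₁ t₂ h₁ h₂ => exact ⟨t₁, t₂, h₁, h₂, rfl⟩
  · rintro ⟨t₁, t₂, h₁, h₂, rfl⟩; exact .seq ρ _ _ t₁ t₂ h₁ h₂

theorem Stmt.tr_label {ρ : Env} {l : Label} {s : Stmt Empty} {t : List Act} :
    (Stmt.label l s).Tr ρ t ↔ s.Tr ρ t := by
  constructor
  · intro h; cases h; assumption
  · exact .label ρ l s t

theorem Stmt.tr_letIn {ρ : Env} {x : Var} {e : Expr Ver Empty} {s : Stmt Empty} {t : List Act} :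
    (Stmt.letIn x e s).Tr ρ t ↔ ∃ t₁ t₂ v, e.Tr ρ t₁ v ∧ s.Tr (Function.update ρ x v) t₂ ∧
      t = t₁ ++ t₂ := by
  constructor
  · intro h; cases h with | letIn _ _ _ _ t₁ t₂ v h₁ h₂ => exact ⟨t₁, t₂, v, h₁, h₂, rfl⟩
  · rintro ⟨t₁, t₂, v, h₁, h₂, rfl⟩; exact .letIn ρ x e s t₁ t₂ v h₁ h₂

theorem Stmt.tr_ite {ρ : Env} {e : Expr Ver Empty} {s₁ s₂ : Stmt Empty} {t : List Act} :
    (Stmt.ite e s₁ s₂).Tr ρ t ↔ ∃ t₁ t₂ v, e.Tr ρ t₁ v ∧ t = t₁ ++ t₂ ∧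
      ((v ≠ .int 0 ∧ s₁.Tr ρ t₂) ∨ (v = .int 0 ∧ s₂.Tr ρ t₂)) := by
  constructor
  · intro h
    cases h with
    | iteTrue _ _ _ _ t t' v h hv hs => exact ⟨t, t', v, h, rfl, .inl ⟨hv, hs⟩⟩
    | iteFalse _ _ _ _ t t' h hs => exact ⟨t, t', _, h, rfl, .inr ⟨rfl, hs⟩⟩
  · rintro ⟨t₁, t₂, v, h, rfl, ⟨hv, hs⟩ | ⟨rfl, hs⟩⟩
    · exact .iteTrue ρ e _ _ t₁ t₂ v h hv hs
    · exact .iteFalse ρ e _ _ t₁ t₂ h hs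

theorem Stmt.tr_assign {ρ : Env} {f : ℕ} {l : Ver} {k : ℕ} {args : Fin k → Expr Ver Empty}
    {e : Expr Ver Empty} {t : List Act} :
    (Stmt.assign f l k args e).Tr ρ t ↔ ∃ ts vs t₁ v, e.Tr ρ t₁ v ∧
      (∀ i, (args i).Tr ρ (ts i) (vs i)) ∧
      t = t₁ ++ (List.ofFn ts).flatten ++ [.write f (List.ofFn vs) v] := by
  constructor
  · intro h; cases h with | assign _ _ _ _ _ _ ts vs t v h₁ h₂ => exact ⟨ts, vs, t, v, h₁, h₂, rfl⟩
  · rintro ⟨ts, vs, t, v, h₁, h₂, rfl⟩; exact .assign ρ f l k args e ts vs t v h₁ h₂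

/-- Closed bounds cause no actions and evaluate to fixed integers. With a nonnegative length this
rules out both failing rules for loops, so that only families of iteration traces remain. -/
theorem Stmt.tr_loop_fill (hΓ : Compatible m n Γ) {ρ : Env} (hρ : Base z ρ) {τ : Order} {x : Var}
    {lo len : TExpr} (hlo : lo.Closed m n) (hlen : len.Closed m n)
    (h0 : 0 ≤ len.num (holeVal Γ z) z) {s : Stmt Empty} {t : List Act} :
    (Stmt.loop τ x (lo.fill Γ) (len.fill Γ) s).Tr ρ t ↔
      ∃ ts : Fin (len.num (holeVal Γ z) z).toNat → List Act,
        (∀ i : Fin _, s.Tr (Function.update ρ x (.int (lo.num (holeVal Γ z) z + (i : ℕ)))) (ts i)) ∧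
        ((τ = .serial ∧ t = (List.ofFn ts).flatten) ∨ (τ = .parallel ∧ Interleave ts t)) := by
  have key : ∀ {t₁ t₂ a k}, (lo.fill Γ).Tr ρ t₁ a → (len.fill Γ).Tr ρ t₂ k →
      t₁ = [] ∧ t₂ = [] ∧ a = .int (lo.num (holeVal Γ z) z) ∧ k = .int (len.num (holeVal Γ z) z) := by
    intro t₁ t₂ a k h₁ h₂
    rw [hlo.tr_fill hΓ hρ] at h₁
    rw [hlen.tr_fill hΓ hρ] at h₂
    exact ⟨h₁.1, h₂.1, h₁.2, h₂.2⟩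
  have clo := (hlo.tr_fill hΓ hρ).2 ⟨rfl, rfl⟩
  have clen := (hlen.tr_fill hΓ hρ).2 ⟨rfl, rfl⟩
  constructor
  · intro h
    cases h with
    | loopSerial _ _ _ _ _ t₁ t₂ a k ts h₁ h₂ hs =>
      obtain ⟨rfl, rfl, ha, hk⟩ := key h₁ h₂
      obtain rfl := Val.int.inj ha
      have hk' := Val.int.inj hk
      obtain rfl : k = (len.num (holeVal Γ z) z).toNat := by omega
      exact ⟨ts, hs, .inl ⟨rfl, rfl⟩⟩
    | loopParallel _ _ _ _ _ t₁ t₂ a k ts t h₁ h₂ hs ht =>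
      obtain ⟨rfl, rfl, ha, hk⟩ := key h₁ h₂
      obtain rfl := Val.int.inj ha
      have hk' := Val.int.inj hk
      obtain rfl : k = (len.num (holeVal Γ z) z).toNat := by omega
      exact ⟨ts, hs, .inr ⟨rfl, ht⟩⟩
    | loopNeg _ _ _ _ _ _ t₁ t₂ a k hk h₁ h₂ =>
      obtain ⟨rfl, rfl, ha, hk'⟩ := key h₁ h₂
      have := Val.int.inj hk'
      omega
    | loopErr _ _ _ _ _ _ t₁ t₂ a k herr h₁ h₂ =>
      obtain ⟨rfl, rfl, rfl, rfl⟩ := key h₁ h₂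
      simp [Val.IsErr] at herr
  · have e : len.num (holeVal Γ z) z = ((len.num (holeVal Γ z) z).toNat : ℤ) := by omega
    rw [e] at clen
    rintro ⟨ts, hs, ⟨rfl, rfl⟩ | ⟨rfl, ht⟩⟩
    · exact .loopSerial ρ x _ _ s [] [] _ _ ts clo clen hs
    · exact .loopParallel ρ x _ _ s [] [] _ _ ts t clo clen hs ht

end Halide

namespace Halide

/-! ## Single steps of a run -/

/-- The action succeeds on `σ` and leads to `σ'`. -/
def Act.Step (σ σ' : Store) : Act → Prop
  | .read f p v => σ' = σ ∧ ∃ b, σ f = some b ∧ b.InBounds p ∧ v = b.val p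
  | .write f p v => ∃ b, σ f = some b ∧ b.InBounds p ∧
      σ' = Function.update σ f (some (b.set p v))
  | .alloc f I => σ' = Function.update σ f (some ⟨I, fun _ => .errMem⟩)
  | .fail _ => False

/-- The action fails on `σ`. -/
def Act.FailsAt (σ : Store) (k : Failure) : Act → Prop
  | .read f p _ => k = .mem ∧ ¬ ∃ b, σ f = some b ∧ b.InBounds p
  | .write f p _ => k = .mem ∧ ¬ ∃ b, σ f = some b ∧ b.InBounds p
  | .alloc _ _ => False
  | .fail k' => k = k'

theorem run_nil {σ : Store} {o : Outcome} : Run σ [] o ↔ o = .done σ := by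
  constructor
  · intro h; cases h; rfl
  · rintro rfl; exact .nil σ

theorem run_cons {σ : Store} {a : Act} {t : List Act} {o : Outcome} :
    Run σ (a :: t) o ↔ (∃ σ', a.Step σ σ' ∧ Run σ' t o) ∨ ∃ k, a.FailsAt σ k ∧ o = .failed k := by
  constructor
  · intro h
    cases h with
    | read _ f p b _ _ hb hp h => exact .inl ⟨σ, ⟨rfl, b, hb, hp, rfl⟩, h⟩
    | write _ f p v b _ _ hb hp h => exact .inl ⟨_, ⟨b, hb, hp, rfl⟩, h⟩
    | alloc _ f I _ _ h => exact .inl ⟨_, rfl, h⟩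
    | readErr _ f p v _ h => exact .inr ⟨_, ⟨rfl, h⟩, rfl⟩
    | writeErr _ f p v _ h => exact .inr ⟨_, ⟨rfl, h⟩, rfl⟩
    | fail _ k _ => exact .inr ⟨k, rfl, rfl⟩
  · rintro (⟨σ', h, hr⟩ | ⟨k, h, rfl⟩)
    · cases a with
      | read f p v => obtain ⟨rfl, b, hb, hp, rfl⟩ := h; exact .read _ f p b t o hb hp hr
      | write f p v => obtain ⟨b, hb, hp, rfl⟩ := h; exact .write σ f p v b t o hb hp hr
      | alloc f I => obtain rfl := h; exact .alloc σ f I t o hr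
      | fail k => exact h.elim
    · cases a with
      | read f p v => obtain ⟨rfl, h⟩ := h; exact .readErr σ f p v t h
      | write f p v => obtain ⟨rfl, h⟩ := h; exact .writeErr σ f p v t h
      | alloc f I => exact h.elim
      | fail k' => obtain rfl := h; exact .fail σ _ t

theorem run_append {σ : Store} {t₁ t₂ : List Act} {o : Outcome} :
    Run σ (t₁ ++ t₂) o ↔ (∃ σ', Run σ t₁ (.done σ') ∧ Run σ' t₂ o) ∨
      ∃ k, Run σ t₁ (.failed k) ∧ o = .failed k := by
  induction t₁ generalizing σ with
  | nil => simp [run_nil]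
  | cons a t ih =>
    simp only [List.cons_append, run_cons, ih]
    constructor
    · rintro (⟨σ', h, ⟨σ'', h1, h2⟩ | ⟨k, h1, rfl⟩⟩ | ⟨k, h, rfl⟩)
      · exact .inl ⟨σ'', .inl ⟨σ', h, h1⟩, h2⟩
      · exact .inr ⟨k, .inl ⟨σ', h, h1⟩, rfl⟩
      · exact .inr ⟨k, .inr ⟨k, h, rfl⟩, rfl⟩
    · rintro (⟨σ'', ⟨σ', h, h1⟩ | ⟨k, _, h1⟩, h2⟩ | ⟨k, ⟨σ', h, h1⟩ | ⟨k', h, h1⟩, rfl⟩)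
      · exact .inl ⟨σ', h, .inl ⟨σ'', h1, h2⟩⟩
      · cases h1
      · exact .inl ⟨σ', h, .inr ⟨k, h1, rfl⟩⟩
      · cases h1; exact .inr ⟨k, h, rfl⟩

/-- Runs of a concatenation all of whose parts leave the store as it is. -/
theorem run_flatten_const {σ : Store} {L : List (List Act)} {t : List Act} {o : Outcome}
    (hL : ∀ l ∈ L, ∀ o, Run σ l o → o = .done σ) (h : Run σ (L.flatten ++ t) o) :
    (∀ l ∈ L, Run σ l (.done σ)) ∧ Run σ t o := by
  induction L with
  | nil => exact ⟨by simp, h⟩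
  | cons l L ih =>
    rw [List.flatten_cons, List.append_assoc, run_append] at h
    rcases h with ⟨σ', h1, h2⟩ | ⟨k, h1, rfl⟩
    · have := hL l (by simp) _ h1
      cases this
      obtain ⟨h3, h4⟩ := ih (fun l hl => hL l (by simp [hl])) h2
      exact ⟨by simpa using ⟨h1, h3⟩, h4⟩
    · cases hL l (by simp) _ h1

theorem run_ofFn_const {k : ℕ} {σ : Store} {ts : Fin k → List Act} {t : List Act} {o : Outcome}
    (hL : ∀ i o, Run σ (ts i) o → o = .done σ) (h : Run σ ((List.ofFn ts).flatten ++ t) o) :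
    (∀ i, Run σ (ts i) (.done σ)) ∧ Run σ t o := by
  obtain ⟨h1, h2⟩ := run_flatten_const (L := List.ofFn ts) (fun l hl => by
    obtain ⟨i, rfl⟩ := List.mem_ofFn.1 hl; exact hL i) h
  exact ⟨fun i => h1 _ (List.mem_ofFn.2 ⟨i, rfl⟩), h2⟩

/-! ## Stores that agree on a region -/

/-- The stores agree, except for the values of `f` outside of `A`. -/
def SAgree (f : ℕ) (A : List Val → Prop) (σ σ' : Store) : Prop :=
  (∀ g ≠ f, σ g = σ' g) ∧ ∃ b b', σ f = some b ∧ σ' f = some b' ∧ b.bounds = b'.bounds ∧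
    ∀ p, A p → b.val p = b'.val p

/-- Whether an access fails depends only on the bounds of the buffers, which agree even where the
contents differ. -/
theorem SAgree.inBounds {f : ℕ} {A : List Val → Prop} {σ σ' : Store} (h : SAgree f A σ σ') (g : ℕ)
    (p : List Val) : (∃ b, σ g = some b ∧ b.InBounds p) ↔ ∃ b, σ' g = some b ∧ b.InBounds p := by
  obtain ⟨h1, b, b', hb, hb', h2, h3⟩ := h
  by_cases hg : g = f
  · subst hg
    simp [hb, hb', Buffer.InBounds, h2]
  · rw [h1 g hg]

theorem SAgree.symm {f : ℕ} {A : List Val → Prop} {σ σ' : Store} (h : SAgree f A σ σ') :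
    SAgree f A σ' σ := by
  obtain ⟨h1, b, b', hb, hb', h2, h3⟩ := h
  exact ⟨fun g hg => (h1 g hg).symm, b', b, hb', hb, h2.symm, fun p hp => (h3 p hp).symm⟩

/-- The action accesses `f` only at points of `A`, and writes to `f` only. -/
def Act.Within (f : ℕ) (A : List Val → Prop) : Act → Prop
  | .read g p _ => g = f → A p
  | .write g p _ => g = f ∧ A p
  | .alloc _ _ => False
  | .fail _ => True

theorem Act.Step.agree {f : ℕ} {A : List Val → Prop} {σ₁ σ₂ σ₁' : Store} (h : SAgree f A σ₁ σ₂)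
    {a : Act} (ha : a.Within f A) (hs : a.Step σ₁ σ₁') :
    ∃ σ₂', a.Step σ₂ σ₂' ∧ SAgree f A σ₁' σ₂' := by
  have hin := h.inBounds
  obtain ⟨h1, b₁, b₂, hb₁, hb₂, h2, h3⟩ := id h
  cases a with
  | read g p v =>
    obtain ⟨rfl, b, hb, hp, rfl⟩ := hs
    obtain ⟨b', hb', hp'⟩ := (hin g p).1 ⟨b, hb, hp⟩
    refine ⟨σ₂, ⟨rfl, b', hb', hp', ?_⟩, h⟩
    by_cases hg : g = f
    · subst hg
      rw [hb₁] at hb; rw [hb₂] at hb'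
      cases hb; cases hb'
      exact h3 p (ha rfl)
    · rw [h1 g hg, hb'] at hb
      cases hb; rfl
  | write g p v =>
    obtain ⟨rfl, hA⟩ := ha
    obtain ⟨b, hb, hp, rfl⟩ := hs
    obtain ⟨b', hb', hp'⟩ := (hin g p).1 ⟨b, hb, hp⟩
    rw [hb₁] at hb; rw [hb₂] at hb'
    cases hb; cases hb'
    refine ⟨_, ⟨b₂, hb₂, hp', rfl⟩, fun g' hg' => ?_, b₁.set p v, b₂.set p v, by simp, by simp, h2, ?_⟩
    · simp [Function.update_of_ne hg', h1 g' hg']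
    · intro q hq
      simp only [Buffer.set]
      split_ifs
      · rfl
      · exact h3 q hq
  | alloc g I => exact ha.elim
  | fail k => exact hs.elim

theorem Act.FailsAt.agree {f : ℕ} {A : List Val → Prop} {σ₁ σ₂ : Store} (h : SAgree f A σ₁ σ₂)
    {a : Act} {k : Failure} (hs : a.FailsAt σ₁ k) : a.FailsAt σ₂ k := by
  cases a with
  | read g p v => exact ⟨hs.1, fun h' => hs.2 ((h.inBounds g p).2 h')⟩
  | write g p v => exact ⟨hs.1, fun h' => hs.2 ((h.inBounds g p).2 h')⟩
  | alloc g I => exact hs.elim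
  | fail k' => exact hs

/-- A trace that accesses `f` within `A` runs alike on stores that agree on `A`. -/
theorem Run.agree {f : ℕ} {A : List Val → Prop} {σ₁ σ₂ : Store} (h : SAgree f A σ₁ σ₂)
    {t : List Act} (ht : ∀ a ∈ t, a.Within f A) {o : Outcome} (hr : Run σ₁ t o) :
    (∃ k, o = .failed k ∧ Run σ₂ t (.failed k)) ∨
      ∃ σ₁' σ₂', o = .done σ₁' ∧ Run σ₂ t (.done σ₂') ∧ SAgree f A σ₁' σ₂' := by
  induction t generalizing σ₁ σ₂ with
  | nil => exact .inr ⟨σ₁, σ₂, run_nil.1 hr, run_nil.2 rfl, h⟩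
  | cons a t ih =>
    rcases run_cons.1 hr with ⟨σ', hs, hr'⟩ | ⟨k, hf, rfl⟩
    · obtain ⟨σ₂', hs', h'⟩ := hs.agree h (ht a (by simp))
      rcases ih h' (fun a ha => ht a (by simp [ha])) hr' with ⟨k, rfl, hk⟩ | ⟨τ, τ', rfl, h1, h2⟩
      · exact .inl ⟨k, rfl, run_cons.2 (.inl ⟨_, hs', hk⟩)⟩
      · exact .inr ⟨τ, τ', rfl, run_cons.2 (.inl ⟨_, hs', h1⟩), h2⟩
    · exact .inl ⟨k, rfl, run_cons.2 (.inr ⟨k, hf.agree h, rfl⟩)⟩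

/-! ## Interleavings of arbitrary families -/

open Classical in
/-- Interleavings of a family with an arbitrary index type. -/
inductive Inter {ι : Type} : (ι → List Act) → List Act → Prop
  | nil : Inter (fun _ => []) []
  | cons (ts : ι → List Act) (k : ι) (a : Act) (t l : List Act) (hk : ts k = a :: t)
      (h : Inter (Function.update ts k t) l) : Inter ts (a :: l)

theorem interleave_iff_inter {k : ℕ} {ts : Fin k → List Act} {t : List Act} :
    Interleave ts t ↔ Inter ts t := by
  constructor
  · intro h
    induction h with
    | nil => exact .nil
    -- The two notions differ only in the decidability instance inside `Function.update`, which
    -- `convert` reconciles.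
    | cons ts i a t l hk _ ih => exact .cons ts i a t l hk (by convert ih)
  · intro h
    induction h with
    | nil => exact .nil
    | cons ts i a t l hk _ ih => exact .cons ts i a t l hk (by convert ih)

/-- Finishing the first interleaving before the second one starts respects the order within each
thread. This is how serial loops are read as interleavings. -/
theorem Inter.append {ι : Type} {ts ts' : ι → List Act} {t t' : List Act} (h : Inter ts t)
    (h' : Inter ts' t') : Inter (fun i => ts i ++ ts' i) (t ++ t') := by
  classical
  induction h with
  | nil => simpa using h'
  | cons ts i a t l hk _ ih =>
    refine .cons _ i a (t ++ ts' i) (l ++ t') (by simp [hk]) ?_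
    convert ih using 1
    funext j
    by_cases hj : j = i
    · subst hj; simp
    · simp [Function.update_of_ne hj]

theorem Inter.eq_nil {ι : Type} {ts : ι → List Act} (h : Inter ts []) : ts = fun _ => [] := by
  cases h; rfl

theorem Inter.of_nil {ι : Type} {t : List Act} (h : Inter (fun _ : ι => []) t) : t = [] := by
  cases h with
  | nil => rfl
  | cons _ _ _ _ _ hk _ => cases hk

open Classical in
theorem Inter.single {ι : Type} (i : ι) (t : List Act) :
    Inter (fun j => if j = i then t else []) t := by
  induction t with
  | nil => simpa using Inter.nil
  | cons a t ih =>
    refine .cons _ i a t _ (by simp) ?_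
    convert ih using 1
    funext j
    by_cases hj : j = i
    · subst hj; simp
    · simp [hj]

open Classical in
theorem Inter.flatMap {ι : Type} (L : List ι) (hL : L.Nodup) (ts : ι → List Act) :
    Inter (fun i => if i ∈ L then ts i else []) (L.flatMap ts) := by
  induction L with
  | nil => simpa using Inter.nil
  | cons i L ih =>
    obtain ⟨h1, h2⟩ := List.nodup_cons.1 hL
    rw [List.flatMap_cons]
    convert (Inter.single i (ts i)).append (ih h2) using 1
    funext j
    by_cases hj : j = i
    · subst hj; simp [h1]
    · simp [hj]

theorem Interleave.flatten_ofFn {k : ℕ} (ts : Fin k → List Act) :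
    Interleave ts (List.ofFn ts).flatten := by
  rw [interleave_iff_inter]
  have := Inter.flatMap (List.finRange k) (List.nodup_finRange k) ts
  simpa [List.flatMap, List.ofFn_eq_map] using this

/-- Change of the index type. -/
theorem Inter.retag {ι κ : Type} {ts : ι → List Act} {t : List Act} (h : Inter ts t) {S : Set ι}
    {f : ι → κ} (hinj : Set.InjOn f S) (hS : ∀ i ∉ S, ts i = []) {ts' : κ → List Act}
    (h1 : ∀ i ∈ S, ts' (f i) = ts i) (h2 : ∀ k, k ∉ f '' S → ts' k = []) : Inter ts' t := by
  classical
  induction h generalizing ts' with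
  | nil =>
    have : ts' = fun _ => [] := by
      funext k
      by_cases hk : k ∈ f '' S
      · obtain ⟨i, hi, rfl⟩ := hk
        exact h1 i hi
      · exact h2 k hk
    rw [this]
    exact .nil
  | cons ts i a t l hk _ ih =>
    have hi : i ∈ S := by
      by_contra hi
      rw [hS i hi] at hk
      cases hk
    refine .cons _ (f i) a t l ((h1 i hi).trans hk) ?_
    have := ih (ts' := Function.update ts' (f i) t) ?_ ?_ ?_
    · convert this
    · intro j hj
      have : j ≠ i := by rintro rfl; exact hj hi
      rw [Function.update_of_ne this]
      exact hS j hj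
    · intro j hj
      by_cases hji : j = i
      · subst hji; simp
      · rw [Function.update_of_ne hji, Function.update_of_ne (fun e => hji (hinj hj hi e))]
        exact h1 j hj
    · intro k' hk'
      rw [Function.update_of_ne (by rintro rfl; exact hk' ⟨i, hi, rfl⟩)]
      exact h2 k' hk'

/-- An interleaving of interleavings. -/
theorem Inter.bind {ι κ : Type} {ts : ι → List Act} {t : List Act} (h : Inter ts t)
    {TS : ι → κ → List Act} (hT : ∀ i, Inter (TS i) (ts i)) :
    Inter (fun q : ι × κ => TS q.1 q.2) t := by
  classical
  induction h generalizing TS with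
  | nil =>
    have : (fun q : ι × κ => TS q.1 q.2) = fun _ => [] := by
      funext q
      rw [(hT q.1).eq_nil]
    rw [this]
    exact .nil
  | cons ts i a t l hk _ ih =>
    have hi := hT i
    rw [hk] at hi
    generalize hTS : TS i = TSi at hi
    cases hi with
    | cons _ j _ r _ hj hr =>
      subst hTS
      refine .cons _ (i, j) a r l hj ?_
      have := ih (TS := Function.update TS i (Function.update (TS i) j r)) ?_
      · convert this using 1
        funext q
        obtain ⟨i', j'⟩ := q
        by_cases h1 : i' = i
        · subst h1
          by_cases h2 : j' = j
          · subst h2; simp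
          · simp [h2]
        · simp [h1]
      · intro i'
        by_cases h1 : i' = i
        · subst h1; simp only [Function.update_self]; convert hr
        · simp only [Function.update_of_ne h1]; exact hT i'

/-- Runs of interleavings preserve predicates that are preserved by the steps of all threads. -/
theorem Inter.run {ι : Type} {OK : ι → Store → List Act → Prop}
    (hstep : ∀ i σ a r, OK i σ (a :: r) → (∀ k, ¬ a.FailsAt σ k) ∧ ∀ σ', a.Step σ σ' →
      OK i σ' r ∧ ∀ j ≠ i, ∀ r', OK j σ r' → OK j σ' r')
    {ts : ι → List Act} {t : List Act} (h : Inter ts t) {σ : Store} (h0 : ∀ i, OK i σ (ts i))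
    {o : Outcome} (hr : Run σ t o) : ∃ σ', o = .done σ' ∧ ∀ i, OK i σ' [] := by
  classical
  induction h generalizing σ with
  | nil => exact ⟨σ, run_nil.1 hr, h0⟩
  | cons ts i a t l hk _ ih =>
    have hi := h0 i
    rw [hk] at hi
    obtain ⟨h1, h2⟩ := hstep i σ a t hi
    rcases run_cons.1 hr with ⟨σ', hs, hr'⟩ | ⟨k, hf, rfl⟩
    · obtain ⟨h3, h4⟩ := h2 σ' hs
      refine ih (fun j => ?_) hr'
      by_cases hj : j = i
      · subst hj; simpa using h3
      · rw [Function.update_of_ne hj]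
        exact h4 j hj _ (h0 j)
    · exact (h1 k hf).elim

/-- Threads that access disjoint regions of `f` do not interfere with each other. -/
theorem Inter.run_disjoint {ι : Type} {f : ℕ} {A : ι → List Val → Prop}
    (hdisj : ∀ i j, i ≠ j → ∀ p, A i p → ¬ A j p) {ts : ι → List Act}
    (hw : ∀ i, ∀ a ∈ ts i, a.Within f (A i)) {Post : ι → Store → Prop}
    (hPost : ∀ i σ σ', SAgree f (A i) σ σ' → Post i σ → Post i σ') {σ : Store} {b : Buffer}
    (hb : σ f = some b)
    (hsolo : ∀ i o, Run σ (ts i) o → ∃ σ', o = .done σ' ∧ Post i σ') {t : List Act}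
    (h : Inter ts t) {o : Outcome} (hr : Run σ t o) :
    ∃ σ', o = .done σ' ∧ (∀ g ≠ f, σ' g = σ g) ∧
      (∃ b', σ' f = some b' ∧ b'.bounds = b.bounds) ∧ ∀ i, Post i σ' := by
  -- Invariant of a thread: its remainder, run alone from the present store, succeeds and
  -- establishes the postcondition. Other threads alter the store only outside of `A i`, so
  -- `Run.agree` carries the solo run over to the altered store.
  let OK : ι → Store → List Act → Prop := fun i τ r =>
    (∀ a ∈ r, a.Within f (A i)) ∧ (∀ g ≠ f, τ g = σ g) ∧
    (∃ b', τ f = some b' ∧ b'.bounds = b.bounds) ∧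
    ∀ o, Run τ r o → ∃ σ', o = .done σ' ∧ Post i σ'
  have hstep : ∀ i τ a r, OK i τ (a :: r) → (∀ k, ¬ a.FailsAt τ k) ∧ ∀ τ', a.Step τ τ' →
      OK i τ' r ∧ ∀ j ≠ i, ∀ r', OK j τ r' → OK j τ' r' := by
    rintro i τ a r ⟨h1, h2, ⟨b', h3, h4⟩, h5⟩
    refine ⟨fun k hk => ?_, fun τ' hs => ?_⟩
    · obtain ⟨_, h6, _⟩ := h5 _ (run_cons.2 (.inr ⟨k, hk, rfl⟩))
      cases h6
    · have ha := h1 a (by simp)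
      have key : (∀ g ≠ f, τ' g = τ g) ∧ ∃ b'', τ' f = some b'' ∧ b''.bounds = b'.bounds ∧
          ∀ p, ¬ A i p → b'.val p = b''.val p := by
        cases a with
        | read g p v => obtain ⟨rfl, _⟩ := hs; exact ⟨fun _ _ => rfl, b', h3, rfl, fun _ _ => rfl⟩
        | write g p v =>
          obtain ⟨rfl, hA⟩ := ha
          obtain ⟨b₁, hb₁, _, rfl⟩ := hs
          rw [h3] at hb₁
          cases hb₁
          refine ⟨fun g' hg' => by simp [Function.update_of_ne hg'], b'.set p v, by simp, rfl, ?_⟩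
          intro q hq
          have : q ≠ p := by rintro rfl; exact hq hA
          simp [Buffer.set, this]
        | alloc g I => exact ha.elim
        | fail k => exact hs.elim
      obtain ⟨k1, b'', k2, k3, k4⟩ := key
      refine ⟨⟨fun a ha => h1 a (by simp [ha]), fun g hg => (k1 g hg).trans (h2 g hg),
        ⟨b'', k2, k3.trans h4⟩, fun o ho => h5 o (run_cons.2 (.inl ⟨τ', hs, ho⟩))⟩, ?_⟩
      rintro j hj r' ⟨j1, j2, j3, j4⟩
      refine ⟨j1, fun g hg => (k1 g hg).trans (h2 g hg), ⟨b'', k2, k3.trans h4⟩, fun o ho => ?_⟩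
      have hag : SAgree f (A j) τ' τ :=
        ⟨k1, b'', b', k2, h3, k3, fun p hp => (k4 p (hdisj j i hj p hp)).symm⟩
      rcases ho.agree hag j1 with ⟨k, rfl, hk⟩ | ⟨τ₁, τ₂, rfl, hd, hag'⟩
      · obtain ⟨_, h6, _⟩ := j4 _ hk
        cases h6
      · obtain ⟨_, h6, h7⟩ := j4 _ hd
        cases h6
        exact ⟨τ₁, rfl, hPost j _ _ hag'.symm h7⟩
  obtain ⟨σ', rfl, h'⟩ := Inter.run (OK := OK) hstep h
    (fun i => ⟨hw i, fun _ _ => rfl, ⟨b, hb, rfl⟩, hsolo i⟩) hr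
  -- What is known of the store as a whole is stored in the invariant of each thread. If there are
  -- no threads, the trace is empty and the store is unchanged.
  by_cases hne : Nonempty ι
  · obtain ⟨i⟩ := hne
    refine ⟨σ', rfl, (h' i).2.1, (h' i).2.2.1, fun j => ?_⟩
    obtain ⟨σ'', h1, h2⟩ := (h' j).2.2.2 _ (.nil σ')
    cases h1
    exact h2
  · have : t = [] := by
      cases h with
      | nil => rfl
      | cons _ i => exact (hne ⟨i⟩).elim
    subst this
    cases run_nil.1 hr
    exact ⟨σ, rfl, fun _ _ => rfl, ⟨b, hb, rfl⟩, fun i => (hne ⟨i⟩).elim⟩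

/-- Threads that do not read `f` and write only good values. -/
theorem Inter.run_writes {ι : Type} {f : ℕ} {Good : List Val → Val → Prop}
    {target : ι → List Val → Prop} {ts : ι → List Act} {σ : Store} {b : Buffer}
    (hb : σ f = some b)
    (hts : ∀ i, (ts i = [] ∧ ∀ p, ¬ target i p) ∨ ∃ r c v, ts i = r ++ [.write f c v] ∧
      (∀ a ∈ r, a.Within f (fun _ => False)) ∧
      (∀ o, Run σ r o → o = .done σ ∧ b.InBounds c ∧ Good c v) ∧ ∀ p, target i p → p = c)
    {t : List Act} (h : Inter ts t) {o : Outcome} (hr : Run σ t o) :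
    ∃ σ', o = .done σ' ∧ (∀ g ≠ f, σ' g = σ g) ∧
      ∃ b', σ' f = some b' ∧ b'.bounds = b.bounds ∧ ∀ i p, target i p → Good p (b'.val p) := by
  -- A thread has finished and its targets hold good values, or its only write is still ahead and
  -- everything before this write leaves the store alone.
  let OK : ι → Store → List Act → Prop := fun i τ r =>
    (∀ g ≠ f, τ g = σ g) ∧ ∃ b', τ f = some b' ∧ b'.bounds = b.bounds ∧
    ((r = [] ∧ ∀ p, target i p → Good p (b'.val p)) ∨ ∃ r' c v, r = r' ++ [.write f c v] ∧
      (∀ a ∈ r', a.Within f (fun _ => False)) ∧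
      (∀ o, Run τ r' o → o = .done τ ∧ b'.InBounds c ∧ Good c v) ∧ ∀ p, target i p → p = c)
  have hstep : ∀ i τ a r, OK i τ (a :: r) → (∀ k, ¬ a.FailsAt τ k) ∧ ∀ τ', a.Step τ τ' →
      OK i τ' r ∧ ∀ j ≠ i, ∀ r', OK j τ r' → OK j τ' r' := by
    rintro i τ a r ⟨h1, b', h2, h3, ⟨h4, _⟩ | ⟨r', c, v, h4, h5, h6, h7⟩⟩
    · cases h4
    · cases r' with
      | nil =>
        simp only [List.nil_append, List.cons.injEq] at h4
        obtain ⟨rfl, rfl⟩ := h4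
        obtain ⟨-, hin, hg⟩ := h6 _ (.nil τ)
        refine ⟨fun k hk => hk.2 ⟨b', h2, hin⟩, ?_⟩
        rintro τ' ⟨b₁, hb₁, _, rfl⟩
        rw [h2] at hb₁
        cases hb₁
        have hoff : ∀ g ≠ f, Function.update τ f (some (b'.set c v)) g = σ g := fun g hg' => by
          rw [Function.update_of_ne hg', h1 g hg']
        refine ⟨⟨hoff, b'.set c v, by simp, h3, .inl ⟨rfl, fun p hp => ?_⟩⟩, ?_⟩
        · obtain rfl := h7 p hp
          simpa [Buffer.set] using hg
        · rintro j hj r₁ ⟨_, b₂, j2, _, j4⟩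
          rw [h2] at j2
          cases j2
          refine ⟨hoff, b'.set c v, by simp, h3, ?_⟩
          rcases j4 with ⟨rfl, j4⟩ | ⟨r₂, c₂, v₂, rfl, j5, j6, j7⟩
          -- A target of a finished thread may be overwritten, but again by a value that is good at
          -- this point. This is what makes redundant iterations harmless.
          · refine .inl ⟨rfl, fun p hp => ?_⟩
            simp only [Buffer.set]
            split_ifs with hpc
            · rw [hpc]; exact hg
            · exact j4 p hp
          · refine .inr ⟨r₂, c₂, v₂, rfl, j5, fun o ho => ?_, j7⟩
            -- Reads of `f` are excluded, so a thread that is still pending does not see the write.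
            have hag : SAgree f (fun _ => False) (Function.update τ f (some (b'.set c v))) τ :=
              ⟨fun g hg' => by rw [Function.update_of_ne hg'], b'.set c v, b', by simp, h2, rfl,
                fun _ hp => hp.elim⟩
            have hsame : ∀ r₂ : List Act, (∀ a ∈ r₂, a.Within f (fun _ => False)) →
                ∀ τ o, Run τ r₂ o → (∃ k, o = .failed k) ∨ o = .done τ := by
              intro r₂ hr₂
              induction r₂ with
              | nil => exact fun τ o ho => .inr (run_nil.1 ho)
              | cons a r₂ ih =>
                intro τ o ho
                rcases run_cons.1 ho with ⟨τ', hs, ho'⟩ | ⟨k, _, rfl⟩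
                · have : τ' = τ := by
                    have ha := hr₂ a (by simp)
                    cases a with
                    | read g p v => exact hs.1
                    | write g p v => exact ha.2.elim
                    | alloc g I => exact ha.elim
                    | fail k => exact hs.elim
                  subst this
                  exact ih (fun a ha => hr₂ a (by simp [ha])) _ _ ho'
                · exact .inl ⟨k, rfl⟩
            rcases ho.agree hag j5 with ⟨k, rfl, hk⟩ | ⟨τ₁, τ₂, rfl, hd, -⟩
            · cases (j6 _ hk).1
            · obtain ⟨-, k2, k3⟩ := j6 _ hd
              rcases hsame r₂ j5 _ _ ho with ⟨k, hk⟩ | hk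
              · cases hk
              · exact ⟨hk, k2, k3⟩
      | cons a' r' =>
        simp only [List.cons_append, List.cons.injEq] at h4
        obtain ⟨rfl, rfl⟩ := h4
        refine ⟨fun k hk => ?_, fun τ' hs => ?_⟩
        · cases (h6 _ (run_cons.2 (.inr ⟨k, hk, rfl⟩))).1
        · have : τ' = τ := by
            have ha := h5 a (by simp)
            cases a with
            | read g p v => exact hs.1
            | write g p v => exact ha.2.elim
            | alloc g I => exact ha.elim
            | fail k => exact hs.elim
          subst this
          exact ⟨⟨h1, b', h2, h3, .inr ⟨r', c, v, rfl, fun a ha => h5 a (by simp [ha]),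
            fun o ho => h6 o (run_cons.2 (.inl ⟨_, hs, ho⟩)), h7⟩⟩, fun j _ r₁ h => h⟩
  obtain ⟨σ', rfl, h'⟩ := Inter.run (OK := OK) hstep h (fun i => ⟨fun _ _ => rfl, b, hb, rfl, by
      rcases hts i with ⟨h1, h2⟩ | h1
      · exact .inl ⟨h1, fun p hp => (h2 p hp).elim⟩
      · exact .inr h1⟩) hr
  by_cases hne : Nonempty ι
  · obtain ⟨i⟩ := hne
    obtain ⟨h1, b', h2, h3, _⟩ := h' i
    refine ⟨σ', rfl, h1, b', h2, h3, fun j p hp => ?_⟩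
    obtain ⟨_, b'', h4, _, ⟨_, h5⟩ | ⟨r', c, v, h5, _⟩⟩ := h' j
    · rw [h2] at h4
      cases h4
      exact h5 p hp
    · simp at h5
  · have : t = [] := by
      cases h with
      | nil => rfl
      | cons _ i => exact (hne ⟨i⟩).elim
    subst this
    cases run_nil.1 hr
    exact ⟨σ, rfl, fun _ _ => rfl, b, hb, rfl, fun i => (hne ⟨i⟩).elim⟩

/-! ## Every program has an execution -/

/-- The trace is chosen for the store at hand, because the values that its reads announce must be
those of the store. After a failure nothing is executed any more, and any trace of the second kind
will do. -/
theorem exists_run_append {σ : Store} {Q Q' : List Act → Prop} (h : ∀ σ, ∃ t, Q t ∧ ∃ o, Run σ t o)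
    (h' : ∀ σ, ∃ t, Q' t ∧ ∃ o, Run σ t o) :
    ∃ t t', Q t ∧ Q' t' ∧ ∃ o, Run σ (t ++ t') o := by
  obtain ⟨t, hq, o, ho⟩ := h σ
  cases o with
  | done σ' =>
    obtain ⟨t', hq', o', ho'⟩ := h' σ'
    exact ⟨t, t', hq, hq', o', run_append.2 (.inl ⟨σ', ho, ho'⟩)⟩
  | failed k =>
    obtain ⟨t', hq', -⟩ := h' σ
    exact ⟨t, t', hq, hq', .failed k, run_append.2 (.inr ⟨k, ho, rfl⟩)⟩

theorem exists_run_flatten {k : ℕ} {Q : Fin k → List Act → Prop}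
    (h : ∀ i σ, ∃ t, Q i t ∧ ∃ o, Run σ t o) (σ : Store) :
    ∃ ts : Fin k → List Act, (∀ i, Q i (ts i)) ∧ ∃ o, Run σ (List.ofFn ts).flatten o := by
  induction k generalizing σ with
  | zero => exact ⟨Fin.elim0, fun i => i.elim0, .done σ, by simpa using Run.nil σ⟩
  | succ k ih =>
    obtain ⟨t, t', h1, ⟨ts, h2, rfl⟩, o, ho⟩ := exists_run_append (σ := σ) (Q := Q 0)
      (Q' := fun t => ∃ ts : Fin k → List Act, (∀ i, Q i.succ (ts i)) ∧ t = (List.ofFn ts).flatten)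
      (h 0) (fun σ => by
        obtain ⟨ts, h1, o, ho⟩ := ih (fun i => h i.succ) σ
        exact ⟨_, ⟨ts, h1, rfl⟩, o, ho⟩)
    exact ⟨Fin.cons t ts, fun i => Fin.cases h1 h2 i, o, by simpa [List.ofFn_succ] using ho⟩

/-- Reads have to be excluded: a read within bounds that announces a wrong value has no run at all.
-/
theorem exists_run_single (a : Act) (ha : ∀ f p v, a ≠ .read f p v) (σ : Store) :
    ∃ o, Run σ [a] o := by
  cases a with
  | read f p v => exact (ha f p v rfl).elim
  | write f p v =>
    by_cases h : ∃ b, σ f = some b ∧ b.InBounds p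
    · obtain ⟨b, hb, hp⟩ := h
      exact ⟨_, .write σ f p v b [] _ hb hp (.nil _)⟩
    · exact ⟨_, .writeErr σ f p v [] h⟩
  | alloc f I => exact ⟨_, .alloc σ f I [] _ (.nil _)⟩
  | fail k => exact ⟨_, .fail σ k []⟩

theorem Expr.exists_run (ρ : Env) (e : Expr Ver Empty) (σ : Store) :
    ∃ t, (∃ v, e.Tr ρ t v) ∧ ∃ o, Run σ t o := by
  induction e generalizing σ with
  | const c => exact ⟨[], ⟨_, .const c⟩, _, .nil σ⟩
  | var x => exact ⟨[], ⟨_, .var x⟩, _, .nil σ⟩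
  | acc f l k args ih =>
    obtain ⟨ts, h1, o, ho⟩ := exists_run_flatten ih σ
    choose vs hvs using h1
    cases o with
    | failed q =>
      -- The run fails before it comes to this read, whose announced value is therefore arbitrary.
      exact ⟨_, ⟨.errMem, .acc f l k args ts vs .errMem hvs⟩, .failed q, run_append.2 (.inr ⟨q, ho, rfl⟩)⟩
    | done σ' =>
      by_cases h : ∃ b, σ' f = some b ∧ b.InBounds (List.ofFn vs)
      · obtain ⟨b, hb, hp⟩ := h
        exact ⟨_, ⟨_, .acc f l k args ts vs _ hvs⟩, .done σ',
          run_append.2 (.inl ⟨σ', ho, .read σ' f _ b [] _ hb hp (.nil _)⟩)⟩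
      · exact ⟨_, ⟨.errMem, .acc f l k args ts vs .errMem hvs⟩, .failed .mem,
          run_append.2 (.inl ⟨σ', ho, .readErr σ' f _ _ [] h⟩)⟩
  | op o args ih =>
    obtain ⟨ts, h1, o', ho⟩ := exists_run_flatten ih σ
    choose vs hvs using h1
    exact ⟨_, ⟨_, .op o args ts vs hvs⟩, o', ho⟩
  | hole x => exact x.elim

/-- Output equivalence demands that some execution exists. Traces are built along with the store on
which they run; a parallel loop can be executed sequentially, and the failing rules take care of
errors and of negative lengths. -/
theorem Stmt.exists_run (ρ : Env) (s : Stmt Empty) (σ : Store) :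
    ∃ t, s.Tr ρ t ∧ ∃ o, Run σ t o := by
  induction s generalizing ρ σ with
  | nop => exact ⟨[], .nop ρ, _, .nil σ⟩
  | assert e =>
    obtain ⟨t, ⟨v, hv⟩, o, ho⟩ := e.exists_run ρ σ
    by_cases h : v = .int 0
    · subst h
      refine ⟨_, .assertFalse ρ e t hv, ?_⟩
      cases o with
      | done σ' => exact ⟨_, run_append.2 (.inl ⟨σ', ho, .fail σ' _ _⟩)⟩
      | failed k => exact ⟨_, run_append.2 (.inr ⟨k, ho, rfl⟩)⟩
    · exact ⟨t, .assertTrue ρ e t v hv h, o, ho⟩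
  | seq s₁ s₂ ih₁ ih₂ =>
    obtain ⟨t₁, t₂, h₁, h₂, h⟩ := exists_run_append (σ := σ) (ih₁ ρ) (ih₂ ρ)
    exact ⟨_, .seq ρ s₁ s₂ t₁ t₂ h₁ h₂, h⟩
  | alloc f k I =>
    obtain ⟨t, t', ⟨ts, h1, rfl⟩, rfl, h⟩ := exists_run_append (σ := σ)
      (Q := fun t => ∃ ts : Fin k → List Act, (∀ i, ∃ t₁ t₂, (∃ v, (I i).1.Tr ρ t₁ v) ∧
        (∃ v, (I i).2.Tr ρ t₂ v) ∧ ts i = t₁ ++ t₂) ∧ t = (List.ofFn ts).flatten)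
      (Q' := fun t => t = [])
      (fun σ => by
        obtain ⟨ts, h1, o, ho⟩ := exists_run_flatten (k := k)
          (Q := fun i t => ∃ t₁ t₂, (∃ v, (I i).1.Tr ρ t₁ v) ∧
            (∃ v, (I i).2.Tr ρ t₂ v) ∧ t = t₁ ++ t₂)
          (fun i σ => by
            obtain ⟨t₁, t₂, h₁, h₂, h⟩ :=
              exists_run_append (σ := σ) ((I i).1.exists_run ρ) ((I i).2.exists_run ρ)
            exact ⟨_, ⟨t₁, t₂, h₁, h₂, rfl⟩, h⟩) σ
        exact ⟨_, ⟨ts, h1, rfl⟩, o, ho⟩)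
      (fun σ => ⟨[], rfl, _, .nil σ⟩)
    choose t₁ t₂ hlo hlen hts using h1
    choose lo hlo using hlo
    choose len hlen using hlen
    obtain rfl : ts = fun i => t₁ i ++ t₂ i := funext hts
    refine ⟨_, .alloc ρ f k I t₁ t₂ lo len hlo hlen, ?_⟩
    rw [List.append_nil] at h
    obtain ⟨o, ho⟩ := h
    cases o with
    | done σ' => exact ⟨_, run_append.2 (.inl ⟨σ', ho, .alloc σ' _ _ [] _ (.nil _)⟩)⟩
    | failed q => exact ⟨_, run_append.2 (.inr ⟨q, ho, rfl⟩)⟩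
  | assign f l k args e =>
    obtain ⟨t, t', ⟨v, hv⟩, ⟨ts, h1, rfl⟩, o, ho⟩ := exists_run_append (σ := σ) (e.exists_run ρ)
      (Q' := fun t => ∃ ts : Fin k → List Act, (∀ i, ∃ v, (args i).Tr ρ (ts i) v) ∧
        t = (List.ofFn ts).flatten)
      (fun σ => by
        obtain ⟨ts, h1, o, ho⟩ := exists_run_flatten (fun i => (args i).exists_run ρ) σ
        exact ⟨_, ⟨ts, h1, rfl⟩, o, ho⟩)
    choose vs hvs using h1
    refine ⟨_, .assign ρ f l k args e ts vs t v hv hvs, ?_⟩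
    cases o with
    | done σ' =>
      obtain ⟨o', ho'⟩ := exists_run_single (.write f (List.ofFn vs) v) (by simp) σ'
      exact ⟨_, run_append.2 (.inl ⟨σ', ho, ho'⟩)⟩
    | failed q => exact ⟨_, run_append.2 (.inr ⟨q, ho, rfl⟩)⟩
  | ite e s₁ s₂ ih₁ ih₂ =>
    obtain ⟨t, ⟨v, hv⟩, o, ho⟩ := e.exists_run ρ σ
    have key : ∀ s : Stmt Empty, (∀ ρ σ, ∃ t, s.Tr ρ t ∧ ∃ o, Run σ t o) →
        ∃ t', s.Tr ρ t' ∧ ∃ o, Run σ (t ++ t') o := by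
      intro s ih
      cases o with
      | done σ' =>
        obtain ⟨t', h1, o', ho'⟩ := ih ρ σ'
        exact ⟨t', h1, o', run_append.2 (.inl ⟨σ', ho, ho'⟩)⟩
      | failed q =>
        obtain ⟨t', h1, -⟩ := ih ρ σ
        exact ⟨t', h1, .failed q, run_append.2 (.inr ⟨q, ho, rfl⟩)⟩
    by_cases h : v = .int 0
    · subst h
      obtain ⟨t', h1, h2⟩ := key s₂ ih₂
      exact ⟨_, .iteFalse ρ e s₁ s₂ t t' hv h1, h2⟩
    · obtain ⟨t', h1, h2⟩ := key s₁ ih₁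
      exact ⟨_, .iteTrue ρ e s₁ s₂ t t' v hv h h1, h2⟩
  | loop τ x lo len s ih =>
    obtain ⟨t₁, t₂, ⟨a, ha⟩, ⟨k, hk⟩, o, ho⟩ :=
      exists_run_append (σ := σ) (lo.exists_run ρ) (len.exists_run ρ)
    have key : ∀ t, (∀ σ, ∃ o, Run σ t o) → ∃ o, Run σ (t₁ ++ t₂ ++ t) o := by
      intro t ht
      cases o with
      | done σ' =>
        obtain ⟨o', ho'⟩ := ht σ'
        exact ⟨o', run_append.2 (.inl ⟨σ', ho, ho'⟩)⟩
      | failed q => exact ⟨.failed q, run_append.2 (.inr ⟨q, ho, rfl⟩)⟩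
    by_cases herr : a.IsErr ∨ k.IsErr
    · exact ⟨_, .loopErr ρ τ x lo len s t₁ t₂ a k herr ha hk, key _ fun σ => ⟨_, .fail σ _ _⟩⟩
    · obtain ⟨a, rfl⟩ : ∃ i, a = .int i := by
        cases a with
        | int i => exact ⟨i, rfl⟩
        | _ => simp [Val.IsErr] at herr
      obtain ⟨k, rfl⟩ : ∃ i, k = .int i := by
        cases k with
        | int i => exact ⟨i, rfl⟩
        | _ => simp [Val.IsErr] at herr
      by_cases hneg : k < 0
      · exact ⟨_, .loopNeg ρ τ x lo len s t₁ t₂ a k hneg ha hk, key _ fun σ => ⟨_, .fail σ _ _⟩⟩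
      · obtain ⟨k, rfl⟩ := Int.eq_ofNat_of_zero_le (not_lt.1 hneg)
        have body : ∀ σ, ∃ ts : Fin k → List Act,
            (∀ i : Fin k, s.Tr (Function.update ρ x (.int (a + (i : ℕ)))) (ts i)) ∧
              ∃ o, Run σ (List.ofFn ts).flatten o :=
          exists_run_flatten fun i σ => ih _ σ
        obtain ⟨ts, h1, h2⟩ : ∃ ts : Fin k → List Act,
            (∀ i : Fin k, s.Tr (Function.update ρ x (.int (a + (i : ℕ)))) (ts i)) ∧
              ∃ o, Run σ (t₁ ++ t₂ ++ (List.ofFn ts).flatten) o := by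
          cases o with
          | done σ' =>
            obtain ⟨ts, h1, o', ho'⟩ := body σ'
            exact ⟨ts, h1, o', run_append.2 (.inl ⟨σ', ho, ho'⟩)⟩
          | failed q =>
            obtain ⟨ts, h1, -⟩ := body σ
            exact ⟨ts, h1, .failed q, run_append.2 (.inr ⟨q, ho, rfl⟩)⟩
        cases τ with
        | serial => exact ⟨_, .loopSerial ρ x lo len s t₁ t₂ a k ts ha hk h1, h2⟩
        | parallel =>
          exact ⟨_, .loopParallel ρ x lo len s t₁ t₂ a k ts _ ha hk h1 (Interleave.flatten_ofFn ts), h2⟩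
  | letIn x e s ih =>
    obtain ⟨t, ⟨v, hv⟩, o, ho⟩ := e.exists_run ρ σ
    cases o with
    | done σ' =>
      obtain ⟨t', h1, o', ho'⟩ := ih (Function.update ρ x v) σ'
      exact ⟨_, .letIn ρ x e s t t' v hv h1, o', run_append.2 (.inl ⟨σ', ho, ho'⟩)⟩
    | failed q =>
      obtain ⟨t', h1, -⟩ := ih (Function.update ρ x v) σ
      exact ⟨_, .letIn ρ x e s t t' v hv h1, .failed q, run_append.2 (.inr ⟨q, ho, rfl⟩)⟩
  | label l s ih =>
    obtain ⟨t, h, h'⟩ := ih ρ σ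
    exact ⟨t, .label ρ l s t h, h'⟩

end Halide

namespace Halide

/-! ## Iteration spaces -/

/-- A loop with its bounds `(lo, len)` as numbers. -/
abbrev NumLoop := Var × ℤ × ℤ

/-- The environments of the iterations of a loop nest, in order. -/
def enum : List NumLoop → Env → List Env
  | [], ρ => [ρ]
  | x :: N, ρ => (List.range x.2.2.toNat).flatMap fun i : ℕ =>
      enum N (Function.update ρ x.1 (.int (x.2.1 + (i : ℤ))))

/-- `ρ` is the environment of an iteration of the loop nest `N` that starts in `ρ₀`. -/
def Box (ρ₀ : Env) (N : List NumLoop) (ρ : Env) : Prop :=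
  (∀ v, v ∉ N.map Prod.fst → ρ v = ρ₀ v) ∧
  ∀ x ∈ N, ∃ t : ℤ, ρ x.1 = .int t ∧ x.2.1 ≤ t ∧ t < x.2.1 + x.2.2

/-- `ρ` is `ρ₀` up to integer values for the variables in `V`. -/
def IntOn (ρ₀ : Env) (V : List Var) (ρ : Env) : Prop :=
  (∀ v, v ∉ V → ρ v = ρ₀ v) ∧ ∀ v ∈ V, ∃ t : ℤ, ρ v = .int t

theorem Box.intOn {ρ₀ ρ : Env} {N : List NumLoop} (h : Box ρ₀ N ρ) :
    IntOn ρ₀ (N.map Prod.fst) ρ := by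
  refine ⟨h.1, fun v hv => ?_⟩
  obtain ⟨x, hx, rfl⟩ := List.mem_map.1 hv
  obtain ⟨t, ht, _⟩ := h.2 x hx
  exact ⟨t, ht⟩

theorem box_nil {ρ₀ ρ : Env} : Box ρ₀ [] ρ ↔ ρ = ρ₀ :=
  ⟨fun h => funext fun v => h.1 v (by simp), by rintro rfl; exact ⟨fun _ _ => rfl, by simp⟩⟩

/-- No inner loop rebinds the variable of the head, so its value in the final environment identifies
the iteration of the outer loop. -/
theorem box_cons {ρ₀ ρ : Env} {x : NumLoop} {N : List NumLoop} (hx : x.1 ∉ N.map Prod.fst) :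
    Box ρ₀ (x :: N) ρ ↔
      ∃ i < x.2.2.toNat, Box (Function.update ρ₀ x.1 (.int (x.2.1 + (i : ℕ)))) N ρ := by
  constructor
  · rintro ⟨h1, h2⟩
    obtain ⟨t, ht, h3, h4⟩ := h2 x (by simp)
    refine ⟨(t - x.2.1).toNat, by omega, fun v hv => ?_, fun y hy => h2 y (by simp [hy])⟩
    by_cases hvx : v = x.1
    · subst hvx
      rw [Function.update_self, ht]
      congr 1
      omega
    · rw [Function.update_of_ne hvx]
      exact h1 v (by simpa [hvx] using hv)
  · rintro ⟨i, hi, h1, h2⟩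
    refine ⟨fun v hv => ?_, fun y hy => ?_⟩
    · simp only [List.map_cons, List.mem_cons, not_or] at hv
      rw [h1 v hv.2, Function.update_of_ne hv.1]
    · rcases List.mem_cons.1 hy with rfl | hy
      · exact ⟨_, by rw [h1 _ hx, Function.update_self], by omega, by omega⟩
      · exact h2 y hy

theorem mem_enum {ρ₀ ρ : Env} {N : List NumLoop} (hN : (N.map Prod.fst).Nodup) :
    ρ ∈ enum N ρ₀ ↔ Box ρ₀ N ρ := by
  induction N generalizing ρ₀ with
  | nil => simp [enum, box_nil]
  | cons x N ih =>
    obtain ⟨h1, h2⟩ := List.nodup_cons.1 hN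
    simp [enum, List.mem_flatMap, box_cons h1, ih h2]

theorem enum_append (A B : List NumLoop) (ρ : Env) :
    enum (A ++ B) ρ = (enum A ρ).flatMap (enum B) := by
  induction A generalizing ρ with
  | nil => simp [enum]
  | cons x A ih => simp [enum, ih, List.flatMap_assoc]

theorem enum_nodup {N : List NumLoop} (hN : (N.map Prod.fst).Nodup) (ρ : Env) :
    (enum N ρ).Nodup := by
  induction N generalizing ρ with
  | nil => simp [enum]
  | cons x N ih =>
    obtain ⟨h1, h2⟩ := List.nodup_cons.1 hN
    rw [enum, List.nodup_flatMap]
    refine ⟨fun i _ => ih h2 _, ?_⟩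
    refine (List.nodup_range (n := x.2.2.toNat)).imp ?_
    intro i j hij ρ' hi hj
    rw [mem_enum h2] at hi hj
    have e1 := hi.1 x.1 h1
    rw [hj.1 x.1 h1] at e1
    simp only [Function.update_self, Val.int.injEq] at e1
    exact hij (by omega)

theorem IntOn.base {m n : ℕ} {z : Input m n} {V : List Var} {ρ₀ ρ : Env} (h : IntOn ρ₀ V ρ)
    (h₀ : Base z ρ₀) (hV : ∀ v ∈ V, v.IsLoop) : Base z ρ := by
  intro v hv
  rw [h.1 v fun h' => hv (hV v h')]
  exact h₀ v hv

/-! ## Concatenations of traces -/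

/-- The trace is a concatenation of traces, one for each environment in the list. -/
inductive Conc (Q : Env → List Act → Prop) : List Env → List Act → Prop
  | nil : Conc Q [] []
  | cons (e : Env) (E : List Env) (t T : List Act) (h : Q e t) (H : Conc Q E T) :
      Conc Q (e :: E) (t ++ T)

theorem conc_nil {Q : Env → List Act → Prop} {t : List Act} : Conc Q [] t ↔ t = [] :=
  ⟨fun h => by cases h; rfl, by rintro rfl; exact .nil⟩

theorem conc_cons {Q : Env → List Act → Prop} {e : Env} {E : List Env} {t : List Act} :
    Conc Q (e :: E) t ↔ ∃ t₁ t₂, Q e t₁ ∧ Conc Q E t₂ ∧ t = t₁ ++ t₂ :=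
  ⟨fun h => by cases h with | cons _ _ t T h H => exact ⟨t, T, h, H, rfl⟩,
    by rintro ⟨t, T, h, H, rfl⟩; exact .cons e E t T h H⟩

theorem conc_singleton {Q : Env → List Act → Prop} {e : Env} {t : List Act} :
    Conc Q [e] t ↔ Q e t := by
  simp [conc_cons, conc_nil]

theorem conc_append {Q : Env → List Act → Prop} {E E' : List Env} {t : List Act} :
    Conc Q (E ++ E') t ↔ ∃ t₁ t₂, Conc Q E t₁ ∧ Conc Q E' t₂ ∧ t = t₁ ++ t₂ := by
  induction E generalizing t with
  | nil => simp [conc_nil]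
  | cons e E ih =>
    simp only [List.cons_append, conc_cons, ih]
    constructor
    · rintro ⟨t₁, _, h₁, ⟨t₂, t₃, h₂, h₃, rfl⟩, rfl⟩
      exact ⟨_, t₃, ⟨t₁, t₂, h₁, h₂, rfl⟩, h₃, by simp⟩
    · rintro ⟨_, t₃, ⟨t₁, t₂, h₁, h₂, rfl⟩, h₃, rfl⟩
      exact ⟨t₁, _, h₁, ⟨t₂, t₃, h₂, h₃, rfl⟩, by simp⟩

theorem conc_flatMap {Q : Env → List Act → Prop} {k : ℕ} {E : ℕ → List Env} {t : List Act} :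
    Conc Q ((List.range k).flatMap E) t ↔
      ∃ ts : Fin k → List Act, (∀ i : Fin k, Conc Q (E i) (ts i)) ∧ t = (List.ofFn ts).flatten := by
  induction k generalizing E t with
  | zero =>
    simp only [List.range_zero, List.flatMap_nil, conc_nil, List.ofFn_zero, List.flatten_nil]
    exact ⟨fun h => ⟨Fin.elim0, fun i => i.elim0, h⟩, fun ⟨_, _, h⟩ => h⟩
  | succ k ih =>
    rw [List.range_succ_eq_map, List.flatMap_cons, conc_append, List.flatMap_map]
    simp only [ih]
    constructor
    · rintro ⟨t₁, _, h₁, ⟨ts, h₂, rfl⟩, rfl⟩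
      exact ⟨Fin.cons t₁ ts, Fin.cases h₁ h₂, by simp [List.ofFn_succ]⟩
    · rintro ⟨ts, h, rfl⟩
      exact ⟨ts 0, _, h 0, ⟨fun i => ts i.succ, fun i => h i.succ, rfl⟩, by simp [List.ofFn_succ]⟩

theorem Conc.mem {Q : Env → List Act → Prop} {E : List Env} {t : List Act} (h : Conc Q E t)
    {a : Act} (ha : a ∈ t) : ∃ e ∈ E, ∃ t', Q e t' ∧ a ∈ t' := by
  induction h with
  | nil => simp at ha
  | cons e E t T h H ih =>
    rcases List.mem_append.1 ha with ha | ha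
    · exact ⟨e, by simp, t, h, ha⟩
    · obtain ⟨e', he', h'⟩ := ih ha
      exact ⟨e', by simp [he'], h'⟩

/-- An iteration without a counterpart contributes the empty trace and may be dropped; the others
are replaced by their counterparts. Comparing serial nests is thus reduced to comparing enumerations
of iterations. -/
theorem conc_filterMap {Q Q' : Env → List Act → Prop} {g : Env → Option Env} {E : List Env}
    (h : ∀ e ∈ E, (∀ e', g e = some e' → ∀ t, Q' e t ↔ Q e' t) ∧ (g e = none → ∀ t, Q' e t ↔ t = []))
    {t : List Act} : Conc Q' E t ↔ Conc Q (E.filterMap g) t := by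
  induction E generalizing t with
  | nil => simp [conc_nil]
  | cons e E ih =>
    have ih := fun t => ih (fun e he => h e (by simp [he])) (t := t)
    obtain ⟨h1, h2⟩ := h e (by simp)
    rw [conc_cons]
    cases hg : g e with
    | none =>
      rw [List.filterMap_cons_none hg]
      simp [h2 hg, ih]
    | some e' =>
      rw [List.filterMap_cons_some hg, conc_cons]
      simp [h1 e' hg, ih]

/-! ## Loop nests -/

/-- The head of a loop. -/
structure Hdr where
  ord : Order
  var : Var
  lo : TExpr
  len : TExpr

/-- A loop nest, given by its loops from the outermost to the innermost one. -/
def nest (Ls : List Hdr) (s : Stmt Hole) : Stmt Hole :=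
  Ls.foldr (fun h s => .loop h.ord h.var h.lo h.len s) s

@[simp] theorem nest_nil (s : Stmt Hole) : nest [] s = s := rfl

@[simp] theorem nest_cons (h : Hdr) (Ls : List Hdr) (s : Stmt Hole) :
    nest (h :: Ls) s = .loop h.ord h.var h.lo h.len (nest Ls s) := rfl

theorem nest_append (A B : List Hdr) (s : Stmt Hole) : nest (A ++ B) s = nest A (nest B s) := by
  simp [nest]

variable {m n : ℕ}

def Hdr.Closed (m n : ℕ) (h : Hdr) : Prop := h.lo.Closed m n ∧ h.len.Closed m n ∧ h.var.IsLoop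

/-- The loop with the values of its bounds. -/
def Hdr.nums (η : Hole → ℤ) (z : Input m n) (h : Hdr) : NumLoop :=
  (h.var, h.lo.num η z, h.len.num η z)

theorem map_fst_nums (η : Hole → ℤ) (z : Input m n) (Ls : List Hdr) :
    (Ls.map (Hdr.nums η z)).map Prod.fst = Ls.map Hdr.var := by
  simp [Hdr.nums, Function.comp_def]

/-- Every loop of the nest that is reached has a nonnegative length. -/
def ReachOK : List NumLoop → Prop
  | [] => True
  | x :: N => 0 ≤ x.2.2 ∧ (0 < x.2.2 → ReachOK N)

/-- Closed bounds have the same values in all iterations, so the recursive query separates into a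
condition on the lengths and the query of the body on a box. An inner length is constrained only if
the outer loops are nonempty, which is why the first condition is `ReachOK` and not the
nonnegativity of all lengths. -/
theorem nest_query_iff {η : Hole → ℤ} {φ : ℕ → List Val → ℤ} {st : Option Stage} {z : Input m n}
    {Ls : List Hdr} {s : Stmt Hole} (hL : ∀ h ∈ Ls, h.Closed m n) (hN : (Ls.map Hdr.var).Nodup)
    {ρ : Env} (hρ : Base z ρ) :
    (nest Ls s).query η φ st ρ ↔ ReachOK (Ls.map (Hdr.nums η z)) ∧
      ∀ ρ', Box ρ (Ls.map (Hdr.nums η z)) ρ' → s.query η φ st ρ' := by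
  induction Ls generalizing ρ with
  | nil => simp [ReachOK, box_nil]
  | cons h Ls ih =>
    obtain ⟨h1, h2⟩ := List.nodup_cons.1 hN
    obtain ⟨c1, c2, c3⟩ := hL h (by simp)
    have ih := fun {ρ} => ih (fun h' hh => hL h' (by simp [hh])) h2 (ρ := ρ)
    have h1' : (h.nums η z).1 ∉ (Ls.map (Hdr.nums η z)).map Prod.fst := by rwa [map_fst_nums]
    simp only [nest_cons, Stmt.query, c1.qval_eq hρ, c2.qval_eq hρ, Val.toInt, List.map_cons,
      box_cons h1', ReachOK]
    constructor
    · rintro ⟨k1, k2⟩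
      refine ⟨⟨k1, fun k3 => ?_⟩, ?_⟩
      · exact ((ih (hρ.update c3 _)).1 (k2 _ le_rfl (by simpa [Hdr.nums] using k3))).1
      · rintro ρ' ⟨i, hi, hb⟩
        simp only [Hdr.nums] at hi hb
        exact ((ih (hρ.update c3 _)).1 (k2 _ (by omega) (by omega))).2 _ hb
    · rintro ⟨⟨k1, k2⟩, k3⟩
      refine ⟨k1, fun t ht1 ht2 => (ih (hρ.update c3 _)).2 ⟨k2 (by simp only [Hdr.nums]; omega), ?_⟩⟩
      intro ρ' hb
      refine k3 ρ' ⟨(t - h.lo.num η z).toNat, by simp only [Hdr.nums]; omega, ?_⟩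
      simp only [Hdr.nums]
      convert hb using 3
      omega

variable {Γ : Hole → Expr Ver Empty} {z : Input m n}

theorem nest_fill_cons (h : Hdr) (Ls : List Hdr) (s : Stmt Hole) :
    (nest (h :: Ls) s).fill Γ =
      .loop h.ord h.var (h.lo.fill Γ) (h.len.fill Γ) ((nest Ls s).fill Γ) := rfl

/-- Traces of a nest of serial loops. -/
theorem nest_serial_tr_iff (hΓ : Compatible m n Γ) {Ls : List Hdr} {s : Stmt Hole}
    (hL : ∀ h ∈ Ls, h.Closed m n) (hS : ∀ h ∈ Ls, h.ord = .serial)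
    (h0 : ReachOK (Ls.map (Hdr.nums (holeVal Γ z) z))) {ρ : Env} (hρ : Base z ρ) {t : List Act} :
    ((nest Ls s).fill Γ).Tr ρ t ↔
      Conc (fun e t => (s.fill Γ).Tr e t) (enum (Ls.map (Hdr.nums (holeVal Γ z) z)) ρ) t := by
  induction Ls generalizing ρ t with
  | nil => simp [enum, conc_singleton]
  | cons h Ls ih =>
    obtain ⟨c1, c2, c3⟩ := hL h (by simp)
    obtain ⟨h0, h0'⟩ := h0
    rw [nest_fill_cons, Stmt.tr_loop_fill hΓ hρ c1 c2 h0]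
    simp only [List.map_cons, enum, conc_flatMap, hS h (by simp), true_and, reduceCtorEq, false_and,
      or_false]
    refine exists_congr fun ts => and_congr_left fun _ => forall_congr' fun i => ?_
    refine ih (fun h' hh => hL h' (by simp [hh])) (fun h' hh => hS h' (by simp [hh])) (h0' ?_)
      (hρ.update c3 _)
    have := i.2
    simp only [Hdr.nums] at this ⊢
    omega

/-- A nest has all the traces that it would have if its loops were serial. -/
theorem nest_tr_of_conc (hΓ : Compatible m n Γ) {Ls : List Hdr} {s : Stmt Hole}
    (hL : ∀ h ∈ Ls, h.Closed m n) (h0 : ReachOK (Ls.map (Hdr.nums (holeVal Γ z) z))) {ρ : Env}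
    (hρ : Base z ρ) {t : List Act}
    (ht : Conc (fun e t => (s.fill Γ).Tr e t) (enum (Ls.map (Hdr.nums (holeVal Γ z) z)) ρ) t) :
    ((nest Ls s).fill Γ).Tr ρ t := by
  induction Ls generalizing ρ t with
  | nil => simpa [enum, conc_singleton] using ht
  | cons h Ls ih =>
    obtain ⟨c1, c2, c3⟩ := hL h (by simp)
    obtain ⟨h0, h0'⟩ := h0
    rw [nest_fill_cons, Stmt.tr_loop_fill hΓ hρ c1 c2 h0]
    rw [List.map_cons, enum, conc_flatMap] at ht
    obtain ⟨ts, h1, rfl⟩ := ht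
    refine ⟨ts, fun i => ih (fun h' hh => hL h' (by simp [hh])) (h0' ?_) (hρ.update c3 _) (h1 i), ?_⟩
    · have := i.2
      simp only [Hdr.nums] at this ⊢
      omega
    · cases h.ord with
      | serial => exact .inl ⟨rfl, rfl⟩
      | parallel => exact .inr ⟨rfl, Interleave.flatten_ofFn ts⟩

/-- A nest around a statement that does nothing does nothing. -/
theorem nest_tr_nil_iff (hΓ : Compatible m n Γ) {Ls : List Hdr} {s : Stmt Hole}
    (hL : ∀ h ∈ Ls, h.Closed m n) (hN : (Ls.map Hdr.var).Nodup)
    (h0 : ReachOK (Ls.map (Hdr.nums (holeVal Γ z) z))) {ρ : Env} (hρ : Base z ρ)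
    (hs : ∀ e, Box ρ (Ls.map (Hdr.nums (holeVal Γ z) z)) e → ∀ t, (s.fill Γ).Tr e t ↔ t = [])
    {t : List Act} : ((nest Ls s).fill Γ).Tr ρ t ↔ t = [] := by
  induction Ls generalizing ρ t with
  | nil => simpa [box_nil] using hs ρ (by simp [box_nil]) t
  | cons h Ls ih =>
    obtain ⟨c1, c2, c3⟩ := hL h (by simp)
    obtain ⟨h0, h0'⟩ := h0
    obtain ⟨n1, n2⟩ := List.nodup_cons.1 hN
    have n1' : (h.nums (holeVal Γ z) z).1 ∉ (Ls.map (Hdr.nums (holeVal Γ z) z)).map Prod.fst := by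
      rwa [map_fst_nums]
    rw [nest_fill_cons, Stmt.tr_loop_fill hΓ hρ c1 c2 h0]
    have key : ∀ i : Fin (h.len.num (holeVal Γ z) z).toNat, ∀ t,
        ((nest Ls s).fill Γ).Tr
          (Function.update ρ h.var (.int (h.lo.num (holeVal Γ z) z + (i : ℕ)))) t ↔ t = [] := by
      intro i t
      have hi := i.2
      refine ih (fun h' hh => hL h' (by simp [hh])) n2 (h0' ?_) (hρ.update c3 _) fun e he => ?_
      · simp only [Hdr.nums]
        omega
      · exact hs e ((box_cons n1').2 ⟨i, by simpa [Hdr.nums] using hi, he⟩)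
    simp only [key]
    constructor
    · rintro ⟨ts, h1, ⟨-, rfl⟩ | ⟨-, h2⟩⟩
      · obtain rfl : ts = fun _ => [] := funext h1
        exact List.flatten_ofFn_nil _
      · obtain rfl : ts = fun _ => [] := funext h1
        exact (interleave_iff_inter.1 h2).of_nil
    · rintro rfl
      refine ⟨fun _ => [], fun _ => rfl, ?_⟩
      cases h.ord with
      | serial => exact .inl ⟨rfl, (List.flatten_ofFn_nil _).symm⟩
      | parallel => exact .inr ⟨rfl, .nil⟩

theorem Inter.mem {ι : Type} {ts : ι → List Act} {t : List Act} (h : Inter ts t) {a : Act}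
    (ha : a ∈ t) : ∃ i, a ∈ ts i := by
  classical
  induction h with
  | nil => simp at ha
  | cons ts i b t l hk _ ih =>
    rcases List.mem_cons.1 ha with rfl | ha
    · exact ⟨i, by simp [hk]⟩
    · obtain ⟨j, hj⟩ := ih ha
      by_cases hji : j = i
      · subst hji
        exact ⟨j, by rw [hk]; simp at hj; simp [hj]⟩
      · exact ⟨j, by rwa [Function.update_of_ne hji] at hj⟩

/-- All actions of a nest but failures come from its iterations. -/
theorem nest_tr_mem (hΓ : Compatible m n Γ) {Ls : List Hdr} {s : Stmt Hole}
    (hL : ∀ h ∈ Ls, h.Closed m n) (hN : (Ls.map Hdr.var).Nodup) {ρ : Env} (hρ : Base z ρ)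
    {t : List Act} (ht : ((nest Ls s).fill Γ).Tr ρ t) {a : Act} (ha : a ∈ t)
    (hf : ∀ k, a ≠ .fail k) :
    ∃ e, Box ρ (Ls.map (Hdr.nums (holeVal Γ z) z)) e ∧ ∃ t', (s.fill Γ).Tr e t' ∧ a ∈ t' := by
  induction Ls generalizing ρ t with
  | nil => exact ⟨ρ, box_nil.2 rfl, t, ht, ha⟩
  | cons h Ls ih =>
    obtain ⟨c1, c2, c3⟩ := hL h (by simp)
    obtain ⟨n1, n2⟩ := List.nodup_cons.1 hN
    have n1' : (h.nums (holeVal Γ z) z).1 ∉ (Ls.map (Hdr.nums (holeVal Γ z) z)).map Prod.fst := by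
      rwa [map_fst_nums]
    rw [nest_fill_cons] at ht
    by_cases h0 : 0 ≤ h.len.num (holeVal Γ z) z
    · obtain ⟨ts, h1, h2⟩ := (Stmt.tr_loop_fill hΓ hρ c1 c2 h0).1 ht
      obtain ⟨i, hi⟩ : ∃ i, a ∈ ts i := by
        rcases h2 with ⟨-, rfl⟩ | ⟨-, h2⟩
        · obtain ⟨l, hl, hal⟩ := List.mem_flatten.1 ha
          obtain ⟨i, rfl⟩ := List.mem_ofFn.1 hl
          exact ⟨i, hal⟩
        · exact (interleave_iff_inter.1 h2).mem ha
      obtain ⟨e, he, h3⟩ := ih (fun h' hh => hL h' (by simp [hh])) n2 (hρ.update c3 _) (h1 i) hi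
      exact ⟨e, (box_cons n1').2 ⟨i, i.2, he⟩, h3⟩
    · have key : ∀ {t₁ t₂ a k}, (h.lo.fill Γ).Tr ρ t₁ a → (h.len.fill Γ).Tr ρ t₂ k →
          t₁ = [] ∧ t₂ = [] ∧ k = .int (h.len.num (holeVal Γ z) z) := by
        intro t₁ t₂ a k h₁ h₂
        rw [c1.tr_fill hΓ hρ] at h₁
        rw [c2.tr_fill hΓ hρ] at h₂
        exact ⟨h₁.1, h₂.1, h₂.2⟩
      generalize h.ord = τ at ht
      cases ht with
      | loopSerial _ _ _ _ _ t₁ t₂ a k ts h₁ h₂ hs =>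
        have := Val.int.inj (key h₁ h₂).2.2
        omega
      | loopParallel _ _ _ _ _ t₁ t₂ a k ts t h₁ h₂ hs ht =>
        have := Val.int.inj (key h₁ h₂).2.2
        omega
      | loopNeg _ _ _ _ _ _ t₁ t₂ a k hk h₁ h₂ =>
        obtain ⟨rfl, rfl, -⟩ := key h₁ h₂
        simp at ha
        exact (hf _ ha).elim
      | loopErr _ _ _ _ _ _ t₁ t₂ a k herr h₁ h₂ =>
        obtain ⟨rfl, rfl, -⟩ := key h₁ h₂
        simp at ha
        exact (hf _ ha).elim

/-! ## Traces of nests as interleavings of slices -/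

def Var.pureB : Var → Bool
  | .pure _ => true
  | _ => false

theorem Var.pureB_iff {v : Var} : v.pureB = true ↔ v.IsPure := by
  cases v <;> simp [Var.pureB, Var.IsPure]

/-- The pure loops. -/
def pureL (N : List NumLoop) : List NumLoop := N.filter fun x => x.1.pureB

/-- The reduction loops. -/
def redL (N : List NumLoop) : List NumLoop := N.filter fun x => !x.1.pureB

theorem pureL_append (A B : List NumLoop) : pureL (A ++ B) = pureL A ++ pureL B := by simp [pureL]

theorem redL_append (A B : List NumLoop) : redL (A ++ B) = redL A ++ redL B := by simp [redL]

theorem mem_pureL {N : List NumLoop} {x : NumLoop} : x ∈ pureL N ↔ x ∈ N ∧ x.1.IsPure := by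
  simp [pureL, List.mem_filter, Var.pureB_iff]

theorem mem_redL {N : List NumLoop} {x : NumLoop} : x ∈ redL N ↔ x ∈ N ∧ ¬ x.1.IsPure := by
  simp [redL, List.mem_filter, ← Var.pureB_iff]

theorem pureL_nodup {N : List NumLoop} (h : (N.map Prod.fst).Nodup) :
    ((pureL N).map Prod.fst).Nodup := h.sublist (List.filter_sublist.map _)

theorem redL_nodup {N : List NumLoop} (h : (N.map Prod.fst).Nodup) :
    ((redL N).map Prod.fst).Nodup := h.sublist (List.filter_sublist.map _)

/-- Iterated form of `Inter.append`: every thread executes its parts of the successive iterations in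
order. -/
theorem Inter.flatten_ofFn {ι : Type} {k : ℕ} {F : Fin k → ι → List Act} {ts : Fin k → List Act}
    (h : ∀ i, Inter (F i) (ts i)) :
    Inter (fun e => (List.ofFn fun i => F i e).flatten) (List.ofFn ts).flatten := by
  induction k with
  | zero => simpa using Inter.nil
  | succ k ih =>
    simp only [List.ofFn_succ, List.flatten_cons]
    exact (h 0).append (ih fun i => h i.succ)

-- Threads are indexed by the environments of the pure loops. A pure loop, serial or parallel,
-- interleaves its iterations, and their threads are distinct because they differ in the value of
-- the loop variable. A reduction loop is serial, so its iterations follow each other and every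
-- thread concatenates its parts. Only the order between different pure iterations is forgotten, so
-- that one statement serves all traversal orders and all ways to nest the two kinds of loops.
open Classical in
theorem nest_tr_inter (hΓ : Compatible m n Γ) {Ls : List Hdr} {s : Stmt Hole}
    (hL : ∀ h ∈ Ls, h.Closed m n) (hN : (Ls.map Hdr.var).Nodup)
    (hS : ∀ h ∈ Ls, ¬ h.var.IsPure → h.ord = .serial)
    (h0 : ReachOK (Ls.map (Hdr.nums (holeVal Γ z) z))) {ρ : Env} (hρ : Base z ρ) {t : List Act}
    (ht : ((nest Ls s).fill Γ).Tr ρ t) :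
    ∃ ts : Env → List Act, Inter ts t ∧
      (∀ e, Box ρ (pureL (Ls.map (Hdr.nums (holeVal Γ z) z))) e →
        Conc (fun e t => (s.fill Γ).Tr e t) (enum (redL (Ls.map (Hdr.nums (holeVal Γ z) z))) e)
          (ts e)) ∧
      ∀ e, ¬ Box ρ (pureL (Ls.map (Hdr.nums (holeVal Γ z) z))) e → ts e = [] := by
  induction Ls generalizing ρ t with
  | nil =>
    refine ⟨fun e => if e = ρ then t else [], Inter.single ρ t, fun e he => ?_, fun e he => ?_⟩
    · obtain rfl := box_nil.1 he
      simpa [redL, enum, conc_singleton] using ht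
    · have : e ≠ ρ := fun h => he (box_nil.2 h)
      simp [this]
  | cons h Ls ih =>
    obtain ⟨c1, c2, c3⟩ := hL h (by simp)
    obtain ⟨h0, h0'⟩ := h0
    obtain ⟨n1, n2⟩ := List.nodup_cons.1 hN
    set N := Ls.map (Hdr.nums (holeVal Γ z) z) with hNdef
    have n1' : (h.nums (holeVal Γ z) z).1 ∉ N.map Prod.fst := by
      rwa [hNdef, map_fst_nums]
    have n1P : (h.nums (holeVal Γ z) z).1 ∉ (pureL N).map Prod.fst := fun hm =>
      n1' ((List.filter_sublist.map _).subset hm)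
    rw [nest_fill_cons] at ht
    obtain ⟨ts, h1, h2⟩ := (Stmt.tr_loop_fill hΓ hρ c1 c2 h0).1 ht
    have hpos : ∀ i : Fin (h.len.num (holeVal Γ z) z).toNat,
        0 < (h.nums (holeVal Γ z) z).2.2 := fun i => by
      have := i.2
      simp only [Hdr.nums]
      omega
    have ih := fun i => ih (fun h' hh => hL h' (by simp [hh])) n2
      (fun h' hh => hS h' (by simp [hh])) (h0' (hpos i)) (hρ.update c3 _) (h1 i)
    choose TS hT1 hT2 hT3 using ih
    by_cases hp : h.var.IsPure
    · have hpl : pureL (h.nums (holeVal Γ z) z :: N) = h.nums (holeVal Γ z) z :: pureL N := by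
        simp [pureL, Hdr.nums, Var.pureB_iff.2 hp]
      have hrl : redL (h.nums (holeVal Γ z) z :: N) = redL N := by
        simp [redL, Hdr.nums, Var.pureB_iff.2 hp]
      have hI : Inter ts t := by
        rcases h2 with ⟨-, rfl⟩ | ⟨-, h2⟩
        · exact interleave_iff_inter.1 (Interleave.flatten_ofFn ts)
        · exact interleave_iff_inter.1 h2
      have huniq : ∀ (i j : Fin (h.len.num (holeVal Γ z) z).toNat) e,
          Box (Function.update ρ h.var (.int (h.lo.num (holeVal Γ z) z + (i : ℕ)))) (pureL N) e →
          Box (Function.update ρ h.var (.int (h.lo.num (holeVal Γ z) z + (j : ℕ)))) (pureL N) e →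
          i = j := by
        intro i j e hi hj
        have e1 := hi.1 h.var n1P
        rw [hj.1 h.var n1P] at e1
        simp only [Function.update_self, Val.int.injEq] at e1
        exact Fin.ext (by omega)
      -- A pure iteration takes its thread from the only outer iteration with its value of the loop
      -- variable.
      let ts' : Env → List Act := fun e =>
        if hx : ∃ i : Fin (h.len.num (holeVal Γ z) z).toNat,
          Box (Function.update ρ h.var (.int (h.lo.num (holeVal Γ z) z + (i : ℕ)))) (pureL N) e
        then TS hx.choose e else []
      have hts' : ∀ i e,
          Box (Function.update ρ h.var (.int (h.lo.num (holeVal Γ z) z + ((i : Fin _) : ℕ)))) (pureL N) e →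
          ts' e = TS i e := by
        intro i e he
        have hx : ∃ i : Fin (h.len.num (holeVal Γ z) z).toNat,
          Box (Function.update ρ h.var (.int (h.lo.num (holeVal Γ z) z + (i : ℕ)))) (pureL N) e :=
          ⟨i, he⟩
        simp only [ts', hx, dif_pos]
        rw [huniq _ _ _ hx.choose_spec he]
      refine ⟨ts', ?_, fun e he => ?_, fun e he => ?_⟩
      · refine (hI.bind hT1).retag (S := {q | Box (Function.update ρ h.var
          (.int (h.lo.num (holeVal Γ z) z + ((q.1 : Fin _) : ℕ)))) (pureL N) q.2}) (f := Prod.snd)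
          ?_ ?_ ?_ ?_
        · rintro ⟨i, e⟩ hi ⟨j, e'⟩ hj (rfl : e = e')
          rw [huniq i j e hi hj]
        · rintro ⟨i, e⟩ hi
          exact hT3 i e hi
        · rintro ⟨i, e⟩ hi
          exact hts' i e hi
        · intro e he
          have hx : ¬ ∃ i : Fin (h.len.num (holeVal Γ z) z).toNat,
            Box (Function.update ρ h.var (.int (h.lo.num (holeVal Γ z) z + (i : ℕ)))) (pureL N) e :=
            fun ⟨i, hi⟩ => he ⟨(i, e), hi, rfl⟩
          simp only [ts', hx, dif_neg, not_false_eq_true]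
      · rw [List.map_cons, hpl, box_cons n1P] at he
        obtain ⟨i, hi, he⟩ := he
        rw [List.map_cons, hrl, hts' ⟨i, hi⟩ e he]
        exact hT2 ⟨i, hi⟩ e he
      · rw [List.map_cons, hpl, box_cons n1P] at he
        have hx : ¬ ∃ i : Fin (h.len.num (holeVal Γ z) z).toNat,
          Box (Function.update ρ h.var (.int (h.lo.num (holeVal Γ z) z + (i : ℕ)))) (pureL N) e :=
          fun ⟨i, hi⟩ => he ⟨i, i.2, hi⟩
        simp only [ts', hx, dif_neg, not_false_eq_true]
    · have hpB : h.var.pureB = false := by simpa [← Var.pureB_iff] using hp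
      have hpl : pureL (h.nums (holeVal Γ z) z :: N) = pureL N := by
        simp [pureL, Hdr.nums, hpB]
      have hrl : redL (h.nums (holeVal Γ z) z :: N) = h.nums (holeVal Γ z) z :: redL N := by
        simp [redL, Hdr.nums, hpB]
      rcases h2 with ⟨-, rfl⟩ | ⟨hpar, -⟩
      · have hbox : ∀ (i : Fin (h.len.num (holeVal Γ z) z).toNat) e, Box ρ (pureL N) e ↔
            e h.var = ρ h.var ∧
            Box (Function.update ρ h.var (.int (h.lo.num (holeVal Γ z) z + (i : ℕ)))) (pureL N)
              (Function.update e h.var (.int (h.lo.num (holeVal Γ z) z + (i : ℕ)))) := by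
          intro i e
          constructor
          · rintro ⟨k1, k2⟩
            refine ⟨k1 _ n1P, fun v hv => ?_, fun x hx => ?_⟩
            · by_cases hvh : v = h.var
              · subst hvh; simp
              · simp [Function.update_of_ne hvh, k1 v hv]
            · have : x.1 ≠ h.var := fun hxe => n1P (List.mem_map.2 ⟨x, hx, hxe⟩)
              rw [Function.update_of_ne this]
              exact k2 x hx
          · rintro ⟨k0, k1, k2⟩
            refine ⟨fun v hv => ?_, fun x hx => ?_⟩
            · by_cases hvh : v = h.var
              · subst hvh; exact k0
              · simpa [Function.update_of_ne hvh] using k1 v hv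
            · have : x.1 ≠ h.var := fun hxe => n1P (List.mem_map.2 ⟨x, hx, hxe⟩)
              have := k2 x hx
              rwa [Function.update_of_ne ‹_›] at this
        refine ⟨fun e => (List.ofFn fun i : Fin (h.len.num (holeVal Γ z) z).toNat =>
          if Box ρ (pureL N) e then
            TS i (Function.update e h.var (.int (h.lo.num (holeVal Γ z) z + (i : ℕ)))) else []).flatten,
          Inter.flatten_ofFn fun i => ?_, fun e he => ?_, fun e he => ?_⟩
        -- Threads of the inner nest are named by environments in which the reduction variable is
        -- set, those of the whole nest by environments in which it is as in `ρ`. Setting it undoes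
        -- the resetting.
        · have hinv : ∀ e, Box (Function.update ρ h.var (.int (h.lo.num (holeVal Γ z) z + (i : ℕ))))
              (pureL N) e →
              Function.update (Function.update e h.var (ρ h.var)) h.var
                (.int (h.lo.num (holeVal Γ z) z + (i : ℕ))) = e := by
            intro e he
            rw [Function.update_idem]
            have := he.1 h.var n1P
            rw [Function.update_self] at this
            rw [← this, Function.update_eq_self]
          refine (hT1 i).retag (S := {e | Box (Function.update ρ h.var
            (.int (h.lo.num (holeVal Γ z) z + (i : ℕ)))) (pureL N) e})
            (f := fun e => Function.update e h.var (ρ h.var)) ?_ ?_ ?_ ?_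
          · intro e he e' he' hee
            rw [← hinv e he, ← hinv e' he']
            exact congrArg (fun e : Env => Function.update e h.var
              (.int (h.lo.num (holeVal Γ z) z + (i : ℕ)))) hee
          · exact fun e he => hT3 i e he
          · intro e he
            have hb : Box ρ (pureL N) (Function.update e h.var (ρ h.var)) :=
              (hbox i _).2 ⟨by simp, by rw [hinv e he]; exact he⟩
            rw [if_pos hb, hinv e he]
          · intro e he
            rw [if_neg]
            intro hb
            obtain ⟨k1, k2⟩ := (hbox i e).1 hb
            refine he ⟨_, k2, ?_⟩
            simp only [Function.update_idem, ← k1, Function.update_eq_self]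
        · rw [List.map_cons, hpl] at he
          rw [List.map_cons, hrl, enum, conc_flatMap]
          refine ⟨_, fun i => ?_, rfl⟩
          rw [if_pos he]
          exact hT2 i _ ((hbox i e).1 he).2
        · rw [List.map_cons, hpl] at he
          simp only [he, if_false]
          exact List.flatten_ofFn_nil _
      · rw [hS h (by simp) hp] at hpar
        cases hpar

end Halide

namespace Halide

variable {m n : ℕ}

/-! ## Statements with the same traces and the same bounds query -/

/-- The statements `s` in `ρ` and `s'` in `ρ'` have the same traces and the same bounds query. -/
def Sim (Γ : Hole → Expr Ver Empty) (z : Input m n) (s : Stmt Hole) (ρ : Env) (s' : Stmt Hole)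
    (ρ' : Env) : Prop :=
  (∀ t, (s.fill Γ).Tr ρ t ↔ (s'.fill Γ).Tr ρ' t) ∧
  ∀ φ st, s.query (holeVal Γ z) φ st ρ ↔ s'.query (holeVal Γ z) φ st ρ'

/-- The statement `s` in `ρ` acts like `s'` in the given environment, or like a no-op if there is none. -/
def SimO (Γ : Hole → Expr Ver Empty) (z : Input m n) (s : Stmt Hole) (ρ : Env) (s' : Stmt Hole) :
    Option Env → Prop
  | some ρ' => Sim Γ z s ρ s' ρ'
  | none => Sim Γ z s ρ .nop ρ

variable {Γ : Hole → Expr Ver Empty} {z : Input m n}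

theorem Sim.refl (s : Stmt Hole) (ρ : Env) : Sim Γ z s ρ s ρ := ⟨fun _ => .rfl, fun _ _ => .rfl⟩

theorem Sim.trans {s s' s'' : Stmt Hole} {ρ ρ' ρ'' : Env} (h : Sim Γ z s ρ s' ρ')
    (h' : Sim Γ z s' ρ' s'' ρ'') : Sim Γ z s ρ s'' ρ'' :=
  ⟨fun t => (h.1 t).trans (h'.1 t), fun φ st => (h.2 φ st).trans (h'.2 φ st)⟩

theorem Sim.symm {s s' : Stmt Hole} {ρ ρ' : Env} (h : Sim Γ z s ρ s' ρ') : Sim Γ z s' ρ' s ρ :=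
  ⟨fun t => (h.1 t).symm, fun φ st => (h.2 φ st).symm⟩

theorem Sim.nop (ρ ρ' : Env) : Sim Γ z .nop ρ .nop ρ' :=
  ⟨fun t => by simp [Stmt.fill, Stmt.tr_nop], fun φ st => Iff.rfl⟩

theorem Sim.letIn (hΓ : Compatible m n Γ) {x : Var} {e : TExpr} (he : e.AccFree) (s : Stmt Hole)
    {ρ : Env} (hρ : Base z ρ) :
    Sim Γ z (.letIn x e s) ρ s (Function.update ρ x (e.tval (holeVal Γ z) ρ)) := by
  refine ⟨fun t => ?_, fun φ st => ?_⟩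
  · simp only [Stmt.fill, Stmt.tr_letIn, he.tr_fill hΓ hρ]
    constructor
    · rintro ⟨_, t₂, _, ⟨rfl, rfl⟩, h, rfl⟩; exact h
    · exact fun h => ⟨[], t, _, ⟨rfl, rfl⟩, h, rfl⟩
  · simp [Stmt.query, he.queryCpu, he.qval_eq]

theorem Sim.guard_true (hΓ : Compatible m n Γ) {e : TExpr} (he : e.AccFree) (s : Stmt Hole)
    {ρ : Env} (hρ : Base z ρ) (h : e.tval (holeVal Γ z) ρ ≠ .int 0) :
    Sim Γ z (.ite e s .nop) ρ s ρ := by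
  refine ⟨fun t => ?_, fun φ st => ?_⟩
  · simp only [Stmt.fill, Stmt.tr_ite, he.tr_fill hΓ hρ]
    constructor
    · rintro ⟨_, t₂, _, ⟨rfl, rfl⟩, rfl, ⟨_, hs⟩ | ⟨h', _⟩⟩
      · exact hs
      · exact (h h').elim
    · exact fun hs => ⟨[], t, _, ⟨rfl, rfl⟩, rfl, .inl ⟨h, hs⟩⟩
  · simp [Stmt.query, he.queryCpu, he.qval_eq, h]

theorem Sim.guard_false (hΓ : Compatible m n Γ) {e : TExpr} (he : e.AccFree) (s : Stmt Hole)
    {ρ : Env} (hρ : Base z ρ) (h : e.tval (holeVal Γ z) ρ = .int 0) :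
    Sim Γ z (.ite e s .nop) ρ .nop ρ := by
  refine ⟨fun t => ?_, fun φ st => ?_⟩
  · simp only [Stmt.fill, Stmt.tr_ite, he.tr_fill hΓ hρ, Stmt.tr_nop]
    constructor
    · rintro ⟨_, t₂, _, ⟨rfl, rfl⟩, rfl, ⟨h', _⟩ | ⟨_, rfl⟩⟩
      · exact (h' h).elim
      · rfl
    · rintro rfl; exact ⟨[], [], _, ⟨rfl, rfl⟩, rfl, .inr ⟨h, rfl⟩⟩
  · simp [Stmt.query, he.queryCpu, he.qval_eq, h]

/-! ## The code below the loops of a stage -/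

/-- The code of a single point update. -/
def IsCore (core : Stmt Hole) : Prop :=
  ∃ p f v k args e, core = .ite p (.assign f v k args e) .nop

/-- `core` below `let`s and guards. -/
inductive Below (core : Stmt Hole) : Stmt Hole → Prop
  | core : Below core core
  | letIn (x : Var) (e : TExpr) (s : Stmt Hole) (hx : x.IsLoop) (he : e.AccFree) (hs : Below core s) :
      Below core (.letIn x e s)
  | guard (e : TExpr) (s : Stmt Hole) (he : e.AccFree) (hs : Below core s) : Below core (.ite e s .nop)

/-- The statement binds `v`. -/
def Stmt.Binds {H : Type} (v : Var) : Stmt H → Prop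
  | .seq s₁ s₂ => s₁.Binds v ∨ s₂.Binds v
  | .ite _ s₁ s₂ => s₁.Binds v ∨ s₂.Binds v
  | .loop _ x _ _ s => v = x ∨ s.Binds v
  | .letIn x _ s => v = x ∨ s.Binds v
  | .label _ s => s.Binds v
  | _ => False

theorem Stmt.Binds.mentions {H : Type} {v : Var} {s : Stmt H} (h : s.Binds v) : s.Mentions v := by
  induction s with
  | seq s₁ s₂ ih₁ ih₂ => exact h.imp ih₁ ih₂
  | ite e s₁ s₂ ih₁ ih₂ => exact .inr (h.imp ih₁ ih₂)
  | loop τ x lo len s ih => exact h.imp_right fun h => .inr (.inr (ih h))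
  | letIn x e s ih => exact h.imp_right fun h => .inr (ih h)
  | label l s ih => exact ih h
  | _ => exact h.elim

theorem sim_core_congr (hΓ : Compatible m n Γ) {core : Stmt Hole} (hc : IsCore core) {ρ ρ' : Env}
    (hρ : Base z ρ) (hρ' : Base z ρ') (h : ∀ v, core.Mentions v → ρ v = ρ' v) :
    Sim Γ z core ρ core ρ' := by
  have tr : ∀ {ρ ρ' : Env}, Base z ρ → Base z ρ' → (∀ v, core.Mentions v → ρ v = ρ' v) →
      ∀ t, (core.fill Γ).Tr ρ t → (core.fill Γ).Tr ρ' t := by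
    obtain ⟨p, f, v, k, args, e, rfl⟩ := hc
    intro ρ ρ' hρ hρ' h t
    simp only [Stmt.fill, Stmt.tr_ite, Stmt.tr_nop, Stmt.tr_assign]
    rintro ⟨t₁, t₂, v, h1, rfl, ⟨hv, ts, vs, t₃, w, h2, h3, rfl⟩ | ⟨hv, h2⟩⟩
    · exact ⟨t₁, _, v, Expr.tr_fill_congr hΓ hρ hρ' (fun x hx => h x (.inl hx)) h1, rfl, .inl ⟨hv, ts, vs,
        t₃, w, Expr.tr_fill_congr hΓ hρ hρ' (fun x hx => h x (.inr (.inl (.inl hx)))) h2,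
        fun i => Expr.tr_fill_congr hΓ hρ hρ' (fun x hx => h x (.inr (.inl (.inr ⟨i, hx⟩)))) (h3 i),
        rfl⟩⟩
    · exact ⟨t₁, t₂, v, Expr.tr_fill_congr hΓ hρ hρ' (fun x hx => h x (.inl hx)) h1, rfl, .inr ⟨hv, h2⟩⟩
  refine ⟨fun t => ⟨tr hρ hρ' h t, tr hρ' hρ (fun v hv => (h v hv).symm) t⟩, fun φ st => ?_⟩
  obtain ⟨p, f, v, k, args, e, rfl⟩ := hc
  have hp : ∀ x ∈ p.vars, ρ x = ρ' x := fun x hx => h x (.inl hx)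
  have he : ∀ x ∈ e.vars, ρ x = ρ' x := fun x hx => h x (.inr (.inl (.inl hx)))
  have ha : ∀ i, ∀ x ∈ (args i).vars, ρ x = ρ' x := fun i x hx => h x (.inr (.inl (.inr ⟨i, hx⟩)))
  have e1 : ∀ i, (args i).qval (holeVal Γ z) φ ρ = (args i).qval (holeVal Γ z) φ ρ' := fun i =>
    Expr.qval_congr (ha i)
  simp only [Stmt.query, Expr.queryCpu_congr hp, Expr.qval_congr hp, e1, Expr.queryCpu_congr he,
    Expr.queryMem_congr he, fun i => Expr.queryCpu_congr (η := holeVal Γ z) (φ := φ) (st := st) (ha i)]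

theorem Below.sim_congr (hΓ : Compatible m n Γ) {core s : Stmt Hole} (hc : IsCore core)
    (hs : Below core s) {ρ ρ' : Env} (hρ : Base z ρ) (hρ' : Base z ρ')
    (h : ∀ v, s.Mentions v → ρ v = ρ' v) : Sim Γ z s ρ s ρ' := by
  induction hs generalizing ρ ρ' with
  | core => exact sim_core_congr hΓ hc hρ hρ' h
  | letIn x e s hx he _ ih =>
    refine (Sim.letIn hΓ he s hρ).trans (Sim.trans ?_ (Sim.letIn hΓ he s hρ').symm)
    have e1 : e.tval (holeVal Γ z) ρ = e.tval (holeVal Γ z) ρ' :=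
      Expr.tval_congr fun v hv => h v (.inr (.inl hv))
    rw [e1]
    refine ih (hρ.update hx _) (hρ'.update hx _) fun v hv => ?_
    by_cases hvx : v = x
    · subst hvx; simp
    · rw [Function.update_of_ne hvx, Function.update_of_ne hvx]
      exact h v (.inr (.inr hv))
  | guard e s he _ ih =>
    have e1 : e.tval (holeVal Γ z) ρ = e.tval (holeVal Γ z) ρ' :=
      Expr.tval_congr fun v hv => h v (.inl hv)
    by_cases h0 : e.tval (holeVal Γ z) ρ = .int 0
    · exact (Sim.guard_false hΓ he s hρ h0).trans ((Sim.nop ρ ρ').trans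
        (Sim.guard_false hΓ he s hρ' (e1 ▸ h0)).symm)
    · exact (Sim.guard_true hΓ he s hρ h0).trans
        ((ih hρ hρ' fun v hv => h v (.inr (.inl hv))).trans
          (Sim.guard_true hΓ he s hρ' (e1 ▸ h0)).symm)

/-! ## Inserting bindings and guards -/

/-- A binding or a guard. -/
inductive Bnd
  | bind (x : Var) (e : TExpr)
  | guard (c : TExpr)

def wrapB : List Bnd → Stmt Hole → Stmt Hole
  | [], s => s
  | .bind x e :: B, s => .letIn x e (wrapB B s)
  | .guard c :: B, s => .ite c (wrapB B s) .nop

/-- The environment below the bindings, if the guards hold. -/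
def runB (η : Hole → ℤ) : List Bnd → Env → Option Env
  | [], ρ => some ρ
  | .bind x e :: B, ρ => runB η B (Function.update ρ x (e.tval η ρ))
  | .guard c :: B, ρ => if c.tval η ρ = .int 0 then none else runB η B ρ

/-- The list `xs` limits the variables that may be set; later these are the variables of the
replaced loops. -/
def Bnd.OK (xs : List Var) : Bnd → Prop
  | .bind x e => x ∈ xs ∧ x.IsLoop ∧ e.AccFree
  | .guard c => c.AccFree

def Bnd.Mentions (y : Var) : Bnd → Prop
  | .bind x e => y = x ∨ y ∈ e.vars
  | .guard c => y ∈ c.vars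

theorem sim_wrapB (hΓ : Compatible m n Γ) {xs : List Var} {B : List Bnd} (hB : ∀ b ∈ B, b.OK xs)
    (s : Stmt Hole) {ρ : Env} (hρ : Base z ρ) :
    SimO Γ z (wrapB B s) ρ s (runB (holeVal Γ z) B ρ) ∧
      ∀ ρ' ∈ runB (holeVal Γ z) B ρ, Base z ρ' ∧ ∀ v ∉ xs, ρ' v = ρ v := by
  induction B generalizing ρ with
  | nil =>
    refine ⟨Sim.refl s ρ, ?_⟩
    rintro ρ' hρ'
    simp only [runB, Option.mem_def, Option.some.injEq] at hρ'
    subst hρ'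
    exact ⟨hρ, fun _ _ => rfl⟩
  | cons b B ih =>
    have hb := hB b (by simp)
    have ih := fun {ρ} => ih (fun b hb => hB b (by simp [hb])) (ρ := ρ)
    cases b with
    | bind x e =>
      obtain ⟨h1, h2, h3⟩ := hb
      have hl := Sim.letIn (z := z) hΓ (x := x) h3 (wrapB B s) hρ
      obtain ⟨k1, k2⟩ := ih (hρ.update h2 (e.tval (holeVal Γ z) ρ))
      constructor
      · simp only [wrapB, runB]
        revert k1
        cases runB (holeVal Γ z) B (Function.update ρ x (e.tval (holeVal Γ z) ρ)) with
        | none => exact fun k1 => (hl.trans k1).trans (Sim.nop _ _)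
        | some ρ' => exact fun k1 => hl.trans k1
      · intro ρ' hρ'
        obtain ⟨k3, k4⟩ := k2 ρ' hρ'
        refine ⟨k3, fun v hv => ?_⟩
        rw [k4 v hv, Function.update_of_ne (by rintro rfl; exact hv h1)]
    | guard c =>
      by_cases h0 : c.tval (holeVal Γ z) ρ = .int 0
      · simp only [wrapB, runB, h0, if_true]
        exact ⟨Sim.guard_false hΓ hb _ hρ h0, by simp⟩
      · simp only [wrapB, runB, h0, if_false]
        obtain ⟨k1, k2⟩ := ih hρ
        refine ⟨?_, k2⟩
        have hl := Sim.guard_true (z := z) hΓ hb (wrapB B s) hρ h0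
        revert k1
        cases runB (holeVal Γ z) B ρ with
        | none => exact fun k1 => hl.trans k1
        | some ρ' => exact fun k1 => hl.trans k1

/-- The bindings neither set nor read `y`, so an assignment to `y` commutes with them. This permits
moving them below a `let` of `y`. -/
theorem runB_update {η : Hole → ℤ} {B : List Bnd} {y : Var} (hy : ∀ b ∈ B, ¬ b.Mentions y) (v : Val)
    (ρ : Env) :
    runB η B (Function.update ρ y v) = (runB η B ρ).map fun ρ => Function.update ρ y v := by
  induction B generalizing ρ with
  | nil => rfl
  | cons b B ih =>
    have hb := hy b (by simp)
    have ih := ih fun b hb => hy b (by simp [hb])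
    cases b with
    | bind x e =>
      simp only [Bnd.Mentions, not_or] at hb
      simp only [runB, Expr.tval_update hb.2]
      rw [Function.update_comm hb.1, ih]
    | guard c =>
      simp only [runB, Expr.tval_update hb, ih]
      split_ifs <;> rfl

/-- A `let` whose expression avoids `xs` has the same value before and after the bindings, and its
variable is foreign to them, so the two may change places. Everywhere else the bindings are inserted
on the spot, where `sim_wrapB` applies. -/
theorem sim_pushDown (hΓ : Compatible m n Γ) {core s : Stmt Hole} (hc : IsCore core)
    (hs : Below core s) {xs : List Var} {B : List Bnd} (hB : ∀ b ∈ B, b.OK xs)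
    (hf : ∀ y, s.Binds y → y ∉ xs ∧ ∀ b ∈ B, ¬ b.Mentions y) {ρ : Env} (hρ : Base z ρ) :
    SimO Γ z (s.pushDown xs (wrapB B)) ρ s (runB (holeVal Γ z) B ρ) := by
  induction hs generalizing ρ with
  | core =>
    have : core.pushDown xs (wrapB B) = wrapB B core := by
      obtain ⟨p, f, v, k, args, e, rfl⟩ := hc
      rfl
    rw [this]
    exact (sim_wrapB hΓ hB _ hρ).1
  | guard e s he hs ih => exact (sim_wrapB hΓ hB _ hρ).1
  | letIn y e s hy he hs ih =>
    simp only [Stmt.pushDown]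
    split_ifs with hx
    · exact (sim_wrapB hΓ hB _ hρ).1
    · obtain ⟨f1, f2⟩ := hf y (.inl rfl)
      have k1 := ih (fun y' hy' => hf y' (.inr hy')) (hρ.update hy (e.tval (holeVal Γ z) ρ))
      rw [runB_update f2] at k1
      have hl := Sim.letIn (z := z) hΓ (x := y) he (s.pushDown xs (wrapB B)) hρ
      have k2 := (sim_wrapB (z := z) hΓ hB .nop hρ).2
      revert k1 k2
      cases runB (holeVal Γ z) B ρ with
      | none => exact fun k1 _ => (hl.trans k1).trans (Sim.nop _ _)
      | some ρ' =>
        intro k1 k2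
        obtain ⟨b1, b2⟩ := k2 ρ' rfl
        have e1 : e.tval (holeVal Γ z) ρ = e.tval (holeVal Γ z) ρ' :=
          Expr.tval_congr fun v hv => (b2 v fun hvx => hx ⟨v, hvx, hv⟩).symm
        refine hl.trans (Sim.trans k1 ?_)
        rw [e1]
        exact (Sim.letIn hΓ he s b1).symm

theorem Below.wrapB {core s : Stmt Hole} (hs : Below core s) {xs : List Var} {B : List Bnd}
    (hB : ∀ b ∈ B, b.OK xs) : Below core (wrapB B s) := by
  induction B with
  | nil => exact hs
  | cons b B ih =>
    have hb := hB b (by simp)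
    have ih := ih fun b hb => hB b (by simp [hb])
    cases b with
    | bind x e => exact .letIn x e _ hb.2.1 hb.2.2 ih
    | guard c => exact .guard c _ hb ih

theorem Below.pushDown {core s : Stmt Hole} (hc : IsCore core) (hs : Below core s) {xs : List Var}
    {B : List Bnd} (hB : ∀ b ∈ B, b.OK xs) : Below core (s.pushDown xs (Halide.wrapB B)) := by
  induction hs with
  | core =>
    obtain ⟨p, f, v, k, args, e, rfl⟩ := hc
    exact Below.wrapB .core hB
  | guard e s he hs ih => exact (Below.guard e s he hs).wrapB hB
  | letIn y e s hy he hs ih =>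
    simp only [Stmt.pushDown]
    split_ifs with hx
    · exact (Below.letIn y e s hy he hs).wrapB hB
    · exact .letIn y e _ hy he ih

theorem binds_wrapB {s : Stmt Hole} {xs : List Var} {B : List Bnd}
    (hB : ∀ b ∈ B, b.OK xs) {v : Var} (h : (wrapB B s).Binds v) : v ∈ xs ∨ s.Binds v := by
  induction B with
  | nil => exact .inr h
  | cons b B ih =>
    have hb := hB b (by simp)
    have ih := ih fun b hb => hB b (by simp [hb])
    cases b with
    | bind x e =>
      rcases h with rfl | h
      · exact .inl hb.1
      · exact ih h
    | guard c =>
      rcases h with h | h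
      · exact ih h
      · exact h.elim

theorem Below.binds_pushDown {core s : Stmt Hole} (hc : IsCore core) (hs : Below core s)
    {xs : List Var} {B : List Bnd} (hB : ∀ b ∈ B, b.OK xs) {v : Var}
    (h : (s.pushDown xs (Halide.wrapB B)).Binds v) : v ∈ xs ∨ s.Binds v := by
  induction hs with
  | core =>
    obtain ⟨p, f, w, k, args, e, rfl⟩ := hc
    exact binds_wrapB hB h
  | guard e s he hs ih => exact binds_wrapB hB h
  | letIn y e s hy he hs ih =>
    simp only [Stmt.pushDown] at h
    split_ifs at h with hx
    · exact binds_wrapB hB h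
    · rcases h with rfl | h
      · exact .inr (.inl rfl)
      · exact (ih h).imp_right .inr

/-! ## Replacing a segment of a loop nest -/

open Classical in
/-- The environment of the old iteration that corresponds to a new one: the variables `V'` of the
new loops are cleared, and the variables `V` of the old ones are set to `H`. -/
noncomputable def segG (V V' : List Var) (P : Env → Prop) (H : Env → Var → ℤ) (ρ : Env) : Option Env :=
  if P ρ then some fun v => if v ∈ V then .int (H ρ v) else if v ∈ V' then .errMem else ρ v
  else none

/-- The loops `C'` run through the iterations of `C`, possibly with additional ones. -/
structure Seg (C C' : List NumLoop) (P : Env → Prop) (H : Env → Var → ℤ) (strict : Prop) :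
    Prop where
  loc : ∀ ρ ρ', (∀ v ∈ C'.map Prod.fst, ρ v = ρ' v) → (P ρ ↔ P ρ') ∧ H ρ = H ρ'
  cover : (∀ x ∈ C, 0 ≤ x.2.2) → ∀ ρ, (∀ v ∈ C'.map Prod.fst, ρ v = .errMem) → ∀ e ∈ enum C ρ,
    ∃ e' ∈ enum C' ρ, segG (C.map Prod.fst) (C'.map Prod.fst) P H e' = some e
  exact : strict → (∀ x ∈ C, 0 ≤ x.2.2) → ∀ ρ, (∀ v ∈ C'.map Prod.fst, ρ v = .errMem) →
    (enum C' ρ).filterMap (segG (C.map Prod.fst) (C'.map Prod.fst) P H) = enum C ρ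
  len : (∀ x ∈ C, 0 ≤ x.2.2) → ∀ x ∈ C', 0 ≤ x.2.2
  reach : strict → ∀ B, ReachOK (C ++ B) → ReachOK (C' ++ B)
  reach' : (∀ x ∈ C, 0 ≤ x.2.2) → ∀ B, ReachOK (C' ++ B) → ReachOK (C ++ B)
  /-- A loop with a nonempty iteration space replaces loops of nonnegative length. -/
  pos : strict → ∀ B, ReachOK (C ++ B) → (∀ x ∈ C', 0 < x.2.2) → ∀ x ∈ C, 0 ≤ x.2.2

/-! ### Decoding the iterations of a replaced segment -/

section SegG

variable {V V' : List Var} {P : Env → Prop} {H : Env → Var → ℤ}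

theorem segG_update (loc : ∀ ρ ρ', (∀ v ∈ V', ρ v = ρ' v) → (P ρ ↔ P ρ') ∧ H ρ = H ρ')
    {y : Var} (hy : y ∉ V) (hy' : y ∉ V') (v : Val) (ρ : Env) :
    segG V V' P H (Function.update ρ y v) =
      (segG V V' P H ρ).map fun ρ => Function.update ρ y v := by
  obtain ⟨h1, h2⟩ := loc (Function.update ρ y v) ρ fun w hw =>
    Function.update_of_ne (by rintro rfl; exact hy' hw) _ _
  simp only [segG, h1, h2]
  by_cases hP : P ρ
  · rw [if_pos (h1.2 hP), if_pos hP]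
    simp only [Option.map_some, Option.some.injEq]
    funext w
    by_cases hw : w = y
    · subst hw; simp [hy, hy']
    · simp [Function.update_of_ne hw]
  · rw [if_neg fun h => hP (h1.1 h), if_neg hP]
    rfl

/-- The loops `B` bind none of the variables that decoding reads or sets, so it does not matter
whether decoding takes place before or after them. A rejected iteration loses its whole inner
enumeration. -/
theorem filterMap_enum_segG (loc : ∀ ρ ρ', (∀ v ∈ V', ρ v = ρ' v) → (P ρ ↔ P ρ') ∧ H ρ = H ρ')
    {B : List NumLoop} (hB : ∀ x ∈ B, x.1 ∉ V ∧ x.1 ∉ V') (ρ : Env) :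
    (enum B ρ).filterMap (segG V V' P H) = (segG V V' P H ρ).elim [] (enum B) := by
  induction B generalizing ρ with
  | nil =>
    cases h : segG V V' P H ρ <;> simp [enum, h]
  | cons x B ih =>
    have ih := ih fun y hy => hB y (by simp [hy])
    simp only [enum, List.filterMap_flatMap, ih,
      segG_update loc (hB x (by simp)).1 (hB x (by simp)).2]
    cases segG V V' P H ρ <;> simp

theorem segG_off {ρ ρ' : Env} (h : segG V V' P H ρ = some ρ') : ∀ v ∉ V, v ∉ V' → ρ' v = ρ v := by
  simp only [segG] at h
  split_ifs at h
  cases h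
  intro v hv hv'
  simp [hv, hv']

theorem segG_int {ρ ρ' : Env} (h : segG V V' P H ρ = some ρ') :
    (∀ v ∈ V, ∃ t : ℤ, ρ' v = .int t) ∧ ∀ v ∈ V', v ∉ V → ρ' v = .errMem := by
  simp only [segG] at h
  split_ifs at h
  cases h
  refine ⟨fun v hv => ⟨H ρ v, by simp [hv]⟩, fun v hv hv' => by simp [hv, hv']⟩

end SegG

/-- The new loops run through the old iterations in the same order. -/
theorem Seg.enum_filterMap {C C' : List NumLoop} {P : Env → Prop} {H : Env → Var → ℤ} {strict : Prop}
    (h : Seg C C' P H strict) (hs : strict) (hC : ∀ x ∈ C, 0 ≤ x.2.2) {A B : List NumLoop}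
    (hA : ∀ x ∈ A, x.1 ∉ C'.map Prod.fst)
    (hB : ∀ x ∈ B, x.1 ∉ C.map Prod.fst ∧ x.1 ∉ C'.map Prod.fst) {ρ : Env}
    (hρ : ∀ v ∈ C'.map Prod.fst, ρ v = .errMem) :
    (enum (A ++ C' ++ B) ρ).filterMap (segG (C.map Prod.fst) (C'.map Prod.fst) P H) =
      enum (A ++ C ++ B) ρ := by
  induction A generalizing ρ with
  | nil =>
    simp only [List.nil_append, enum_append, List.filterMap_flatMap, filterMap_enum_segG h.loc hB]
    rw [← h.exact hs hC ρ hρ]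
    induction enum C' ρ with
    | nil => simp
    | cons e E ih =>
      rw [List.flatMap_cons, ih]
      cases hg : segG (C.map Prod.fst) (C'.map Prod.fst) P H e with
      | none => rw [List.filterMap_cons_none hg]; simp
      | some e' => rw [List.filterMap_cons_some hg]; simp
  | cons x A ih =>
    have ih := fun {ρ} => ih (fun y hy => hA y (by simp [hy])) (ρ := ρ)
    simp only [List.cons_append, enum, List.filterMap_flatMap]
    congr 1
    funext i
    refine ih fun v hv => ?_
    rw [Function.update_of_ne (by rintro rfl; exact hA x (by simp) hv), hρ v hv]

/-- For shift and round this existence statement is all that is left of the equality of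
enumerations. -/
theorem Seg.enum_cover {C C' : List NumLoop} {P : Env → Prop} {H : Env → Var → ℤ} {strict : Prop}
    (h : Seg C C' P H strict) (hC : ∀ x ∈ C, 0 ≤ x.2.2) {A B : List NumLoop}
    (hA : ∀ x ∈ A, x.1 ∉ C'.map Prod.fst)
    (hB : ∀ x ∈ B, x.1 ∉ C.map Prod.fst ∧ x.1 ∉ C'.map Prod.fst) {ρ : Env}
    (hρ : ∀ v ∈ C'.map Prod.fst, ρ v = .errMem) :
    ∀ e ∈ enum (A ++ C ++ B) ρ, ∃ e' ∈ enum (A ++ C' ++ B) ρ,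
      segG (C.map Prod.fst) (C'.map Prod.fst) P H e' = some e := by
  induction A generalizing ρ with
  | nil =>
    intro e he
    simp only [List.nil_append, enum_append, List.mem_flatMap] at he ⊢
    obtain ⟨c, hc, he⟩ := he
    obtain ⟨c', hc', hg⟩ := h.cover hC ρ hρ c hc
    have := filterMap_enum_segG h.loc hB c'
    rw [hg, Option.elim_some] at this
    rw [← this, List.mem_filterMap] at he
    obtain ⟨e', he', hg'⟩ := he
    exact ⟨e', ⟨c', hc', he'⟩, hg'⟩
  | cons x A ih =>
    intro e he
    simp only [List.cons_append, enum, List.mem_flatMap] at he ⊢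
    obtain ⟨i, hi, he⟩ := he
    obtain ⟨e', he', hg⟩ := ih (fun y hy => hA y (by simp [hy])) (fun v hv => by
      rw [Function.update_of_ne (by rintro rfl; exact hA x (by simp) hv), hρ v hv]) e he
    exact ⟨e', ⟨i, hi, he'⟩, hg⟩

/-- Two positions with the same image would produce a repetition in the output. Since boxes are
enumerated without repetition, this yields the injectivity of decoding. -/
theorem filterMap_inj {α β : Type} {g : α → Option β} {L : List α} (h : (L.filterMap g).Nodup)
    {a b : α} (ha : a ∈ L) (hb : b ∈ L) {c : β} (hga : g a = some c) (hgb : g b = some c) : a = b := by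
  induction L with
  | nil => simp at ha
  | cons x L ih =>
    cases hg : g x with
    | none =>
      rw [List.filterMap_cons_none hg] at h
      have ha' : a ∈ L := by
        rcases List.mem_cons.1 ha with rfl | h'
        · rw [hg] at hga; cases hga
        · exact h'
      have hb' : b ∈ L := by
        rcases List.mem_cons.1 hb with rfl | h'
        · rw [hg] at hgb; cases hgb
        · exact h'
      exact ih h ha' hb'
    | some y =>
      rw [List.filterMap_cons_some hg, List.nodup_cons] at h
      rcases List.mem_cons.1 ha with ha1 | ha'
      · rcases List.mem_cons.1 hb with hb1 | hb'
        · rw [ha1, hb1]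
        · rw [← ha1, hga] at hg
          cases hg
          exact (h.1 (List.mem_filterMap.2 ⟨b, hb', hgb⟩)).elim
      · rcases List.mem_cons.1 hb with hb1 | hb'
        · rw [← hb1, hgb] at hg
          cases hg
          exact (h.1 (List.mem_filterMap.2 ⟨a, ha', hga⟩)).elim
        · exact ih h.2 ha' hb'

end Halide

namespace Halide

variable {m n : ℕ} {Γ : Hole → Expr Ver Empty} {z : Input m n}

/-! ## What a scheduled loop nest computes -/

/-- The environment without its reduction variables. -/
def purePart (ρ : Env) : Env
  | .red _ => .errMem
  | v => ρ v

theorem purePart_of_isPure (ρ : Env) {v : Var} (h : v.IsPure) : purePart ρ v = ρ v := by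
  cases v <;> simp_all [purePart, Var.IsPure]

theorem purePart_of_isRed (ρ : Env) {v : Var} (h : v.IsRed) : purePart ρ v = .errMem := by
  cases v <;> simp_all [purePart, Var.IsRed]

theorem purePart_of_not_isRed (ρ : Env) {v : Var} (h : ¬ v.IsRed) : purePart ρ v = ρ v := by
  cases v <;> simp_all [purePart, Var.IsRed]

theorem Var.IsPure.not_isRed {v : Var} (h : v.IsPure) : ¬ v.IsRed := by
  cases v <;> simp_all [Var.IsPure, Var.IsRed]

theorem Var.IsPure.isLoop {v : Var} (h : v.IsPure) : v.IsLoop := Var.isLoop_iff.2 (.inl h)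

theorem Var.IsRed.isLoop {v : Var} (h : v.IsRed) : v.IsLoop := Var.isLoop_iff.2 (.inr h)

abbrev vars (N : List NumLoop) : List Var := N.map Prod.fst

def Nonneg (N : List NumLoop) : Prop := ∀ x ∈ N, 0 ≤ x.2.2

theorem mem_vars_pureL {N : List NumLoop} {v : Var} : v ∈ vars (pureL N) ↔ v ∈ vars N ∧ v.IsPure := by
  simp only [vars, List.mem_map, mem_pureL]
  constructor
  · rintro ⟨x, ⟨h1, h2⟩, rfl⟩; exact ⟨⟨x, h1, rfl⟩, h2⟩
  · rintro ⟨⟨x, h1, rfl⟩, h2⟩; exact ⟨x, ⟨h1, h2⟩, rfl⟩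

theorem IntOn.purePart {N : List NumLoop} {ρ : Env} (h : IntOn z.env (vars N) ρ)
    (hN : ∀ v ∈ vars N, v.IsLoop) :
    IntOn z.env (vars (pureL N)) (purePart ρ) := by
  refine ⟨fun v hv => ?_, fun v hv => ?_⟩
  · by_cases hr : v.IsRed
    · rw [purePart_of_isRed ρ hr, z.env_loop hr.isLoop]
    · rw [purePart_of_not_isRed ρ hr]
      by_cases hm : v ∈ vars N
      · by_cases hl : v.IsPure
        · exact (hv (mem_vars_pureL.2 ⟨hm, hl⟩)).elim
        · exact ((Var.isLoop_iff.1 (hN v hm)).elim hl hr).elim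
      · exact h.1 v hm
  · obtain ⟨h1, h2⟩ := mem_vars_pureL.1 hv
    rw [purePart_of_isPure ρ h2]
    exact h.2 v h1

/-- The loops `N` around `tail` compute what the loops `N₀` around `core` do: `dec` leads from the
environments of the iterations of `N` to those of `N₀`, and `decP` does so for the pure variables. -/
structure Sem (Γ : Hole → Expr Ver Empty) (z : Input m n) (core : Stmt Hole) (N₀ N : List NumLoop)
    (tail : Stmt Hole) (strict : Prop) (dec decP : Env → Option Env) : Prop where
  sim : ∀ ρ, IntOn z.env (vars N) ρ → SimO Γ z tail ρ core (dec ρ)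
  dec_int : ∀ ρ, IntOn z.env (vars N) ρ → ∀ ρ', dec ρ = some ρ' →
    IntOn z.env (vars N₀) ρ' ∧ decP (purePart ρ) = some (purePart ρ')
  decP_int : ∀ ρ, IntOn z.env (vars (pureL N)) ρ → ∀ ρ', decP ρ = some ρ' →
    IntOn z.env (vars (pureL N₀)) ρ'
  redLen : Nonneg (redL N₀) → Nonneg (redL N)
  pureLen : Nonneg (pureL N₀) → Nonneg (pureL N)
  slice : Nonneg (redL N₀) → ∀ ρ, IntOn z.env (vars (pureL N)) ρ →
    (enum (redL N) ρ).filterMap dec = (decP ρ).elim [] (enum (redL N₀))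
  cover : Nonneg (pureL N₀) → ∀ ρ', Box z.env (pureL N₀) ρ' →
    ∃ ρ, Box z.env (pureL N) ρ ∧ decP ρ = some ρ'
  box : strict → Nonneg (pureL N₀) → ∀ ρ ρ', Box z.env (pureL N) ρ → decP ρ = some ρ' →
    Box z.env (pureL N₀) ρ'
  inj : strict → Nonneg (pureL N₀) → ∀ ρ₁ ρ₂ ρ', Box z.env (pureL N) ρ₁ → Box z.env (pureL N) ρ₂ →
    decP ρ₁ = some ρ' → decP ρ₂ = some ρ' → ρ₁ = ρ₂

theorem IntOn.congr {ρ₀ ρ : Env} {V V' : List Var} (h : ∀ v, v ∈ V ↔ v ∈ V') :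
    IntOn ρ₀ V ρ ↔ IntOn ρ₀ V' ρ := by simp [IntOn, h]

theorem Box.congr {ρ₀ ρ : Env} {N N' : List NumLoop} (h : ∀ x, x ∈ N ↔ x ∈ N') :
    Box ρ₀ N ρ ↔ Box ρ₀ N' ρ := by simp [Box, List.mem_map, h]

theorem Sem.refl (core : Stmt Hole) (N : List NumLoop) : Sem Γ z core N N core True some some where
  sim ρ _ := Sim.refl core ρ
  dec_int ρ h ρ' h' := by cases h'; exact ⟨h, rfl⟩
  decP_int ρ h ρ' h' := by cases h'; exact h
  redLen := id
  pureLen := id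
  slice _ ρ _ := by simp
  cover _ ρ h := ⟨ρ, h, rfl⟩
  box _ _ ρ ρ' h h' := by cases h'; exact h
  inj _ _ ρ₁ ρ₂ ρ' _ _ h h' := by cases h; cases h'; rfl

/-- All clauses see the loops as a set, except for `slice` and `redLen`, which see the list of
reduction loops. A swap with at least one pure loop leaves this list as it is. -/
theorem Sem.perm {core tail : Stmt Hole} {N₀ N N' : List NumLoop} {strict : Prop}
    {dec decP : Env → Option Env} (h : Sem Γ z core N₀ N tail strict dec decP)
    (hm : ∀ x, x ∈ N ↔ x ∈ N') (hr : redL N = redL N') : Sem Γ z core N₀ N' tail strict dec decP := by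
  have hp : ∀ x, x ∈ pureL N ↔ x ∈ pureL N' := fun x => by rw [mem_pureL, mem_pureL, hm]
  have hv : ∀ v, v ∈ vars N ↔ v ∈ vars N' := fun v => by simp [vars, hm]
  have hvp : ∀ v, v ∈ vars (pureL N) ↔ v ∈ vars (pureL N') := fun v => by simp [vars, hp]
  constructor
  · exact fun ρ hρ => h.sim ρ ((IntOn.congr hv).2 hρ)
  · exact fun ρ hρ => h.dec_int ρ ((IntOn.congr hv).2 hρ)
  · exact fun ρ hρ => h.decP_int ρ ((IntOn.congr hvp).2 hρ)
  · rw [← hr]; exact h.redLen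
  · exact fun h0 x hx => h.pureLen h0 x ((hp x).2 hx)
  · rw [← hr]; exact fun h0 ρ hρ => h.slice h0 ρ ((IntOn.congr hvp).2 hρ)
  · intro h0 ρ' hρ'
    obtain ⟨ρ, h1, h2⟩ := h.cover h0 ρ' hρ'
    exact ⟨ρ, (Box.congr hp).1 h1, h2⟩
  · exact fun hs h0 ρ ρ' h1 => h.box hs h0 ρ ρ' ((Box.congr hp).2 h1)
  · exact fun hs h0 ρ₁ ρ₂ ρ' h1 h2 => h.inj hs h0 ρ₁ ρ₂ ρ' ((Box.congr hp).2 h1) ((Box.congr hp).2 h2)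

/-- Decoding clears the new loop variables to `errMem`, and this is the value that loop variables
have in `z.env`; hence a decoded environment looks as if the new loops had never existed. -/
theorem segG_intOn {A B C C' : List NumLoop} {P : Env → Prop} {H : Env → Var → ℤ}
    (hA : ∀ x ∈ A, x.1 ∉ vars C ∧ x.1 ∉ vars C') (hB : ∀ x ∈ B, x.1 ∉ vars C ∧ x.1 ∉ vars C')
    (hC' : ∀ v ∈ vars C', v.IsLoop) {ρ ρ' : Env} (h : IntOn z.env (vars (A ++ C' ++ B)) ρ)
    (hg : segG (vars C) (vars C') P H ρ = some ρ') : IntOn z.env (vars (A ++ C ++ B)) ρ' := by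
  obtain ⟨h1, h2⟩ := segG_int hg
  have h3 := segG_off hg
  have hAB : ∀ v, (v ∈ vars A ∨ v ∈ vars B) → v ∉ vars C ∧ v ∉ vars C' := by
    rintro v (hv | hv) <;> obtain ⟨x, hx, rfl⟩ := List.mem_map.1 hv
    · exact hA x hx
    · exact hB x hx
  refine ⟨fun v hv => ?_, fun v hv => ?_⟩
  · simp only [vars, List.map_append, List.mem_append, not_or] at hv
    by_cases hc : v ∈ vars C'
    · rw [h2 v hc hv.1.2, z.env_loop (hC' v hc)]
    · rw [h3 v hv.1.2 hc]
      refine h.1 v ?_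
      simp only [vars, List.map_append, List.mem_append, not_or]
      exact ⟨⟨hv.1.1, hc⟩, hv.2⟩
  · by_cases hc : v ∈ vars C
    · exact h1 v hc
    · have hab : v ∈ vars A ∨ v ∈ vars B := by
        simp only [vars, List.map_append, List.mem_append] at hv
        rcases hv with (hv | hv) | hv
        · exact .inl hv
        · exact (hc hv).elim
        · exact .inr hv
      rw [h3 v hc (hAB v hab).2]
      refine h.2 v ?_
      simp only [vars, List.map_append, List.mem_append]
      exact hab.elim (fun h => .inl (.inl h)) .inr

theorem segG_purePart {V V' : List Var} {P : Env → Prop} {H : Env → Var → ℤ}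
    (loc : ∀ ρ ρ', (∀ v ∈ V', ρ v = ρ' v) → (P ρ ↔ P ρ') ∧ H ρ = H ρ')
    (hV : ∀ v ∈ V, v.IsPure) (hV' : ∀ v ∈ V', v.IsPure) (ρ : Env) :
    segG V V' P H (purePart ρ) = (segG V V' P H ρ).map purePart := by
  obtain ⟨h1, h2⟩ := loc (purePart ρ) ρ fun w hw => purePart_of_isPure ρ (hV' w hw)
  simp only [segG, h1, h2]
  by_cases hP : P ρ
  · rw [if_pos (h1.2 hP), if_pos hP]
    simp only [Option.map_some, Option.some.injEq]
    funext w
    by_cases hw : w.IsRed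
    · have w1 : w ∉ V := fun h => (hV w h).not_isRed hw
      have w2 : w ∉ V' := fun h => (hV' w h).not_isRed hw
      simp [w1, w2, purePart_of_isRed _ hw]
    · simp [purePart_of_not_isRed _ hw]
  · rw [if_neg fun h => hP (h1.1 h), if_neg hP]
    rfl

theorem SimO.trans_sim {s s' core : Stmt Hole} {ρ : Env} {o : Option Env} {d : Env → Option Env}
    (h : SimO Γ z s ρ s' o) (h' : ∀ ρ' ∈ o, SimO Γ z s' ρ' core (d ρ')) :
    SimO Γ z s ρ core (o.bind d) := by
  cases o with
  | none => exact h
  | some ρ' =>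
    have h1 := h' ρ' rfl
    simp only [Option.bind_some]
    revert h1
    cases d ρ' with
    | none => exact fun h1 => (Sim.trans h h1).trans (Sim.nop _ _)
    | some ρ'' => exact fun h1 => Sim.trans h h1

theorem pureL_eq_self {C : List NumLoop} (h : ∀ x ∈ C, x.1.IsPure) : pureL C = C ∧ redL C = [] := by
  refine ⟨List.filter_eq_self.2 fun x hx => Var.pureB_iff.2 (h x hx), List.filter_eq_nil_iff.2 ?_⟩
  intro x hx
  simp [Var.pureB_iff.2 (h x hx)]

theorem redL_eq_self {C : List NumLoop} (h : ∀ x ∈ C, ¬ x.1.IsPure) : redL C = C ∧ pureL C = [] := by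
  have h' : ∀ x ∈ C, x.1.pureB = false := fun x hx => by simpa [← Var.pureB_iff] using h x hx
  refine ⟨List.filter_eq_self.2 fun x hx => by simp [h' x hx], List.filter_eq_nil_iff.2 ?_⟩
  intro x hx
  simp [h' x hx]

theorem mem_of_mem_pureL {N : List NumLoop} {x : NumLoop} (h : x ∈ pureL N) : x ∈ N :=
  (mem_pureL.1 h).1

theorem mem_of_mem_redL {N : List NumLoop} {x : NumLoop} (h : x ∈ redL N) : x ∈ N :=
  (mem_redL.1 h).1

/-- Decodings compose: first the segment, then the decoding at hand. If the segment is pure, the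
enumeration of a reduction slice is untouched and `Seg` is applied to the pure box, where covering
suffices. If it consists of reduction loops, the pure box is untouched, but the order of the
iterations within a slice matters, so that `q` is required in order to have exactness. -/
theorem Sem.segment {core tail tail' : Stmt Hole} {N₀ A B C C' : List NumLoop} {strict q : Prop}
    {dec decP : Env → Option Env} {P : Env → Prop} {H : Env → Var → ℤ}
    (h : Sem Γ z core N₀ (A ++ C ++ B) tail strict dec decP) (hseg : Seg C C' P H q)
    (hnd : (vars (A ++ C ++ B)).Nodup) (hnd' : (vars (A ++ C' ++ B)).Nodup)
    (hl : ∀ v ∈ vars (A ++ C' ++ B), v.IsLoop)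
    (hk : ((∀ x ∈ C, x.1.IsPure) ∧ ∀ x ∈ C', x.1.IsPure) ∨
      q ∧ (∀ x ∈ C, x.1.IsRed) ∧ ∀ x ∈ C', x.1.IsRed)
    (hsim : ∀ ρ, IntOn z.env (vars (A ++ C' ++ B)) ρ →
      SimO Γ z tail' ρ tail (segG (vars C) (vars C') P H ρ)) :
    ∃ dec' decP', Sem Γ z core N₀ (A ++ C' ++ B) tail' (strict ∧ q) dec' decP' := by
  set g := segG (vars C) (vars C') P H with hg
  have hA : ∀ x ∈ A, x.1 ∉ vars C ∧ x.1 ∉ vars C' := by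
    intro x hx
    have hx' : x.1 ∈ vars A := List.mem_map_of_mem hx
    simp only [vars, List.map_append, List.nodup_append, List.mem_append] at hnd hnd'
    exact ⟨fun hc => hnd.1.2.2 _ hx' _ hc rfl, fun hc => hnd'.1.2.2 _ hx' _ hc rfl⟩
  have hB : ∀ x ∈ B, x.1 ∉ vars C ∧ x.1 ∉ vars C' := by
    intro x hx
    have hx' : x.1 ∈ vars B := List.mem_map_of_mem hx
    simp only [vars, List.map_append, List.nodup_append, List.mem_append] at hnd hnd'
    exact ⟨fun hc => hnd.2.2 _ (.inr hc) _ hx' rfl, fun hc => hnd'.2.2 _ (.inr hc) _ hx' rfl⟩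
  have hC' : ∀ v ∈ vars C', v.IsLoop := fun v hv => hl v (by
    simp only [vars, List.map_append, List.mem_append]; exact .inl (.inr hv))
  have hpA : ∀ x ∈ pureL A, x.1 ∉ vars C ∧ x.1 ∉ vars C' := fun x hx => hA x (mem_of_mem_pureL hx)
  have hpB : ∀ x ∈ pureL B, x.1 ∉ vars C ∧ x.1 ∉ vars C' := fun x hx => hB x (mem_of_mem_pureL hx)
  have hrA : ∀ x ∈ redL A, x.1 ∉ vars C ∧ x.1 ∉ vars C' := fun x hx => hA x (mem_of_mem_redL hx)
  have hrB : ∀ x ∈ redL B, x.1 ∉ vars C ∧ x.1 ∉ vars C' := fun x hx => hB x (mem_of_mem_redL hx)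
  have hsim' : ∀ ρ, IntOn z.env (vars (A ++ C' ++ B)) ρ →
      SimO Γ z tail' ρ core ((g ρ).bind dec) := fun ρ hρ =>
    (hsim ρ hρ).trans_sim fun ρ' hρ' => h.sim ρ' (segG_intOn hA hB hC' hρ hρ')
  rcases hk with ⟨k1, k2⟩ | ⟨hq, k1, k2⟩
  · have v1 : ∀ v ∈ vars C, v.IsPure := fun v hv => by
      obtain ⟨x, hx, rfl⟩ := List.mem_map.1 hv; exact k1 x hx
    have v2 : ∀ v ∈ vars C', v.IsPure := fun v hv => by
      obtain ⟨x, hx, rfl⟩ := List.mem_map.1 hv; exact k2 x hx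
    have eP : pureL (A ++ C ++ B) = pureL A ++ C ++ pureL B := by
      rw [pureL_append, pureL_append, (pureL_eq_self k1).1]
    have eP' : pureL (A ++ C' ++ B) = pureL A ++ C' ++ pureL B := by
      rw [pureL_append, pureL_append, (pureL_eq_self k2).1]
    have eR : redL (A ++ C' ++ B) = redL (A ++ C ++ B) := by
      simp only [redL_append, (pureL_eq_self k1).2, (pureL_eq_self k2).2]
    -- The clauses of `Seg` need nonnegative lengths of the replaced loops. These are inherited from
    -- the lowered loops through `pureLen`.
    have hCpos : Nonneg (pureL N₀) → ∀ x ∈ C, 0 ≤ x.2.2 := fun h0 x hx =>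
      h.pureLen h0 x (by rw [eP]; simp [hx])
    have ndP := pureL_nodup hnd
    have ndP' := pureL_nodup hnd'
    have henv : ∀ v ∈ vars C', z.env v = .errMem := fun v hv => z.env_loop (hC' v hv)
    refine ⟨fun ρ => (g ρ).bind dec, fun ρ => (g ρ).bind decP, hsim', ?_, ?_, ?_, ?_, ?_, ?_, ?_, ?_⟩
    · intro ρ hρ ρ' hρ'
      obtain ⟨ρ₁, h1, h2⟩ := Option.bind_eq_some_iff.1 hρ'
      obtain ⟨h3, h4⟩ := h.dec_int ρ₁ (segG_intOn hA hB hC' hρ h1) ρ' h2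
      refine ⟨h3, ?_⟩
      rw [hg, segG_purePart hseg.loc v1 v2, ← hg, h1]
      exact h4
    · intro ρ hρ ρ' hρ'
      obtain ⟨ρ₁, h1, h2⟩ := Option.bind_eq_some_iff.1 hρ'
      rw [eP'] at hρ
      exact h.decP_int ρ₁ (by rw [eP]; exact segG_intOn hpA hpB hC' hρ h1) ρ' h2
    · rw [eR]; exact h.redLen
    · intro h0 x hx
      rw [eP'] at hx
      simp only [List.mem_append] at hx
      rcases hx with (hx | hx) | hx
      · exact h.pureLen h0 x (by rw [eP]; simp [hx])
      · exact hseg.len (hCpos h0) x hx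
      · exact h.pureLen h0 x (by rw [eP]; simp [hx])
    · intro h0 ρ hρ
      rw [eP'] at hρ
      rw [eR, ← List.filterMap_filterMap, hg, filterMap_enum_segG hseg.loc (B := redL (A ++ C ++ B)), ← hg]
      · cases h1 : g ρ with
        | none => simp
        | some ρ₁ =>
          exact h.slice h0 ρ₁ (by rw [eP]; exact segG_intOn hpA hpB hC' hρ h1)
      · intro x hx
        obtain ⟨h1, h2⟩ := mem_redL.1 hx
        exact ⟨fun h => h2 (v1 _ h), fun h => h2 (v2 _ h)⟩
    · intro h0 ρ' hρ'
      obtain ⟨ρ₁, h1, h2⟩ := h.cover h0 ρ' hρ'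
      rw [← mem_enum ndP, eP] at h1
      obtain ⟨ρ, h3, h4⟩ := hseg.enum_cover (hCpos h0) (fun x hx => (hpA x hx).2) hpB henv ρ₁ h1
      refine ⟨ρ, ?_, by rw [hg, h4]; exact h2⟩
      rw [← eP', mem_enum ndP'] at h3
      exact h3
    · rintro ⟨hs, hq⟩ h0 ρ ρ' h1 h2
      obtain ⟨ρ₁, h3, h4⟩ := Option.bind_eq_some_iff.1 h2
      refine h.box hs h0 ρ₁ ρ' ?_ h4
      rw [← mem_enum ndP, eP,
        ← hseg.enum_filterMap hq (hCpos h0) (fun x hx => (hpA x hx).2) hpB henv, List.mem_filterMap]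
      refine ⟨ρ, ?_, h3⟩
      rw [← eP', mem_enum ndP']
      exact h1
    · rintro ⟨hs, hq⟩ h0 ρ₁ ρ₂ ρ' h1 h2 h3 h4
      obtain ⟨σ₁, h5, h6⟩ := Option.bind_eq_some_iff.1 h3
      obtain ⟨σ₂, h7, h8⟩ := Option.bind_eq_some_iff.1 h4
      have efm := hseg.enum_filterMap hq (hCpos h0) (fun x hx => (hpA x hx).2) hpB henv
      have m1 : ρ₁ ∈ enum (pureL A ++ C' ++ pureL B) z.env := by
        rw [← eP', mem_enum ndP']; exact h1
      have m2 : ρ₂ ∈ enum (pureL A ++ C' ++ pureL B) z.env := by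
        rw [← eP', mem_enum ndP']; exact h2
      have b1 : Box z.env (pureL (A ++ C ++ B)) σ₁ := by
        rw [← mem_enum ndP, eP, ← efm, List.mem_filterMap]; exact ⟨ρ₁, m1, h5⟩
      have b2 : Box z.env (pureL (A ++ C ++ B)) σ₂ := by
        rw [← mem_enum ndP, eP, ← efm, List.mem_filterMap]; exact ⟨ρ₂, m2, h7⟩
      obtain rfl := h.inj hs h0 σ₁ σ₂ ρ' b1 b2 h6 h8
      -- Decoding the new pure box enumerates the old one, which has no repetitions.
      refine filterMap_inj (g := g) ?_ m1 m2 h5 h7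
      rw [efm, ← eP]
      exact enum_nodup ndP _
  · have k1' : ∀ x ∈ C, ¬ x.1.IsPure := fun x hx h => h.not_isRed (k1 x hx)
    have k2' : ∀ x ∈ C', ¬ x.1.IsPure := fun x hx h => h.not_isRed (k2 x hx)
    have v1 : ∀ v ∈ vars C, v.IsRed := fun v hv => by
      obtain ⟨x, hx, rfl⟩ := List.mem_map.1 hv; exact k1 x hx
    have v2 : ∀ v ∈ vars C', v.IsRed := fun v hv => by
      obtain ⟨x, hx, rfl⟩ := List.mem_map.1 hv; exact k2 x hx
    have eR : redL (A ++ C ++ B) = redL A ++ C ++ redL B := by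
      rw [redL_append, redL_append, (redL_eq_self k1').1]
    have eR' : redL (A ++ C' ++ B) = redL A ++ C' ++ redL B := by
      rw [redL_append, redL_append, (redL_eq_self k2').1]
    have eP : pureL (A ++ C' ++ B) = pureL (A ++ C ++ B) := by
      simp only [pureL_append, (redL_eq_self k1').2, (redL_eq_self k2').2]
    have hCpos : Nonneg (redL N₀) → ∀ x ∈ C, 0 ≤ x.2.2 := fun h0 x hx =>
      h.redLen h0 x (by rw [eR]; simp [hx])
    -- Decoding a reduction segment is invisible to the pure variables, so `decP` stays the same.
    have hpg : ∀ ρ ρ', g ρ = some ρ' → purePart ρ = purePart ρ' := by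
      intro ρ ρ' hρ
      funext v
      by_cases hr : v.IsRed
      · rw [purePart_of_isRed _ hr, purePart_of_isRed _ hr]
      · rw [purePart_of_not_isRed _ hr, purePart_of_not_isRed _ hr]
        exact (segG_off hρ v (fun h => hr (v1 v h)) (fun h => hr (v2 v h))).symm
    refine ⟨fun ρ => (g ρ).bind dec, decP, hsim', ?_, ?_, ?_, ?_, ?_, ?_, ?_, ?_⟩
    · intro ρ hρ ρ' hρ'
      obtain ⟨ρ₁, h1, h2⟩ := Option.bind_eq_some_iff.1 hρ'
      obtain ⟨h3, h4⟩ := h.dec_int ρ₁ (segG_intOn hA hB hC' hρ h1) ρ' h2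
      exact ⟨h3, by rw [hpg _ _ h1]; exact h4⟩
    · rw [eP]; exact h.decP_int
    · intro h0 x hx
      rw [eR'] at hx
      simp only [List.mem_append] at hx
      rcases hx with (hx | hx) | hx
      · exact h.redLen h0 x (by rw [eR]; simp [hx])
      · exact hseg.len (hCpos h0) x hx
      · exact h.redLen h0 x (by rw [eR]; simp [hx])
    · rw [eP]; exact h.pureLen
    · intro h0 ρ hρ
      rw [eP] at hρ
      rw [eR', ← List.filterMap_filterMap, hg,
        hseg.enum_filterMap hq (hCpos h0) (fun x hx => (hrA x hx).2) hrB, ← eR]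
      · exact h.slice h0 ρ hρ
      · intro v hv
        rw [hρ.1 v, z.env_loop (hC' v hv)]
        intro hv'
        exact (mem_vars_pureL.1 hv').2.not_isRed (v2 v hv)
    · rw [eP]; exact h.cover
    · rw [eP]; exact fun hs => h.box hs.1
    · rw [eP]; exact fun hs => h.inj hs.1

end Halide

namespace Halide

variable {m n : ℕ} {Γ : Hole → Expr Ver Empty} {z : Input m n}

/-! ## Index arithmetic of split and fused loops -/

/-- Division with remainder: `u = i + k * o` runs through the range in the lexicographic order of
`(o, i)`. Guarded splits read this from right to left, fuses from left to right. -/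
theorem range_mul_flatMap {β : Type} (c k : ℕ) (G : ℕ → List β) :
    (List.range (c * k)).flatMap G =
      (List.range c).flatMap fun o => (List.range k).flatMap fun i => G (i + k * o) := by
  induction c with
  | zero => simp
  | succ c ih =>
    rw [Nat.succ_mul, List.range_add, List.flatMap_append, ih, List.range_succ, List.flatMap_append]
    congr 1
    simp only [List.flatMap_map, List.flatMap_singleton]
    congr 1
    funext i
    rw [Nat.add_comm, Nat.mul_comm]

/-- This is the effect of the guard: the excess of the last tile is cut off. -/
theorem range_flatMap_ite {β : Type} {k N : ℕ} (h : k ≤ N) (G : ℕ → List β) :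
    ((List.range N).flatMap fun u => if u < k then G u else []) = (List.range k).flatMap G := by
  obtain ⟨d, rfl⟩ := Nat.exists_eq_add_of_le h
  rw [List.range_add, List.flatMap_append, List.flatMap_map]
  have h1 : ((List.range d).flatMap fun i => if k + i < k then G (k + i) else []) = [] := by
    simp
  have h2 : ((List.range k).flatMap fun u => if u < k then G u else []) = (List.range k).flatMap G :=
    List.flatMap_congr fun u hu => by simp [List.mem_range.1 hu]
  rw [h1, h2, List.append_nil]

/-- Floor division with `a / 0 = 0`. -/
def fdiv0 (a b : ℤ) : ℤ := if b = 0 then 0 else a.fdiv b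

def fmod0 (a b : ℤ) : ℤ := if b = 0 then 0 else a.fmod b

def ceilDivInt (a k : ℤ) : ℤ := fdiv0 (a + (k - 1)) k

theorem ceilDivInt_spec {a k : ℤ} (hk : 0 < k) :
    a ≤ k * ceilDivInt a k ∧ k * ceilDivInt a k < a + k := by
  have h0 : k ≠ 0 := hk.ne'
  rw [ceilDivInt, fdiv0, if_neg h0, Int.fdiv_eq_ediv_of_nonneg _ hk.le]
  have h1 := Int.mul_ediv_add_emod (a + (k - 1)) k
  have h2 := Int.emod_nonneg (a + (k - 1)) h0
  have h3 := Int.emod_lt_of_pos (a + (k - 1)) hk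
  constructor <;> linarith

theorem ceilDivInt_nonneg {a k : ℤ} (hk : 0 < k) (ha : 0 ≤ a) : 0 ≤ ceilDivInt a k := by
  by_contra h
  have := (ceilDivInt_spec (a := a) hk).1
  nlinarith

/-- For `ReachOK`: the code inside a split loop is reached exactly when it was reached before. -/
theorem ceilDivInt_pos_iff {a k : ℤ} (hk : 0 < k) : 0 < ceilDivInt a k ↔ 0 < a := by
  obtain ⟨h1, h2⟩ := ceilDivInt_spec (a := a) hk
  constructor
  · intro h
    nlinarith
  · intro h
    by_contra h'
    nlinarith

/-! ## The segments of split and fuse -/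

section Split

variable {x xo xi : Var} {lo a k : ℤ}

theorem enum_split (ρ : Env) :
    enum [(xo, 0, ceilDivInt a k), (xi, 0, k)] ρ = (List.range (ceilDivInt a k).toNat).flatMap fun o : ℕ =>
      (List.range k.toNat).flatMap fun i : ℕ =>
        [Function.update (Function.update ρ xo (.int (o : ℤ))) xi (.int (i : ℤ))] := by
  simp [enum]

theorem segG_split_env {P : Env → Prop} {H : Env → Var → ℤ} (hoi : xo ≠ xi) (hxo : x ≠ xo)
    (hxi : x ≠ xi) {ρ : Env} (ho : ρ xo = .errMem) (hi : ρ xi = .errMem) (o i : ℕ) {v : ℤ}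
    (hP : P (Function.update (Function.update ρ xo (.int o)) xi (.int i)))
    (hv : H (Function.update (Function.update ρ xo (.int o)) xi (.int i)) x = v) :
    segG [x] [xo, xi] P H (Function.update (Function.update ρ xo (.int o)) xi (.int i)) =
      some (Function.update ρ x (.int v)) := by
  rw [segG, if_pos hP, Option.some.injEq]
  funext w
  by_cases h1 : w = x
  · subst h1; simp [hv]
  · by_cases h2 : w = xi
    · subst h2; simp [h1, hi]
    · by_cases h3 : w = xo
      · subst h3; simp [h1, ho]
      · simp [h1, h2, h3]

/-- The iterations of a split loop that the guard admits. -/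
def splitP (xo xi : Var) (a k : ℤ) (ρ : Env) : Prop := (ρ xi).toInt + k * (ρ xo).toInt < a

def splitH (xo xi : Var) (lo k : ℤ) (ρ : Env) (_ : Var) : ℤ := lo + ((ρ xi).toInt + k * (ρ xo).toInt)

def shiftH (xo xi : Var) (lo a k : ℤ) (ρ : Env) (_ : Var) : ℤ :=
  lo + ((ρ xi).toInt + min (k * (ρ xo).toInt) (max 0 (a - k)))

theorem enum_split_guard (hk : 0 < k) (hoi : xo ≠ xi) (hxo : x ≠ xo) (hxi : x ≠ xi) (ha : 0 ≤ a)
    {ρ : Env} (ho : ρ xo = .errMem) (hi : ρ xi = .errMem) :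
    (enum [(xo, 0, ceilDivInt a k), (xi, 0, k)] ρ).filterMap
      (segG [x] [xo, xi] (splitP xo xi a k) (splitH xo xi lo k)) = enum [(x, lo, a)] ρ := by
  obtain ⟨c1, c2⟩ := ceilDivInt_spec (a := a) hk
  have c0 := ceilDivInt_nonneg hk ha
  obtain ⟨c, hc⟩ := Int.eq_ofNat_of_zero_le c0
  obtain ⟨k', rfl⟩ := Int.eq_ofNat_of_zero_le hk.le
  obtain ⟨a', rfl⟩ := Int.eq_ofNat_of_zero_le ha
  -- Together the `c` tiles have room for all iterations.
  have hle : a' ≤ c * k' := by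
    rw [hc] at c1
    rw [Nat.mul_comm]
    exact_mod_cast c1
  have key : ∀ o i : ℕ, [Function.update (Function.update ρ xo (.int (o : ℤ))) xi (.int (i : ℤ))].filterMap
      (segG [x] [xo, xi] (splitP xo xi a' k') (splitH xo xi lo k')) =
      if i + k' * o < a' then [Function.update ρ x (.int (lo + ((i + k' * o : ℕ) : ℤ)))] else [] := by
    intro o i
    have e1 : splitP xo xi a' k' (Function.update (Function.update ρ xo (.int o)) xi (.int i)) ↔
        i + k' * o < a' := by
      simp only [splitP, Function.update_self, Val.toInt, Function.update_of_ne hoi]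
      exact_mod_cast Iff.rfl
    split_ifs with h
    · rw [List.filterMap_cons_some (segG_split_env hoi hxo hxi ho hi o i (e1.2 h)
        (v := lo + ((i + k' * o : ℕ) : ℤ)) ?_), List.filterMap_nil]
      simp [splitH, Val.toInt, Function.update_of_ne hoi]
    · rw [List.filterMap_cons_none, List.filterMap_nil]
      rw [segG, if_neg fun h' => h (e1.1 h')]
  have e2 : enum [(x, lo, (a' : ℤ))] ρ =
      (List.range a').flatMap fun u : ℕ => [Function.update ρ x (.int (lo + (u : ℤ)))] := by
    simp [enum]
  rw [enum_split, hc, e2]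
  simp only [List.filterMap_flatMap, Int.toNat_natCast, key]
  rw [← range_mul_flatMap c k' fun u =>
    if u < a' then [Function.update ρ x (.int (lo + (u : ℤ)))] else []]
  exact range_flatMap_ite hle _

theorem seg_split_guard (hk : 0 < k) (hoi : xo ≠ xi) (hxo : x ≠ xo) (hxi : x ≠ xi) :
    Seg [(x, lo, a)] [(xo, 0, ceilDivInt a k), (xi, 0, k)] (splitP xo xi a k) (splitH xo xi lo k)
      True := by
  have hex : ∀ ρ : Env, 0 ≤ a → (∀ v ∈ vars [(xo, 0, ceilDivInt a k), (xi, (0 : ℤ), k)], ρ v = .errMem) →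
      (enum [(xo, 0, ceilDivInt a k), (xi, 0, k)] ρ).filterMap
      (segG [x] [xo, xi] (splitP xo xi a k) (splitH xo xi lo k)) = enum [(x, lo, a)] ρ :=
    fun ρ ha hρ => enum_split_guard hk hoi hxo hxi ha (hρ xo (by simp)) (hρ xi (by simp))
  constructor
  · intro ρ ρ' h
    have h1 := h xo (by simp)
    have h2 := h xi (by simp)
    constructor
    · simp [splitP, h1, h2]
    · funext v; simp [splitH, h1, h2]
  · intro hC ρ hρ e he
    rw [← hex ρ (hC (x, lo, a) (by simp)) hρ, List.mem_filterMap] at he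
    exact he
  · exact fun _ hC ρ hρ => hex ρ (hC (x, lo, a) (by simp)) hρ
  · intro hC y hy
    simp only [List.mem_cons, List.not_mem_nil, or_false] at hy
    rcases hy with rfl | rfl
    · exact ceilDivInt_nonneg hk (hC (x, lo, a) (by simp))
    · exact hk.le
  · rintro - B ⟨h1, h2⟩
    exact ⟨ceilDivInt_nonneg hk h1, fun h => ⟨hk.le, fun _ => h2 ((ceilDivInt_pos_iff hk).1 h)⟩⟩
  · rintro hC B ⟨h1, h2⟩
    exact ⟨hC (x, lo, a) (by simp), fun h => (h2 ((ceilDivInt_pos_iff hk).2 h)).2 hk⟩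
  · rintro - B ⟨h1, h2⟩ - y hy
    simp only [List.mem_cons, List.not_mem_nil, or_false] at hy
    subst hy
    exact h1

/-- The guarded iterations are among the unguarded ones and decode in the same way, so covering is
inherited. Iterations past the end of the loop have no original, so `strict` is `False` and the
clauses that depend on it are vacuous. -/
theorem seg_split_round (hk : 0 < k) (hoi : xo ≠ xi) (hxo : x ≠ xo) (hxi : x ≠ xi) :
    Seg [(x, lo, a)] [(xo, 0, ceilDivInt a k), (xi, 0, k)] (fun _ => True) (splitH xo xi lo k)
      False := by
  have h := seg_split_guard (lo := lo) (a := a) hk hoi hxo hxi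
  constructor
  · exact fun ρ ρ' h' => ⟨Iff.rfl, (h.loc ρ ρ' h').2⟩
  · intro hC ρ hρ e he
    obtain ⟨e', h1, h2⟩ := h.cover hC ρ hρ e he
    refine ⟨e', h1, ?_⟩
    simp only [segG] at h2 ⊢
    split_ifs at h2
    rw [if_pos trivial]
    exact h2
  · exact fun h => h.elim
  · exact h.len
  · exact fun h => h.elim
  · exact h.reach'
  · exact fun h => h.elim

/-- The iteration `u` lies in the tile `u / k`. If this tile is not moved, the offset is `u % k`.
Otherwise the tile starts at `max 0 (a - k)`, and `u - max 0 (a - k)` is an offset below `k` because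
`u < a`. -/
theorem shift_cover {u : ℤ} (hk : 0 < k) (hu : 0 ≤ u) (hua : u < a) :
    ∃ o i : ℕ, o < (ceilDivInt a k).toNat ∧ i < k.toNat ∧
      (i : ℤ) + min (k * o) (max 0 (a - k)) = u := by
  obtain ⟨c1, c2⟩ := ceilDivInt_spec (a := a) hk
  have h1 := Int.mul_ediv_add_emod u k
  have h2 := Int.emod_nonneg u hk.ne'
  have h3 := Int.emod_lt_of_pos u hk
  have h4 : 0 ≤ u / k := Int.ediv_nonneg hu hk.le
  have h5 : u / k < ceilDivInt a k := by
    by_contra h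
    have : k * ceilDivInt a k ≤ k * (u / k) := by
      apply mul_le_mul_of_nonneg_left (not_lt.1 h) hk.le
    linarith
  have e1 : ((u / k).toNat : ℤ) = u / k := Int.toNat_of_nonneg h4
  have p0 : 0 ≤ k * (u / k) := mul_nonneg hk.le h4
  rcases le_total (k * (u / k)) (max 0 (a - k)) with hm | hm
  · refine ⟨(u / k).toNat, (u % k).toNat, by omega, by omega, ?_⟩
    rw [e1, min_eq_left hm, Int.toNat_of_nonneg h2]
    linarith
  · refine ⟨(u / k).toNat, (u - max 0 (a - k)).toNat, by omega, ?_, ?_⟩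
    · omega
    · rw [e1, min_eq_right hm, Int.toNat_of_nonneg (by linarith)]
      ring

/-- Moving back the last tile repeats iterations, and a loop shorter than a tile is overrun, so that
the enumeration is covered but not preserved. -/
theorem seg_split_shift (hk : 0 < k) (hoi : xo ≠ xi) (hxo : x ≠ xo) (hxi : x ≠ xi) :
    Seg [(x, lo, a)] [(xo, 0, ceilDivInt a k), (xi, 0, k)] (fun _ => True) (shiftH xo xi lo a k)
      False := by
  have h := seg_split_guard (lo := lo) (a := a) hk hoi hxo hxi
  constructor
  · intro ρ ρ' h
    have h1 := h xo (by simp)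
    have h2 := h xi (by simp)
    refine ⟨Iff.rfl, ?_⟩
    funext v; simp [shiftH, h1, h2]
  · intro hC ρ hρ e he
    simp only [enum, List.mem_flatMap, List.mem_range, List.mem_singleton] at he
    obtain ⟨u, hu, rfl⟩ := he
    obtain ⟨o, i, ho, hi, hoiu⟩ := shift_cover (a := a) (u := (u : ℤ)) hk (by omega) (by omega)
    refine ⟨Function.update (Function.update ρ xo (.int o)) xi (.int i), ?_, ?_⟩
    · rw [enum_split]
      simp only [List.mem_flatMap, List.mem_range, List.mem_singleton]
      exact ⟨o, ho, i, hi, rfl⟩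
    · refine segG_split_env hoi hxo hxi (hρ xo (by simp)) (hρ xi (by simp)) o i trivial ?_
      simp only [shiftH, Function.update_self, Val.toInt, Function.update_of_ne hoi, hoiu]
  · exact fun h => h.elim
  · exact h.len
  · exact fun h => h.elim
  · exact h.reach'
  · exact fun h => h.elim

end Split

/-! ### The iterations of fused loops -/

section Fuse

variable {x₁ x₂ y : Var} {m₁ n₁ m₂ n₂ : ℤ}

def fuseH (x₁ y : Var) (m₁ m₂ n₂ : ℤ) (ρ : Env) (v : Var) : ℤ :=
  if v = x₁ then m₁ + fdiv0 (ρ y).toInt n₂ else m₂ + fmod0 (ρ y).toInt n₂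

theorem enum_fuse (h12 : x₁ ≠ x₂) (h1y : x₁ ≠ y) (h2y : x₂ ≠ y) (hn₁ : 0 ≤ n₁) (hn₂ : 0 ≤ n₂)
    {ρ : Env} (hy : ρ y = .errMem) :
    (enum [(y, 0, n₁ * n₂)] ρ).filterMap (segG [x₁, x₂] [y] (fun _ => True) (fuseH x₁ y m₁ m₂ n₂)) =
      enum [(x₁, m₁, n₁), (x₂, m₂, n₂)] ρ := by
  obtain ⟨a, rfl⟩ := Int.eq_ofNat_of_zero_le hn₁
  obtain ⟨b, rfl⟩ := Int.eq_ofNat_of_zero_le hn₂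
  have e1 : ((a : ℤ) * b).toNat = a * b := by exact_mod_cast Int.toNat_natCast (a * b)
  simp only [enum, e1, Int.toNat_natCast, List.filterMap_flatMap, List.filterMap_cons,
    List.filterMap_nil, range_mul_flatMap a b]
  refine List.flatMap_congr fun o _ => List.flatMap_congr fun i hi => ?_
  have hb : i < b := List.mem_range.1 hi
  -- An inner iteration exists, so the fused index is never divided by zero.
  have hb0 : (b : ℤ) ≠ 0 := by omega
  have hd : Int.fdiv ((i + b * o : ℕ) : ℤ) b = o := by
    rw [Int.fdiv_eq_ediv_of_nonneg _ (by omega)]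
    have : (i + b * o) / b = o := by
      rw [Nat.add_mul_div_left _ _ (by omega), Nat.div_eq_of_lt hb, Nat.zero_add]
    exact_mod_cast this
  have hmod : Int.fmod ((i + b * o : ℕ) : ℤ) b = i := by
    rw [Int.fmod_eq_emod_of_nonneg _ (by omega)]
    have : (i + b * o) % b = i := by
      rw [Nat.add_mul_mod_self_left, Nat.mod_eq_of_lt hb]
    exact_mod_cast this
  have : segG [x₁, x₂] [y] (fun _ => True) (fuseH x₁ y m₁ m₂ b)
      (Function.update ρ y (.int (0 + ((i + b * o : ℕ) : ℤ)))) =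
      some (Function.update (Function.update ρ x₁ (.int (m₁ + o))) x₂ (.int (m₂ + i))) := by
    rw [segG, if_pos trivial, Option.some.injEq]
    funext w
    by_cases hw2 : w = x₂
    · subst hw2
      simp only [zero_add, List.mem_cons, true_or, or_true, if_true, fuseH, Ne.symm h12, if_false,
        Function.update_self, Val.toInt, fmod0, hb0, hmod]
    · by_cases hw1 : w = x₁
      · subst hw1
        simp only [zero_add, List.mem_cons, true_or, if_true, fuseH,
          Function.update_self, Val.toInt, fdiv0, hb0, if_false, hd, Function.update_of_ne hw2]
      · by_cases hwy : w = y
        · subst hwy; simp [hw1, hw2, hy]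
        · simp [hw1, hw2, hwy]
  simp only [this]

/-- The enumerations agree for nonnegative lengths. From a query of the old nest, `n₁` is
nonnegative, while `n₂` is known to be so only if `n₁` is positive, and this is enough for a
nonnegative product. There is no way back without hypotheses on both lengths: the product of two
negative lengths is positive. -/
theorem seg_fuse (h12 : x₁ ≠ x₂) (h1y : x₁ ≠ y) (h2y : x₂ ≠ y) :
    Seg [(x₁, m₁, n₁), (x₂, m₂, n₂)] [(y, 0, n₁ * n₂)] (fun _ => True) (fuseH x₁ y m₁ m₂ n₂)
      True := by
  have hex : ∀ ρ : Env, (∀ x ∈ [(x₁, m₁, n₁), (x₂, m₂, n₂)], 0 ≤ x.2.2) →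
      (∀ v ∈ vars [(y, (0 : ℤ), n₁ * n₂)], ρ v = .errMem) →
      (enum [(y, 0, n₁ * n₂)] ρ).filterMap (segG [x₁, x₂] [y] (fun _ => True) (fuseH x₁ y m₁ m₂ n₂)) =
      enum [(x₁, m₁, n₁), (x₂, m₂, n₂)] ρ := fun ρ hC hρ =>
    enum_fuse h12 h1y h2y (hC (x₁, m₁, n₁) (by simp)) (hC (x₂, m₂, n₂) (by simp)) (hρ y (by simp))
  constructor
  · intro ρ ρ' h
    refine ⟨Iff.rfl, ?_⟩
    funext v; simp [fuseH, h y (by simp)]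
  · intro hC ρ hρ e he
    rw [← hex ρ hC hρ, List.mem_filterMap] at he
    exact he
  · exact fun _ hC ρ hρ => hex ρ hC hρ
  · intro hC y hy
    simp only [List.mem_cons, List.not_mem_nil, or_false] at hy
    subst hy
    exact mul_nonneg (hC (x₁, m₁, n₁) (by simp)) (hC (x₂, m₂, n₂) (by simp))
  · rintro - B ⟨h1, h2⟩
    simp only at h1 h2
    rcases h1.eq_or_lt with h0 | h0
    -- An empty outer loop hides an inner length of either sign, and the fused loop is empty too.
    · subst h0
      exact ⟨by simp, by simp⟩
    · obtain ⟨h3, h4⟩ := h2 h0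
      simp only at h3 h4
      exact ⟨mul_nonneg h1 h3, fun h => h4 (pos_of_mul_pos_right h h1)⟩
  · rintro hC B ⟨h1, h2⟩
    have c1 : 0 ≤ n₁ := hC (x₁, m₁, n₁) (by simp)
    have c2 : 0 ≤ n₂ := hC (x₂, m₂, n₂) (by simp)
    exact ⟨c1, fun h => ⟨c2, fun h' => h2 (mul_pos h h')⟩⟩
  · rintro - B ⟨h1, h2⟩ hpos
    simp only at h1 h2
    have h3 : 0 < n₁ * n₂ := hpos (y, 0, n₁ * n₂) (by simp)
    have h4 : 0 < n₁ := by
      rcases h1.eq_or_lt with h0 | h0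
      · subst h0; simp at h3
      · exact h0
    obtain ⟨h5, -⟩ := h2 h4
    intro x hx
    simp only [List.mem_cons, List.not_mem_nil, or_false] at hx
    rcases hx with rfl | rfl
    · exact h1
    · exact h5

end Fuse

/-! ## The bindings that split and fuse insert -/

theorem Expr.accFree_bin {o : Op} {h : o.arity = 2} {a b : TExpr} (ha : a.AccFree) (hb : b.AccFree) :
    (bin o h a b).AccFree := by
  intro i
  change (![a, b] (i.cast h)).AccFree
  rcases h' : i.cast h with ⟨_ | _ | j, hj⟩
  · exact ha
  · exact hb
  · omega

theorem Expr.mem_vars_bin {o : Op} {h : o.arity = 2} {a b : TExpr} {v : Var}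
    (hv : v ∈ (bin o h a b).vars) : v ∈ a.vars ∨ v ∈ b.vars := by
  obtain ⟨i, hi⟩ := Expr.mem_vars_op.1 hv
  rcases h' : i.cast h with ⟨_ | _ | j, hj⟩
  · rw [h'] at hi; exact .inl hi
  · rw [h'] at hi; exact .inr hi
  · omega

theorem Expr.Closed.bin {o : Op} {h : o.arity = 2} {a b : TExpr} (ha : a.Closed m n)
    (hb : b.Closed m n) : (bin o h a b).Closed m n :=
  ⟨Expr.accFree_bin ha.1 hb.1, fun v hv => (Expr.mem_vars_bin hv).elim (ha.2 v) (hb.2 v)⟩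

theorem Expr.closed_const {c : ℤ} : (Expr.const c : TExpr).Closed m n :=
  ⟨trivial, fun v hv => by simp [Expr.vars] at hv⟩

theorem Expr.tval_bin {η : Hole → ℤ} {ρ : Env} {o : Op} {h : o.arity = 2} {a b : TExpr} {p q : ℤ}
    (ha : a.tval η ρ = .int p) (hb : b.tval η ρ = .int q) :
    (bin o h a b).tval η ρ = .int (o.apply fun i => ![p, q] (i.cast h)) := by
  refine Op.eval_int fun i => ?_
  change (![a, b] (i.cast h)).tval η ρ = .int (![p, q] (i.cast h))
  rcases h' : i.cast h with ⟨_ | _ | j, hj⟩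
  · exact ha
  · exact hb
  · omega

/-! ### Values of arithmetic on access-free expressions -/

section Values

variable {η : Hole → ℤ} {ρ : Env} {a b : TExpr} {p q : ℤ}

theorem Expr.tval_plus (ha : a.tval η ρ = .int p) (hb : b.tval η ρ = .int q) :
    (a.plus b).tval η ρ = .int (p + q) := Expr.tval_bin ha hb

theorem Expr.tval_minus (ha : a.tval η ρ = .int p) (hb : b.tval η ρ = .int q) :
    (a.minus b).tval η ρ = .int (p - q) := Expr.tval_bin ha hb

theorem Expr.tval_times (ha : a.tval η ρ = .int p) (hb : b.tval η ρ = .int q) :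
    (a.times b).tval η ρ = .int (p * q) := Expr.tval_bin ha hb

theorem Expr.tval_div (ha : a.tval η ρ = .int p) (hb : b.tval η ρ = .int q) :
    (bin .div rfl a b).tval η ρ = .int (fdiv0 p q) := Expr.tval_bin ha hb

theorem Expr.tval_mod (ha : a.tval η ρ = .int p) (hb : b.tval η ρ = .int q) :
    (bin .mod rfl a b).tval η ρ = .int (fmod0 p q) := Expr.tval_bin ha hb

theorem Expr.tval_min (ha : a.tval η ρ = .int p) (hb : b.tval η ρ = .int q) :
    (bin .min rfl a b).tval η ρ = .int (min p q) := Expr.tval_bin ha hb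

theorem Expr.tval_max (ha : a.tval η ρ = .int p) (hb : b.tval η ρ = .int q) :
    (bin .max rfl a b).tval η ρ = .int (max p q) := Expr.tval_bin ha hb

theorem Expr.tval_lt (ha : a.tval η ρ = .int p) (hb : b.tval η ρ = .int q) :
    (bin .lt rfl a b).tval η ρ = .int (if p < q then 1 else 0) := Expr.tval_bin ha hb

theorem Expr.tval_const {c : ℤ} : (Expr.const c : TExpr).tval η ρ = .int c := rfl

theorem Expr.tval_var {v : Var} : (Expr.var v : TExpr).tval η ρ = ρ v := rfl

end Values

theorem Expr.num_eq_of_tval {η : Hole → ℤ} {e : TExpr} {p : ℤ} (h : e.tval η z.env = .int p) :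
    e.num η z = p := by rw [Expr.num, h, Val.toInt]

theorem Expr.Closed.num_ceilDiv {η : Hole → ℤ} {a b : TExpr} (ha : a.Closed m n) (hb : b.Closed m n) :
    (a.ceilDiv b).num η z = ceilDivInt (a.num η z) (b.num η z) := by
  have h1 := ha.tval_eq (η := η) (Base.refl z)
  have h2 := hb.tval_eq (η := η) (Base.refl z)
  exact Expr.num_eq_of_tval (Expr.tval_div
    (Expr.tval_plus h1 (Expr.tval_minus h2 Expr.tval_const)) h2)

theorem Expr.Closed.num_times {η : Hole → ℤ} {a b : TExpr} (ha : a.Closed m n) (hb : b.Closed m n) :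
    (a.times b).num η z = a.num η z * b.num η z :=
  Expr.num_eq_of_tval (Expr.tval_times (ha.tval_eq (Base.refl z)) (hb.tval_eq (Base.refl z)))

/-- The bindings and guards that a split inserts. -/
def splitB (φ : Tail) (x xo xi : Var) (lo len fac : TExpr) : List Bnd :=
  match φ with
  | .guard => [.bind x ((lo.plus (.var xi)).plus (fac.times (.var xo))),
      .guard (bin .lt rfl (.var x) (lo.plus len))]
  | .shift => [.bind x ((lo.plus (.var xi)).plus
      (bin .min rfl (fac.times (.var xo)) (bin .max rfl (.const 0) (len.minus fac))))]
  | .round => [.bind x ((lo.plus (.var xi)).plus (fac.times (.var xo)))]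

theorem Tail.wrap_eq (φ : Tail) (x xo xi : Var) (lo len fac : TExpr) :
    φ.wrap x xo xi lo len fac = wrapB (splitB φ x xo xi lo len fac) := by
  cases φ <;> rfl

def fuseB (y x₁ x₂ : Var) (lo₁ lo₂ len₂ : TExpr) : List Bnd :=
  [.bind x₁ (lo₁.plus (bin .div rfl (.var y) len₂)), .bind x₂ (lo₂.plus (bin .mod rfl (.var y) len₂))]

/-- The admitted iterations, for all strategies. -/
def tailP (φ : Tail) (xo xi : Var) (a k : ℤ) : Env → Prop :=
  match φ with
  | .guard => splitP xo xi a k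
  | _ => fun _ => True

def tailH (φ : Tail) (xo xi : Var) (lo a k : ℤ) : Env → Var → ℤ :=
  match φ with
  | .shift => shiftH xo xi lo a k
  | _ => splitH xo xi lo k

theorem seg_split (φ : Tail) {x xo xi : Var} {lo a k : ℤ} (hk : 0 < k) (hoi : xo ≠ xi) (hxo : x ≠ xo)
    (hxi : x ≠ xi) :
    Seg [(x, lo, a)] [(xo, 0, ceilDivInt a k), (xi, 0, k)] (tailP φ xo xi a k) (tailH φ xo xi lo a k)
      (φ = .guard) := by
  cases φ with
  | guard =>
    have := seg_split_guard (lo := lo) (a := a) hk hoi hxo hxi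
    exact ⟨this.loc, this.cover, fun _ => this.exact trivial, this.len, fun _ => this.reach trivial,
      this.reach', fun _ => this.pos trivial⟩
  | shift =>
    have := seg_split_shift (lo := lo) (a := a) hk hoi hxo hxi
    exact ⟨this.loc, this.cover, nofun, this.len, nofun, this.reach', nofun⟩
  | round =>
    have := seg_split_round (lo := lo) (a := a) hk hoi hxo hxi
    exact ⟨this.loc, this.cover, nofun, this.len, nofun, this.reach', nofun⟩

/-- Executing the bindings leaves the new loop variables as they are, whereas `segG` clears them.
The code `s` mentions none of them, so the difference cannot be observed. -/
theorem simO_segG (hΓ : Compatible m n Γ) {core s s' : Stmt Hole} (hc : IsCore core)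
    (hs : Below core s) {V V' : List Var} {P : Env → Prop} {H : Env → Var → ℤ} {ρ : Env}
    (hρ : Base z ρ) (hV : ∀ v ∈ V, v.IsLoop) (hV' : ∀ v ∈ V', v.IsLoop)
    (hm : ∀ v ∈ V', ¬ s.Mentions v) {o : Option Env} (h : SimO Γ z s' ρ s o)
    (ho : (¬ P ρ → o = none) ∧
      (P ρ → ∃ ρ₁, o = some ρ₁ ∧ ∀ v, ρ₁ v = if v ∈ V then .int (H ρ v) else ρ v)) :
    SimO Γ z s' ρ s (segG V V' P H ρ) := by
  by_cases hP : P ρ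
  · obtain ⟨ρ₁, rfl, h1⟩ := ho.2 hP
    rw [segG, if_pos hP]
    refine Sim.trans h (hs.sim_congr hΓ hc ?_ ?_ ?_)
    · intro v hv
      rw [h1, if_neg fun h => hv (hV v h)]
      exact hρ v hv
    · intro v hv
      simp only [if_neg fun h => hv (hV v h), if_neg fun h => hv (hV' v h)]
      exact hρ v hv
    · intro v hv
      rw [h1]
      split_ifs with h2 h3
      · rfl
      · exact (hm v h3 hv).elim
      · rfl
  · rw [ho.1 hP] at h
    rw [segG, if_neg hP]
    exact h

theorem splitB_ok (φ : Tail) {x xo xi : Var} {lo len fac : TExpr} (hx : x.IsLoop) (hlo : lo.AccFree)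
    (hlen : len.AccFree) (hfac : fac.AccFree) : ∀ b ∈ splitB φ x xo xi lo len fac, b.OK [x] := by
  have h1 : ((lo.plus (.var xi)).plus (fac.times (.var xo))).AccFree :=
    Expr.accFree_bin (Expr.accFree_bin hlo trivial) (Expr.accFree_bin hfac trivial)
  intro b hb
  cases φ <;> simp only [splitB, List.mem_cons, List.not_mem_nil, or_false] at hb
  · rcases hb with rfl | rfl
    · exact ⟨by simp, hx, h1⟩
    · exact Expr.accFree_bin trivial (Expr.accFree_bin hlo hlen)
  · subst hb
    exact ⟨by simp, hx, Expr.accFree_bin (Expr.accFree_bin hlo trivial)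
      (Expr.accFree_bin (Expr.accFree_bin hfac trivial) (Expr.accFree_bin trivial
        (Expr.accFree_bin hlen hfac)))⟩
  · subst hb
    exact ⟨by simp, hx, h1⟩

theorem fuseB_ok {y x₁ x₂ : Var} {lo₁ lo₂ len₂ : TExpr} (h₁ : x₁.IsLoop) (h₂ : x₂.IsLoop)
    (hlo₁ : lo₁.AccFree) (hlo₂ : lo₂.AccFree) (hlen₂ : len₂.AccFree) :
    ∀ b ∈ fuseB y x₁ x₂ lo₁ lo₂ len₂, b.OK [x₁, x₂] := by
  intro b hb
  simp only [fuseB, List.mem_cons, List.not_mem_nil, or_false] at hb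
  rcases hb with rfl | rfl
  · exact ⟨by simp, h₁, Expr.accFree_bin hlo₁ (Expr.accFree_bin trivial hlen₂)⟩
  · exact ⟨by simp, h₂, Expr.accFree_bin hlo₂ (Expr.accFree_bin trivial hlen₂)⟩

theorem splitB_mentions (φ : Tail) {x xo xi : Var} {lo len fac : TExpr} (hlo : lo.Closed m n)
    (hlen : len.Closed m n) (hfac : fac.Closed m n) {y : Var} (hy : y.IsLoop) (h1 : y ≠ x)
    (h2 : y ≠ xo) (h3 : y ≠ xi) : ∀ b ∈ splitB φ x xo xi lo len fac, ¬ b.Mentions y := by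
  have k1 : y ∉ lo.vars := fun h => hlo.not_loop y h hy
  have k2 : y ∉ len.vars := fun h => hlen.not_loop y h hy
  have k3 : y ∉ fac.vars := fun h => hfac.not_loop y h hy
  have kv : ∀ w : Var, y ≠ w → y ∉ (Expr.var w : TExpr).vars := fun w h => by simpa [Expr.vars] using h
  have kb : ∀ {o : Op} {h : o.arity = 2} {a b : TExpr}, y ∉ a.vars → y ∉ b.vars →
      y ∉ (bin o h a b).vars := fun ha hb h => (Expr.mem_vars_bin h).elim ha hb
  have kc : y ∉ (Expr.const 0 : TExpr).vars := by simp [Expr.vars]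
  intro b hb
  cases φ <;> simp only [splitB, List.mem_cons, List.not_mem_nil, or_false] at hb
  · rcases hb with rfl | rfl
    · simp only [Bnd.Mentions, not_or]
      exact ⟨h1, kb (kb k1 (kv _ h3)) (kb k3 (kv _ h2))⟩
    · exact kb (kv _ h1) (kb k1 k2)
  · subst hb
    simp only [Bnd.Mentions, not_or]
    exact ⟨h1, kb (kb k1 (kv _ h3)) (kb (kb k3 (kv _ h2)) (kb kc (kb k2 k3)))⟩
  · subst hb
    simp only [Bnd.Mentions, not_or]
    exact ⟨h1, kb (kb k1 (kv _ h3)) (kb k3 (kv _ h2))⟩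

theorem fuseB_mentions {v x₁ x₂ : Var} {lo₁ lo₂ len₂ : TExpr} (hlo₁ : lo₁.Closed m n)
    (hlo₂ : lo₂.Closed m n) (hlen₂ : len₂.Closed m n) {y : Var} (hy : y.IsLoop) (h1 : y ≠ x₁)
    (h2 : y ≠ x₂) (h3 : y ≠ v) : ∀ b ∈ fuseB v x₁ x₂ lo₁ lo₂ len₂, ¬ b.Mentions y := by
  have k1 : y ∉ lo₁.vars := fun h => hlo₁.not_loop y h hy
  have k2 : y ∉ lo₂.vars := fun h => hlo₂.not_loop y h hy
  have k3 : y ∉ len₂.vars := fun h => hlen₂.not_loop y h hy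
  have kv : y ∉ (Expr.var v : TExpr).vars := by simpa [Expr.vars] using h3
  have kb : ∀ {o : Op} {h : o.arity = 2} {a b : TExpr}, y ∉ a.vars → y ∉ b.vars →
      y ∉ (bin o h a b).vars := fun ha hb h => (Expr.mem_vars_bin h).elim ha hb
  intro b hb
  simp only [fuseB, List.mem_cons, List.not_mem_nil, or_false] at hb
  rcases hb with rfl | rfl
  · simp only [Bnd.Mentions, not_or]
    exact ⟨h1, kb k1 (kb kv k3)⟩
  · simp only [Bnd.Mentions, not_or]
    exact ⟨h2, kb k2 (kb kv k3)⟩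

theorem runB_splitB (φ : Tail) {x xo xi : Var} {lo len fac : TExpr} (hlo : lo.Closed m n)
    (hlen : len.Closed m n) (hfac : fac.Closed m n) {η : Hole → ℤ} {ρ : Env} (hρ : Base z ρ)
    (hx : x.IsLoop) {o i : ℤ} (ho : ρ xo = .int o) (hi : ρ xi = .int i) :
    (¬ tailP φ xo xi (len.num η z) (fac.num η z) ρ → runB η (splitB φ x xo xi lo len fac) ρ = none) ∧
    (tailP φ xo xi (len.num η z) (fac.num η z) ρ → ∃ ρ₁,
      runB η (splitB φ x xo xi lo len fac) ρ = some ρ₁ ∧ ∀ v, ρ₁ v = if v ∈ [x] then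
        .int (tailH φ xo xi (lo.num η z) (len.num η z) (fac.num η z) ρ v) else ρ v) := by
  have v1 := hlo.tval_eq (η := η) hρ
  have v2 := hlen.tval_eq (η := η) hρ
  have v3 := hfac.tval_eq (η := η) hρ
  have w1 : (Expr.var xi : TExpr).tval η ρ = .int i := hi
  have w2 : (Expr.var xo : TExpr).tval η ρ = .int o := ho
  have e1 := Expr.tval_plus (Expr.tval_plus v1 w1) (Expr.tval_times v3 w2)
  have e2 := Expr.tval_plus (Expr.tval_plus v1 w1) (Expr.tval_min (Expr.tval_times v3 w2)
    (Expr.tval_max (Expr.tval_const (c := 0)) (Expr.tval_minus v2 v3)))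
  have upd : ∀ (p : ℤ) (v : Var), Function.update ρ x (.int p) v = if v ∈ [x] then .int p else ρ v := by
    intro p v
    by_cases h : v = x
    · subst h; simp
    · simp [h]
  cases φ with
  | guard =>
    set ρ' := Function.update ρ x (.int (lo.num η z + i + fac.num η z * o)) with hρ'
    have b' : Base z ρ' := hρ.update hx _
    have wx : (Expr.var x : TExpr).tval η ρ' = .int (lo.num η z + i + fac.num η z * o) := by
      simp [hρ', Expr.tval_var]
    have e3 := Expr.tval_lt wx (Expr.tval_plus (hlo.tval_eq (η := η) b') (hlen.tval_eq (η := η) b'))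
    have run : runB η (splitB .guard x xo xi lo len fac) ρ =
        if (.int (if lo.num η z + i + fac.num η z * o < lo.num η z + len.num η z then 1 else 0) : Val) =
          .int 0 then none else some ρ' := by
      simp only [splitB, runB, e1]
      rw [← hρ', e3]
    have hiff : tailP .guard xo xi (len.num η z) (fac.num η z) ρ ↔
        lo.num η z + i + fac.num η z * o < lo.num η z + len.num η z := by
      simp only [tailP, splitP, ho, hi, Val.toInt]
      constructor <;> intro h <;> linarith
    rw [hiff, run]
    refine ⟨fun h => by simp [h], fun h => ⟨ρ', by simp [h], fun v => ?_⟩⟩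
    rw [hρ', upd]
    simp [tailH, splitH, ho, hi, Val.toInt, add_assoc]
  | shift =>
    refine ⟨fun h => (h trivial).elim, fun _ => ⟨_, rfl, fun v => ?_⟩⟩
    rw [e2, upd]
    simp [tailH, shiftH, ho, hi, Val.toInt, add_assoc]
  | round =>
    refine ⟨fun h => (h trivial).elim, fun _ => ⟨_, rfl, fun v => ?_⟩⟩
    rw [e1, upd]
    simp [tailH, splitH, ho, hi, Val.toInt, add_assoc]

theorem runB_fuseB {y x₁ x₂ : Var} {lo₁ lo₂ len₂ : TExpr} (hlo₁ : lo₁.Closed m n)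
    (hlo₂ : lo₂.Closed m n) (hlen₂ : len₂.Closed m n) {η : Hole → ℤ} {ρ : Env} (hρ : Base z ρ)
    (hx₁ : x₁.IsLoop) (h12 : x₁ ≠ x₂) (h1y : x₁ ≠ y) {u : ℤ} (hy : ρ y = .int u) :
    ∃ ρ₁, runB η (fuseB y x₁ x₂ lo₁ lo₂ len₂) ρ = some ρ₁ ∧ ∀ v, ρ₁ v = if v ∈ [x₁, x₂] then
      .int (fuseH x₁ y (lo₁.num η z) (lo₂.num η z) (len₂.num η z) ρ v) else ρ v := by
  have v1 := hlo₁.tval_eq (η := η) hρ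
  have v2 := hlen₂.tval_eq (η := η) hρ
  have w1 : (Expr.var y : TExpr).tval η ρ = .int u := hy
  have e1 := Expr.tval_plus v1 (Expr.tval_div w1 v2)
  set ρ' := Function.update ρ x₁ (.int (lo₁.num η z + fdiv0 u (len₂.num η z))) with hρ'
  have b' : Base z ρ' := hρ.update hx₁ _
  -- The second binding is evaluated below the first; as `x₁ ≠ y`, the fused variable is still
  -- visible there.
  have w2 : (Expr.var y : TExpr).tval η ρ' = .int u := by
    rw [Expr.tval_var, hρ', Function.update_of_ne (Ne.symm h1y), hy]
  have e2 := Expr.tval_plus (hlo₂.tval_eq (η := η) b') (Expr.tval_mod w2 (hlen₂.tval_eq (η := η) b'))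
  refine ⟨_, rfl, fun v => ?_⟩
  rw [e1, ← hρ', e2]
  by_cases hv2 : v = x₂
  · subst hv2
    simp [fuseH, Ne.symm h12, hy, Val.toInt]
  · by_cases hv1 : v = x₁
    · subst hv1
      simp [fuseH, hρ', hy, Val.toInt, Function.update_of_ne hv2]
    · simp [hv1, hv2, hρ']

end Halide

namespace Halide

variable {m n : ℕ} {Γ : Hole → Expr Ver Empty} {z : Input m n}

/-! ## Scheduled stages -/

/-- A loop nest around bindings and guards around `core`. -/
structure NestOK (m n : ℕ) (core : Stmt Hole) (Ls : List Hdr) (tail : Stmt Hole) : Prop where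
  closed : ∀ h ∈ Ls, h.Closed m n
  nodup : (Ls.map Hdr.var).Nodup
  serial : ∀ h ∈ Ls, ¬ h.var.IsPure → h.ord = .serial
  below : Below core tail
  fresh : ∀ h ∈ Ls, ¬ tail.Binds h.var

theorem vars_nums (η : Hole → ℤ) (z : Input m n) (Ls : List Hdr) :
    vars (Ls.map (Hdr.nums η z)) = Ls.map Hdr.var := map_fst_nums η z Ls

theorem mentions_nest {Ls : List Hdr} {s : Stmt Hole} {v : Var} :
    (nest Ls s).Mentions v ↔
      (∃ h ∈ Ls, v = h.var ∨ v ∈ h.lo.vars ∨ v ∈ h.len.vars) ∨ s.Mentions v := by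
  induction Ls with
  | nil => simp
  | cons h Ls ih =>
    simp only [nest_cons, Stmt.Mentions, ih, List.mem_cons, exists_eq_or_imp, or_assoc]

theorem Below.binds_isLoop {core s : Stmt Hole} (hc : IsCore core) (hs : Below core s) {v : Var}
    (h : s.Binds v) : v.IsLoop := by
  induction hs with
  | core => obtain ⟨p, f, w, k, args, e, rfl⟩ := hc; simp [Stmt.Binds] at h
  | letIn x e s hx he _ ih => exact h.elim (fun h => h ▸ hx) ih
  | guard e s he _ ih => exact h.elim ih False.elim

theorem Below.not_loop_sub {core s : Stmt Hole} (hc : IsCore core) (hs : Below core s) {τ : Order}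
    {x : Var} {lo len : TExpr} {s' : Stmt Hole} : ¬ (Stmt.loop τ x lo len s').Sub s := by
  induction hs with
  | core => obtain ⟨p, f, w, k, args, e, rfl⟩ := hc; simp [Stmt.Sub]
  | letIn x e s hx he _ ih => simpa [Stmt.Sub] using ih
  | guard e s he _ ih => simpa [Stmt.Sub] using ih

/-- The loops that occur in a loop nest. -/
theorem loop_sub_nest {core tail : Stmt Hole} (hc : IsCore core) (ht : Below core tail) {Ls : List Hdr}
    {τ : Order} {x : Var} {lo len : TExpr} {s : Stmt Hole}
    (h : (Stmt.loop τ x lo len s).Sub (nest Ls tail)) :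
    ∃ A B, Ls = A ++ ⟨τ, x, lo, len⟩ :: B ∧ s = nest B tail := by
  induction Ls with
  | nil => exact (ht.not_loop_sub hc h).elim
  | cons l Ls ih =>
    rcases h with h | h
    · cases h
      exact ⟨[], Ls, rfl, rfl⟩
    · obtain ⟨A, B, rfl, rfl⟩ := ih h
      exact ⟨l :: A, B, rfl, rfl⟩

/-- Loop variables of a nest are distinct, so the traversal stops at exactly one loop, and what lies
outside of it is left alone. -/
theorem modLoop_nest {A B : List Hdr} {h : Hdr} (hnd : ((A ++ h :: B).map Hdr.var).Nodup)
    (tail : Stmt Hole) (g : Stmt Hole → Stmt Hole) :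
    (nest (A ++ h :: B) tail).modLoop h.var g = nest A (g (nest (h :: B) tail)) := by
  induction A with
  | nil => simp [Stmt.modLoop]
  | cons a A ih =>
    rw [List.cons_append, List.map_cons, List.nodup_cons] at hnd
    have hne : a.var ≠ h.var := fun e => hnd.1 (by simp [e])
    simp only [List.cons_append, nest_cons, Stmt.modLoop, if_neg hne, ih hnd.2]

theorem pushDown_nest (xs : List Var) (φ : Stmt Hole → Stmt Hole) (B : List Hdr) (s : Stmt Hole) :
    (nest B s).pushDown xs φ = nest B (s.pushDown xs φ) := by
  induction B with
  | nil => rfl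
  | cons h B ih => simp only [nest_cons, Stmt.pushDown, ih]

/-- The loops `C` between `A` and `B` are replaced by `C'`, and `tail` by `tail'`. -/
structure Repl (Γ : Hole → Expr Ver Empty) (z : Input m n) (core : Stmt Hole) (A C C' B : List Hdr)
    (tail tail' : Stmt Hole) (P : Env → Prop) (H : Env → Var → ℤ) (strict : Prop) : Prop where
  ok : NestOK m n core (A ++ C ++ B) tail
  ok' : NestOK m n core (A ++ C' ++ B) tail'
  seg : Seg (C.map (Hdr.nums (holeVal Γ z) z)) (C'.map (Hdr.nums (holeVal Γ z) z)) P H strict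
  sim : ∀ ρ, IntOn z.env ((A ++ C' ++ B).map Hdr.var) ρ →
    SimO Γ z tail' ρ tail (segG (C.map Hdr.var) (C'.map Hdr.var) P H ρ)
  serial : ∀ h ∈ C', h.ord = .serial

/-- The inserted bindings set the variables of the loops that disappear, and the new loop variables
were mentioned nowhere in the stage. So loop variables stay distinct and are not rebound below the
loops. -/
theorem NestOK.replace {core tail : Stmt Hole} {A C C' B : List Hdr}
    (hok : NestOK m n core (A ++ C ++ B) tail) (hc : IsCore core)
    (hcl : ∀ h ∈ C', h.Closed m n) (hser : ∀ h ∈ C', h.ord = .serial) (hnd : (C'.map Hdr.var).Nodup)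
    (hnew : ∀ h ∈ C', ¬ (nest (A ++ C ++ B) tail).Mentions h.var) {Bs : List Bnd}
    (hB : ∀ b ∈ Bs, b.OK (C.map Hdr.var)) :
    NestOK m n core (A ++ C' ++ B) (tail.pushDown (C.map Hdr.var) (wrapB Bs)) := by
  have hnew' : ∀ h ∈ C', ∀ h' ∈ A ++ C ++ B, h.var ≠ h'.var := fun h hh h' hh' e =>
    hnew h hh (mentions_nest.2 (.inl ⟨h', hh', .inl e⟩))
  have h0 := hok.nodup
  simp only [List.map_append, List.nodup_append, List.mem_append, List.mem_map] at h0
  constructor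
  · intro h hh
    simp only [List.mem_append] at hh
    rcases hh with (hh | hh) | hh
    · exact hok.closed h (by simp [hh])
    · exact hcl h hh
    · exact hok.closed h (by simp [hh])
  · simp only [List.map_append, List.nodup_append, List.mem_append, List.mem_map]
    refine ⟨⟨h0.1.1, hnd, ?_⟩, h0.2.1, ?_⟩
    · rintro _ ⟨a, ha, rfl⟩ _ ⟨c, hc, rfl⟩ e
      exact hnew' c hc a (by simp [ha]) e.symm
    · rintro _ (⟨a, ha, rfl⟩ | ⟨c, hc, rfl⟩) _ ⟨b, hb, rfl⟩
      · exact h0.2.2 _ (.inl ⟨a, ha, rfl⟩) _ ⟨b, hb, rfl⟩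
      · exact hnew' c hc b (by simp [hb])
  · intro h hh hp
    simp only [List.mem_append] at hh
    rcases hh with (hh | hh) | hh
    · exact hok.serial h (by simp [hh]) hp
    · exact hser h hh
    · exact hok.serial h (by simp [hh]) hp
  · exact hok.below.pushDown hc hB
  · intro h hh hb
    rcases hok.below.binds_pushDown hc hB hb with hx | hx
    · obtain ⟨c, hc, he⟩ := List.mem_map.1 hx
      simp only [List.mem_append] at hh
      rcases hh with (hh | hh) | hh
      · exact h0.1.2.2 _ ⟨h, hh, rfl⟩ _ ⟨c, hc, rfl⟩ he.symm
      · exact hnew' h hh c (by simp [hc]) he.symm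
      · exact h0.2.2 _ (.inr ⟨c, hc, rfl⟩) _ ⟨h, hh, rfl⟩ he
    · simp only [List.mem_append] at hh
      rcases hh with (hh | hh) | hh
      · exact hok.fresh h (by simp [hh]) hx
      · exact hnew h hh (mentions_nest.2 (.inr hx.mentions))
      · exact hok.fresh h (by simp [hh]) hx

theorem IntOn.base_of_closed {Ls : List Hdr} (h : ∀ l ∈ Ls, l.Closed m n) {ρ : Env}
    (hρ : IntOn z.env (Ls.map Hdr.var) ρ) : Base z ρ :=
  hρ.base (Base.refl z) fun v hv => by
    obtain ⟨l, hl, rfl⟩ := List.mem_map.1 hv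
    exact (h l hl).2.2

/-- Common frame of split and fuse: a segment, together with bindings whose effect `hrun` is the
decoding of this segment. -/
theorem Repl.of_binds (hΓ : Compatible m n Γ) {core tail : Stmt Hole} {A C C' B : List Hdr}
    (hok : NestOK m n core (A ++ C ++ B) tail) (hc : IsCore core)
    (hcl : ∀ h ∈ C', h.Closed m n) (hser : ∀ h ∈ C', h.ord = .serial) (hnd : (C'.map Hdr.var).Nodup)
    (hnew : ∀ h ∈ C', ¬ (nest (A ++ C ++ B) tail).Mentions h.var) {Bs : List Bnd}
    (hB : ∀ b ∈ Bs, b.OK (C.map Hdr.var))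
    (hBm : ∀ y, y.IsLoop → y ∉ C.map Hdr.var → y ∉ C'.map Hdr.var → ∀ b ∈ Bs, ¬ b.Mentions y)
    {P : Env → Prop} {H : Env → Var → ℤ} {strict : Prop}
    (hseg : Seg (C.map (Hdr.nums (holeVal Γ z) z)) (C'.map (Hdr.nums (holeVal Γ z) z)) P H strict)
    (hrun : ∀ ρ, Base z ρ → (∀ v ∈ C'.map Hdr.var, ∃ t : ℤ, ρ v = .int t) →
      (¬ P ρ → runB (holeVal Γ z) Bs ρ = none) ∧ (P ρ → ∃ ρ₁, runB (holeVal Γ z) Bs ρ = some ρ₁ ∧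
        ∀ v, ρ₁ v = if v ∈ C.map Hdr.var then .int (H ρ v) else ρ v)) :
    Repl Γ z core A C C' B tail (tail.pushDown (C.map Hdr.var) (wrapB Bs)) P H strict := by
  have hok' := hok.replace hc hcl hser hnd hnew hB
  refine ⟨hok, hok', hseg, fun ρ hρ => ?_, hser⟩
  have hb := hρ.base_of_closed hok'.closed
  refine simO_segG hΓ hc hok.below hb ?_ ?_ ?_ (sim_pushDown hΓ hc hok.below hB ?_ hb)
    (hrun ρ hb fun v hv => hρ.2 v (by simp only [List.map_append, List.mem_append]; exact .inl (.inr hv)))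
  · intro v hv
    obtain ⟨h, hh, rfl⟩ := List.mem_map.1 hv
    exact (hok.closed h (by simp [hh])).2.2
  · intro v hv
    obtain ⟨h, hh, rfl⟩ := List.mem_map.1 hv
    exact (hcl h hh).2.2
  · intro v hv hm
    obtain ⟨h, hh, rfl⟩ := List.mem_map.1 hv
    exact hnew h hh (mentions_nest.2 (.inr hm))
  · intro y hy
    have h1 : y ∉ C.map Hdr.var := fun hyc => by
      obtain ⟨h, hh, rfl⟩ := List.mem_map.1 hyc
      exact hok.fresh h (by simp [hh]) hy
    refine ⟨h1, hBm y (hok.below.binds_isLoop hc hy) h1 fun hyc => ?_⟩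
    obtain ⟨h, hh, rfl⟩ := List.mem_map.1 hyc
    exact hnew h hh (mentions_nest.2 (.inr hy.mentions))

theorem Repl.split (hΓ : Compatible m n Γ) {core tail : Stmt Hole} {A B : List Hdr} {τ : Order}
    {x xo xi : Var} {lo len fac : TExpr} (φ : Tail)
    (hok : NestOK m n core (A ++ [⟨τ, x, lo, len⟩] ++ B) tail) (hc : IsCore core)
    (hfac : fac.Closed m n) (hpos : 0 < fac.num (holeVal Γ z) z) (hoi : xo ≠ xi)
    (hxo : ¬ (nest (A ++ [⟨τ, x, lo, len⟩] ++ B) tail).Mentions xo)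
    (hxi : ¬ (nest (A ++ [⟨τ, x, lo, len⟩] ++ B) tail).Mentions xi) (hlo : xo.IsLoop)
    (hli : xi.IsLoop) :
    Repl Γ z core A [⟨τ, x, lo, len⟩]
      [⟨.serial, xo, .const 0, len.ceilDiv fac⟩, ⟨.serial, xi, .const 0, fac⟩] B tail
      (tail.pushDown [x] (φ.wrap x xo xi lo len fac))
      (tailP φ xo xi (len.num (holeVal Γ z) z) (fac.num (holeVal Γ z) z))
      (tailH φ xo xi (lo.num (holeVal Γ z) z) (len.num (holeVal Γ z) z) (fac.num (holeVal Γ z) z))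
      (φ = .guard) := by
  obtain ⟨c1, c2, c3⟩ := hok.closed ⟨τ, x, lo, len⟩ (by simp)
  simp only at c1 c2 c3
  have hx : (nest (A ++ [⟨τ, x, lo, len⟩] ++ B) tail).Mentions x :=
    mentions_nest.2 (.inl ⟨⟨τ, x, lo, len⟩, by simp, .inl rfl⟩)
  have n1 : x ≠ xo := by rintro rfl; exact hxo hx
  have n2 : x ≠ xi := by rintro rfl; exact hxi hx
  have hcd : (len.ceilDiv fac).Closed m n :=
    (c2.bin (hfac.bin Expr.closed_const)).bin hfac
  rw [Tail.wrap_eq]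
  refine Repl.of_binds hΓ hok hc ?_ ?_ ?_ ?_ ?_ ?_ ?_ ?_
  · simp only [List.mem_cons, List.not_mem_nil, or_false, forall_eq_or_imp, forall_eq]
    exact ⟨⟨Expr.closed_const, hcd, hlo⟩, Expr.closed_const, hfac, hli⟩
  · simp
  · simpa using hoi
  · simp only [List.mem_cons, List.not_mem_nil, or_false, forall_eq_or_imp, forall_eq]
    exact ⟨hxo, hxi⟩
  · exact splitB_ok φ c3 c1.1 c2.1 hfac.1
  · intro y hy h1 h2
    simp only [List.map_cons, List.map_nil, List.mem_cons, List.not_mem_nil, or_false, not_or] at h1 h2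
    exact splitB_mentions φ c1 c2 hfac hy h1 h2.1 h2.2
  · have h0 : (Expr.const 0 : TExpr).num (holeVal Γ z) z = 0 := rfl
    simp only [List.map_cons, List.map_nil, Hdr.nums, h0, c2.num_ceilDiv hfac]
    exact seg_split φ hpos hoi n1 n2
  · intro ρ hρ hint
    obtain ⟨o, ho⟩ := hint xo (by simp)
    obtain ⟨i, hi⟩ := hint xi (by simp)
    exact runB_splitB φ c1 c2 hfac hρ c3 ho hi

theorem Repl.fuse (hΓ : Compatible m n Γ) {core tail : Stmt Hole} {A B : List Hdr} {τ₁ τ₂ : Order}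
    {x₁ x₂ y : Var} {lo₁ len₁ lo₂ len₂ : TExpr}
    (hok : NestOK m n core (A ++ [⟨τ₁, x₁, lo₁, len₁⟩, ⟨τ₂, x₂, lo₂, len₂⟩] ++ B) tail)
    (hc : IsCore core)
    (hy : ¬ (nest (A ++ [⟨τ₁, x₁, lo₁, len₁⟩, ⟨τ₂, x₂, lo₂, len₂⟩] ++ B) tail).Mentions y)
    (hly : y.IsLoop) :
    Repl Γ z core A [⟨τ₁, x₁, lo₁, len₁⟩, ⟨τ₂, x₂, lo₂, len₂⟩]
      [⟨.serial, y, .const 0, len₁.times len₂⟩] B tail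
      (tail.pushDown [x₁, x₂] fun s' =>
        .letIn x₁ (lo₁.plus (bin .div rfl (.var y) len₂))
          (.letIn x₂ (lo₂.plus (bin .mod rfl (.var y) len₂)) s'))
      (fun _ => True)
      (fuseH x₁ y (lo₁.num (holeVal Γ z) z) (lo₂.num (holeVal Γ z) z) (len₂.num (holeVal Γ z) z))
      True := by
  obtain ⟨c1, c2, c3⟩ := hok.closed ⟨τ₁, x₁, lo₁, len₁⟩ (by simp)
  obtain ⟨d1, d2, d3⟩ := hok.closed ⟨τ₂, x₂, lo₂, len₂⟩ (by simp)
  simp only at c1 c2 c3 d1 d2 d3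
  have n1 : x₁ ≠ y := by
    rintro rfl
    exact hy (mentions_nest.2 (.inl ⟨⟨τ₁, x₁, lo₁, len₁⟩, by simp, .inl rfl⟩))
  have n2 : x₂ ≠ y := by
    rintro rfl
    exact hy (mentions_nest.2 (.inl ⟨⟨τ₂, x₂, lo₂, len₂⟩, by simp, .inl rfl⟩))
  have h12 : x₁ ≠ x₂ := by
    have := hok.nodup
    simp only [List.map_append, List.nodup_append, List.map_cons, List.map_nil, List.nodup_cons,
      List.mem_cons, List.not_mem_nil, or_false] at this
    exact this.1.2.1.1
  refine Repl.of_binds (C := [⟨τ₁, x₁, lo₁, len₁⟩, ⟨τ₂, x₂, lo₂, len₂⟩])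
    (Bs := fuseB y x₁ x₂ lo₁ lo₂ len₂) hΓ hok hc ?_ ?_ ?_ ?_ ?_ ?_ ?_ ?_
  · simp only [List.mem_cons, List.not_mem_nil, or_false, forall_eq]
    exact ⟨Expr.closed_const, c2.bin d2, hly⟩
  · simp
  · simp
  · simpa using hy
  · exact fuseB_ok c3 d3 c1.1 d1.1 d2.1
  · intro y' hy' h1 h2
    simp only [List.map_cons, List.map_nil, List.mem_cons, List.not_mem_nil, or_false, not_or] at h1 h2
    exact fuseB_mentions c1 d1 d2 hy' h1.1 h1.2 h2
  · have h0 : (Expr.const 0 : TExpr).num (holeVal Γ z) z = 0 := rfl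
    simp only [List.map_cons, List.map_nil, Hdr.nums, h0, c2.num_times d2]
    exact seg_fuse h12 n1 n2
  · intro ρ hρ hint
    obtain ⟨u, hu⟩ := hint y (by simp)
    exact ⟨fun h => (h trivial).elim, fun _ => runB_fuseB c1 d1 d2 hρ c3 h12 n1 hu⟩

/-! ## Queries and traces of a stage in which loops have been replaced -/

theorem ReachOK.prefix {A B : List NumLoop} (h : ReachOK (A ++ B)) : ReachOK A := by
  induction A with
  | nil => trivial
  | cons x A ih => exact ⟨h.1, fun h0 => ih (h.2 h0)⟩

theorem ReachOK.suffix {A B : List NumLoop} (h : ReachOK (A ++ B)) (hA : ∀ x ∈ A, 0 < x.2.2) :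
    ReachOK B := by
  induction A with
  | nil => exact h
  | cons x A ih => exact ih (h.2 (hA x (by simp))) fun y hy => hA y (by simp [hy])

theorem ReachOK.append_of {A B B' : List NumLoop} (h : ReachOK (A ++ B))
    (hB : ReachOK B → ReachOK B') : ReachOK (A ++ B') := by
  induction A with
  | nil => exact hB h
  | cons x A ih => exact ⟨h.1, fun h0 => ih (h.2 h0)⟩

theorem enum_eq_nil {N : List NumLoop} {x : NumLoop} (hx : x ∈ N) (h : x.2.2 ≤ 0) (ρ : Env) :
    enum N ρ = [] := by
  induction N generalizing ρ with
  | nil => simp at hx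
  | cons y N ih =>
    rcases List.mem_cons.1 hx with rfl | hx
    · simp [enum, Int.toNat_of_nonpos h]
    · simp [enum, ih hx]

theorem Box.pos {ρ₀ ρ : Env} {N : List NumLoop} (h : Box ρ₀ N ρ) : ∀ x ∈ N, 0 < x.2.2 := by
  intro x hx
  obtain ⟨t, _, h1, h2⟩ := h.2 x hx
  linarith

/-- Both nests have the same heads, so a family of iteration traces of one, and any interleaving of
it, serves the other as well. Only the bodies have to be compared. -/
theorem nest_tr_mono (hΓ : Compatible m n Γ) {Ls : List Hdr} {s s' : Stmt Hole}
    (hL : ∀ h ∈ Ls, h.Closed m n) (hN : (Ls.map Hdr.var).Nodup)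
    (h0 : ReachOK (Ls.map (Hdr.nums (holeVal Γ z) z))) {ρ ρ' : Env} (hρ : Base z ρ) (hρ' : Base z ρ')
    (hs : ∀ e e', Box ρ (Ls.map (Hdr.nums (holeVal Γ z) z)) e →
      Box ρ' (Ls.map (Hdr.nums (holeVal Γ z) z)) e' → (∀ v ∈ Ls.map Hdr.var, e v = e' v) →
      ∀ t, (s.fill Γ).Tr e t → (s'.fill Γ).Tr e' t) {t : List Act}
    (ht : ((nest Ls s).fill Γ).Tr ρ t) : ((nest Ls s').fill Γ).Tr ρ' t := by
  induction Ls generalizing ρ ρ' t with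
  | nil => exact hs ρ ρ' (box_nil.2 rfl) (box_nil.2 rfl) (by simp) t ht
  | cons h Ls ih =>
    obtain ⟨c1, c2, c3⟩ := hL h (by simp)
    obtain ⟨h0, h0'⟩ := h0
    obtain ⟨n1, n2⟩ := List.nodup_cons.1 hN
    have n1' : (h.nums (holeVal Γ z) z).1 ∉ (Ls.map (Hdr.nums (holeVal Γ z) z)).map Prod.fst := by
      rwa [map_fst_nums]
    rw [nest_fill_cons, Stmt.tr_loop_fill hΓ hρ c1 c2 h0] at ht
    rw [nest_fill_cons, Stmt.tr_loop_fill hΓ hρ' c1 c2 h0]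
    obtain ⟨ts, h1, h2⟩ := ht
    refine ⟨ts, fun i => ?_, h2⟩
    have hi := i.2
    refine ih (fun h' hh => hL h' (by simp [hh])) n2 (h0' (by
      show 0 < h.len.num (holeVal Γ z) z
      omega)) (hρ.update c3 _) (hρ'.update c3 _) ?_ (h1 i)
    intro e e' he he' hee
    refine hs e e' ?_ ?_ ?_
    · rw [List.map_cons, box_cons n1']; exact ⟨i, hi, he⟩
    · rw [List.map_cons, box_cons n1']; exact ⟨i, hi, he'⟩
    · intro v hv
      rcases List.mem_cons.1 hv with rfl | hv
      · have e1 := he.1 _ n1'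
        have e2 := he'.1 _ n1'
        simp only [Hdr.nums] at e1 e2
        rw [e1, e2]
        simp
      · exact hee v hv

section Repl

variable {core tail tail' : Stmt Hole} {A C C' B : List Hdr} {P : Env → Prop} {H : Env → Var → ℤ}
  {strict : Prop}

theorem Repl.sep_left (h : Repl Γ z core A C C' B tail tail' P H strict) :
    ∀ x ∈ A.map (Hdr.nums (holeVal Γ z) z),
      x.1 ∉ vars (C.map (Hdr.nums (holeVal Γ z) z)) ∧ x.1 ∉ vars (C'.map (Hdr.nums (holeVal Γ z) z)) := by
  have h1 := h.ok.nodup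
  have h2 := h.ok'.nodup
  simp only [List.map_append, List.nodup_append, List.mem_append] at h1 h2
  intro x hx
  have hx' : x.1 ∈ A.map Hdr.var := by rw [← vars_nums (holeVal Γ z) z]; exact List.mem_map_of_mem hx
  rw [vars_nums, vars_nums]
  exact ⟨fun hc => h1.1.2.2 _ hx' _ hc rfl, fun hc => h2.1.2.2 _ hx' _ hc rfl⟩

theorem Repl.sep_right (h : Repl Γ z core A C C' B tail tail' P H strict) :
    ∀ x ∈ B.map (Hdr.nums (holeVal Γ z) z),
      x.1 ∉ vars (C.map (Hdr.nums (holeVal Γ z) z)) ∧ x.1 ∉ vars (C'.map (Hdr.nums (holeVal Γ z) z)) := by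
  have h1 := h.ok.nodup
  have h2 := h.ok'.nodup
  simp only [List.map_append, List.nodup_append, List.mem_append] at h1 h2
  intro x hx
  have hx' : x.1 ∈ B.map Hdr.var := by rw [← vars_nums (holeVal Γ z) z]; exact List.mem_map_of_mem hx
  rw [vars_nums, vars_nums]
  exact ⟨fun hc => h1.2.2 _ (.inr hc) _ hx' rfl, fun hc => h2.2.2 _ (.inr hc) _ hx' rfl⟩

theorem Repl.loop_new (h : Repl Γ z core A C C' B tail tail' P H strict) {v : Var}
    (hv : v ∈ vars (C'.map (Hdr.nums (holeVal Γ z) z))) : z.env v = .errMem := by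
  rw [vars_nums] at hv
  obtain ⟨c, hc, rfl⟩ := List.mem_map.1 hv
  exact z.env_loop (h.ok'.closed c (by simp [hc])).2.2

/-- Every old iteration is the image of a new one, where the query is known. The lengths have to be
assumed nonnegative, since the new loops need not show a negative one: a slightly negative length is
rounded up to zero tiles, and two negative lengths have a positive product. -/
theorem Repl.query_of_new (h : Repl Γ z core A C C' B tail tail' P H strict)
    (hpos : ∀ x ∈ C.map (Hdr.nums (holeVal Γ z) z), 0 ≤ x.2.2) {φ : ℕ → List Val → ℤ}
    {st : Option Stage} (hq : (nest (A ++ C' ++ B) tail').query (holeVal Γ z) φ st z.env) :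
    (nest (A ++ C ++ B) tail).query (holeVal Γ z) φ st z.env := by
  rw [nest_query_iff h.ok'.closed h.ok'.nodup (Base.refl z)] at hq
  rw [nest_query_iff h.ok.closed h.ok.nodup (Base.refl z)]
  obtain ⟨h1, h2⟩ := hq
  have nd : ((A ++ C ++ B).map (Hdr.nums (holeVal Γ z) z) |>.map Prod.fst).Nodup := by
    rw [map_fst_nums]; exact h.ok.nodup
  have nd' : ((A ++ C' ++ B).map (Hdr.nums (holeVal Γ z) z) |>.map Prod.fst).Nodup := by
    rw [map_fst_nums]; exact h.ok'.nodup
  constructor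
  · simp only [List.map_append, List.append_assoc] at h1 ⊢
    exact h1.append_of (h.seg.reach' hpos _)
  · intro e he
    rw [← mem_enum nd] at he
    simp only [List.map_append] at he
    obtain ⟨e', he', hg⟩ := h.seg.enum_cover hpos (fun x hx => (h.sep_left x hx).2) h.sep_right
      (fun v hv => h.loop_new hv) e he
    rw [← List.map_append, ← List.map_append, mem_enum nd'] at he'
    have hs := h.sim e' (by rw [← vars_nums (holeVal Γ z) z]; exact he'.intOn)
    rw [map_fst_nums, map_fst_nums] at hg
    rw [hg] at hs
    exact (hs.2 φ st).1 (h2 e' he')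

/-- In the exact case a new iteration decodes to an old one, whose query is given, or acts as a
no-op, whose query is trivial. -/
theorem Repl.query_new (h : Repl Γ z core A C C' B tail tail' P H strict) (hst : strict)
    {φ : ℕ → List Val → ℤ} {st : Option Stage}
    (hq : (nest (A ++ C ++ B) tail).query (holeVal Γ z) φ st z.env) :
    (nest (A ++ C' ++ B) tail').query (holeVal Γ z) φ st z.env := by
  rw [nest_query_iff h.ok.closed h.ok.nodup (Base.refl z)] at hq
  rw [nest_query_iff h.ok'.closed h.ok'.nodup (Base.refl z)]
  obtain ⟨h1, h2⟩ := hq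
  have nd : ((A ++ C ++ B).map (Hdr.nums (holeVal Γ z) z) |>.map Prod.fst).Nodup := by
    rw [map_fst_nums]; exact h.ok.nodup
  have nd' : ((A ++ C' ++ B).map (Hdr.nums (holeVal Γ z) z) |>.map Prod.fst).Nodup := by
    rw [map_fst_nums]; exact h.ok'.nodup
  constructor
  · simp only [List.map_append, List.append_assoc] at h1 ⊢
    exact h1.append_of (h.seg.reach hst _)
  · intro e' he'
    have hs := h.sim e' (by rw [← vars_nums (holeVal Γ z) z]; exact he'.intOn)
    have hp := he'.pos
    rw [← mem_enum nd'] at he'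
    cases hg : segG (C.map Hdr.var) (C'.map Hdr.var) P H e' with
    | none =>
      rw [hg] at hs
      exact (hs.2 φ st).2 trivial
    | some e =>
      rw [hg] at hs
      refine (hs.2 φ st).2 (h2 e ?_)
      -- A new iteration exists, so all new loops have positive lengths, and `Seg.pos` gives
      -- nonnegative old ones.
      have hpos : ∀ x ∈ C.map (Hdr.nums (holeVal Γ z) z), 0 ≤ x.2.2 := by
        simp only [List.map_append, List.append_assoc] at h1 hp
        exact h.seg.pos hst _ (h1.suffix fun x hx => hp x (by simp [hx])) fun x hx => hp x (by simp [hx])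
      rw [← mem_enum nd]
      simp only [List.map_append] at he' ⊢
      rw [← h.seg.enum_filterMap hst hpos (fun x hx => (h.sep_left x hx).2) h.sep_right
        (fun v hv => h.loop_new hv), List.mem_filterMap]
      exact ⟨e', he', by rw [map_fst_nums, map_fst_nums]; exact hg⟩

/-- The loops `B` change neither `P` nor `H`, which depend on the new loop variables only. Hence all
iterations of `B` are rejected together, or are decoded with the same values of the old variables.
-/
theorem Repl.inner_tr (hΓ : Compatible m n Γ) (h : Repl Γ z core A C C' B tail tail' P H strict)
    {e' : Env} (he' : IntOn z.env ((A ++ C').map Hdr.var) e')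
    (hB : ReachOK (B.map (Hdr.nums (holeVal Γ z) z))) :
    (∀ e, segG (C.map Hdr.var) (C'.map Hdr.var) P H e' = some e →
      ∀ t, ((nest B tail').fill Γ).Tr e' t ↔ ((nest B tail).fill Γ).Tr e t) ∧
    (segG (C.map Hdr.var) (C'.map Hdr.var) P H e' = none →
      ∀ t, ((nest B tail').fill Γ).Tr e' t ↔ t = []) := by
  have hcB : ∀ l ∈ B, l.Closed m n := fun l hl => h.ok.closed l (by simp [hl])
  have hnB : (B.map Hdr.var).Nodup := by
    have := h.ok.nodup
    simp only [List.map_append, List.nodup_append] at this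
    exact this.2.1
  have hb' : Base z e' := he'.base_of_closed fun l hl => h.ok'.closed l (by
    rcases List.mem_append.1 hl with hl | hl <;> simp [hl])
  have hloc : ∀ ρ ρ', (∀ v ∈ C'.map Hdr.var, ρ v = ρ' v) → (P ρ ↔ P ρ') ∧ H ρ = H ρ' := by
    have := h.seg.loc
    rwa [map_fst_nums] at this
  have hsB : ∀ v ∈ B.map Hdr.var, v ∉ C.map Hdr.var ∧ v ∉ C'.map Hdr.var := by
    intro v hv
    have := h.sep_right
    rw [← vars_nums (holeVal Γ z) z] at hv
    obtain ⟨x, hx, rfl⟩ := List.mem_map.1 hv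
    have := this x hx
    rwa [vars_nums, vars_nums] at this
  have key : ∀ f, Box e' (B.map (Hdr.nums (holeVal Γ z) z)) f →
      IntOn z.env ((A ++ C' ++ B).map Hdr.var) f ∧ (P f ↔ P e') ∧ H f = H e' := by
    intro f hf
    have hf1 : ∀ v, v ∉ B.map Hdr.var → f v = e' v := fun v hv => hf.1 v (by rwa [map_fst_nums])
    refine ⟨⟨fun v hv => ?_, fun v hv => ?_⟩, hloc f e' fun v hv => hf1 v fun hvB => (hsB v hvB).2 hv⟩
    · rw [List.map_append, List.mem_append, not_or] at hv
      rw [hf1 v hv.2, he'.1 v hv.1]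
    · by_cases hvB : v ∈ B.map Hdr.var
      · exact hf.intOn.2 v (by rwa [map_fst_nums])
      · rw [hf1 v hvB]
        rw [List.map_append, List.mem_append] at hv
        exact he'.2 v (hv.resolve_right hvB)
  constructor
  · intro e he t
    have hPe : P e' ∧ e = fun v => if v ∈ C.map Hdr.var then .int (H e' v) else
        if v ∈ C'.map Hdr.var then .errMem else e' v := by
      rw [segG] at he
      split_ifs at he with hP
      exact ⟨hP, by cases he; rfl⟩
    obtain ⟨hP, hee⟩ := hPe
    have hb : Base z e := by
      intro v hv
      rw [hee]
      have h1 : v ∉ C.map Hdr.var := fun hv' => by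
        obtain ⟨l, hl, rfl⟩ := List.mem_map.1 hv'
        exact hv (h.ok.closed l (by simp [hl])).2.2
      have h2 : v ∉ C'.map Hdr.var := fun hv' => by
        obtain ⟨l, hl, rfl⟩ := List.mem_map.1 hv'
        exact hv (h.ok'.closed l (by simp [hl])).2.2
      simp only [if_neg h1, if_neg h2]
      exact hb' v hv
    have hsim : ∀ f f', Box e' (B.map (Hdr.nums (holeVal Γ z) z)) f →
        Box e (B.map (Hdr.nums (holeVal Γ z) z)) f' → (∀ v ∈ B.map Hdr.var, f v = f' v) →
        ∀ t, (tail'.fill Γ).Tr f t ↔ (tail.fill Γ).Tr f' t := by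
      intro f f' hf hf' hff t
      obtain ⟨k1, k2, k3⟩ := key f hf
      have hs := h.sim f k1
      have : segG (C.map Hdr.var) (C'.map Hdr.var) P H f = some f' := by
        rw [segG, if_pos (k2.2 hP), k3, Option.some.injEq]
        funext v
        by_cases hvB : v ∈ B.map Hdr.var
        · simp only [if_neg (hsB v hvB).1, if_neg (hsB v hvB).2, hff v hvB]
        · rw [hf'.1 v (by rwa [map_fst_nums]), hee, hf.1 v (by rwa [map_fst_nums])]
      rw [this] at hs
      exact hs.1 t
    exact ⟨nest_tr_mono hΓ hcB hnB hB hb' hb fun f f' hf hf' hff t => (hsim f f' hf hf' hff t).1,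
      nest_tr_mono hΓ hcB hnB hB hb hb' fun f f' hf hf' hff t =>
        (hsim f' f hf' hf (fun v hv => (hff v hv).symm) t).2⟩
  · intro he t
    have hP : ¬ P e' := by
      rw [segG] at he
      split_ifs at he with hP
      exact hP
    refine nest_tr_nil_iff hΓ hcB hnB hB hb' fun f hf t => ?_
    obtain ⟨k1, k2, -⟩ := key f hf
    have hs := h.sim f k1
    rw [segG, if_neg fun h => hP (k2.1 h)] at hs
    rw [hs.1 t]
    simp [Stmt.fill, Stmt.tr_nop]

/-- The traces of the new loops below `A`, in terms of those of the old ones. -/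
theorem Repl.segment_tr (hΓ : Compatible m n Γ) (h : Repl Γ z core A C C' B tail tail' P H strict)
    (hst : strict) {e : Env} (he : IntOn z.env (A.map Hdr.var) e)
    (hr : ReachOK ((C ++ B).map (Hdr.nums (holeVal Γ z) z))) {t : List Act} :
    ((nest (C' ++ B) tail').fill Γ).Tr e t ↔
      Conc (fun e t => ((nest B tail).fill Γ).Tr e t)
        (enum (C.map (Hdr.nums (holeVal Γ z) z)) e) t := by
  have hcC' : ∀ l ∈ C', l.Closed m n := fun l hl => h.ok'.closed l (by simp [hl])
  have hnC' : ((C'.map (Hdr.nums (holeVal Γ z) z)).map Prod.fst).Nodup := by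
    rw [map_fst_nums]
    have := h.ok'.nodup
    simp only [List.map_append, List.nodup_append] at this
    exact this.1.2.1
  have hb : Base z e := he.base_of_closed fun l hl => h.ok.closed l (by simp [hl])
  rw [List.map_append] at hr
  have hr' := h.seg.reach hst _ hr
  rw [nest_append, nest_serial_tr_iff hΓ hcC' h.serial hr'.prefix hb]
  by_cases hp : ∀ x ∈ C'.map (Hdr.nums (holeVal Γ z) z), 0 < x.2.2
  · have hC0 := h.seg.pos hst _ hr hp
    have hB := hr'.suffix hp
    have herr : ∀ v ∈ (C'.map (Hdr.nums (holeVal Γ z) z)).map Prod.fst, e v = .errMem := by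
      intro v hv
      rw [he.1 v, h.loop_new hv]
      intro hvA
      rw [← vars_nums (holeVal Γ z) z] at hvA
      obtain ⟨x, hx, rfl⟩ := List.mem_map.1 hvA
      exact (h.sep_left x hx).2 hv
    rw [← h.seg.exact hst hC0 e herr]
    rw [map_fst_nums, map_fst_nums]
    refine conc_filterMap fun e' he' => ?_
    rw [mem_enum hnC'] at he'
    refine h.inner_tr hΓ ⟨fun v hv => ?_, fun v hv => ?_⟩ hB
    · rw [List.map_append, List.mem_append, not_or] at hv
      rw [he'.1 v (by rw [map_fst_nums]; exact hv.2), he.1 v hv.1]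
    · by_cases hvC : v ∈ C'.map Hdr.var
      · exact he'.intOn.2 v (by rwa [map_fst_nums])
      · rw [List.map_append, List.mem_append] at hv
        rw [he'.1 v (by rwa [map_fst_nums])]
        exact he.2 v (hv.resolve_right hvC)
  -- Some new loop is empty. If all old loops were nonempty, covering would produce an iteration of
  -- the new ones, from any start environment in which the new variables are cleared.
  · have hC : ∃ x ∈ C.map (Hdr.nums (holeVal Γ z) z), x.2.2 ≤ 0 := by
      by_contra hC
      push Not at hC
      refine hp fun x hx => ?_
      by_contra hx0
      have hcov := h.seg.cover (fun x hx => (hC x hx).le) (fun v => .errMem) (fun _ _ => rfl)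
      rw [enum_eq_nil hx (not_lt.1 hx0)] at hcov
      have : ∀ N : List NumLoop, (∀ x ∈ N, 0 < x.2.2) → ∀ ρ, ∃ f, f ∈ enum N ρ := by
        intro N
        induction N with
        | nil => exact fun _ ρ => ⟨ρ, by simp [enum]⟩
        | cons x N ih =>
          intro hN ρ
          obtain ⟨f, hf⟩ := ih (fun y hy => hN y (by simp [hy]))
            (Function.update ρ x.1 (.int (x.2.1 + (0 : ℕ))))
          have := hN x (by simp)
          exact ⟨f, List.mem_flatMap.2 ⟨0, by simp [this], hf⟩⟩
      obtain ⟨f, hf⟩ := this _ hC fun v => .errMem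
      obtain ⟨f', hf', -⟩ := hcov f hf
      simp at hf'
    push Not at hp
    obtain ⟨x, hx, hx0⟩ := hp
    obtain ⟨y, hy, hy0⟩ := hC
    rw [enum_eq_nil hx hx0, enum_eq_nil hy hy0, conc_nil, conc_nil]

/-- The outer loops `A` are common to both nests. Below them the new loops are serial, and their
traces are the concatenations over the old iterations in order. Parallel old loops have these traces
among others; serial ones have no others. -/
theorem Repl.tr_sub (hΓ : Compatible m n Γ) (h : Repl Γ z core A C C' B tail tail' P H strict)
    (hst : strict) (hr : ReachOK ((A ++ C ++ B).map (Hdr.nums (holeVal Γ z) z))) :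
    (∀ t, ((nest (A ++ C' ++ B) tail').fill Γ).Tr z.env t →
      ((nest (A ++ C ++ B) tail).fill Γ).Tr z.env t) ∧
    ((∀ c ∈ C, c.ord = .serial) → ∀ t, ((nest (A ++ C ++ B) tail).fill Γ).Tr z.env t →
      ((nest (A ++ C' ++ B) tail').fill Γ).Tr z.env t) := by
  have hcA : ∀ l ∈ A, l.Closed m n := fun l hl => h.ok.closed l (by simp [hl])
  have hcC : ∀ l ∈ C, l.Closed m n := fun l hl => h.ok.closed l (by simp [hl])
  have hnA : (A.map Hdr.var).Nodup := by
    have := h.ok.nodup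
    simp only [List.map_append, List.nodup_append] at this
    exact this.1.1
  rw [List.append_assoc, List.append_assoc, nest_append A, nest_append A]
  rw [List.append_assoc, List.map_append] at hr
  have env_eq : ∀ e e', Box z.env (A.map (Hdr.nums (holeVal Γ z) z)) e →
      Box z.env (A.map (Hdr.nums (holeVal Γ z) z)) e' → (∀ v ∈ A.map Hdr.var, e v = e' v) → e = e' := by
    intro e e' he he' hee
    funext v
    by_cases hv : v ∈ A.map Hdr.var
    · exact hee v hv
    · rw [he.1 v (by rwa [map_fst_nums]), he'.1 v (by rwa [map_fst_nums])]
  have hint : ∀ e, Box z.env (A.map (Hdr.nums (holeVal Γ z) z)) e → IntOn z.env (A.map Hdr.var) e :=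
    fun e he => by have := he.intOn; rwa [map_fst_nums] at this
  constructor
  · intro t
    refine nest_tr_mono hΓ hcA hnA hr.prefix (Base.refl z) (Base.refl z) fun e e' he he' hee t ht => ?_
    obtain rfl := env_eq e e' he he' hee
    have hr2 := hr.suffix he.pos
    rw [h.segment_tr hΓ hst (hint e he) hr2] at ht
    rw [nest_append]
    rw [List.map_append] at hr2
    exact nest_tr_of_conc hΓ hcC hr2.prefix ((hint e he).base_of_closed hcA) ht
  · intro hser t
    refine nest_tr_mono hΓ hcA hnA hr.prefix (Base.refl z) (Base.refl z) fun e e' he he' hee t ht => ?_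
    obtain rfl := env_eq e e' he he' hee
    have hr2 := hr.suffix he.pos
    rw [h.segment_tr hΓ hst (hint e he) hr2]
    rw [nest_append] at ht
    rw [List.map_append] at hr2
    exact (nest_serial_tr_iff hΓ hcC hser hr2.prefix ((hint e he).base_of_closed hcA)).1 ht

end Repl

end Halide

namespace Halide

variable {m n : ℕ} {Γ : Hole → Expr Ver Empty} {z : Input m n}

/-! ## Loop directives preserve what a stage computes -/

theorem Sem.mono {core tail : Stmt Hole} {N₀ N : List NumLoop} {strict strict' : Prop}
    {dec decP : Env → Option Env} (h : Sem Γ z core N₀ N tail strict dec decP) (hs : strict' → strict) :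
    Sem Γ z core N₀ N tail strict' dec decP :=
  ⟨h.sim, h.dec_int, h.decP_int, h.redLen, h.pureLen, h.slice, h.cover, fun h' => h.box (hs h'),
    fun h' => h.inj (hs h')⟩

/-- The code of a stage after loop directives. If `pureOnly` holds all of its loops are pure, and if
`strict` holds there are no redundant iterations. -/
structure StageOK (m n : ℕ) (core : Stmt Hole) (Ls₀ : List Hdr) (pureOnly strict : Prop)
    (Ls : List Hdr) (tail : Stmt Hole) : Prop where
  ok : NestOK m n core Ls tail
  pure : pureOnly → ∀ h ∈ Ls, h.var.IsPure
  sem : ∀ (Γ : Hole → Expr Ver Empty) (z : Input m n), Compatible m n Γ → ∃ dec decP,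
    Sem Γ z core (Ls₀.map (Hdr.nums (holeVal Γ z) z)) (Ls.map (Hdr.nums (holeVal Γ z) z)) tail strict
      dec decP

theorem NestOK.split_modLoop {core tail : Stmt Hole} {Ls : List Hdr} (hok : NestOK m n core Ls tail)
    (hc : IsCore core) {τ : Order} {x xo xi : Var} {lo len fac : TExpr} {s : Stmt Hole} (φ : Tail)
    (hsub : (Stmt.loop τ x lo len s).Sub (nest Ls tail)) (hfac : fac.Closed m n)
    (hpos : ∀ (Γ : Hole → Expr Ver Empty) (z : Input m n), 0 < fac.num (holeVal Γ z) z)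
    (hoi : xo ≠ xi) (hxo : ¬ (nest Ls tail).Mentions xo) (hxi : ¬ (nest Ls tail).Mentions xi)
    (hlo : xo.IsLoop) (hli : xi.IsLoop) :
    ∃ A B, Ls = A ++ [⟨τ, x, lo, len⟩] ++ B ∧
      (nest Ls tail).modLoop x (Stmt.split xo xi fac φ) =
        nest (A ++ [⟨.serial, xo, .const 0, len.ceilDiv fac⟩, ⟨.serial, xi, .const 0, fac⟩] ++ B)
          (tail.pushDown [x] (φ.wrap x xo xi lo len fac)) ∧
      ∀ (Γ : Hole → Expr Ver Empty) (z : Input m n), Compatible m n Γ → ∃ P H,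
        Repl Γ z core A [⟨τ, x, lo, len⟩]
          [⟨.serial, xo, .const 0, len.ceilDiv fac⟩, ⟨.serial, xi, .const 0, fac⟩] B tail
          (tail.pushDown [x] (φ.wrap x xo xi lo len fac)) P H (φ = .guard) := by
  obtain ⟨A, B, rfl, rfl⟩ := loop_sub_nest hc hok.below hsub
  have e : A ++ ⟨τ, x, lo, len⟩ :: B = A ++ [⟨τ, x, lo, len⟩] ++ B := by simp
  refine ⟨A, B, e, ?_, fun Γ z hΓ => ?_⟩
  · rw [modLoop_nest (h := ⟨τ, x, lo, len⟩) hok.nodup]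
    simp only [nest_cons, Stmt.split, pushDown_nest, List.append_assoc, List.cons_append,
      List.nil_append, nest_append]
  · rw [e] at hok hxo hxi
    exact ⟨_, _, Repl.split hΓ φ hok hc hfac (hpos Γ z) hoi hxo hxi hlo hli⟩

theorem NestOK.fuse_modLoop {core tail : Stmt Hole} {Ls : List Hdr} (hok : NestOK m n core Ls tail)
    (hc : IsCore core) {τ₁ τ₂ : Order} {x₁ x₂ y : Var} {lo₁ len₁ lo₂ len₂ : TExpr} {s : Stmt Hole}
    (hsub : (Stmt.loop τ₁ x₁ lo₁ len₁ (.loop τ₂ x₂ lo₂ len₂ s)).Sub (nest Ls tail))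
    (hy : ¬ (nest Ls tail).Mentions y) (hly : y.IsLoop) :
    ∃ A B tail', Ls = A ++ [⟨τ₁, x₁, lo₁, len₁⟩, ⟨τ₂, x₂, lo₂, len₂⟩] ++ B ∧
      (nest Ls tail).modLoop x₁ (Stmt.fuse y) =
        nest (A ++ [⟨.serial, y, .const 0, len₁.times len₂⟩] ++ B) tail' ∧
      ∀ (Γ : Hole → Expr Ver Empty) (z : Input m n), Compatible m n Γ → ∃ P H,
        Repl Γ z core A [⟨τ₁, x₁, lo₁, len₁⟩, ⟨τ₂, x₂, lo₂, len₂⟩]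
          [⟨.serial, y, .const 0, len₁.times len₂⟩] B tail tail' P H True := by
  obtain ⟨A, B', rfl, hs⟩ := loop_sub_nest hc hok.below hsub
  cases B' with
  | nil =>
    rw [nest_nil] at hs
    exact (hok.below.not_loop_sub hc (by rw [← hs]; exact .inl rfl : (Stmt.loop τ₂ x₂ lo₂ len₂ s).Sub _)).elim
  | cons h B =>
    obtain ⟨o, v, a, b⟩ := h
    simp only [nest_cons, Stmt.loop.injEq] at hs
    obtain ⟨rfl, rfl, rfl, rfl, rfl⟩ := hs
    have e : A ++ ⟨τ₁, x₁, lo₁, len₁⟩ :: ⟨τ₂, x₂, lo₂, len₂⟩ :: B =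
        A ++ [⟨τ₁, x₁, lo₁, len₁⟩, ⟨τ₂, x₂, lo₂, len₂⟩] ++ B := by simp
    refine ⟨A, B, tail.pushDown [x₁, x₂] fun s' =>
      .letIn x₁ (lo₁.plus (bin .div rfl (.var y) len₂))
        (.letIn x₂ (lo₂.plus (bin .mod rfl (.var y) len₂)) s'), e, ?_, fun Γ z hΓ => ?_⟩
    rotate_left
    · rw [e] at hok hy
      exact ⟨_, _, Repl.fuse hΓ hok hc hy hly⟩
    · rw [modLoop_nest (h := ⟨τ₁, x₁, lo₁, len₁⟩) hok.nodup]
      simp only [nest_cons, Stmt.fuse, pushDown_nest, List.append_assoc, List.cons_append,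
        List.nil_append, nest_append]

theorem Repl.sem {core tail tail' : Stmt Hole} {A B C C' Ls₀ : List Hdr} {P : Env → Prop}
    {H : Env → Var → ℤ} {strict q : Prop} {dec decP : Env → Option Env}
    (h : Repl Γ z core A C C' B tail tail' P H q)
    (hsem : Sem Γ z core (Ls₀.map (Hdr.nums (holeVal Γ z) z))
      ((A ++ C ++ B).map (Hdr.nums (holeVal Γ z) z)) tail strict dec decP)
    (hk : ((∀ x ∈ C, x.var.IsPure) ∧ ∀ x ∈ C', x.var.IsPure) ∨
      q ∧ (∀ x ∈ C, x.var.IsRed) ∧ ∀ x ∈ C', x.var.IsRed) :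
    ∃ dec' decP', Sem Γ z core (Ls₀.map (Hdr.nums (holeVal Γ z) z))
      ((A ++ C' ++ B).map (Hdr.nums (holeVal Γ z) z)) tail' (strict ∧ q) dec' decP' := by
  have nd := h.ok.nodup
  have nd' := h.ok'.nodup
  rw [← vars_nums (holeVal Γ z) z] at nd nd'
  have hl : ∀ v ∈ vars ((A ++ C' ++ B).map (Hdr.nums (holeVal Γ z) z)), v.IsLoop := by
    rw [vars_nums]
    intro v hv
    obtain ⟨x, hx, rfl⟩ := List.mem_map.1 hv
    exact (h.ok'.closed x hx).2.2
  have hsim := h.sim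
  rw [← vars_nums (holeVal Γ z) z, ← vars_nums (holeVal Γ z) z, ← vars_nums (holeVal Γ z) z] at hsim
  have hm : ∀ {K : Var → Prop} {D : List Hdr}, (∀ x ∈ D, K x.var) →
      ∀ x ∈ D.map (Hdr.nums (holeVal Γ z) z), K x.1 := by
    intro K D hD x hx
    obtain ⟨y, hy, rfl⟩ := List.mem_map.1 hx
    exact hD y hy
  rw [List.map_append, List.map_append] at nd nd' hl hsem hsim ⊢
  exact hsem.segment h.seg nd nd' hl
    (hk.imp (fun h => ⟨hm h.1, hm h.2⟩) fun h => ⟨h.1, hm h.2.1, hm h.2.2⟩) hsim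

theorem NestOK.perm {core tail : Stmt Hole} {Ls Ls' : List Hdr} (h : NestOK m n core Ls tail)
    (hp : Ls.Perm Ls') : NestOK m n core Ls' tail :=
  ⟨fun x hx => h.closed x (hp.mem_iff.2 hx), (hp.map _).nodup_iff.1 h.nodup,
    fun x hx => h.serial x (hp.mem_iff.2 hx), h.below, fun x hx => h.fresh x (hp.mem_iff.2 hx)⟩

theorem num_toTgt_pos {fac : AExpr} (hf : fac.Startup m n)
    (hpos : ∀ z : Input m n, ∃ k : ℤ, 0 < k ∧ fac.eval z.env (fun _ _ => .errMem) Empty.elim = .int k)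
    (η : Hole → ℤ) (z : Input m n) : 0 < fac.toTgt.num η z := by
  obtain ⟨k, h1, h2⟩ := hpos z
  have : fac.toTgt.tval η z.env = .int k := by
    rw [← h2]
    exact hf.closed.1.eval_lower
  rwa [Expr.num_eq_of_tval this]

/-- The split directives among `ds` for the given stage use the guard strategy. -/
def GuardsOnly (ds : List LoopDir) (f i j : ℕ) : Prop :=
  ∀ l xo xi fac φ, LoopDir.split l xo xi fac φ ∈ ds → l.func = f → l.idx = i → l.spec = j → φ = .guard

/-- Split and fuse replace a segment, swap is a permutation that keeps the order of the reduction
loops, and traverse changes the order flag of a pure loop, which `Sem` does not see. -/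
theorem StageOK.apply {T : Prog Hole m n} {s : LoopDir} (hs : s.Valid T) {core tail : Stmt Hole}
    {Ls₀ Ls : List Hdr} {strict : Prop} (hc : IsCore core)
    (hb : ∀ b, T.StageAt s.loopName b → b = nest Ls tail)
    (h : StageOK m n core Ls₀ (s.loopName.idx = 0) strict Ls tail) :
    ∃ Ls' tail', (nest Ls tail).modLoop s.loopName.var s.rewrite = nest Ls' tail' ∧
      StageOK m n core Ls₀ (s.loopName.idx = 0)
        (strict ∧ GuardsOnly [s] s.loopName.func s.loopName.idx s.loopName.spec) Ls' tail' := by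
  have isLoop_of : ∀ {v w : Var}, (v.IsPure ∧ w.IsPure) ∨ (v.IsRed ∧ w.IsRed) → w.IsLoop := by
    rintro v w (h | h)
    · exact h.2.isLoop
    · exact h.2.isLoop
  cases s with
  | split l xo xi fac φ =>
    obtain ⟨⟨τ, lo, len, s, body, hat, hsub⟩, hoi, ⟨hxo, ko⟩, ⟨hxi, ki⟩, hfac, hpos, hφ⟩ := hs
    have hxo := hxo body hat
    have hxi := hxi body hat
    obtain rfl := hb body hat
    obtain ⟨A, B, rfl, e, hR⟩ := h.ok.split_modLoop hc φ hsub hfac.closed.lower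
      (fun Γ z => num_toTgt_pos hfac hpos (holeVal Γ z) z) hoi hxo hxi (isLoop_of ko) (isLoop_of ki)
    refine ⟨_, _, e, ?_, fun h0 => ?_, fun Γ z hΓ => ?_⟩
    · classical
      -- The form of the new nest does not depend on a hole substitution or an input, but `hR`
      -- yields it for given ones only; zero holes and a zero input will do.
      obtain ⟨P, H, hR⟩ := hR (fun _ => .const 0) ⟨fun _ => 0, fun _ => 0, fun _ => 0⟩
        fun _ => ⟨by simp [Expr.Sub], by simp [Expr.vars]⟩
      exact hR.ok'
    · have hp := h.pure h0
      have hx : l.var.IsPure := hp ⟨τ, l.var, lo, len⟩ (by simp)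
      have k1 : xo.IsPure := (ko.resolve_right fun h => hx.not_isRed h.1).2
      have k2 : xi.IsPure := (ki.resolve_right fun h => hx.not_isRed h.1).2
      intro y hy
      simp only [List.mem_append, List.mem_cons, List.not_mem_nil, or_false] at hy
      rcases hy with (hy | rfl | rfl) | hy
      · exact hp y (by simp [hy])
      · exact k1
      · exact k2
      · exact hp y (by simp [hy])
    · obtain ⟨P, H, hR⟩ := hR Γ z hΓ
      obtain ⟨dec, decP, hsem⟩ := h.sem Γ z hΓ
      obtain ⟨dec', decP', hsem'⟩ := hR.sem hsem (by
        by_cases hx : l.var.IsPure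
        · left
          have k1 : xo.IsPure := (ko.resolve_right fun h => hx.not_isRed h.1).2
          have k2 : xi.IsPure := (ki.resolve_right fun h => hx.not_isRed h.1).2
          simp [hx, k1, k2]
        · right
          have k1 := ko.resolve_left fun h => hx h.1
          have k2 := ki.resolve_left fun h => hx h.1
          refine ⟨?_, by simp [k1], by simp [k1, k2]⟩
          -- All loops of stage `0` are pure, so a reduction loop belongs to an update stage, where
          -- only the guard strategy is allowed; this provides the exactness needed for reduction
          -- segments.
          have h0 : ¬ l.idx = 0 := fun h0 => hx (h.pure h0 ⟨τ, l.var, lo, len⟩ (by simp))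
          cases φ with
          | guard => rfl
          | shift => exact (h0 (hφ (.inl rfl))).elim
          | round => exact (h0 (hφ (.inr rfl))).elim)
      exact ⟨dec', decP', hsem'.mono fun hh => ⟨hh.1, hh.2 l xo xi fac φ (by simp) rfl rfl rfl⟩⟩
  | fuse l y =>
    obtain ⟨⟨τ, lo, len, τ', x', lo', len', s, ⟨body, hat, hsub⟩, hk⟩, hy, ky⟩ := hs
    have hy := hy body hat
    obtain rfl := hb body hat
    obtain ⟨A, B, tail', rfl, e, hR⟩ := h.ok.fuse_modLoop hc hsub hy (isLoop_of ky)
    refine ⟨_, _, e, ?_, fun h0 => ?_, fun Γ z hΓ => ?_⟩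
    · obtain ⟨P, H, hR⟩ := hR (fun _ => .const 0) ⟨fun _ => 0, fun _ => 0, fun _ => 0⟩
        fun _ => ⟨by simp [Expr.Sub], by simp [Expr.vars]⟩
      exact hR.ok'
    · have hp := h.pure h0
      have hx : l.var.IsPure := hp ⟨τ, l.var, lo, len⟩ (by simp)
      have k1 : y.IsPure := (ky.resolve_right fun h => hx.not_isRed h.1).2
      intro y' hy'
      simp only [List.mem_append, List.mem_cons, List.not_mem_nil, or_false] at hy'
      rcases hy' with (hy' | rfl) | hy'
      · exact hp y' (by simp [hy'])
      · exact k1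
      · exact hp y' (by simp [hy'])
    · obtain ⟨P, H, hR⟩ := hR Γ z hΓ
      obtain ⟨dec, decP, hsem⟩ := h.sem Γ z hΓ
      obtain ⟨dec', decP', hsem'⟩ := hR.sem hsem (by
        by_cases hx : l.var.IsPure
        · left
          have k1 : y.IsPure := (ky.resolve_right fun h => hx.not_isRed h.1).2
          have k2 : x'.IsPure := (hk.resolve_right fun h => hx.not_isRed h.1).2
          simp [hx, k1, k2]
        · right
          have k1 := ky.resolve_left fun h => hx h.1
          have k2 := hk.resolve_left fun h => hx h.1
          exact ⟨trivial, by simp [k2], by simp [k1]⟩)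
      exact ⟨dec', decP', hsem'.mono fun hh => ⟨hh.1, trivial⟩⟩
  | swap l =>
    obtain ⟨τ, lo, len, τ', x', lo', len', s, ⟨body, hat, hsub⟩, hk⟩ := hs
    obtain rfl := hb body hat
    obtain ⟨A, B', rfl, hs⟩ := loop_sub_nest hc h.ok.below hsub
    cases B' with
    | nil =>
      rw [nest_nil] at hs
      exact (h.ok.below.not_loop_sub hc (by rw [← hs]; exact .inl rfl : (Stmt.loop τ' x' lo' len' s).Sub _)).elim
    | cons h' B =>
      obtain ⟨o, v, a, b⟩ := h'
      simp only [nest_cons, Stmt.loop.injEq] at hs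
      obtain ⟨rfl, rfl, rfl, rfl, rfl⟩ := hs
      have hp : (A ++ ⟨τ, l.var, lo, len⟩ :: ⟨τ', x', lo', len'⟩ :: B).Perm
          (A ++ ⟨τ', x', lo', len'⟩ :: ⟨τ, l.var, lo, len⟩ :: B) := (List.Perm.swap _ _ B).append_left A
      refine ⟨A ++ ⟨τ', x', lo', len'⟩ :: ⟨τ, l.var, lo, len⟩ :: B, tail, ?_, h.ok.perm hp,
        fun h0 x hx => h.pure h0 x (hp.mem_iff.2 hx), fun Γ z hΓ => ?_⟩
      · have := modLoop_nest (h := ⟨τ, l.var, lo, len⟩) h.ok.nodup tail Stmt.swap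
        simp only [LoopDir.loopName, LoopDir.rewrite] at this ⊢
        rw [this]
        simp only [nest_cons, Stmt.swap, nest_append]
      · obtain ⟨dec, decP, hsem⟩ := h.sem Γ z hΓ
        refine ⟨dec, decP, (hsem.perm (fun x => (hp.map _).mem_iff) ?_).mono And.left⟩
        -- The side condition of swap: two adjacent loops are not both reduction loops, so the list
        -- of reduction loops is the same after the exchange.
        have e1 : ∀ x y : NumLoop, (x.1.IsPure ∨ y.1.IsPure) → ∀ N, redL (x :: y :: N) = redL (y :: x :: N) := by
          rintro x y (hx | hx) N
          · simp [redL, List.filter_cons, Var.pureB_iff.2 hx]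
          · simp [redL, List.filter_cons, Var.pureB_iff.2 hx]
        simp only [List.map_append, redL_append, List.map_cons]
        rw [e1]
        exact hk
  | traverse l τ₁ =>
    obtain ⟨⟨τ, lo, len, s, body, hat, hsub⟩, hx⟩ := hs
    obtain rfl := hb body hat
    obtain ⟨A, B, rfl, rfl⟩ := loop_sub_nest hc h.ok.below hsub
    have em : ∀ {β : Type} (g : Hdr → β), g ⟨τ₁, l.var, lo, len⟩ = g ⟨τ, l.var, lo, len⟩ →
        (A ++ ⟨τ₁, l.var, lo, len⟩ :: B).map g = (A ++ ⟨τ, l.var, lo, len⟩ :: B).map g := by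
      intro β g hg
      simp [hg]
    refine ⟨A ++ ⟨τ₁, l.var, lo, len⟩ :: B, tail, ?_, ⟨?_, ?_, ?_, h.ok.below, ?_⟩, fun h0 => ?_,
      fun Γ z hΓ => ?_⟩
    · have := modLoop_nest (h := ⟨τ, l.var, lo, len⟩) h.ok.nodup tail (Stmt.traverse τ₁)
      simp only [LoopDir.loopName, LoopDir.rewrite] at this ⊢
      rw [this]
      simp only [nest_cons, Stmt.traverse, nest_append]
    · have := h.ok.closed
      simp only [List.mem_append, List.mem_cons] at this ⊢
      rintro y (hy | rfl | hy)
      · exact this y (.inl hy)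
      · exact this ⟨τ, l.var, lo, len⟩ (.inr (.inl rfl))
      · exact this y (.inr (.inr hy))
    · rw [em Hdr.var rfl]; exact h.ok.nodup
    · have := h.ok.serial
      simp only [List.mem_append, List.mem_cons] at this ⊢
      rintro y (hy | rfl | hy) hp
      · exact this y (.inl hy) hp
      · exact (hp hx).elim
      · exact this y (.inr (.inr hy)) hp
    · have := h.ok.fresh
      simp only [List.mem_append, List.mem_cons] at this ⊢
      rintro y (hy | rfl | hy)
      · exact this y (.inl hy)
      · exact this ⟨τ, l.var, lo, len⟩ (.inr (.inl rfl))
      · exact this y (.inr (.inr hy))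
    · have := h.pure h0
      simp only [List.mem_append, List.mem_cons] at this ⊢
      rintro y (hy | rfl | hy)
      · exact this y (.inl hy)
      · exact hx
      · exact this y (.inr (.inr hy))
    · obtain ⟨dec, decP, hsem⟩ := h.sem Γ z hΓ
      refine ⟨dec, decP, Sem.mono ?_ And.left⟩
      rw [em _ rfl]
      exact hsem

end Halide

namespace Halide

variable {m n : ℕ}

/-! ## The form of scheduled programs -/

/-- The version of the func after its stage `i` in specialization `j`. -/
def Func.ver (F : Func) (i j : ℕ) : Ver := if i = F.updates.length then .last else .mid i j

/-- The single point update of stage `i` in specialization `j`. -/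
def Func.core (F : Func) (i j : ℕ) (U : Update F.arity) : Stmt Hole :=
  let lw : AExpr → TExpr := Expr.lower F.name (.mid (i - 1) j)
  .ite (lw U.pred) (.assign F.name (F.ver i j) F.arity (fun d => lw (U.lhs d)) (lw U.rhs)) .nop

/-- The dimensions over which a stage loops. -/
def Func.dims (F : Func) (U : Update F.arity) : List (Fin F.arity) :=
  (List.finRange F.arity).filter fun d => (U.lhs d).isVar (.pure (F.vars d))

def Func.pureHdrs (F : Func) (v : Ver) (U : Update F.arity) : List Hdr :=
  ((F.dims U).map fun d => ⟨.serial, .pure (F.vars d), .hole (.cpu F.name v d .min),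
    .hole (.cpu F.name v d .len)⟩).reverse

def Func.redHdrs (F : Func) (i j : ℕ) (U : Update F.arity) : List Hdr :=
  (U.rdom.map fun b => ⟨.serial, .red b.1, b.2.1.lower F.name (.mid (i - 1) j),
    b.2.2.lower F.name (.mid (i - 1) j)⟩).reverse

/-- The loops that lowering emits. -/
def Func.hdrs (F : Func) (i j : ℕ) (U : Update F.arity) : List Hdr :=
  F.pureHdrs (F.ver i j) U ++ F.redHdrs i j U

def Func.label (F : Func) (i j : ℕ) (U : Update F.arity) : Stage :=
  ⟨F.name, F.arity, i, j, F.ver i j, !U.rdom.isEmpty⟩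

/-- The code of the stages of a func, with loop nests `B`. -/
def Func.stagesCode (F : Func) (B : ℕ → ℕ → ℕ → Stmt Hole) (j : ℕ) : Stmt Hole :=
  seqs (F.stages.zipIdx.map fun U => .label (.stage (F.label U.2 j U.1)) (B F.name U.2 j))

def Func.branchCode (F : Func) (B : ℕ → ℕ → ℕ → Stmt Hole) : List AExpr → ℕ → Stmt Hole
  | [], _ => .label (.spec F.name 0) (F.stagesCode B 0)
  | e :: es, j => .ite e.toTgt (.label (.spec F.name j) (F.stagesCode B j)) (F.branchCode B es (j + 1))

def Func.specCode (F : Func) (B : ℕ → ℕ → ℕ → Stmt Hole) : Option (List AExpr) → Stmt Hole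
  | none => F.stagesCode B 0
  | some es => F.branchCode B es 1

def Func.code (F : Func) (B : ℕ → ℕ → ℕ → Stmt Hole) (sp : Option (List AExpr)) : Stmt Hole :=
  .seq (.alloc F.name F.arity fun d => (.hole (.mem F.name d .min), .hole (.mem F.name d .len)))
    (.label (.func F.name) (F.specCode B sp))

def Alg.code (P : Alg) (B : ℕ → ℕ → ℕ → Stmt Hole) (sp : ℕ → Option (List AExpr)) : Stmt Hole :=
  seqs (P.funcs.map fun F => F.code B (sp F.name))

/-! ### Lowering -/

theorem foldl_loop {β : Type} (g : β → Hdr) (L : List β) (s : Stmt Hole) :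
    L.foldl (fun s b => .loop (g b).ord (g b).var (g b).lo (g b).len s) s = nest (L.map g).reverse s := by
  induction L generalizing s with
  | nil => rfl
  | cons b L ih => rw [List.foldl_cons, ih, List.map_cons, List.reverse_cons, nest_append]; rfl

theorem foldl_ite {β γ : Type} (p : β → Bool) (g : γ → β → γ) (L : List β) (s : γ) :
    L.foldl (fun s b => if p b then g s b else s) s = (L.filter p).foldl g s := by
  induction L generalizing s with
  | nil => rfl
  | cons b L ih =>
    rw [List.foldl_cons, ih, List.filter_cons]
    split_ifs <;> rfl

/-- A left fold puts the loop of the first list element innermost, whereas `nest` lists the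
outermost loop first. This is the reason for the reversals in `pureHdrs` and `redHdrs`. -/
theorem Func.lowerStage_eq (F : Func) (i : ℕ) (U : Update F.arity) :
    F.lowerStage i U = .label (.stage (F.label i 0 U)) (nest (F.hdrs i 0 U) (F.core i 0 U)) := by
  have h1 := foldl_loop (fun b : ℕ × AExpr × AExpr => (⟨.serial, .red b.1,
    b.2.1.lower F.name (.mid (i - 1) 0), b.2.2.lower F.name (.mid (i - 1) 0)⟩ : Hdr)) U.rdom (F.core i 0 U)
  have h2 := foldl_loop (fun d : Fin F.arity => (⟨.serial, .pure (F.vars d),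
    .hole (.cpu F.name (F.ver i 0) d .min), .hole (.cpu F.name (F.ver i 0) d .len)⟩ : Hdr)) (F.dims U)
    (nest (F.redHdrs i 0 U) (F.core i 0 U))
  have h3 := foldl_ite (fun d : Fin F.arity => (U.lhs d).isVar (.pure (F.vars d)))
    (fun s d => Stmt.loop .serial (.pure (F.vars d)) (.hole (.cpu F.name (F.ver i 0) d .min))
      (.hole (.cpu F.name (F.ver i 0) d .len)) s) (List.finRange F.arity)
    (nest (F.redHdrs i 0 U) (F.core i 0 U))
  rw [Func.hdrs, nest_append, Func.pureHdrs, ← h2]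
  rw [Func.redHdrs] at h3 ⊢
  rw [← h1] at h3 ⊢
  exact congrArg _ h3

theorem Expr.respec_lower (f k j : ℕ) (e : AExpr) :
    (e.lower f (.mid k 0)).respec f j = e.lower f (.mid k j) := by
  induction e with
  | const c => rfl
  | var v => rfl
  | acc g l n args ih =>
    simp only [Expr.lower, Expr.respec, ih]
    by_cases h : g = f <;> simp [h, Ver.respec]
  | op o args ih => simp only [Expr.lower, Expr.respec, ih]
  | hole h => exact h.elim

theorem Func.ver_respec (F : Func) (i j : ℕ) : (F.ver i 0).respec j = F.ver i j := by
  rw [Func.ver, Func.ver]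
  split_ifs <;> rfl

theorem Stmt.respec_nest (f j : ℕ) (Ls : List Hdr) (s : Stmt Hole) :
    (nest Ls s).respec f j =
      nest (Ls.map fun h => ⟨h.ord, h.var, h.lo.respec f j, h.len.respec f j⟩) (s.respec f j) := by
  induction Ls with
  | nil => rfl
  | cons h Ls ih => simp only [nest_cons, Stmt.respec, ih, List.map_cons]

theorem Func.lowerStage_respec (F : Func) (i j : ℕ) (U : Update F.arity) :
    (F.lowerStage i U).respec F.name j =
      .label (.stage (F.label i j U)) (nest (F.hdrs i j U) (F.core i j U)) := by
  have hv := F.ver_respec i j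
  have hc : (F.core i 0 U).respec F.name j = F.core i j U := by
    simp only [Func.core, Stmt.respec, Expr.respec_lower, if_true, hv]
  have hp : (F.hdrs i 0 U).map (fun h => (⟨h.ord, h.var, h.lo.respec F.name j, h.len.respec F.name j⟩ : Hdr)) =
      F.hdrs i j U := by
    simp only [Func.hdrs, Func.pureHdrs, Func.redHdrs, List.map_append, List.map_reverse, List.map_map,
      Function.comp_def, Expr.respec, Expr.respec_lower, if_true, hv]
  rw [F.lowerStage_eq, Stmt.respec, Stmt.respec_nest, hc, hp]
  simp only [Func.label, if_true, hv]

theorem Stmt.respec_seqs (f j : ℕ) (l : List (Stmt Hole)) :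
    (seqs l).respec f j = seqs (l.map (Stmt.respec f j)) := by
  induction l with
  | nil => rfl
  | cons s l ih => exact congrArg _ ih

/-- The code of the stages right after lowering. -/
def Alg.bodies (P : Alg) (f i j : ℕ) : Stmt Hole :=
  match P.funcs.find? fun F => F.name = f with
  | none => .nop
  | some F => match F.stages[i]? with
    | none => .nop
    | some U => nest (F.hdrs i j U) (F.core i j U)

theorem find_func {L : List Func} (h : (L.map Func.name).Nodup) {F : Func} (hF : F ∈ L) :
    L.find? (fun G => G.name = F.name) = some F := by
  induction L with
  | nil => simp at hF
  | cons G L ih =>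
    rw [List.map_cons, List.nodup_cons] at h
    rcases List.mem_cons.1 hF with rfl | hF
    · simp
    · have : G.name ≠ F.name := fun e => h.1 (by rw [e]; exact List.mem_map_of_mem hF)
      rw [List.find?_cons_of_neg (by simpa using this), ih h.2 hF]

theorem Alg.bodies_eq {P : Alg} (hP : P.Valid) {F : Func} (hF : F ∈ P.funcs) {i : ℕ}
    {U : Update F.arity} (hU : F.stages[i]? = some U) (j : ℕ) :
    P.bodies F.name i j = nest (F.hdrs i j U) (F.core i j U) := by
  simp only [Alg.bodies, find_func hP.func_names hF, hU]

theorem mem_zipIdx_stages {F : Func} {U : Update F.arity × ℕ} (h : U ∈ F.stages.zipIdx) :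
    F.stages[U.2]? = some U.1 := by
  have := List.mem_zipIdx_iff_getElem?.1 h
  exact this

theorem Func.stagesCode_respec {P : Alg} (hP : P.Valid) {F : Func} (hF : F ∈ P.funcs) (j : ℕ) :
    (seqs (F.stages.zipIdx.map fun U => F.lowerStage U.2 U.1)).respec F.name j =
      F.stagesCode P.bodies j := by
  rw [Stmt.respec_seqs, List.map_map, Func.stagesCode]
  congr 1
  refine List.map_congr_left fun U hU => ?_
  rw [Function.comp_apply, F.lowerStage_respec, P.bodies_eq hP hF (mem_zipIdx_stages hU)]

theorem Alg.lower_eq {P : Alg} (hP : P.Valid) : P.lower.body = P.code P.bodies fun _ => none := by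
  simp only [Alg.lower, Alg.code]
  congr 1
  refine List.map_congr_left fun F hF => ?_
  simp only [Func.lower, Func.code, Func.specCode, Func.stagesCode]
  congr 3
  refine List.map_congr_left fun U hU => ?_
  rw [F.lowerStage_eq, P.bodies_eq hP hF (mem_zipIdx_stages hU)]

/-! ### Specialization -/

/-- The statement has no labels. -/
def Stmt.NoLabel : Stmt Hole → Prop
  | .seq s₁ s₂ => s₁.NoLabel ∧ s₂.NoLabel
  | .ite _ s₁ s₂ => s₁.NoLabel ∧ s₂.NoLabel
  | .loop _ _ _ _ s => s.NoLabel
  | .letIn _ _ s => s.NoLabel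
  | .label _ _ => False
  | _ => True

theorem Stmt.NoLabel.specialize {s : Stmt Hole} (h : s.NoLabel) (f : ℕ) (es : List AExpr) :
    s.specialize f es = s := by
  induction s with
  | seq s₁ s₂ ih₁ ih₂ => simp only [Stmt.specialize, ih₁ h.1, ih₂ h.2]
  | ite e s₁ s₂ ih₁ ih₂ => simp only [Stmt.specialize, ih₁ h.1, ih₂ h.2]
  | loop τ x lo len s ih => simp only [Stmt.specialize, ih h]
  | letIn x e s ih => simp only [Stmt.specialize, ih h]
  | label l s ih => exact h.elim
  | _ => rfl

theorem Stmt.NoLabel.modStage {s : Stmt Hole} (h : s.NoLabel) (l : LoopName) (g : Stmt Hole → Stmt Hole) :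
    s.modStage l g = s := by
  induction s with
  | seq s₁ s₂ ih₁ ih₂ => simp only [Stmt.modStage, ih₁ h.1, ih₂ h.2]
  | ite e s₁ s₂ ih₁ ih₂ => simp only [Stmt.modStage, ih₁ h.1, ih₂ h.2]
  | loop τ x lo len s ih => simp only [Stmt.modStage, ih h]
  | letIn x e s ih => simp only [Stmt.modStage, ih h]
  | label l s ih => exact h.elim
  | _ => rfl

theorem Stmt.NoLabel.not_sub {s : Stmt Hole} (h : s.NoLabel) (l : Label) (b : Stmt Hole) :
    ¬ (Stmt.label l b).Sub s := by
  induction s with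
  | seq s₁ s₂ ih₁ ih₂ => simp [Stmt.Sub, ih₁ h.1, ih₂ h.2]
  | ite e s₁ s₂ ih₁ ih₂ => simp [Stmt.Sub, ih₁ h.1, ih₂ h.2]
  | loop τ x lo len s ih => simp [Stmt.Sub, ih h]
  | letIn x e s ih => simp [Stmt.Sub, ih h]
  | label l s ih => exact h.elim
  | _ => simp [Stmt.Sub]

theorem Func.isCore_core (F : Func) (i j : ℕ) (U : Update F.arity) : IsCore (F.core i j U) :=
  ⟨_, _, _, _, _, _, rfl⟩

theorem Below.noLabel {core s : Stmt Hole} (hc : IsCore core) (hs : Below core s) : s.NoLabel := by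
  induction hs with
  | core => obtain ⟨p, f, v, k, args, e, rfl⟩ := hc; exact ⟨trivial, trivial⟩
  | letIn x e s _ _ _ ih => exact ih
  | guard e s _ _ ih => exact ⟨ih, trivial⟩

theorem noLabel_nest {Ls : List Hdr} {s : Stmt Hole} (h : s.NoLabel) : (nest Ls s).NoLabel := by
  induction Ls with
  | nil => exact h
  | cons l Ls ih => exact ih

theorem Alg.bodies_noLabel (P : Alg) (f i j : ℕ) : (P.bodies f i j).NoLabel := by
  rw [Alg.bodies]
  split
  · trivial
  · split
    · trivial
    · exact noLabel_nest (Below.core.noLabel (Func.isCore_core _ _ _ _))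

theorem Stmt.specialize_seqs (f : ℕ) (es : List AExpr) (l : List (Stmt Hole)) :
    (seqs l).specialize f es = seqs (l.map (Stmt.specialize f es)) := by
  induction l with
  | nil => rfl
  | cons s l ih => exact congrArg _ ih

theorem Func.stagesCode_specialize {B : ℕ → ℕ → ℕ → Stmt Hole} (hB : ∀ f i j, (B f i j).NoLabel)
    (F : Func) (j f : ℕ) (es : List AExpr) :
    (F.stagesCode B j).specialize f es = F.stagesCode B j := by
  rw [Func.stagesCode, Stmt.specialize_seqs, List.map_map]
  congr 1
  refine List.map_congr_left fun U _ => ?_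
  simp only [Function.comp_apply, Stmt.specialize, (hB _ _ _).specialize]

theorem Func.specCode_specialize {B : ℕ → ℕ → ℕ → Stmt Hole} (hB : ∀ f i j, (B f i j).NoLabel)
    (F : Func) (sp : Option (List AExpr)) (f : ℕ) (es : List AExpr) :
    (F.specCode B sp).specialize f es = F.specCode B sp := by
  have hb : ∀ es' j, (F.branchCode B es' j).specialize f es = F.branchCode B es' j := by
    intro es'
    induction es' with
    | nil => intro j; simp only [Func.branchCode, Stmt.specialize, F.stagesCode_specialize hB]
    | cons e es' ih =>
      intro j
      simp only [Func.branchCode, Stmt.specialize, F.stagesCode_specialize hB, ih]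
  cases sp with
  | none => exact F.stagesCode_specialize hB 0 f es
  | some es' => exact hb es' 1

theorem Func.branches_eq {P : Alg} (hP : P.Valid) {F : Func} (hF : F ∈ P.funcs) (es : List AExpr)
    (j : ℕ) : (F.stagesCode P.bodies 0).branches F.name es j = F.branchCode P.bodies es j := by
  have h : ∀ j, (F.stagesCode P.bodies 0).respec F.name j = F.stagesCode P.bodies j := by
    intro j
    have h0 : F.stagesCode P.bodies 0 = seqs (F.stages.zipIdx.map fun U => F.lowerStage U.2 U.1) := by
      rw [Func.stagesCode]
      congr 1
      refine List.map_congr_left fun U hU => ?_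
      rw [F.lowerStage_eq, P.bodies_eq hP hF (mem_zipIdx_stages hU)]
    rw [h0, F.stagesCode_respec hP hF]
  induction es generalizing j with
  | nil => simp only [Stmt.branches, Func.branchCode, h]
  | cons e es ih => simp only [Stmt.branches, Func.branchCode, h, ih]

/-- As `f` has not been specialized before, its code still carries specialization `0`, which
`respec` replaces by the number of the branch. In the code of other funcs no label names `f`. -/
theorem Alg.code_specialize {P : Alg} (hP : P.Valid) {sp : ℕ → Option (List AExpr)} {f : ℕ}
    (hf : sp f = none) (es : List AExpr) :
    (P.code P.bodies sp).specialize f es = P.code P.bodies (Function.update sp f (some es)) := by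
  rw [Alg.code, Stmt.specialize_seqs, List.map_map, Alg.code]
  congr 1
  refine List.map_congr_left fun F hF => ?_
  simp only [Function.comp_apply, Func.code, Stmt.specialize]
  by_cases h : F.name = f
  · subst h
    simp only [if_true, Function.update_self, hf, Func.specCode, Func.branches_eq hP hF]
  · simp only [if_neg h, Function.update_of_ne h, F.specCode_specialize P.bodies_noLabel]

/-! ### Loop directives -/

/-- Transform the code of one stage. -/
def modBodies (l : LoopName) (g : Stmt Hole → Stmt Hole) (B : ℕ → ℕ → ℕ → Stmt Hole) (f i j : ℕ) :
    Stmt Hole :=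
  if f = l.func ∧ i = l.idx ∧ j = l.spec then g (B f i j) else B f i j

theorem Stmt.modStage_seqs (l : LoopName) (g : Stmt Hole → Stmt Hole) (L : List (Stmt Hole)) :
    (seqs L).modStage l g = seqs (L.map (Stmt.modStage l g)) := by
  induction L with
  | nil => rfl
  | cons s L ih => exact congrArg _ ih

theorem Func.stagesCode_modStage {B : ℕ → ℕ → ℕ → Stmt Hole} {F : Func}
    (hB : ∀ i U, F.stages[i]? = some U → ∀ j, (B F.name i j).NoLabel) (j : ℕ) (l : LoopName)
    (g : Stmt Hole → Stmt Hole) :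
    (F.stagesCode B j).modStage l g = F.stagesCode (modBodies l g B) j := by
  rw [Func.stagesCode, Stmt.modStage_seqs, List.map_map, Func.stagesCode]
  congr 1
  refine List.map_congr_left fun U hU => ?_
  simp only [Function.comp_apply, Stmt.modStage, modBodies,
    (hB _ _ (mem_zipIdx_stages hU) _).modStage, Func.label]
  split_ifs <;> rfl

theorem Func.specCode_modStage {B : ℕ → ℕ → ℕ → Stmt Hole} {F : Func}
    (hB : ∀ i U, F.stages[i]? = some U → ∀ j, (B F.name i j).NoLabel) (sp : Option (List AExpr))
    (l : LoopName) (g : Stmt Hole → Stmt Hole) :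
    (F.specCode B sp).modStage l g = F.specCode (modBodies l g B) sp := by
  have hb : ∀ es j, (F.branchCode B es j).modStage l g = F.branchCode (modBodies l g B) es j := by
    intro es
    induction es with
    | nil => intro j; simp only [Func.branchCode, Stmt.modStage, Func.stagesCode_modStage hB]
    | cons e es ih =>
      intro j
      simp only [Func.branchCode, Stmt.modStage, Func.stagesCode_modStage hB, ih]
  cases sp with
  | none => exact Func.stagesCode_modStage hB 0 l g
  | some es => exact hb es 1

theorem Alg.code_modStage {P : Alg} {B : ℕ → ℕ → ℕ → Stmt Hole}
    (hB : ∀ F ∈ P.funcs, ∀ i U, F.stages[i]? = some U → ∀ j, (B F.name i j).NoLabel)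
    (sp : ℕ → Option (List AExpr)) (l : LoopName) (g : Stmt Hole → Stmt Hole) :
    (P.code B sp).modStage l g = P.code (modBodies l g B) sp := by
  rw [Alg.code, Stmt.modStage_seqs, List.map_map, Alg.code]
  congr 1
  refine List.map_congr_left fun F hF => ?_
  simp only [Function.comp_apply, Func.code, Stmt.modStage, Func.specCode_modStage (hB F hF)]

theorem label_sub_seqs {l : Label} {b : Stmt Hole} {L : List (Stmt Hole)}
    (h : (Stmt.label l b).Sub (seqs L)) : ∃ s ∈ L, (Stmt.label l b).Sub s := by
  induction L with
  | nil => simp [seqs, Stmt.Sub] at h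
  | cons s L ih =>
    simp only [seqs, List.foldr_cons, Stmt.Sub, reduceCtorEq, false_or] at h
    rcases h with h | h
    · exact ⟨s, by simp, h⟩
    · obtain ⟨s', h1, h2⟩ := ih h
      exact ⟨s', by simp [h1], h2⟩

theorem Func.stage_sub_stagesCode {B : ℕ → ℕ → ℕ → Stmt Hole} {F : Func}
    (hB : ∀ i U, F.stages[i]? = some U → ∀ j, (B F.name i j).NoLabel) {j : ℕ} {st : Stage}
    {b : Stmt Hole} (h : (Stmt.label (.stage st) b).Sub (F.stagesCode B j)) :
    ∃ i U, F.stages[i]? = some U ∧ st = F.label i j U ∧ b = B F.name i j := by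
  obtain ⟨s, hs, h⟩ := label_sub_seqs h
  obtain ⟨U, hU, rfl⟩ := List.mem_map.1 hs
  have hU' := mem_zipIdx_stages hU
  rcases h with h | h
  · cases h
    exact ⟨U.2, U.1, hU', rfl, rfl⟩
  · exact ((hB _ _ hU' _).not_sub _ _ h).elim

/-- Loop nests contain no labels, so a stage label can only be one that lowering or specialization
has put there. -/
theorem Alg.stage_sub_code {P : Alg} {B : ℕ → ℕ → ℕ → Stmt Hole}
    (hB : ∀ F ∈ P.funcs, ∀ i U, F.stages[i]? = some U → ∀ j, (B F.name i j).NoLabel)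
    {sp : ℕ → Option (List AExpr)} {st : Stage} {b : Stmt Hole}
    (h : (Stmt.label (.stage st) b).Sub (P.code B sp)) :
    ∃ F ∈ P.funcs, ∃ i U, F.stages[i]? = some U ∧ ∃ j, st = F.label i j U ∧ b = B F.name i j := by
  obtain ⟨s, hs, h⟩ := label_sub_seqs h
  obtain ⟨F, hF, rfl⟩ := List.mem_map.1 hs
  refine ⟨F, hF, ?_⟩
  simp only [Func.code, Stmt.Sub, reduceCtorEq, false_or, Stmt.label.injEq, false_and] at h
  have hb : ∀ es j, (Stmt.label (.stage st) b).Sub (F.branchCode B es j) →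
      ∃ j, (Stmt.label (.stage st) b).Sub (F.stagesCode B j) := by
    intro es
    induction es with
    | nil =>
      intro j h
      simp only [Func.branchCode, Stmt.Sub, reduceCtorEq, false_or, Stmt.label.injEq, false_and] at h
      exact ⟨_, h⟩
    | cons e es ih =>
      intro j h
      simp only [Func.branchCode, Stmt.Sub, reduceCtorEq, false_or, Stmt.label.injEq, false_and] at h
      exact h.elim (fun h => ⟨_, h⟩) (ih _)
  have : ∃ j, (Stmt.label (.stage st) b).Sub (F.stagesCode B j) := by
    cases hsp : sp F.name with
    | none => rw [hsp] at h; exact ⟨0, h⟩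
    | some es => rw [hsp] at h; exact hb es 1 h
  obtain ⟨j, hj⟩ := this
  obtain ⟨i, U, h1, h2, h3⟩ := Func.stage_sub_stagesCode (hB F hF) hj
  exact ⟨i, U, h1, j, h2, h3⟩

/-! ### Scheduled programs -/

/-- `T` is the program of `P` with specializations `sp` and loop nests `B`, which are those of
lowering after the loop directives `ds`. -/
structure Scheduled (P : Alg) (ds : List LoopDir) (T : Prog Hole P.nparams P.out.arity)
    (sp : ℕ → Option (List AExpr)) (B : ℕ → ℕ → ℕ → Stmt Hole) : Prop where
  out : T.out = P.out.name
  body : T.body = P.code B sp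
  spec : ∀ f es, sp f = some es → ∀ e ∈ es, e.Closed P.nparams P.out.arity
  stages : ∀ F ∈ P.funcs, ∀ i U, F.stages[i]? = some U → ∀ j, ∃ Ls tail, B F.name i j = nest Ls tail ∧
    StageOK P.nparams P.out.arity (F.core i j U) (F.hdrs i j U) (i = 0) (GuardsOnly ds F.name i j) Ls tail

theorem Func.stages_zero {F : Func} {U : Update F.arity} (h : F.stages[0]? = some U) :
    U = ⟨[], fun d => .var (.pure (F.vars d)), F.body, .const 1⟩ := by
  simpa [Func.stages, eq_comm] using h

theorem Func.stages_succ {F : Func} {i : ℕ} {U : Update F.arity} (h : F.stages[i + 1]? = some U) :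
    F.updates[i]? = some U := by
  simpa [Func.stages] using h

theorem Func.stages_mem {F : Func} {i : ℕ} {U : Update F.arity} (h : F.stages[i]? = some U) :
    U ∈ F.stages := List.mem_of_getElem? h

theorem Alg.Valid.rdom {P : Alg} (hP : P.Valid) {F : Func} (hF : F ∈ P.funcs) {U : Update F.arity}
    (hU : U ∈ F.stages) : (U.rdom.map Prod.fst).Nodup ∧
      ∀ b ∈ U.rdom, b.2.1.Closed P.nparams 0 ∧ b.2.2.Closed P.nparams 0 := by
  rcases List.mem_cons.1 hU with rfl | hU
  · exact ⟨List.nodup_nil, by simp⟩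
  · exact ⟨hP.red_names F hF U hU, fun b hb =>
      ⟨(hP.rdom_startup F hF U hU b hb).1.closed, (hP.rdom_startup F hF U hU b hb).2.closed⟩⟩

theorem Func.mem_pureHdrs {F : Func} {v : Ver} {U : Update F.arity} {h : Hdr} :
    h ∈ F.pureHdrs v U ↔ ∃ d ∈ F.dims U, h = ⟨.serial, .pure (F.vars d),
      .hole (.cpu F.name v d .min), .hole (.cpu F.name v d .len)⟩ := by
  simp [Func.pureHdrs, eq_comm]

theorem Func.mem_redHdrs {F : Func} {i j : ℕ} {U : Update F.arity} {h : Hdr} :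
    h ∈ F.redHdrs i j U ↔ ∃ b ∈ U.rdom, h = ⟨.serial, .red b.1, b.2.1.lower F.name (.mid (i - 1) j),
      b.2.2.lower F.name (.mid (i - 1) j)⟩ := by
  simp [Func.redHdrs, eq_comm]

theorem Func.hdrs_ok {P : Alg} (hP : P.Valid) {F : Func} (hF : F ∈ P.funcs) {i : ℕ}
    {U : Update F.arity} (hU : F.stages[i]? = some U) (j : ℕ) :
    NestOK P.nparams P.out.arity (F.core i j U) (F.hdrs i j U) (F.core i j U) := by
  obtain ⟨r1, r2⟩ := hP.rdom hF (Func.stages_mem hU)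
  constructor
  · intro h hh
    rcases List.mem_append.1 hh with hh | hh
    · obtain ⟨d, -, rfl⟩ := Func.mem_pureHdrs.1 hh
      exact ⟨⟨trivial, by simp [Expr.vars]⟩, ⟨trivial, by simp [Expr.vars]⟩, trivial⟩
    · obtain ⟨b, hb, rfl⟩ := Func.mem_redHdrs.1 hh
      exact ⟨(r2 b hb).1.mono_window.lower, (r2 b hb).2.mono_window.lower, trivial⟩
  · rw [Func.hdrs, List.map_append, List.nodup_append]
    refine ⟨?_, ?_, ?_⟩
    · simp only [Func.pureHdrs, List.map_reverse, List.nodup_reverse, List.map_map]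
      refine List.Nodup.map_on ?_ ((List.nodup_finRange _).filter _)
      intro d _ d' _ hdd
      simp only [Function.comp_apply, Var.pure.injEq] at hdd
      exact hP.pure_names F hF hdd
    · simp only [Func.redHdrs, List.map_reverse, List.nodup_reverse, List.map_map]
      have : (Hdr.var ∘ fun b : ℕ × AExpr × AExpr => (⟨.serial, .red b.1,
          b.2.1.lower F.name (.mid (i - 1) j), b.2.2.lower F.name (.mid (i - 1) j)⟩ : Hdr)) =
          Var.red ∘ Prod.fst := rfl
      rw [this, ← List.map_map]
      exact r1.map fun a b h => by cases h; rfl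
    · intro v hv w hw
      obtain ⟨h, hh, rfl⟩ := List.mem_map.1 hv
      obtain ⟨h', hh', rfl⟩ := List.mem_map.1 hw
      obtain ⟨d, -, rfl⟩ := Func.mem_pureHdrs.1 hh
      obtain ⟨b, hb, rfl⟩ := Func.mem_redHdrs.1 hh'
      simp
  · intro h hh _
    rcases List.mem_append.1 hh with hh | hh
    · obtain ⟨d, -, rfl⟩ := Func.mem_pureHdrs.1 hh
      rfl
    · obtain ⟨b, hb, rfl⟩ := Func.mem_redHdrs.1 hh
      rfl
  · exact .core
  · intro h _
    simp [Func.core, Stmt.Binds]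

theorem Scheduled.noLabel {P : Alg} {ds : List LoopDir} {T : Prog Hole P.nparams P.out.arity}
    {sp : ℕ → Option (List AExpr)} {B : ℕ → ℕ → ℕ → Stmt Hole} (h : Scheduled P ds T sp B) :
    ∀ F ∈ P.funcs, ∀ i U, F.stages[i]? = some U → ∀ j, (B F.name i j).NoLabel := by
  intro F hF i U hU j
  obtain ⟨Ls, tail, e, hs⟩ := h.stages F hF i U hU j
  rw [e]
  exact noLabel_nest (hs.ok.below.noLabel (F.isCore_core i j U))

theorem scheduled_specs {P : Alg} (hP : P.Valid) (specs : List (ℕ × List AExpr))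
    (h1 : (specs.map Prod.fst).Nodup) (h3 : ∀ s ∈ specs, ∀ e ∈ s.2, e.Startup P.nparams P.out.arity) :
    ∃ sp, Scheduled P [] (applySpecs specs P.lower) sp P.bodies := by
  have key : ∀ specs : List (ℕ × List AExpr), (specs.map Prod.fst).Nodup →
      (∀ s ∈ specs, ∀ e ∈ s.2, e.Startup P.nparams P.out.arity) →
      ∀ sp : ℕ → Option (List AExpr), (∀ s ∈ specs, sp s.1 = none) →
      (∀ f es, sp f = some es → ∀ e ∈ es, e.Closed P.nparams P.out.arity) →
      ∀ T : Prog Hole P.nparams P.out.arity, T.out = P.out.name → T.body = P.code P.bodies sp →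
      ∃ sp', (applySpecs specs T).out = P.out.name ∧
        (applySpecs specs T).body = P.code P.bodies sp' ∧
        ∀ f es, sp' f = some es → ∀ e ∈ es, e.Closed P.nparams P.out.arity := by
    intro specs
    induction specs with
    | nil => intro _ _ sp _ hcl T h4 h5; exact ⟨sp, h4, h5, hcl⟩
    | cons s specs ih =>
      intro h1 h3 sp hsp hcl T h4 h5
      rw [List.map_cons, List.nodup_cons] at h1
      refine ih h1.2 (fun s hs => h3 s (by simp [hs])) (Function.update sp s.1 (some s.2)) ?_ ?_
        ⟨T.out, T.body.specialize s.1 s.2⟩ h4 ?_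
      · intro s' hs'
        have hne : s'.1 ≠ s.1 := fun e => h1.1 (by rw [← e]; exact List.mem_map_of_mem hs')
        rw [Function.update_of_ne hne]
        exact hsp s' (by simp [hs'])
      · intro f es hf
        by_cases hfs : f = s.1
        · subst hfs
          rw [Function.update_self] at hf
          cases hf
          exact fun e he => (h3 s (by simp) e he).closed
        · rw [Function.update_of_ne hfs] at hf
          exact hcl f es hf
      · rw [h5]
        exact P.code_specialize hP (hsp s (by simp)) s.2
  obtain ⟨sp, e1, e2, e3⟩ := key specs h1 h3 (fun _ => none) (fun _ _ => rfl) (by simp) P.lower rfl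
    (P.lower_eq hP)
  refine ⟨sp, e1, e2, e3, fun F hF i U hU j => ⟨_, _, P.bodies_eq hP hF hU j, F.hdrs_ok hP hF hU j, ?_,
    fun Γ z hΓ => ⟨some, some, (Sem.refl _ _).mono fun _ => trivial⟩⟩⟩
  rintro rfl h hh
  obtain rfl := Func.stages_zero hU
  rcases List.mem_append.1 hh with hh | hh
  · obtain ⟨d, -, rfl⟩ := Func.mem_pureHdrs.1 hh
    trivial
  · obtain ⟨b, hb, rfl⟩ := Func.mem_redHdrs.1 hh
    simp at hb

/-- The code of a stage is a function of its name. Side conditions that quantify over occurrences of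
a stage thus speak of one known loop nest. -/
theorem Scheduled.stageAt {P : Alg} {ds : List LoopDir} {T : Prog Hole P.nparams P.out.arity}
    {sp : ℕ → Option (List AExpr)} {B : ℕ → ℕ → ℕ → Stmt Hole} (h : Scheduled P ds T sp B)
    {l : LoopName} {b : Stmt Hole} (hb : T.StageAt l b) :
    b = B l.func l.idx l.spec ∧ ∃ F ∈ P.funcs, F.name = l.func ∧ ∃ U, F.stages[l.idx]? = some U := by
  obtain ⟨st, h1, h2, h3, h4⟩ := hb
  rw [h.body] at h1
  obtain ⟨F, hF, i, U, hU, j, rfl, rfl⟩ := Alg.stage_sub_code h.noLabel h1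
  simp only [Func.label] at h2 h3 h4
  subst h3 h4
  rw [← h2]
  exact ⟨rfl, F, hF, rfl, U, hU⟩

theorem Scheduled.apply {P : Alg} {ds : List LoopDir}
    {T : Prog Hole P.nparams P.out.arity} {sp : ℕ → Option (List AExpr)} {B : ℕ → ℕ → ℕ → Stmt Hole}
    (h : Scheduled P ds T sp B) {s : LoopDir} (hs : s.Valid T) :
    Scheduled P (ds ++ [s]) (s.apply T) sp
      (modBodies s.loopName (Stmt.modLoop s.loopName.var s.rewrite) B) := by
  refine ⟨h.out, ?_, h.spec, ?_⟩
  · simp only [LoopDir.apply]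
    rw [h.body, Alg.code_modStage h.noLabel]
  · intro F hF i U hU j
    obtain ⟨Ls, tail, e, hst⟩ := h.stages F hF i U hU j
    rw [modBodies]
    split_ifs with hk
    · obtain ⟨k1, rfl, rfl⟩ := hk
      obtain ⟨Ls', tail', e', hst'⟩ := hst.apply hs (F.isCore_core _ _ U) fun b hb => by
        rw [(h.stageAt hb).1, ← k1, e]
      rw [e, e']
      refine ⟨Ls', tail', rfl, hst'.ok, hst'.pure, fun Γ z hΓ => ?_⟩
      obtain ⟨dec, decP, hsem⟩ := hst'.sem Γ z hΓ
      refine ⟨dec, decP, hsem.mono fun hg => ⟨fun l xo xi fac φ hm => hg l xo xi fac φ (by simp [hm]), ?_⟩⟩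
      rw [← k1]
      exact fun l xo xi fac φ hm => hg l xo xi fac φ (by simp at hm; simp [hm])
    · refine ⟨Ls, tail, e, hst.ok, hst.pure, fun Γ z hΓ => ?_⟩
      obtain ⟨dec, decP, hsem⟩ := hst.sem Γ z hΓ
      exact ⟨dec, decP, hsem.mono fun hg l xo xi fac φ hm => hg l xo xi fac φ (by simp [hm])⟩

theorem scheduled_apply {P : Alg} (hP : P.Valid) {S : Schedule} (hS : S.Valid P) :
    ∃ sp B, Scheduled P S.loops (S.apply P) sp B := by
  obtain ⟨sp, h0⟩ := scheduled_specs hP S.specs hS.spec_once hS.spec_startup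
  have key : ∀ pre post, S.loops = pre ++ post →
      ∃ B, Scheduled P pre (applyLoops pre (applySpecs S.specs P.lower)) sp B := by
    intro pre
    -- The validity of a directive refers to the program that all directives before it produce, so
    -- the induction appends at the end.
    induction pre using List.reverseRecOn with
    | nil => exact fun _ _ => ⟨_, h0⟩
    | append_singleton pre s ih =>
      intro post hpost
      rw [List.append_assoc] at hpost
      obtain ⟨B, hB⟩ := ih _ hpost
      refine ⟨modBodies s.loopName (Stmt.modLoop s.loopName.var s.rewrite) B, ?_⟩
      rw [applyLoops, List.foldl_append]
      exact hB.apply (hS.loops_valid pre s post hpost)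
  obtain ⟨B, hB⟩ := key S.loops [] (by simp)
  exact ⟨sp, B, hB⟩

/-- Only stages without a reduction domain may have redundant iterations. -/
theorem guardsOnly_update {P : Alg} {S : Schedule} (hS : S.Valid P) {s : LoopDir}
    (hs : s.Valid (S.apply P)) (f i j : ℕ) : GuardsOnly (S.loops ++ [s]) f (i + 1) j := by
  intro l xo xi fac φ hm h1 h2 h3
  have hv : ∃ T : Prog Hole P.nparams P.out.arity, (LoopDir.split l xo xi fac φ).Valid T := by
    rcases List.mem_append.1 hm with hm | hm
    · obtain ⟨pre, post, e⟩ := List.append_of_mem hm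
      exact ⟨_, hS.loops_valid pre _ post e⟩
    · rw [List.mem_singleton] at hm
      exact ⟨_, hm ▸ hs⟩
  obtain ⟨T, -, -, -, -, -, -, hφ⟩ := hv
  cases φ with
  | guard => rfl
  | shift => have := hφ (.inl rfl); omega
  | round => have := hφ (.inr rfl); omega

end Halide

namespace Halide

variable {m n : ℕ} {Γ : Hole → Expr Ver Empty} {z : Input m n}

/-! ## The bounds queries and traces of programs with different loop nests -/

/-- The stages are below sequences, labels and branches on startup conditions. -/
def Stmt.Skel : Stmt Hole → Prop
  | .seq s₁ s₂ => s₁.Skel ∧ s₂.Skel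
  | .ite e s₁ s₂ => e.AccFree ∧ s₁.Skel ∧ s₂.Skel
  | .label (.stage _) s => s.NoLabel
  | .label _ s => s.Skel
  | .loop _ _ _ _ _ => False
  | .letIn _ _ _ => False
  | _ => True

/-- With this, a program and its image under a directive are two instances of `modStage`, which the
following comparisons treat symmetrically. -/
theorem Stmt.modStage_id (l : LoopName) (s : Stmt Hole) : s.modStage l id = s := by
  induction s with
  | seq s₁ s₂ ih₁ ih₂ => simp only [Stmt.modStage, ih₁, ih₂]
  | ite e s₁ s₂ ih₁ ih₂ => simp only [Stmt.modStage, ih₁, ih₂]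
  | loop τ x lo len s ih => simp only [Stmt.modStage, ih]
  | letIn x e s ih => simp only [Stmt.modStage, ih]
  | label lb s ih =>
    cases lb <;> simp only [Stmt.modStage, ih, id, ite_self]
  | _ => rfl

/-- No variable is bound above a stage, so all stages are queried in the environment of the program,
and a comparison of single stages in this environment is sufficient. -/
theorem Stmt.Skel.modStage_query {s : Stmt Hole} (h : s.Skel) {l : LoopName}
    {g₁ g₂ : Stmt Hole → Stmt Hole} {η : Hole → ℤ} {φ : ℕ → List Val → ℤ} {ρ : Env}
    (hg : ∀ st b, (Stmt.label (.stage st) b).Sub s →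
      st.func = l.func → st.idx = l.idx → st.spec = l.spec →
      (g₁ b).query η φ (some st) ρ → (g₂ b).query η φ (some st) ρ) {st : Option Stage}
    (hq : (s.modStage l g₁).query η φ st ρ) : (s.modStage l g₂).query η φ st ρ := by
  induction s generalizing st with
  | seq s₁ s₂ ih₁ ih₂ =>
    exact ⟨ih₁ h.1 (fun st b hb => hg st b (.inr (.inl hb))) hq.1,
      ih₂ h.2 (fun st b hb => hg st b (.inr (.inr hb))) hq.2⟩
  | ite e s₁ s₂ ih₁ ih₂ =>
    exact ⟨hq.1, fun h' => ih₁ h.2.1 (fun st b hb => hg st b (.inr (.inl hb))) (hq.2.1 h'),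
      fun h' => ih₂ h.2.2 (fun st b hb => hg st b (.inr (.inr hb))) (hq.2.2 h')⟩
  | label lb s ih =>
    cases lb with
    | stage st' =>
      simp only [Stmt.modStage, Stmt.NoLabel.modStage h] at hq ⊢
      split_ifs at hq ⊢ with hk
      · exact ⟨hq.1, hg st' s (.inl rfl) hk.1 hk.2.1 hk.2.2 hq.2⟩
      · exact hq
    | func f => exact ih h (fun st b hb => hg st b (.inr hb)) hq
    | spec f j => exact ih h (fun st b hb => hg st b (.inr hb)) hq
  | loop τ x lo len s ih => exact h.elim
  | letIn x e s ih => exact h.elim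
  | _ => exact hq

/-- The comparison of the stage may use its query, which is known only on the branch that is taken.
The branch conditions are access-free, so the query and the trace agree on which branch this is. -/
theorem Stmt.Skel.modStage_tr (hΓ : Compatible m n Γ) {s : Stmt Hole} (h : s.Skel) {l : LoopName}
    {g₁ g₂ : Stmt Hole → Stmt Hole} {φ : ℕ → List Val → ℤ}
    (hg : ∀ st b, (Stmt.label (.stage st) b).Sub s →
      st.func = l.func → st.idx = l.idx → st.spec = l.spec →
      b.query (holeVal Γ z) φ (some st) z.env →
      ∀ t, ((g₁ b).fill Γ).Tr z.env t → ((g₂ b).fill Γ).Tr z.env t) {st : Option Stage}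
    (hq : s.query (holeVal Γ z) φ st z.env) {t : List Act}
    (ht : ((s.modStage l g₁).fill Γ).Tr z.env t) : ((s.modStage l g₂).fill Γ).Tr z.env t := by
  induction s generalizing st t with
  | seq s₁ s₂ ih₁ ih₂ =>
    simp only [Stmt.modStage, Stmt.fill, Stmt.tr_seq] at ht ⊢
    obtain ⟨t₁, t₂, h1, h2, rfl⟩ := ht
    exact ⟨t₁, t₂, ih₁ h.1 (fun st b hb => hg st b (.inr (.inl hb))) hq.1 h1,
      ih₂ h.2 (fun st b hb => hg st b (.inr (.inr hb))) hq.2 h2, rfl⟩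
  | ite e s₁ s₂ ih₁ ih₂ =>
    simp only [Stmt.modStage, Stmt.fill, Stmt.tr_ite, h.1.tr_fill hΓ (Base.refl z)] at ht ⊢
    simp only [Stmt.query, h.1.qval_eq] at hq
    obtain ⟨_, t₂, _, ⟨rfl, rfl⟩, he, ht⟩ := ht
    refine ⟨[], t₂, _, ⟨rfl, rfl⟩, he, ht.imp ?_ ?_⟩
    · exact fun h' => ⟨h'.1, ih₁ h.2.1 (fun st b hb => hg st b (.inr (.inl hb))) (hq.2.1 h'.1) h'.2⟩
    · exact fun h' => ⟨h'.1, ih₂ h.2.2 (fun st b hb => hg st b (.inr (.inr hb))) (hq.2.2 h'.1) h'.2⟩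
  | label lb s ih =>
    cases lb with
    | stage st' =>
      simp only [Stmt.modStage, Stmt.NoLabel.modStage h] at ht ⊢
      split_ifs at ht ⊢ with hk
      · simp only [Stmt.fill, Stmt.tr_label] at ht ⊢
        exact hg st' s (.inl rfl) hk.1 hk.2.1 hk.2.2 hq.2 t ht
      · exact ht
    | func f =>
      simp only [Stmt.modStage, Stmt.fill, Stmt.tr_label] at ht ⊢
      exact ih h (fun st b hb => hg st b (.inr hb)) hq ht
    | spec f j =>
      simp only [Stmt.modStage, Stmt.fill, Stmt.tr_label] at ht ⊢
      exact ih h (fun st b hb => hg st b (.inr hb)) hq ht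
  | loop τ x lo len s ih => exact h.elim
  | letIn x e s ih => exact h.elim
  | _ => exact ht

theorem skel_seqs {L : List (Stmt Hole)} (h : ∀ s ∈ L, s.Skel) : (seqs L).Skel := by
  induction L with
  | nil => trivial
  | cons s L ih => exact ⟨h s (by simp), ih fun s hs => h s (by simp [hs])⟩

theorem Func.skel_stagesCode {B : ℕ → ℕ → ℕ → Stmt Hole} {F : Func}
    (hB : ∀ i U, F.stages[i]? = some U → ∀ j, (B F.name i j).NoLabel) (j : ℕ) :
    (F.stagesCode B j).Skel := by
  refine skel_seqs fun s hs => ?_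
  obtain ⟨U, hU, rfl⟩ := List.mem_map.1 hs
  exact hB _ _ (mem_zipIdx_stages hU) _

variable {P : Alg} {ds : List LoopDir} {T : Prog Hole P.nparams P.out.arity}
  {sp : ℕ → Option (List AExpr)} {B : ℕ → ℕ → ℕ → Stmt Hole}

theorem Scheduled.skel (h : Scheduled P ds T sp B) : T.body.Skel := by
  rw [h.body]
  refine skel_seqs fun s hs => ?_
  obtain ⟨F, hF, rfl⟩ := List.mem_map.1 hs
  refine ⟨trivial, ?_⟩
  have hB := h.noLabel F hF
  have hb : ∀ es : List AExpr, (∀ e ∈ es, e.Closed P.nparams P.out.arity) → ∀ j, (F.branchCode B es j).Skel := by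
    intro es
    induction es with
    | nil => exact fun _ j => Func.skel_stagesCode hB 0
    | cons e es ih =>
      intro hes j
      exact ⟨(hes e (by simp)).1.lower, Func.skel_stagesCode hB j, ih (fun e he => hes e (by simp [he])) _⟩
  show (F.specCode B (sp F.name)).Skel
  cases hsp : sp F.name with
  | none => exact Func.skel_stagesCode hB 0
  | some es => exact hb es (h.spec _ _ hsp) 1

/-- What a directive does with the bounds query and the traces, given what it does with those of the
stage. -/
theorem Scheduled.modStage (h : Scheduled P ds T sp B) {Γ : Hole → Expr Ver Empty}
    {z : Input P.nparams P.out.arity} {s : LoopDir} {b : Stmt Hole}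
    (hb : ∀ b', T.StageAt s.loopName b' → b' = b) (b' : Stmt Hole)
    (hb' : b.modLoop s.loopName.var s.rewrite = b') :
    ((∀ φ st, b'.query (holeVal Γ z) φ st z.env → b.query (holeVal Γ z) φ st z.env) →
      (s.apply T).QueryAt Γ z → T.QueryAt Γ z) ∧
    ((∀ φ st, b.query (holeVal Γ z) φ st z.env → b'.query (holeVal Γ z) φ st z.env) →
      T.QueryAt Γ z → (s.apply T).QueryAt Γ z) ∧
    (Compatible P.nparams P.out.arity Γ → (∀ φ st, b.query (holeVal Γ z) φ st z.env →
        ∀ t, (b'.fill Γ).Tr z.env t → (b.fill Γ).Tr z.env t) →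
      T.QueryAt Γ z → ((s.apply T).fill Γ).traces z ⊆ (T.fill Γ).traces z) ∧
    (Compatible P.nparams P.out.arity Γ → (∀ φ st, b.query (holeVal Γ z) φ st z.env →
        ∀ t, (b.fill Γ).Tr z.env t → (b'.fill Γ).Tr z.env t) →
      T.QueryAt Γ z → (T.fill Γ).traces z ⊆ ((s.apply T).fill Γ).traces z) := by
  have hid := Stmt.modStage_id s.loopName T.body
  have heq : ∀ st c, (Stmt.label (.stage st) c).Sub T.body → st.func = s.loopName.func →
      st.idx = s.loopName.idx → st.spec = s.loopName.spec → c = b := fun st c h0 h1 h2 h3 =>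
    hb c ⟨st, h0, h1, h2, h3⟩
  refine ⟨fun hq h' => ⟨h'.1, fun φ => ?_, h'.2.2⟩, fun hq h' => ⟨h'.1, fun φ => ?_, h'.2.2⟩,
    fun hΓ ht hq t h' => ?_, fun hΓ ht hq t h' => ?_⟩
  · rw [← hid]
    refine h.skel.modStage_query (fun st c h0 h1 h2 h3 hc => ?_) (h'.2.1 φ)
    obtain rfl := heq st c h0 h1 h2 h3
    rw [hb'] at hc
    exact hq φ _ hc
  · have := h'.2.1 φ
    rw [← hid] at this
    refine h.skel.modStage_query (fun st c h0 h1 h2 h3 hc => ?_) this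
    obtain rfl := heq st c h0 h1 h2 h3
    rw [hb']
    exact hq φ _ hc
  · show (T.body.fill Γ).Tr z.env t
    rw [← hid]
    -- The func values are irrelevant here: the comparison uses the query for the lengths of loops
    -- only, and zero is as good as any.
    refine h.skel.modStage_tr hΓ (fun st c h0 h1 h2 h3 hc t h4 => ?_) (hq.2.1 fun _ _ => 0) h'
    obtain rfl := heq st c h0 h1 h2 h3
    rw [hb'] at h4
    exact ht _ _ hc t h4
  · have h' : (T.body.fill Γ).Tr z.env t := h'
    rw [← hid] at h'
    refine h.skel.modStage_tr hΓ (fun st c h0 h1 h2 h3 hc t h4 => ?_) (hq.2.1 fun _ _ => 0) h'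
    obtain rfl := heq st c h0 h1 h2 h3
    rw [hb']
    exact ht _ _ hc t h4

theorem Repl.modStage (h : Scheduled P ds T sp B) {Γ : Hole → Expr Ver Empty}
    (hΓ : Compatible P.nparams P.out.arity Γ) {z : Input P.nparams P.out.arity} {s : LoopDir}
    {core tail tail' : Stmt Hole} {A C C' D : List Hdr} {Q : Env → Prop} {H : Env → Var → ℤ} {strict : Prop}
    (hR : Repl Γ z core A C C' D tail tail' Q H strict)
    (hb : ∀ b', T.StageAt s.loopName b' → b' = nest (A ++ C ++ D) tail)
    (hb' : (nest (A ++ C ++ D) tail).modLoop s.loopName.var s.rewrite = nest (A ++ C' ++ D) tail') :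
    ((∀ c ∈ C, 0 ≤ c.len.num (holeVal Γ z) z) → (s.apply T).QueryAt Γ z → T.QueryAt Γ z) ∧
    (strict → T.QueryAt Γ z → (s.apply T).QueryAt Γ z ∧
      ((s.apply T).fill Γ).traces z ⊆ (T.fill Γ).traces z ∧
      ((∀ c ∈ C, c.ord = .serial) → ((s.apply T).fill Γ).traces z = (T.fill Γ).traces z)) := by
  obtain ⟨k1, k2, k3, k4⟩ := h.modStage (Γ := Γ) (z := z) hb _ hb'
  have hr : ∀ φ st, (nest (A ++ C ++ D) tail).query (holeVal Γ z) φ st z.env →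
      ReachOK ((A ++ C ++ D).map (Hdr.nums (holeVal Γ z) z)) := fun φ st hq =>
    ((nest_query_iff hR.ok.closed hR.ok.nodup (Base.refl z)).1 hq).1
  refine ⟨fun hpos => k1 fun φ st => hR.query_of_new ?_, fun hst hq => ?_⟩
  · intro x hx
    obtain ⟨c, hc, rfl⟩ := List.mem_map.1 hx
    exact hpos c hc
  · have hsub := k3 hΓ (fun φ st hq => (hR.tr_sub hΓ hst (hr φ st hq)).1) hq
    exact ⟨k2 (fun φ st => hR.query_new hst) hq, hsub, fun hser =>
      hsub.antisymm (k4 hΓ (fun φ st hq => (hR.tr_sub hΓ hst (hr φ st hq)).2 hser) hq)⟩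

theorem Scheduled.split (h : Scheduled P ds T sp B) {l : LoopName} {xo xi : Var} {fac : AExpr} {φ : Tail}
    (hs : (LoopDir.split l xo xi fac φ).Valid T) {τ : Order} {lo len : TExpr} {b : Stmt Hole}
    (hl : T.LoopAt l τ lo len b) {Γ : Hole → Expr Ver Empty}
    (hΓ : Compatible P.nparams P.out.arity Γ) (z : Input P.nparams P.out.arity) :
    (0 ≤ (len.eval z.env (fun _ _ => .errMem) fun h => .int (holeVal Γ z h)).toInt →
      ((LoopDir.split l xo xi fac φ).apply T).QueryAt Γ z → T.QueryAt Γ z) ∧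
    (φ = .guard → T.QueryAt Γ z →
      ((LoopDir.split l xo xi fac φ).apply T).QueryAt Γ z ∧
      (((LoopDir.split l xo xi fac φ).apply T).fill Γ).traces z ⊆ (T.fill Γ).traces z ∧
      (τ = .serial →
        (((LoopDir.split l xo xi fac φ).apply T).fill Γ).traces z = (T.fill Γ).traces z)) := by
  obtain ⟨-, hoi, ⟨hxo, ko⟩, ⟨hxi, ki⟩, hfac, hpos, -⟩ := hs
  obtain ⟨body, hat, hsub⟩ := hl
  have hxo := hxo body hat
  have hxi := hxi body hat
  obtain ⟨e1, F, hF, hn, U, hU⟩ := h.stageAt hat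
  obtain ⟨Ls, tail, e2, hst⟩ := h.stages F hF _ U hU l.spec
  rw [hn] at e2
  rw [e1, e2] at hsub hxo hxi
  obtain ⟨A, D, rfl, e, hR⟩ := hst.ok.split_modLoop (F.isCore_core _ _ U) φ hsub hfac.closed.lower
    (fun Γ z => num_toTgt_pos hfac hpos (holeVal Γ z) z) hoi hxo hxi
    (ko.elim (fun h => h.2.isLoop) fun h => h.2.isLoop) (ki.elim (fun h => h.2.isLoop) fun h => h.2.isLoop)
  obtain ⟨Q, H, hR⟩ := hR Γ z hΓ
  obtain ⟨k1, k2⟩ := hR.modStage h hΓ (s := .split l xo xi fac φ)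
    (fun b' hb' => by rw [(h.stageAt hb').1]; exact e2) e
  refine ⟨fun h0 => k1 (by simpa using (show 0 ≤ len.num (holeVal Γ z) z from h0)), fun hφ hq => ?_⟩
  obtain ⟨k3, k4, k5⟩ := k2 hφ hq
  exact ⟨k3, k4, fun hτ => k5 (by simpa using hτ)⟩

theorem Scheduled.fuse (h : Scheduled P ds T sp B) {l : LoopName} {y : Var}
    (hs : (LoopDir.fuse l y).Valid T) {τ τ' : Order} {x' : Var} {lo len lo' len' : TExpr} {b : Stmt Hole}
    (hl : T.LoopAt l τ lo len (.loop τ' x' lo' len' b)) {Γ : Hole → Expr Ver Empty}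
    (hΓ : Compatible P.nparams P.out.arity Γ) (z : Input P.nparams P.out.arity) :
    (0 ≤ (len.eval z.env (fun _ _ => .errMem) fun h => .int (holeVal Γ z h)).toInt →
      0 ≤ (len'.eval z.env (fun _ _ => .errMem) fun h => .int (holeVal Γ z h)).toInt →
      ((LoopDir.fuse l y).apply T).QueryAt Γ z → T.QueryAt Γ z) ∧
    (T.QueryAt Γ z →
      ((LoopDir.fuse l y).apply T).QueryAt Γ z ∧
      (((LoopDir.fuse l y).apply T).fill Γ).traces z ⊆ (T.fill Γ).traces z ∧
      (τ = .serial → τ' = .serial →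
        (((LoopDir.fuse l y).apply T).fill Γ).traces z = (T.fill Γ).traces z)) := by
  obtain ⟨-, hy, ky⟩ := hs
  obtain ⟨body, hat, hsub⟩ := hl
  have hy := hy body hat
  obtain ⟨e1, F, hF, hn, U, hU⟩ := h.stageAt hat
  obtain ⟨Ls, tail, e2, hst⟩ := h.stages F hF _ U hU l.spec
  rw [hn] at e2
  rw [e1, e2] at hsub hy
  obtain ⟨A, D, tail', rfl, e, hR⟩ := hst.ok.fuse_modLoop (F.isCore_core _ _ U) hsub hy
    (ky.elim (fun h => h.2.isLoop) fun h => h.2.isLoop)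
  obtain ⟨Q, H, hR⟩ := hR Γ z hΓ
  obtain ⟨k1, k2⟩ := hR.modStage h hΓ (s := .fuse l y)
    (fun b' hb' => by rw [(h.stageAt hb').1]; exact e2) e
  refine ⟨fun h0 h0' => k1 (by simpa using ⟨h0, h0'⟩), fun hq => ?_⟩
  obtain ⟨k3, k4, k5⟩ := k2 trivial hq
  exact ⟨k3, k4, fun hτ hτ' => k5 (by simpa using ⟨hτ, hτ'⟩)⟩

end Halide

namespace Halide

/-! ## The points that a stage accesses -/

/-- Every action of the trace is a read of a point for which `K` holds. -/
def ReadsOnly (K : ℕ → List Val → Prop) (t : List Act) : Prop :=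
  ∀ a ∈ t, ∃ g p v, a = .read g p v ∧ K g p

theorem readsOnly_flatten {k : ℕ} {K : ℕ → List Val → Prop} {ts : Fin k → List Act}
    (h : ∀ i, ReadsOnly K (ts i)) : ReadsOnly K (List.ofFn ts).flatten := by
  intro a ha
  obtain ⟨t, ht, ha⟩ := List.mem_flatten.1 ha
  obtain ⟨i, rfl⟩ := (List.mem_ofFn' _ _).1 ht
  exact h i a ha

theorem Expr.lower_readsOnly {Γ : Hole → Expr Ver Empty} {f : ℕ} {v : Ver} {ρ : Env}
    {K : ℕ → List Val → Prop} {e : AExpr}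
    (hK : ∀ g l n args, (Expr.acc g l n args).Sub e → ∀ (vs : Fin n → Val),
      (∀ i, ∃ t, (((args i).lower f v).fill Γ).Tr ρ t (vs i)) → K g (List.ofFn vs))
    {t : List Act} {w : Val} (h : ((e.lower f v).fill Γ).Tr ρ t w) : ReadsOnly K t := by
  induction e generalizing t w with
  | const c => rw [Expr.lower, Expr.fill, Expr.tr_const] at h; rw [h.1]; simp [ReadsOnly]
  | var x => rw [Expr.lower, Expr.fill, Expr.tr_var] at h; rw [h.1]; simp [ReadsOnly]
  | hole x => exact x.elim
  | op o args ih =>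
    rw [Expr.lower, Expr.fill, Expr.tr_op] at h
    obtain ⟨ts, vs, h1, rfl, -⟩ := h
    exact readsOnly_flatten fun i =>
      ih i (fun g l n args' hs => hK g l n args' (.inr ⟨i, hs⟩)) (h1 i)
  | acc g l n args ih =>
    rw [Expr.lower, Expr.fill, Expr.tr_acc] at h
    obtain ⟨ts, vs, h1, rfl⟩ := h
    intro a ha
    rcases List.mem_append.1 ha with ha | ha
    · exact readsOnly_flatten (fun i =>
        ih i (fun g l n args' hs => hK g l n args' (.inr ⟨i, hs⟩)) (h1 i)) a ha
    · rw [List.mem_singleton] at ha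
      exact ⟨g, _, w, ha, hK g l n args (.inl rfl) vs fun i => ⟨ts i, h1 i⟩⟩

/-- The points that agree with the loop variables of the stage. -/
def Func.Slice (F : Func) (U : Update F.arity) (ρ : Env) (p : List Val) : Prop :=
  ∀ d ∈ F.dims U, p[(d : ℕ)]? = some (ρ (.pure (F.vars d)))

theorem Func.mem_dims {F : Func} {U : Update F.arity} {d : Fin F.arity} :
    d ∈ F.dims U ↔ U.lhs d = .var (.pure (F.vars d)) := by
  simp only [Func.dims, List.mem_filter, List.mem_finRange, true_and]
  cases h : U.lhs d <;> simp [Expr.isVar]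

variable {P : Alg} {F : Func} {i : ℕ} {U : Update F.arity}

/-- Accesses refer to earlier funcs, and in update stages to the func itself. -/
theorem Alg.Valid.refs (hP : P.Valid) {pre post : List Func} (hF : P.funcs = pre ++ F :: post)
    (hU : F.stages[i]? = some U) {e : AExpr} (he : e ∈ U.exprs) {g : ℕ} {l : Unit} {n : ℕ}
    {args : Fin n → AExpr} (hs : (Expr.acc g l n args).Sub e) :
    (∃ G ∈ pre, G.name = g ∧ G.arity = n) ∨ 0 < i ∧ g = F.name ∧ n = F.arity := by
  cases i with
  | zero =>
    obtain rfl := Func.stages_zero hU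
    simp only [Update.exprs, List.mem_cons, List.mem_ofFn'] at he
    rcases he with rfl | rfl | ⟨d, rfl⟩
    · exact .inl (hP.body_refs pre F post hF g l n args hs)
    · simp [Expr.Sub] at hs
    · simp [Expr.Sub] at hs
  | succ i =>
    obtain ⟨G, hG, h1, h2⟩ := hP.update_refs pre F post hF U
      (List.mem_of_getElem? (Func.stages_succ hU)) e he g l n args hs
    rcases List.mem_append.1 hG with hG | hG
    · exact .inl ⟨G, hG, h1, h2⟩
    · obtain rfl := List.mem_singleton.1 hG
      exact .inr ⟨i.succ_pos, h1.symm, h2.symm⟩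

theorem Alg.Valid.not_mem_pre (hP : P.Valid) {pre post : List Func} (hF : P.funcs = pre ++ F :: post)
    {G : Func} (hG : G ∈ pre) : G.name ≠ F.name := by
  have := hP.func_names
  rw [hF, List.map_append, List.map_cons, List.nodup_append] at this
  exact this.2.2 _ (List.mem_map_of_mem hG) _ (by simp)

/-- A dimension is looped over because the left-hand side is `x_d` there. Then `x_d` occurs in the
stage, and syntactic separation forces it into position `d` of every access to the func. -/
theorem Alg.Valid.acc_self (hP : P.Valid) (hF : F ∈ P.funcs) (hU : F.stages[i]? = some U) {e : AExpr}
    (he : e ∈ U.exprs) {l : Unit} {n : ℕ} {args : Fin n → AExpr}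
    (hs : (Expr.acc F.name l n args).Sub e) :
    0 < i ∧ n = F.arity ∧ ∀ d ∈ F.dims U, ∀ h : (d : ℕ) < n, args ⟨d, h⟩ = .var (.pure (F.vars d)) := by
  obtain ⟨pre, post, hpp⟩ := List.append_of_mem hF
  rcases hP.refs hpp hU he hs with ⟨G, hG, h1, -⟩ | ⟨h1, -, h2⟩
  · exact (hP.not_mem_pre hpp hG h1).elim
  · refine ⟨h1, h2, fun d hd h => ?_⟩
    have hd := Func.mem_dims.1 hd
    refine ((hP.separated F hF U (Func.stages_mem hU)) d ⟨U.lhs d, ?_, by simp [hd, Expr.vars]⟩).2 e he l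
      n args hs h
    simp [Update.exprs]

theorem expr_within (hP : P.Valid) (hF : F ∈ P.funcs) (hU : F.stages[i]? = some U)
    {Γ : Hole → Expr Ver Empty} {v : Ver} {ρ : Env} {e : AExpr} (he : e ∈ U.exprs) {t : List Act} {w : Val}
    (h : ((e.lower F.name v).fill Γ).Tr ρ t w) :
    ReadsOnly (fun g p => g = F.name → 0 < i ∧ F.Slice U ρ p) t := by
  refine Expr.lower_readsOnly ?_ h
  rintro g l n args hs vs hvs rfl
  obtain ⟨h1, h2, h3⟩ := hP.acc_self hF hU he hs
  subst h2
  refine ⟨h1, fun d hd => ?_⟩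
  obtain ⟨t, ht⟩ := hvs d
  have h3 : args d = .var (.pure (F.vars d)) := h3 d hd d.2
  rw [h3, Expr.lower, Expr.fill, Expr.tr_var] at ht
  rw [← ht.2]
  simp

theorem ReadsOnly.within {f : ℕ} {A : List Val → Prop} {K : ℕ → List Val → Prop} {t : List Act}
    (h : ReadsOnly K t) (hK : ∀ p, K f p → A p) : ∀ a ∈ t, a.Within f A := by
  intro a ha
  obtain ⟨g, p, v, rfl, hk⟩ := h a ha
  rintro rfl
  exact hK p hk

/-- Reads of the func stay in the slice of the iteration by `Alg.Valid.acc_self`, and the write does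
because the left-hand side has `x_d` in every dimension that is looped over. -/
theorem core_within (hP : P.Valid) (hF : F ∈ P.funcs) (hU : F.stages[i]? = some U)
    {Γ : Hole → Expr Ver Empty} {j : ℕ} {ρ : Env} {t : List Act}
    (h : ((F.core i j U).fill Γ).Tr ρ t) : ∀ a ∈ t, a.Within F.name (F.Slice U ρ) := by
  simp only [Func.core, Stmt.fill, Stmt.tr_ite, Stmt.tr_nop, Stmt.tr_assign] at h
  obtain ⟨t₁, t₂, v, h1, rfl, h2⟩ := h
  have k1 := (expr_within hP hF hU (by simp [Update.exprs]) h1).within fun p hp => (hp rfl).2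
  intro a ha
  rcases List.mem_append.1 ha with ha | ha
  · exact k1 a ha
  rcases h2 with ⟨-, ts, vs, t₃, w, h3, h4, rfl⟩ | ⟨-, rfl⟩
  · simp only [List.mem_append, List.mem_singleton] at ha
    rcases ha with (ha | ha) | rfl
    · exact (expr_within hP hF hU (by simp [Update.exprs]) h3).within (fun p hp => (hp rfl).2) a ha
    · refine (readsOnly_flatten fun d => expr_within hP hF hU ?_ (h4 d)).within (fun p hp => (hp rfl).2) a ha
      simp [Update.exprs]
    · refine ⟨rfl, fun d hd => ?_⟩
      have := h4 d
      rw [Func.mem_dims.1 hd, Expr.lower, Expr.fill, Expr.tr_var] at this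
      rw [← this.2]
      simp
  · simp at ha

theorem pureL_hdrs {m n : ℕ} (η : Hole → ℤ) (z : Input m n) (i j : ℕ) (U : Update F.arity) :
    pureL ((F.hdrs i j U).map (Hdr.nums η z)) = (F.pureHdrs (F.ver i j) U).map (Hdr.nums η z) := by
  rw [Func.hdrs, List.map_append, pureL_append, (pureL_eq_self _).1, (redL_eq_self _).2, List.append_nil]
  · intro x hx
    obtain ⟨h, hh, rfl⟩ := List.mem_map.1 hx
    obtain ⟨b, hb, rfl⟩ := Func.mem_redHdrs.1 hh
    exact id
  · intro x hx
    obtain ⟨h, hh, rfl⟩ := List.mem_map.1 hx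
    obtain ⟨d, hd, rfl⟩ := Func.mem_pureHdrs.1 hh
    trivial

theorem redL_hdrs {m n : ℕ} (η : Hole → ℤ) (z : Input m n) (i j : ℕ) (U : Update F.arity) :
    redL ((F.hdrs i j U).map (Hdr.nums η z)) = (F.redHdrs i j U).map (Hdr.nums η z) := by
  rw [Func.hdrs, List.map_append, redL_append, (pureL_eq_self _).2, (redL_eq_self _).1, List.nil_append]
  · intro x hx
    obtain ⟨h, hh, rfl⟩ := List.mem_map.1 hx
    obtain ⟨b, hb, rfl⟩ := Func.mem_redHdrs.1 hh
    exact id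
  · intro x hx
    obtain ⟨h, hh, rfl⟩ := List.mem_map.1 hx
    obtain ⟨d, hd, rfl⟩ := Func.mem_pureHdrs.1 hh
    trivial

/-- Membership in the loops of a stage over its pure dimensions. -/
theorem box_pureHdrs {m n : ℕ} {η : Hole → ℤ} {z : Input m n} {v : Ver} {ρ : Env} :
    Box z.env ((F.pureHdrs v U).map (Hdr.nums η z)) ρ ↔
      (∀ x, (∀ d ∈ F.dims U, x ≠ .pure (F.vars d)) → ρ x = z.env x) ∧
      ∀ d ∈ F.dims U, ∃ t : ℤ, ρ (.pure (F.vars d)) = .int t ∧ η (.cpu F.name v d .min) ≤ t ∧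
        t < η (.cpu F.name v d .min) + η (.cpu F.name v d .len) := by
  have hm : ∀ x : NumLoop, x ∈ (F.pureHdrs v U).map (Hdr.nums η z) ↔ ∃ d ∈ F.dims U,
      x = (.pure (F.vars d), η (.cpu F.name v d .min), η (.cpu F.name v d .len)) := by
    intro x
    simp only [List.mem_map, Func.mem_pureHdrs]
    constructor
    · rintro ⟨h, ⟨d, hd, rfl⟩, rfl⟩; exact ⟨d, hd, rfl⟩
    · rintro ⟨d, hd, rfl⟩; exact ⟨_, ⟨d, hd, rfl⟩, rfl⟩
  constructor
  · rintro ⟨h1, h2⟩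
    refine ⟨fun x hx => h1 x fun hx' => ?_, fun d hd => h2 _ ((hm _).2 ⟨d, hd, rfl⟩)⟩
    obtain ⟨y, hy, rfl⟩ := List.mem_map.1 hx'
    obtain ⟨d, hd, rfl⟩ := (hm y).1 hy
    exact hx d hd rfl
  · rintro ⟨h1, h2⟩
    refine ⟨fun x hx => h1 x fun d hd e => hx ?_, fun x hx => ?_⟩
    · rw [e]; exact List.mem_map.2 ⟨_, (hm _).2 ⟨d, hd, rfl⟩, rfl⟩
    · obtain ⟨d, hd, rfl⟩ := (hm x).1 hx
      exact h2 d hd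

theorem nonneg_pureHdrs {m n : ℕ} {η : Hole → ℤ} {z : Input m n} (h : ∀ f v d, 0 ≤ η (.cpu f v d .len))
    (v : Ver) : Nonneg ((F.pureHdrs v U).map (Hdr.nums η z)) := by
  intro x hx
  obtain ⟨l, hl, rfl⟩ := List.mem_map.1 hx
  obtain ⟨d, hd, rfl⟩ := Func.mem_pureHdrs.1 hl
  exact h _ _ _

/-- The point determines the variables of the dimensions looped over, and the box fixes all others
to their initial values. So the slices of different pure iterations are disjoint. -/
theorem Func.Slice.eq {m n : ℕ} {η η' : Hole → ℤ} {z : Input m n} {v v' : Ver} {ρ ρ' : Env} {p : List Val}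
    (h : Box z.env ((F.pureHdrs v U).map (Hdr.nums η z)) ρ)
    (h' : Box z.env ((F.pureHdrs v' U).map (Hdr.nums η' z)) ρ') (hp : F.Slice U ρ p)
    (hp' : F.Slice U ρ' p) : ρ = ρ' := by
  rw [box_pureHdrs] at h h'
  funext x
  by_cases hx : ∃ d ∈ F.dims U, x = .pure (F.vars d)
  · obtain ⟨d, hd, rfl⟩ := hx
    have := hp d hd
    rw [hp' d hd, Option.some.injEq] at this
    exact this.symm
  · push Not at hx
    rw [h.1 x hx, h'.1 x hx]

theorem Func.slice_purePart {ρ : Env} {p : List Val} : F.Slice U (purePart ρ) p ↔ F.Slice U ρ p :=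
  Iff.rfl

theorem Box.purePart {m n : ℕ} {z : Input m n} {N : List NumLoop} {ρ : Env} (h : Box z.env N ρ)
    (hl : ∀ v ∈ vars N, v.IsLoop) : Box z.env (pureL N) (purePart ρ) := by
  refine ⟨(h.intOn.purePart hl).1, fun x hx => ?_⟩
  obtain ⟨h1, h2⟩ := mem_pureL.1 hx
  rw [purePart_of_isPure ρ h2]
  exact h.2 x h1

/-! ## Reached statements -/

theorem Stmt.NoLabel.not_reach {Γ : Hole → Expr Ver Empty} {s : Stmt Hole} (h : s.NoLabel) {ρ ρ' : Env}
    {l : Label} {b : Stmt Empty} : ¬ (s.fill Γ).Reach ρ ρ' (.label l b) := by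
  induction s generalizing ρ with
  | seq s₁ s₂ ih₁ ih₂ =>
    intro hr
    cases hr with
    | seqLeft _ _ _ _ _ hr => exact ih₁ h.1 hr
    | seqRight _ _ _ _ _ hr => exact ih₂ h.2 hr
  | ite e s₁ s₂ ih₁ ih₂ =>
    intro hr
    cases hr with
    | iteTrue _ _ _ _ _ _ _ _ _ _ hr => exact ih₁ h.1 hr
    | iteFalse _ _ _ _ _ _ _ _ hr => exact ih₂ h.2 hr
  | loop τ x lo len s ih =>
    intro hr
    cases hr with
    | loop _ _ _ _ _ _ _ _ _ _ _ _ _ _ _ _ hr => exact ih h hr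
  | letIn x e s ih =>
    intro hr
    cases hr with
    | letIn _ _ _ _ _ _ _ _ _ hr => exact ih h hr
  | label l s ih => exact h.elim
  | _ => intro hr; cases hr

theorem Stmt.Skel.reach {Γ : Hole → Expr Ver Empty} {s : Stmt Hole} (h : s.Skel) {ρ ρ' : Env}
    {st : Stage} {b : Stmt Empty} (hr : (s.fill Γ).Reach ρ ρ' (.label (.stage st) b)) :
    ρ' = ρ ∧ ∃ b', (Stmt.label (.stage st) b').Sub s ∧ b = b'.fill Γ := by
  induction s generalizing ρ with
  | seq s₁ s₂ ih₁ ih₂ =>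
    cases hr with
    | seqLeft _ _ _ _ _ hr =>
      obtain ⟨h1, b', h2, h3⟩ := ih₁ h.1 hr
      exact ⟨h1, b', .inr (.inl h2), h3⟩
    | seqRight _ _ _ _ _ hr =>
      obtain ⟨h1, b', h2, h3⟩ := ih₂ h.2 hr
      exact ⟨h1, b', .inr (.inr h2), h3⟩
  | ite e s₁ s₂ ih₁ ih₂ =>
    cases hr with
    | iteTrue _ _ _ _ _ _ _ _ _ _ hr =>
      obtain ⟨h1, b', h2, h3⟩ := ih₁ h.2.1 hr
      exact ⟨h1, b', .inr (.inl h2), h3⟩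
    | iteFalse _ _ _ _ _ _ _ _ hr =>
      obtain ⟨h1, b', h2, h3⟩ := ih₂ h.2.2 hr
      exact ⟨h1, b', .inr (.inr h2), h3⟩
  | loop τ x lo len s ih => exact h.elim
  | letIn x e s ih => exact h.elim
  | label l s ih =>
    cases l with
    | stage st' =>
      cases hr with
      | refl => exact ⟨rfl, s, .inl rfl, rfl⟩
      | label _ _ _ _ _ hr => exact (Stmt.NoLabel.not_reach h hr).elim
    | func f =>
      cases hr with
      | label _ _ _ _ _ hr =>
        obtain ⟨h1, b', h2, h3⟩ := ih h hr
        exact ⟨h1, b', .inr h2, h3⟩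
    | spec f j =>
      cases hr with
      | label _ _ _ _ _ hr =>
        obtain ⟨h1, b', h2, h3⟩ := ih h hr
        exact ⟨h1, b', .inr h2, h3⟩
  | _ => cases hr

theorem Below.not_reach_loop {Γ : Hole → Expr Ver Empty} {core s : Stmt Hole} (hc : IsCore core)
    (hs : Below core s) {ρ ρ' : Env} {τ : Order} {x : Var} {lo len : Expr Ver Empty} {b : Stmt Empty} :
    ¬ (s.fill Γ).Reach ρ ρ' (.loop τ x lo len b) := by
  induction hs generalizing ρ with
  | core =>
    obtain ⟨p, f, w, k, args, e, rfl⟩ := hc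
    intro hr
    cases hr with
    | iteTrue _ _ _ _ _ _ _ _ _ _ hr => cases hr
    | iteFalse _ _ _ _ _ _ _ _ hr => cases hr
  | letIn x e s hx he _ ih =>
    intro hr
    cases hr with
    | letIn _ _ _ _ _ _ _ _ _ hr => exact ih hr
  | guard e s he _ ih =>
    intro hr
    cases hr with
    | iteTrue _ _ _ _ _ _ _ _ _ _ hr => exact ih hr
    | iteFalse _ _ _ _ _ _ _ _ hr => cases hr

theorem reach_loop_nest {m n : ℕ} {Γ : Hole → Expr Ver Empty} (hΓ : Compatible m n Γ) {z : Input m n}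
    {core tail : Stmt Hole} (hc : IsCore core) {Ls : List Hdr} (hok : NestOK m n core Ls tail)
    {ρ₀ ρ : Env} (hρ : Base z ρ₀) {τ : Order} {x : Var} {lo len : Expr Ver Empty} {b : Stmt Empty}
    (hr : ((nest Ls tail).fill Γ).Reach ρ₀ ρ (.loop τ x lo len b)) :
    ∃ A h D, Ls = A ++ h :: D ∧ x = h.var ∧ lo = h.lo.fill Γ ∧ len = h.len.fill Γ ∧
      b = (nest D tail).fill Γ ∧ Box ρ₀ (A.map (Hdr.nums (holeVal Γ z) z)) ρ := by
  induction Ls generalizing ρ₀ with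
  | nil => exact (hok.below.not_reach_loop hc hr).elim
  | cons h Ls ih =>
    obtain ⟨c1, c2, c3⟩ := hok.closed h (by simp)
    have hok' : NestOK m n core Ls tail := ⟨fun l hl => hok.closed l (by simp [hl]),
      (List.nodup_cons.1 hok.nodup).2, fun l hl => hok.serial l (by simp [hl]), hok.below,
      fun l hl => hok.fresh l (by simp [hl])⟩
    rw [nest_fill_cons] at hr
    cases hr with
    | refl => exact ⟨[], h, Ls, rfl, rfl, rfl, rfl, rfl, box_nil.2 rfl⟩
    | loop _ _ _ _ _ _ _ _ t₁ t₂ a k i h₁ h₂ hi hr =>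
      rw [c1.tr_fill hΓ hρ] at h₁
      rw [c2.tr_fill hΓ hρ] at h₂
      obtain ⟨-, h₁⟩ := h₁
      obtain ⟨-, h₂⟩ := h₂
      simp only [Val.int.injEq] at h₁ h₂
      obtain ⟨A, h', D, rfl, k1, k2, k3, k4, k5⟩ := ih hok' (hρ.update c3 _) hr
      refine ⟨h :: A, h', D, rfl, k1, k2, k3, k4, ?_⟩
      rw [List.map_cons, box_cons]
      · refine ⟨i, ?_, by rw [h₁] at k5; exact k5⟩
        show i < (h.len.num (holeVal Γ z) z).toNat
        omega
      · rw [map_fst_nums]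
        have := (List.nodup_cons.1 hok.nodup).1
        simp only [List.map_append, List.mem_append, not_or] at this
        exact this.1

theorem Box.append {ρ₀ ρ ρ' : Env} {A B : List NumLoop} (hnd : (vars (A ++ B)).Nodup) (h : Box ρ₀ A ρ)
    (h' : Box ρ B ρ') : Box ρ₀ (A ++ B) ρ' := by
  have e := enum_append A B ρ₀
  simp only [vars, List.map_append, List.nodup_append] at hnd
  rw [← mem_enum (by simpa only [List.map_append, List.nodup_append] using hnd), e, List.mem_flatMap]
  exact ⟨ρ, (mem_enum hnd.1).2 h, (mem_enum hnd.2.1).2 h'⟩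

/-- Every access in an iteration of the loop comes from a full iteration of the nest and lies in the
slice of the lowered iteration to which that decodes. A common point of two iterations forces the
same slice, hence the same lowered iteration. As all splits are guarded, decoding is injective on
the pure variables, and one of these is the loop variable itself. -/
theorem Scheduled.disjointIterations {ds : List LoopDir} {T : Prog Hole P.nparams P.out.arity}
    {sp : ℕ → Option (List AExpr)} {B : ℕ → ℕ → ℕ → Stmt Hole} (hP : P.Valid) (h : Scheduled P ds T sp B)
    {l : LoopName} (hl : l.var.IsPure) (hg : GuardsOnly ds l.func l.idx l.spec)
    {Q : Prog Empty P.nparams P.out.arity} (hQ : Q ∈ T.BI) (z : Input P.nparams P.out.arity) :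
    Q.DisjointIterations l z := by
  obtain ⟨Γ, hΓ, hq, rfl⟩ := hQ
  intro st body ρ₀ ρ τ lo len s t₁ t₂ a k i j t t' p v hr1 hs1 hs2 hs3 hr2 hlo hlen hi hj hij ht ht' hw w
  obtain ⟨rfl, b', hb', rfl⟩ := h.skel.reach hr1
  obtain ⟨e1, F, hF, hn, U, hU⟩ := h.stageAt (l := l) ⟨st, hb', hs1, hs2, hs3⟩
  obtain ⟨Ls, tail, e2, hst⟩ := h.stages F hF _ U hU l.spec
  rw [hn] at e2
  rw [e1, e2] at hr2
  obtain ⟨A, c, D, rfl, hv, rfl, rfl, rfl, hbox⟩ :=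
    reach_loop_nest hΓ (F.isCore_core _ _ U) hst.ok (Base.refl z) hr2
  obtain ⟨c1, c2, c3⟩ := hst.ok.closed c (by simp)
  have hbρ : Base z ρ := by
    have := hbox.intOn
    rw [map_fst_nums] at this
    exact this.base_of_closed fun l hl => hst.ok.closed l (by simp [hl])
  rw [c1.tr_fill hΓ hbρ] at hlo
  rw [c2.tr_fill hΓ hbρ] at hlen
  obtain ⟨-, hlo⟩ := hlo
  obtain ⟨-, hlen⟩ := hlen
  simp only [Val.int.injEq] at hlo hlen
  obtain ⟨dec, decP, hsem⟩ := hst.sem Γ z hΓ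
  have nd : (vars ((A ++ c :: D).map (Hdr.nums (holeVal Γ z) z))).Nodup := by
    rw [vars_nums]; exact hst.ok.nodup
  have hlv : ∀ v ∈ vars ((A ++ c :: D).map (Hdr.nums (holeVal Γ z) z)), v.IsLoop := by
    rw [vars_nums]
    intro v hv
    obtain ⟨x, hx, rfl⟩ := List.mem_map.1 hv
    exact (hst.ok.closed x hx).2.2
  have hcD : ∀ h ∈ D, h.Closed P.nparams P.out.arity := fun h hh => hst.ok.closed h (by simp [hh])
  have hnD : (D.map Hdr.var).Nodup ∧ c.var ∉ D.map Hdr.var := by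
    have := hst.ok.nodup
    rw [List.map_append, List.nodup_append, List.map_cons, List.nodup_cons] at this
    exact ⟨this.2.1.2, this.2.1.1⟩
  -- the original iteration of an action
  have key : ∀ (i : ℕ) (t : List Act) (act : Act), i < k →
      ((nest D tail).fill Γ).Tr (Function.update ρ l.var (.int (a + i))) t → act ∈ t →
      (∀ k, act ≠ .fail k) → ∃ e e₀, Box z.env (pureL ((A ++ c :: D).map (Hdr.nums (holeVal Γ z) z))) e ∧
        e l.var = .int (a + i) ∧ decP e = some e₀ ∧ act.Within F.name (F.Slice U e₀) := by
    intro i t act hi ht hact hf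
    obtain ⟨e, he, t', ht', hact'⟩ := nest_tr_mem hΓ hcD hnD.1
      (hbρ.update hl.isLoop _) ht hact hf
    have hex : e l.var = .int (a + i) := by
      rw [he.1 l.var (by rw [map_fst_nums, hv]; exact hnD.2)]
      simp
    have hbe : Box z.env ((A ++ c :: D).map (Hdr.nums (holeVal Γ z) z)) e := by
      rw [List.map_append] at nd ⊢
      refine Box.append nd hbox ?_
      rw [List.map_cons, box_cons]
      · refine ⟨i, ?_, ?_⟩
        · show i < (c.len.num (holeVal Γ z) z).toNat
          omega
        · show Box (Function.update ρ c.var (.int (c.lo.num (holeVal Γ z) z + (i : ℕ)))) _ e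
          rw [← hv, ← hlo]
          exact he
      · rw [map_fst_nums]; exact hnD.2
    have hsim := hsem.sim e hbe.intOn
    cases hd : dec e with
    | none =>
      rw [hd] at hsim
      have := (hsim.1 t').1 ht'
      simp only [Stmt.fill, Stmt.tr_nop] at this
      simp [this] at hact'
    | some e₀ =>
      rw [hd] at hsim
      obtain ⟨-, k2⟩ := hsem.dec_int e hbe.intOn e₀ hd
      refine ⟨purePart e, purePart e₀, hbe.purePart hlv, ?_, k2, ?_⟩
      · rw [purePart_of_isPure e hl, hex]
      · exact core_within hP hF hU ((hsim.1 t').1 ht') act hact'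
  obtain ⟨e, e₀, k1, k2, k3, k4⟩ := key i t _ hi ht hw (fun _ => nofun)
  have hnn : Nonneg (pureL ((F.hdrs l.idx l.spec U).map (Hdr.nums (holeVal Γ z) z))) := by
    rw [pureL_hdrs]
    exact nonneg_pureHdrs (hq z).1 _
  have hgF : GuardsOnly ds F.name l.idx l.spec := by rw [hn]; exact hg
  -- Reads and writes are treated at once: apart from failures, all actions of the other iteration
  -- stay away from `p`.
  have fin : ∀ act ∈ t', (∀ k, act ≠ .fail k) → act.Within l.func (fun q => q ≠ p) := by
    intro act hact hf
    obtain ⟨e', e₀', k1', k2', k3', k4'⟩ := key j t' act hj ht' hact hf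
    have hne : ∀ q, F.Slice U e₀' q → q ≠ p := by
      rintro q hs rfl
      -- Both lowered iterations lie in the lowered box and their slices share `p`, so they are
      -- equal. Injectivity then identifies scheduled iterations that differ in the loop variable.
      have b1 := hsem.box hgF hnn e e₀ k1 k3
      have b2 := hsem.box hgF hnn e' e₀' k1' k3'
      rw [pureL_hdrs] at b1 b2
      obtain rfl := Func.Slice.eq b1 b2 (k4.2) hs
      obtain rfl := hsem.inj hgF hnn e e' e₀ k1 k1' k3 k3'
      rw [k2, Val.int.injEq] at k2'
      omega
    cases act with
    | read g q w => exact fun hg => hne q (k4' (hg.trans hn.symm))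
    | write g q w => exact ⟨k4'.1.trans hn, hne q k4'.2⟩
    | alloc g I => exact k4'
    | fail k => trivial
  exact ⟨fun hm => (fin _ hm fun _ => nofun).2 rfl, fun hm => fin _ hm (fun _ => nofun) rfl rfl⟩

end Halide

namespace Halide

/-! ## The order of values

An error approximates every value. The funcs of an algorithm are monotone: an access at a point with
errors among its coordinates is an error, or has the same value at every point that refines it. -/

/-- The value `p` is an error, or it is `v`. -/
def Val.Le (p v : Val) : Prop := p.IsErr ∨ p = v

theorem Val.Le.refl (p : Val) : p.Le p := .inr rfl

theorem Val.cases_int (v : Val) : v.IsErr ∨ ∃ k, v = .int k := by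
  cases v <;> simp [Val.IsErr]

theorem Val.not_isErr_int (k : ℤ) : ¬ (Val.int k).IsErr := by simp [Val.IsErr]

theorem Op.eval_cases (o : Op) (a : Fin o.arity → Val) :
    (o.eval a).IsErr ∨ ∃ k : Fin o.arity → ℤ, (∀ i, a i = .int (k i)) ∧ o.eval a = .int (o.apply k) := by
  by_cases h : ∀ i, ∃ k, a i = .int k
  · choose k hk using h
    exact .inr ⟨k, hk, Op.eval_int hk⟩
  · push Not at h
    obtain ⟨i, hi⟩ := h
    left
    unfold Op.eval
    split_ifs with h1 h2
    · exact .inr rfl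
    · exact .inl rfl
    · rcases (a i).cases_int with (h | h) | ⟨k, hk⟩
      · exact absurd ⟨i, h⟩ h2
      · exact absurd ⟨i, h⟩ h1
      · exact absurd hk (hi k)

/-- Strictness: if the result is not an error, all arguments are integers already, and refinement
cannot change them. -/
theorem Op.eval_mono {o : Op} {a b : Fin o.arity → Val} (h : ∀ i, (a i).Le (b i)) :
    (o.eval a).Le (o.eval b) := by
  rcases o.eval_cases a with he | ⟨k, hk, he⟩
  · exact .inl he
  · right
    congr 1
    funext i
    rcases h i with h | h
    · rw [hk i] at h; exact absurd h (Val.not_isErr_int _)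
    · exact h

/-- Pointwise order of points. -/
def PtLe (c c' : List Val) : Prop := ∀ i, (c.getD i .errMem).Le (c'.getD i .errMem)

def FunVal.Mono (A : FunVal) : Prop := ∀ c c', PtLe c c' → (A c).Le (A c')

theorem ptLe_ofFn {n : ℕ} {u v : Fin n → Val} (h : ∀ i, (u i).Le (v i)) :
    PtLe (List.ofFn u) (List.ofFn v) := by
  intro i
  by_cases hi : i < n
  · simpa [List.getD_eq_getElem?_getD, List.getElem?_ofFn, hi] using h ⟨i, hi⟩
  · simp [List.getD_eq_getElem?_getD, hi, Val.Le.refl]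

theorem Expr.eval_mono {L H : Type} {ρ ρ' : Env} {A : ℕ → FunVal} {η : H → Val} (hA : ∀ g, (A g).Mono)
    (hρ : ∀ v, (ρ v).Le (ρ' v)) (e : Expr L H) : (e.eval ρ A η).Le (e.eval ρ' A η) := by
  induction e with
  | const c => exact .refl _
  | var v => exact hρ v
  | acc f l n args ih => exact hA f _ _ (ptLe_ofFn ih)
  | op o args ih => exact Op.eval_mono ih
  | hole h => exact .refl _

theorem Func.env_mono (F : Func) (ρ : Env) (R : ℕ → Val) {c c' : List Val} (h : PtLe c c') (v : Var) :
    (F.env ρ R c v).Le (F.env ρ R c' v) := by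
  cases v with
  | pure x =>
    simp only [Func.env]
    split
    · exact h _
    · exact .refl _
  | _ => exact .refl _

/-- The condition of a point update. -/
def updateCond {n : ℕ} (u : Fin n → Val) (p : Val) (c : List Val) (L : List (Fin n)) : Val :=
  L.foldr (fun d b => Op.and.eval ![Op.eq.eval ![u d, c.getD d .errMem], b]) p

theorem updateCond_mono {n : ℕ} {u u' : Fin n → Val} {p p' : Val} {c c' : List Val}
    (hu : ∀ d, (u d).Le (u' d)) (hp : p.Le p') (hc : PtLe c c') (L : List (Fin n)) :
    (updateCond u p c L).Le (updateCond u' p' c' L) := by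
  induction L with
  | nil => exact hp
  | cons d L ih =>
    exact Op.eval_mono (o := .and) (Fin.forall_fin_two.2
      ⟨Op.eval_mono (o := .eq) (Fin.forall_fin_two.2 ⟨hu d, hc d⟩), ih⟩)

/-- By strictness a condition without error has integer operands throughout, so its truth value
reflects genuine equality of the indices with the coordinates of the point. -/
theorem updateCond_cases {n : ℕ} (u : Fin n → Val) (p : Val) (c : List Val) (L : List (Fin n)) :
    (updateCond u p c L).IsErr ∨ ((∃ k, p = .int k) ∧ (∀ d ∈ L, ∃ k, u d = .int k) ∧
      (∃ k, updateCond u p c L = .int k) ∧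
      (updateCond u p c L ≠ .int 0 ↔ p ≠ .int 0 ∧ ∀ d ∈ L, u d = c.getD d .errMem)) := by
  induction L with
  | nil =>
    rcases p.cases_int with h | ⟨k, rfl⟩
    · exact .inl h
    · exact .inr ⟨⟨k, rfl⟩, by simp, ⟨k, rfl⟩, by simp [updateCond]⟩
  | cons d L ih =>
    have e : updateCond u p c (d :: L) =
      Op.and.eval ![Op.eq.eval ![u d, c.getD d .errMem], updateCond u p c L] := rfl
    rcases Op.eval_cases .and ![Op.eq.eval ![u d, c.getD d .errMem], updateCond u p c L] with h | ⟨k, hk, h⟩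
    · exact .inl (e ▸ h)
    have h0 : Op.eq.eval ![u d, c.getD d .errMem] = .int (k (0 : Fin 2)) := hk (0 : Fin 2)
    have h1 : updateCond u p c L = .int (k (1 : Fin 2)) := hk (1 : Fin 2)
    rcases ih with ih | ⟨i1, i2, i3, i4⟩
    · rw [h1] at ih; exact absurd ih (Val.not_isErr_int _)
    rcases Op.eval_cases .eq ![u d, c.getD d .errMem] with h' | ⟨k', hk', h'⟩
    · rw [h0] at h'; exact absurd h' (Val.not_isErr_int _)
    have j0 : u d = .int (k' (0 : Fin 2)) := hk' (0 : Fin 2)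
    have j1 : c.getD d .errMem = .int (k' (1 : Fin 2)) := hk' (1 : Fin 2)
    right
    refine ⟨i1, by simpa [j0] using i2, ⟨_, e.trans h⟩, ?_⟩
    rw [h0] at h'
    rw [h1] at i4
    have h'' : k (0 : Fin 2) = if k' (0 : Fin 2) = k' (1 : Fin 2) then 1 else 0 := by
      injection h'
    rw [e, h]
    simp only [Op.apply, List.mem_cons, forall_eq_or_imp, j0, j1, h'', ne_eq, Val.int.injEq] at i4 ⊢
    by_cases hkk : k' (0 : Fin 2) = k' (1 : Fin 2) <;> simp [hkk, i4]

theorem Func.pointUpdate_eq (F : Func) (U : Update F.arity) (ρ : Env) (G : ℕ → FunVal)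
    (R : ℕ → Val) (prev : FunVal) (c : List Val) :
    F.pointUpdate U ρ G R prev c = Op.select.eval ![updateCond
      (fun d => (U.lhs d).eval (F.env ρ R c) (fun g => if g = F.name then prev else G g) Empty.elim)
      (U.pred.eval (F.env ρ R c) (fun g => if g = F.name then prev else G g) Empty.elim) c
      (List.finRange F.arity),
      U.rhs.eval (F.env ρ R c) (fun g => if g = F.name then prev else G g) Empty.elim, prev c] := rfl

theorem mono_self {f : ℕ} {G : ℕ → FunVal} {prev : FunVal} (hG : ∀ g, (G g).Mono) (hp : prev.Mono) (g : ℕ) :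
    FunVal.Mono (if g = f then prev else G g) := by
  split
  · exact hp
  · exact hG g

theorem Func.pointUpdate_mono (F : Func) (U : Update F.arity) (ρ : Env) {G : ℕ → FunVal}
    (hG : ∀ g, (G g).Mono) (R : ℕ → Val) {prev : FunVal} (hp : prev.Mono) :
    (F.pointUpdate U ρ G R prev).Mono := by
  intro c c' hc
  have hA := mono_self (f := F.name) hG hp
  have he := fun e : AExpr => e.eval_mono (η := Empty.elim) hA (F.env_mono ρ R hc)
  rw [Func.pointUpdate_eq, Func.pointUpdate_eq]
  refine Op.eval_mono (o := .select) ?_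
  intro i
  match i with
  | (0 : Fin 3) => exact updateCond_mono (fun d => he _) (he _) hc _
  | (1 : Fin 3) => exact he _
  | (2 : Fin 3) => exact hp _ _ hc

theorem unroll_ind {Q : FunVal → Prop} {step : (ℕ → Val) → FunVal → FunVal}
    (h : ∀ R g, Q g → Q (step R g)) (L : List (ℕ × ℤ × ℤ)) (R : ℕ → Val) {g : FunVal} (hg : Q g) :
    Q (unroll step L R g) := by
  induction L generalizing R g with
  | nil => exact h R g hg
  | cons x L ih =>
    obtain ⟨r, lo, len⟩ := x
    simp only [unroll]
    generalize List.range len.toNat = E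
    induction E generalizing g with
    | nil => exact hg
    | cons t E ihE => exact ihE (ih _ hg)

theorem Func.update_mono (F : Func) (U : Update F.arity) (ρ : Env) {G : ℕ → FunVal}
    (hG : ∀ g, (G g).Mono) {prev : FunVal} (hp : prev.Mono) : (F.update ρ G prev U).Mono := by
  simp only [Func.update]
  split
  · exact fun c c' _ => .refl _
  · exact unroll_ind (Q := FunVal.Mono) (fun R g hg => F.pointUpdate_mono U ρ hG R hg) _ _ hp

/-- The func after the stages up to `i`. -/
def Func.stageVal (F : Func) (ρ : Env) (G : ℕ → FunVal) (i : ℕ) : FunVal :=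
  (F.updates.take i).foldl (F.update ρ G)
    fun c => F.body.eval (F.env ρ (fun _ => .errMem) c) G Empty.elim

theorem Func.stageVal_mono (F : Func) (ρ : Env) {G : ℕ → FunVal} (hG : ∀ g, (G g).Mono) (i : ℕ) :
    (F.stageVal ρ G i).Mono := by
  unfold Func.stageVal
  have h0 : FunVal.Mono fun c => F.body.eval (F.env ρ (fun _ => .errMem) c) G Empty.elim :=
    fun c c' hc => Expr.eval_mono hG (F.env_mono ρ _ hc) _
  generalize F.updates.take i = E
  revert h0
  generalize (fun c => F.body.eval (F.env ρ (fun _ => .errMem) c) G Empty.elim) = g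
  intro h0
  induction E generalizing g with
  | nil => exact h0
  | cons U E ih => exact ih _ (F.update_mono U ρ hG h0)

theorem Func.stageVal_succ (F : Func) (ρ : Env) (G : ℕ → FunVal) {i : ℕ} {U : Update F.arity}
    (h : F.updates[i]? = some U) : F.stageVal ρ G (i + 1) = F.update ρ G (F.stageVal ρ G i) U := by
  simp [Func.stageVal, List.take_add_one, h]

theorem Func.stageVal_length (F : Func) (ρ : Env) (G : ℕ → FunVal) :
    F.stageVal ρ G F.updates.length = F.val ρ G := by
  simp [Func.stageVal, Func.val]

/-- The funcs denoted by the first `k` definitions. -/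
def Alg.vals (P : Alg) (ρ : Env) (k : ℕ) : ℕ → FunVal :=
  (P.funcs.take k).foldl (fun G F => Function.update G F.name (F.val ρ G)) fun _ _ => .errMem

theorem Alg.vals_succ (P : Alg) (ρ : Env) {k : ℕ} {F : Func} (h : P.funcs[k]? = some F) :
    P.vals ρ (k + 1) = Function.update (P.vals ρ k) F.name (F.val ρ (P.vals ρ k)) := by
  simp [Alg.vals, List.take_add_one, h]

theorem Alg.vals_mono (P : Alg) (ρ : Env) (k : ℕ) : ∀ g, (P.vals ρ k g).Mono := by
  induction k with
  | zero => exact fun g c c' _ => .refl _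
  | succ k ih =>
    cases h : P.funcs[k]? with
    | none =>
      have : P.vals ρ (k + 1) = P.vals ρ k := by simp [Alg.vals, List.take_add_one, h]
      rwa [this]
    | some F =>
      rw [P.vals_succ ρ h]
      intro g
      by_cases hg : g = F.name
      · subst hg
        rw [Function.update_self, ← F.stageVal_length]
        exact F.stageVal_mono ρ ih _
      · rw [Function.update_of_ne hg]
        exact ih g

/-- Unrolling runs through the iterations of the loops of the rdom. -/
theorem unroll_eq_foldl (step : (ℕ → Val) → FunVal → FunVal) (L : List (ℕ × ℤ × ℤ)) (ρ : Env)
    (prev : FunVal) : unroll step L (fun r => ρ (.red r)) prev =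
      (enum (L.map fun b => (Var.red b.1, b.2.1, b.2.2)) ρ).foldl
        (fun g e => step (fun r => e (.red r)) g) prev := by
  induction L generalizing ρ prev with
  | nil => rfl
  | cons x L ih =>
    obtain ⟨r, lo, len⟩ := x
    simp only [unroll, List.map_cons, enum]
    generalize List.range len.toNat = E
    induction E generalizing prev with
    | nil => rfl
    | cons t E ihE =>
      rw [List.bind_eq_flatMap] at ihE ⊢
      rw [List.flatMap_cons, List.flatMap_cons, List.foldl_append, List.foldl_append, ihE, ← ih]
      congr 1
      change unroll step L _ prev = _
      congr 1
      funext r'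
      by_cases h : r' = r
      · subst h; simp
      · rw [Function.update_of_ne h, Function.update_of_ne (by simpa using h)]

end Halide

namespace Halide

/-! ## Evaluation in the target language

On a store that holds refinements of the values of the funcs, the expressions that satisfy the bounds
query evaluate to refinements of the values that they have in the algorithm. -/

/-- The value `v` is an integer that refines `p`. -/
def Val.Rel (p v : Val) : Prop := (∃ k, v = .int k) ∧ p.Le v

theorem Val.Le.trans {p v w : Val} (h : p.Le v) (h' : v.Le w) : p.Le w := by
  rcases h with h | rfl
  · exact .inl h
  · exact h'

theorem Val.Le.rel {p q v : Val} (h : p.Le q) (h' : q.Rel v) : p.Rel v := ⟨h'.1, h.trans h'.2⟩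

/-- The contents of the store, with errors read as zero. -/
def storeVal (σ : Store) (g : ℕ) (p : List Val) : ℤ :=
  match σ g with
  | some b => (b.val p).toInt
  | none => 0

/-- The buffer was allocated with the allocation bounds of the `n`-dimensional func `f`. -/
def Buffer.AllocAs (η : Hole → ℤ) (f n : ℕ) (b : Buffer) : Prop :=
  b.bounds = List.ofFn fun d : Fin n => (.int (η (.mem f d .min)), .int (η (.mem f d .len)))

theorem Buffer.AllocAs.inBounds {η : Hole → ℤ} {f n : ℕ} {b : Buffer} (h : b.AllocAs η f n) {p : List Val}
    (hn : p.length = n) (hp : InBox η (.mem f) p) : b.InBounds p := by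
  unfold Buffer.InBounds
  rw [h, List.forall₂_iff_get]
  refine ⟨by simp [hn], fun i h₁ h₂ => ?_⟩
  obtain ⟨t, h1, h2, h3⟩ := hp i h₁
  exact ⟨t, _, _, h1, by simp, h2, h3⟩

section Eval

variable {Γ : Hole → Expr Ver Empty} {η : Hole → ℤ} {ρ : Env} {σ : Store} {st : Option Stage} {f : ℕ} {v : Ver}

/-- The func values of the query are taken to be the contents of the store. With this choice the
points in the query are the points accessed at run time, so that their reads succeed and return
refinements. -/
theorem Expr.lower_run {A : ℕ → FunVal} (hA : ∀ g, (A g).Mono) {e : AExpr}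
    (hread : ∀ g l n args, (Expr.acc g l n args).Sub e → ∀ p,
      p = (List.ofFn fun i : Fin n => ((args i).lower f v).qval η (storeVal σ) ρ) →
      InBox η (.mem g) p → InBox η (.cpu g (if g = f then v else .last)) p →
      (∀ st' ∈ st, st'.func = g → st'.reductive = true → InBox η (.cpu g st'.ver) p) →
      ∃ b, σ g = some b ∧ b.InBounds p ∧ (A g p).Rel (b.val p))
    (hvars : ∀ x ∈ e.vars, ∃ k, ρ x = .int k) (hq : (e.lower f v).queryCpu η (storeVal σ) ρ st) :
    (e.eval ρ A Empty.elim).Rel ((e.lower f v).qval η (storeVal σ) ρ) ∧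
      ∀ t w, ((e.lower f v).fill Γ).Tr ρ t w → ∀ o, Run σ t o →
        o = .done σ ∧ w = (e.lower f v).qval η (storeVal σ) ρ := by
  induction e with
  | const c =>
    refine ⟨⟨⟨c, rfl⟩, .refl _⟩, fun t w h o hr => ?_⟩
    rw [Expr.lower, Expr.fill, Expr.tr_const] at h
    obtain ⟨rfl, rfl⟩ := h
    exact ⟨run_nil.1 hr, rfl⟩
  | var x =>
    refine ⟨⟨hvars x (by simp [Expr.vars]), .refl _⟩, fun t w h o hr => ?_⟩
    rw [Expr.lower, Expr.fill, Expr.tr_var] at h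
    obtain ⟨rfl, rfl⟩ := h
    exact ⟨run_nil.1 hr, rfl⟩
  | hole x => exact x.elim
  | op o args ih =>
    have ih' := fun i => ih i (fun g l n args' hs => hread g l n args' (.inr ⟨i, hs⟩))
      (fun x hx => hvars x (Expr.mem_vars_op.2 ⟨i, hx⟩)) (hq i)
    choose k hk using fun i => (ih' i).1.1
    refine ⟨⟨⟨_, Op.eval_int hk⟩, Op.eval_mono fun i => (ih' i).1.2⟩, fun t w h o' hr => ?_⟩
    rw [Expr.lower, Expr.fill, Expr.tr_op] at h
    obtain ⟨ts, vs, h1, rfl, rfl⟩ := h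
    rw [← List.append_nil (List.ofFn ts).flatten] at hr
    obtain ⟨h2, h3⟩ := run_ofFn_const (fun i o ho => ((ih' i).2 _ _ (h1 i) o ho).1) hr
    refine ⟨run_nil.1 h3, ?_⟩
    change o.eval vs = o.eval _
    congr 1
    funext i
    exact ((ih' i).2 _ _ (h1 i) _ (h2 i)).2
  | acc g l n args ih =>
    obtain ⟨hq1, hq2, hq3, hq4⟩ := hq
    have ih' := fun i => ih i (fun g l n args' hs => hread g l n args' (.inr ⟨i, hs⟩))
      (fun x hx => hvars x (Expr.mem_vars_acc.2 ⟨i, hx⟩)) (hq1 i)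
    obtain ⟨b, hb, hin, hrel⟩ := hread g l n args (.inl rfl) _ rfl hq2 hq3 hq4
    set p := List.ofFn fun i : Fin n => ((args i).lower f v).qval η (storeVal σ) ρ with hp
    -- Reading errors as zero does no harm: within the compute bounds the stored value is known to
    -- be an integer.
    have hval : ((Expr.acc g l n args).lower f v).qval η (storeVal σ) ρ = b.val p := by
      obtain ⟨k, hk⟩ := hrel.1
      change Val.int (storeVal σ g p) = _
      simp [storeVal, hb, hk, Val.toInt]
    rw [hval]
    -- The algorithm may access a point with errors among its coordinates; monotonicity compares its
    -- value there with the one at the point of the run.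
    refine ⟨(hA g _ _ (ptLe_ofFn fun i => (ih' i).1.2)).rel hrel, fun t w h o hr => ?_⟩
    rw [Expr.lower, Expr.fill, Expr.tr_acc] at h
    obtain ⟨ts, vs, h1, rfl⟩ := h
    obtain ⟨h2, h3⟩ := run_ofFn_const (fun i o ho => ((ih' i).2 _ _ (h1 i) o ho).1) hr
    have hvs : List.ofFn vs = p := by
      rw [hp]; congr 1; funext i; exact ((ih' i).2 _ _ (h1 i) _ (h2 i)).2
    rw [hvs, run_cons] at h3
    rcases h3 with ⟨σ', ⟨rfl, b', hb', -, rfl⟩, h4⟩ | ⟨k, ⟨-, hf⟩, -⟩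
    · rw [hb] at hb'; cases hb'
      exact ⟨run_nil.1 h4, rfl⟩
    · exact absurd ⟨b, hb, hin⟩ hf

/-- Outside of the compute bounds nothing is known about the value that is read, but the allocation
bounds ensure that the read succeeds. Index expressions are still queried for compute bounds, so the
points themselves are exact. -/
theorem Expr.lower_run_mem {A : ℕ → FunVal} (hA : ∀ g, (A g).Mono) {e : AExpr}
    (hread : ∀ g l n args, (Expr.acc g l n args).Sub e → ∀ p,
      p = (List.ofFn fun i : Fin n => ((args i).lower f v).qval η (storeVal σ) ρ) →
      InBox η (.mem g) p → InBox η (.cpu g (if g = f then v else .last)) p →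
      (∀ st' ∈ st, st'.func = g → st'.reductive = true → InBox η (.cpu g st'.ver) p) →
      ∃ b, σ g = some b ∧ b.InBounds p ∧ (A g p).Rel (b.val p))
    (hmem : ∀ g l n args, (Expr.acc g l n args).Sub e → ∀ p : List Val, p.length = n → InBox η (.mem g) p →
      ∃ b, σ g = some b ∧ b.InBounds p)
    (hvars : ∀ x ∈ e.vars, ∃ k, ρ x = .int k) (hq : (e.lower f v).queryMem η (storeVal σ) ρ st)
    {t : List Act} {w : Val} (h : ((e.lower f v).fill Γ).Tr ρ t w) {o : Outcome} (hr : Run σ t o) :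
    o = .done σ := by
  induction e generalizing t w o with
  | const c =>
    rw [Expr.lower, Expr.fill, Expr.tr_const] at h
    rw [h.1] at hr
    exact run_nil.1 hr
  | var x =>
    rw [Expr.lower, Expr.fill, Expr.tr_var] at h
    rw [h.1] at hr
    exact run_nil.1 hr
  | hole x => exact x.elim
  | op o' args ih =>
    rw [Expr.lower, Expr.fill, Expr.tr_op] at h
    obtain ⟨ts, vs, h1, rfl, rfl⟩ := h
    rw [← List.append_nil (List.ofFn ts).flatten] at hr
    exact run_nil.1 (run_ofFn_const (fun i o ho => ih i
      (fun g l n args' hs => hread g l n args' (.inr ⟨i, hs⟩))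
      (fun g l n args' hs => hmem g l n args' (.inr ⟨i, hs⟩))
      (fun x hx => hvars x (Expr.mem_vars_op.2 ⟨i, hx⟩)) (hq i) (h1 i) ho) hr).2
  | acc g l n args ih =>
    obtain ⟨hq1, hq2⟩ := hq
    have ih' := fun i => (args i).lower_run (Γ := Γ) hA
      (fun g l n args' hs => hread g l n args' (.inr ⟨i, hs⟩))
      (fun x hx => hvars x (Expr.mem_vars_acc.2 ⟨i, hx⟩)) (hq1 i)
    rw [Expr.lower, Expr.fill, Expr.tr_acc] at h
    obtain ⟨ts, vs, h1, rfl⟩ := h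
    obtain ⟨h2, h3⟩ := run_ofFn_const (fun i o ho => ((ih' i).2 _ _ (h1 i) o ho).1) hr
    have hvs : List.ofFn vs = List.ofFn fun i : Fin n => ((args i).lower f v).qval η (storeVal σ) ρ := by
      congr 1; funext i; exact ((ih' i).2 _ _ (h1 i) _ (h2 i)).2
    rw [hvs, run_cons] at h3
    rcases h3 with ⟨σ', ⟨rfl, -⟩, h4⟩ | ⟨k, ⟨-, hf⟩, -⟩
    · exact run_nil.1 h4
    · exact absurd (hmem g l n args (.inl rfl) _ (by simp) hq2) hf

end Eval

/-! ## A single point update -/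

section Core

variable {P : Alg} {pre post : List Func} {F : Func} {i j : ℕ} {U : Update F.arity}

/-- The store holds refinements of the values `G` of the funcs in `pre`, within their compute bounds. -/
def Known (η : Hole → ℤ) (G : ℕ → FunVal) (pre : List Func) (σ : Store) : Prop :=
  ∀ H ∈ pre, ∃ b, σ H.name = some b ∧ b.AllocAs η H.name H.arity ∧
    ∀ c : List Val, c.length = H.arity → InBox η (.cpu H.name .last) c → (G H.name c).Rel (b.val c)

theorem Known.congr {η : Hole → ℤ} {G : ℕ → FunVal} {σ σ' : Store} (h : Known η G pre σ)
    (hσ : ∀ H ∈ pre, σ' H.name = σ H.name) : Known η G pre σ' := fun H hH => by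
  rw [hσ H hH]; exact h H hH

/-- Separation turns each occurrence of a pure variable into a loop over its dimension, so every
variable of a stage is bound when its code runs. -/
theorem Func.vars_cases (hP : P.Valid) (hF : F ∈ P.funcs) (hU : U ∈ F.stages) {e : AExpr}
    (he : e ∈ U.exprs) {x : Var} (hx : x ∈ e.vars) :
    (∃ k < P.nparams, x = .par k) ∨ (∃ d ∈ F.dims U, x = .pure (F.vars d)) ∨ ∃ b ∈ U.rdom, x = .red b.1 := by
  rcases hP.in_scope F hF U hU e he x hx with h | ⟨d, rfl⟩ | h
  · exact .inl h
  · exact .inr (.inl ⟨d, Func.mem_dims.2 (hP.separated F hF U hU d ⟨e, he, hx⟩).1, rfl⟩)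
  · exact .inr (.inr h)

variable {z : Input P.nparams P.out.arity} {ρ : Env} {η : Hole → ℤ}

theorem Func.base_of_intOn (hP : P.Valid) (hF : F ∈ P.funcs) (hU : F.stages[i]? = some U)
    (hρ : IntOn z.env (Halide.vars ((F.hdrs i j U).map (Hdr.nums η z))) ρ) : Base z ρ := by
  refine hρ.base (.refl z) fun v hv => ?_
  rw [vars_nums, List.mem_map] at hv
  obtain ⟨h, hh, rfl⟩ := hv
  exact ((Func.hdrs_ok hP hF hU j).closed h hh).2.2

theorem Func.vars_int (hP : P.Valid) (hF : F ∈ P.funcs) (hU : F.stages[i]? = some U)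
    (hρ : IntOn z.env (Halide.vars ((F.hdrs i j U).map (Hdr.nums η z))) ρ) {e : AExpr} (he : e ∈ U.exprs) {x : Var}
    (hx : x ∈ e.vars) : ∃ k, ρ x = .int k := by
  rcases Func.vars_cases hP hF (Func.stages_mem hU) he hx with ⟨k, hk, rfl⟩ | ⟨d, hd, rfl⟩ | ⟨b, hb, rfl⟩
  · rw [Func.base_of_intOn hP hF hU hρ _ (by simp [Var.IsLoop])]
    exact ⟨z.params ⟨k, hk⟩, by simp only [Input.env, hk, dif_pos]⟩
  · refine hρ.2 _ ?_
    rw [vars_nums, List.mem_map]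
    exact ⟨_, List.mem_append_left _ (Func.mem_pureHdrs.2 ⟨d, hd, rfl⟩), rfl⟩
  · refine hρ.2 _ ?_
    rw [vars_nums, List.mem_map]
    exact ⟨_, List.mem_append_right _ (Func.mem_redHdrs.2 ⟨b, hb, rfl⟩), rfl⟩

theorem Func.env_pure (hP : P.Valid) (hF : F ∈ P.funcs) (ρ : Env) (R : ℕ → Val) (c : List Val)
    (d : Fin F.arity) : F.env ρ R c (.pure (F.vars d)) = c.getD d .errMem := by
  have : (List.finRange F.arity).find? (fun d' => F.vars d' = F.vars d) = some d := by
    have h1 : ((List.finRange F.arity).find? (fun d' => F.vars d' = F.vars d)).isSome := by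
      rw [List.find?_isSome]
      exact ⟨d, List.mem_finRange d, by simp⟩
    obtain ⟨d', hd'⟩ := Option.isSome_iff_exists.1 h1
    rw [hd']
    have := List.find?_some hd'
    simp only [decide_eq_true_eq] at this
    rw [hP.pure_names F hF this]
  simp only [Func.env, this]

/-- The point `c` and the iteration agree in the dimensions looped over, and by separation no other
pure variable occurs in the stage. -/
theorem Func.env_eq (hP : P.Valid) (hF : F ∈ P.funcs) (hU : U ∈ F.stages) (hρ : Base z ρ)
    {c : List Val} (hc : F.Slice U ρ c) {e : AExpr} (he : e ∈ U.exprs) {x : Var} (hx : x ∈ e.vars) :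
    F.env z.env (fun r => ρ (.red r)) c x = ρ x := by
  rcases Func.vars_cases hP hF hU he hx with ⟨k, hk, rfl⟩ | ⟨d, hd, rfl⟩ | ⟨b, hb, rfl⟩
  · rw [hρ _ (by simp [Var.IsLoop])]; rfl
  · rw [Func.env_pure hP hF, List.getD_eq_getElem?_getD, hc d hd]; rfl
  · rfl

/-- The version `w` names the box on which the contents of the func are known while the stage runs.
An access that satisfies the query lies in this box by `hw`, and separation puts its point into the
slice of the iteration, the only part of the func about which anything is assumed. -/
theorem Func.self_reads (hP : P.Valid) (hF : P.funcs = pre ++ F :: post)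
    (hU : F.stages[i]? = some U) {G : ℕ → FunVal} {prev : FunVal} {σ : Store} (hk : Known η G pre σ)
    {b : Buffer} (hb : σ F.name = some b) (hm : b.AllocAs η F.name F.arity) {w : Ver}
    (hw : 0 < i → ∀ c, InBox η (.cpu F.name (.mid (i - 1) j)) c →
      (U.rdom ≠ [] → InBox η (.cpu F.name (F.ver i j)) c) → InBox η (.cpu F.name w) c)
    (hI : 0 < i → ∀ c, c.length = F.arity → InBox η (.cpu F.name w) c → F.Slice U ρ c →
      (prev c).Rel (b.val c)) {e : AExpr} (he : e ∈ U.exprs) {φ : ℕ → List Val → ℤ} :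
    ∀ g l n args, (Expr.acc g l n args).Sub e → ∀ p,
      p = (List.ofFn fun d : Fin n => ((args d).lower F.name (.mid (i - 1) j)).qval η φ ρ) →
      InBox η (.mem g) p → InBox η (.cpu g (if g = F.name then .mid (i - 1) j else .last)) p →
      (∀ st' ∈ some (F.label i j U), st'.func = g → st'.reductive = true → InBox η (.cpu g st'.ver) p) →
      ∃ b, σ g = some b ∧ b.InBounds p ∧ ((if g = F.name then prev else G g) p).Rel (b.val p) := by
  intro g l n args hs p hp h1 h2 h3
  rcases hP.refs hF hU he hs with ⟨H, hH, rfl, rfl⟩ | ⟨hi, rfl, rfl⟩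
  · have hne := hP.not_mem_pre hF hH
    rw [if_neg hne] at h2 ⊢
    obtain ⟨b', hb', hm', hv⟩ := hk H hH
    have hl : p.length = H.arity := by simp [hp]
    exact ⟨b', hb', hm'.inBounds hl h1, hv p hl h2⟩
  · rw [if_pos rfl] at h2 ⊢
    have hl : p.length = F.arity := by simp [hp]
    refine ⟨b, hb, hm.inBounds hl h1, hI hi p hl (hw hi p h2 fun hr => ?_) fun d hd => ?_⟩
    · exact h3 _ rfl rfl (by simpa [Func.label, List.isEmpty_iff] using hr)
    · have hF' : F ∈ P.funcs := by simp [hF]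
      rw [hp, List.getElem?_ofFn, dif_pos d.2, (hP.acc_self hF' hU he hs).2.2 d hd d.2]
      rfl

theorem Func.mem_reads (hP : P.Valid) (hF : P.funcs = pre ++ F :: post)
    (hU : F.stages[i]? = some U) {G : ℕ → FunVal} {σ : Store} (hk : Known η G pre σ)
    {b : Buffer} (hb : σ F.name = some b) (hm : b.AllocAs η F.name F.arity) {e : AExpr} (he : e ∈ U.exprs) :
    ∀ g l n args, (Expr.acc g l n args).Sub e → ∀ p : List Val, p.length = n → InBox η (.mem g) p →
      ∃ b, σ g = some b ∧ b.InBounds p := by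
  intro g l n args hs p hp h1
  rcases hP.refs hF hU he hs with ⟨H, hH, rfl, rfl⟩ | ⟨hi, rfl, rfl⟩
  · obtain ⟨b', hb', hm', -⟩ := hk H hH
    exact ⟨b', hb', hm'.inBounds hp h1⟩
  · exact ⟨b, hb, hm.inBounds hp h1⟩

/-- On the slice of the iteration the algorithm evaluates the stage under the same variables as the
run. If its new value at `c` is an error, only integrality is left to show. Otherwise strictness
makes predicate and indices error-free in the algorithm, so that they coincide with those of the
run, and both sides agree on whether `c` is overwritten. -/
theorem Func.core_run (hP : P.Valid) (hF : P.funcs = pre ++ F :: post)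
    {Γ : Hole → Expr Ver Empty} (hU : F.stages[i]? = some U)
    (hρ : IntOn z.env (Halide.vars ((F.hdrs i j U).map (Hdr.nums η z))) ρ) {G : ℕ → FunVal}
    (hG : ∀ g, (G g).Mono) {prev : FunVal} (hprev : prev.Mono) {σ : Store} (hk : Known η G pre σ)
    {b : Buffer} (hb : σ F.name = some b) (hm : b.AllocAs η F.name F.arity) {w : Ver}
    (hcw : ∀ c : List Val, c.length = F.arity → InBox η (.cpu F.name (F.ver i j)) c → InBox η (.cpu F.name w) c)
    (hw : ∀ c, InBox η (.cpu F.name (.mid (i - 1) j)) c →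
      (U.rdom ≠ [] → InBox η (.cpu F.name (F.ver i j)) c) → InBox η (.cpu F.name w) c)
    (hI : ∀ c, c.length = F.arity → InBox η (.cpu F.name w) c → F.Slice U ρ c → (prev c).Rel (b.val c))
    (hq : ∀ φ, (F.core i j U).query η φ (some (F.label i j U)) ρ) {t : List Act}
    (ht : ((F.core i j U).fill Γ).Tr ρ t) {o : Outcome} (hr : Run σ t o) :
    ∃ b', o = .done (Function.update σ F.name (some b')) ∧ b'.AllocAs η F.name F.arity ∧
      ∀ c, c.length = F.arity → InBox η (.cpu F.name (F.ver i j)) c → F.Slice U ρ c →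
        (F.pointUpdate U z.env G (fun r => ρ (.red r)) prev c).Rel (b'.val c) := by
  have hF' : F ∈ P.funcs := by simp [hF]
  have hU' := Func.stages_mem hU
  have hA := mono_self (f := F.name) hG hprev
  set A : ℕ → FunVal := fun g => if g = F.name then prev else G g with hAdef
  -- The query holds for all func values, in particular for those stored at present.
  set φ := storeVal σ with hφ
  have hreads := fun (e : AExpr) (he : e ∈ U.exprs) =>
    Func.self_reads (ρ := ρ) (j := j) (φ := φ) hP hF hU hk hb hm (fun _ => hw) (fun _ => hI) he
  have ev := fun (e : AExpr) (he : e ∈ U.exprs)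
      (hq : (e.lower F.name (.mid (i - 1) j)).queryCpu η φ ρ (some (F.label i j U))) =>
    e.lower_run (Γ := Γ) hA (hreads e he) (fun x hx => Func.vars_int hP hF' hU hρ he hx) hq
  have hmp : U.pred ∈ U.exprs := by simp [Update.exprs]
  have hmr : U.rhs ∈ U.exprs := by simp [Update.exprs]
  have hml : ∀ d, U.lhs d ∈ U.exprs := fun d => by simp [Update.exprs]
  -- values of the point update on the slice
  have hpu : ∀ c, F.Slice U ρ c → F.pointUpdate U z.env G (fun r => ρ (.red r)) prev c =
      Op.select.eval ![updateCond (fun d => (U.lhs d).eval ρ A Empty.elim) (U.pred.eval ρ A Empty.elim) c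
        (List.finRange F.arity), U.rhs.eval ρ A Empty.elim, prev c] := by
    intro c hc
    have he := fun (e : AExpr) (he : e ∈ U.exprs) => e.eval_congr (A := A) (η := Empty.elim)
      fun x hx => Func.env_eq hP hF' hU' (Func.base_of_intOn hP hF' hU hρ) hc he hx
    rw [Func.pointUpdate_eq, ← hAdef, he _ hmp, he _ hmr]
    simp only [he _ (hml _)]
  have hcase : ∀ c, F.Slice U ρ c → (F.pointUpdate U z.env G (fun r => ρ (.red r)) prev c).IsErr ∨
      (¬ (U.pred.eval ρ A Empty.elim).IsErr ∧ (∀ d, ¬ ((U.lhs d).eval ρ A Empty.elim).IsErr) ∧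
        ((U.pred.eval ρ A Empty.elim ≠ .int 0 ∧ ∀ d, (U.lhs d).eval ρ A Empty.elim = c.getD d .errMem) ∧
          F.pointUpdate U z.env G (fun r => ρ (.red r)) prev c = U.rhs.eval ρ A Empty.elim ∨
        ¬ (U.pred.eval ρ A Empty.elim ≠ .int 0 ∧ ∀ d, (U.lhs d).eval ρ A Empty.elim = c.getD d .errMem) ∧
          F.pointUpdate U z.env G (fun r => ρ (.red r)) prev c = prev c)) := by
    intro c hc
    rw [hpu c hc]
    rcases Op.eval_cases .select ![updateCond (fun d => (U.lhs d).eval ρ A Empty.elim)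
      (U.pred.eval ρ A Empty.elim) c (List.finRange F.arity), U.rhs.eval ρ A Empty.elim, prev c] with
      h | ⟨k, hk, h⟩
    · exact .inl h
    have k0 : updateCond (fun d => (U.lhs d).eval ρ A Empty.elim) (U.pred.eval ρ A Empty.elim) c
      (List.finRange F.arity) = .int (k (0 : Fin 3)) := hk (0 : Fin 3)
    have k1 : U.rhs.eval ρ A Empty.elim = .int (k (1 : Fin 3)) := hk (1 : Fin 3)
    have k2 : prev c = .int (k (2 : Fin 3)) := hk (2 : Fin 3)
    right
    rcases updateCond_cases (fun d => (U.lhs d).eval ρ A Empty.elim) (U.pred.eval ρ A Empty.elim) c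
      (List.finRange F.arity) with h' | ⟨⟨a, h1⟩, h2, -, h4⟩
    · rw [k0] at h'; exact absurd h' (Val.not_isErr_int _)
    refine ⟨by rw [h1]; exact Val.not_isErr_int _, fun d hd => ?_, ?_⟩
    · obtain ⟨a, ha⟩ := h2 d (List.mem_finRange d)
      rw [ha] at hd; exact Val.not_isErr_int _ hd
    · rw [k0] at h4
      simp only [List.mem_finRange, true_implies] at h4
      rw [← h4, h, k1, k2]
      simp only [Op.apply]
      by_cases hz : k (0 : Fin 3) = 0
      · right; simp [hz]
      · left; simp [hz]
  have hint : ∀ c, c.length = F.arity → InBox η (.cpu F.name (F.ver i j)) c → F.Slice U ρ c →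
      (prev c).Rel (b.val c) := fun c hl hc hs => hI c hl (hcw c hl hc) hs
  -- execution
  obtain ⟨hq1, hq2, -⟩ := hq φ
  simp only [Func.core, Stmt.fill] at ht
  obtain ⟨t₁, t₂, v, hv, rfl, hs⟩ := Stmt.tr_ite.1 ht
  obtain ⟨hpr, hpt⟩ := ev _ hmp hq1
  rw [run_append] at hr
  have hr' : Run σ t₂ o := by
    rcases hr with ⟨σ', h1, h2⟩ | ⟨k, h1, -⟩
    · have := (hpt _ _ hv _ h1).1
      cases this; exact h2
    · cases (hpt _ _ hv _ h1).1
  have hvq : v = (U.pred.lower F.name (.mid (i - 1) j)).qval η φ ρ := by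
    rcases hr with ⟨σ', h1, -⟩ | ⟨k, h1, -⟩
    · exact (hpt _ _ hv _ h1).2
    · cases (hpt _ _ hv _ h1).1
  rw [← hvq] at hpr
  rcases hs with ⟨hv0, hs⟩ | ⟨rfl, hs⟩
  · obtain ⟨qa, qb, qc, qd⟩ := hq2 (by rw [← hvq]; exact hv0)
    obtain ⟨ts, vs, t₃, x, hx, hvs, rfl⟩ := Stmt.tr_assign.1 hs
    rw [List.append_assoc, run_append] at hr'
    have hmemr := Func.mem_reads hP hF hU hk hb hm hmr
    have hr3 : Run σ t₃ (.done σ) ∧ Run σ ((List.ofFn ts).flatten ++ [.write F.name (List.ofFn vs) x]) o := by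
      rcases hr' with ⟨σ', h1, h2⟩ | ⟨k, h1, -⟩
      · have := U.rhs.lower_run_mem hA (hreads _ hmr) hmemr (fun x hx => Func.vars_int hP hF' hU hρ hmr hx)
          qc hx h1
        cases this; exact ⟨h1, h2⟩
      · cases U.rhs.lower_run_mem hA (hreads _ hmr) hmemr (fun x hx => Func.vars_int hP hF' hU hρ hmr hx)
          qc hx h1
    obtain ⟨h2, h3⟩ := run_ofFn_const (fun d o ho => ((ev _ (hml d) (qb d)).2 _ _ (hvs d) o ho).1) hr3.2
    have hvs' : ∀ d, vs d = ((U.lhs d).lower F.name (.mid (i - 1) j)).qval η φ ρ := fun d =>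
      ((ev _ (hml d) (qb d)).2 _ _ (hvs d) _ (h2 d)).2
    have hvse : List.ofFn vs = List.ofFn fun d => ((U.lhs d).lower F.name (.mid (i - 1) j)).qval η φ ρ := by
      congr 1; funext d; exact hvs' d
    have hin : b.InBounds (List.ofFn vs) := hm.inBounds (by simp) (by rw [hvse]; exact qa)
    rw [run_cons] at h3
    rcases h3 with ⟨σ', ⟨b₁, hb₁, -, rfl⟩, h4⟩ | ⟨k, ⟨-, hf⟩, -⟩
    swap
    · exact absurd ⟨b, hb, hin⟩ hf
    rw [hb] at hb₁; cases hb₁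
    refine ⟨_, run_nil.1 h4, hm, fun c hl hc hs => ?_⟩
    simp only [Buffer.set]
    by_cases hcv : c = List.ofFn vs
    · rw [if_pos hcv]
      obtain ⟨hx1, hx2⟩ := ev _ hmr (qd (by rw [← hvse, ← hcv]; exact hc))
      have hxv := (hx2 _ _ hx _ hr3.1).2
      rw [← hxv] at hx1
      refine ⟨hx1.1, ?_⟩
      rcases hcase c hs with h | ⟨e1, e2, ⟨-, h⟩ | ⟨hn, -⟩⟩
      · exact .inl h
      · rw [h]; exact hx1.2
      -- The run has written `c`. Predicate and indices being the same, the algorithm updates `c` as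
      -- well.
      · refine absurd ⟨?_, fun d => ?_⟩ hn
        · rcases hpr.2 with h | h
          · exact absurd h e1
          · rw [h]; exact hv0
        · rcases (ev _ (hml d) (qb d)).1.2 with h | h
          · exact absurd h (e2 d)
          · rw [h, ← hvs' d, hcv]; simp [List.getD_eq_getElem?_getD]
    · rw [if_neg hcv]
      have h0 := hint c hl hc hs
      refine ⟨h0.1, ?_⟩
      rcases hcase c hs with h | ⟨e1, e2, ⟨⟨-, hn⟩, h⟩ | ⟨-, h⟩⟩
      · exact .inl h
      -- The algorithm updates `c`, whereas the run has written another point, although the indices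
      -- coincide.
      · refine absurd (List.ext_getElem (by simp [hl]) fun d h₁ h₂ => ?_) hcv
        have hd : d < F.arity := hl ▸ h₁
        have := hn ⟨d, hd⟩
        rcases (ev _ (hml ⟨d, hd⟩) (qb ⟨d, hd⟩)).1.2 with h | h
        · exact absurd h (e2 ⟨d, hd⟩)
        · rw [h, ← hvs'] at this
          rw [List.getElem_ofFn, this]
          simp [List.getD_eq_getElem?_getD, h₁]
      · rw [h]; exact h0.2
  · rw [Stmt.tr_nop] at hs
    subst hs
    refine ⟨b, ?_, hm, fun c hl hc hs => ?_⟩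
    · rw [run_nil.1 hr', ← hb, Function.update_eq_self]
    · have h0 := hint c hl hc hs
      refine ⟨h0.1, ?_⟩
      rcases hcase c hs with h | ⟨e1, e2, ⟨⟨hn, -⟩, h⟩ | ⟨-, h⟩⟩
      · exact .inl h
      · rcases hpr.2 with h | h
        · exact absurd h e1
        · exact absurd h hn
      · rw [h]; exact h0.2

end Core

end Halide

namespace Halide

/-! ## Stages -/

theorem Act.Within.mono {f : ℕ} {A A' : List Val → Prop} (h : ∀ p, A p → A' p) {a : Act}
    (ha : a.Within f A) : a.Within f A' := by
  cases a with
  | read g p v => exact fun hg => h p (ha hg)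
  | write g p v => exact ⟨ha.1, h p ha.2⟩
  | _ => exact ha

section Threads

variable {m n : ℕ} {Γ : Hole → Expr Ver Empty} {z : Input m n}

theorem nodup_pureL_redL {N : List NumLoop} (h : (vars N).Nodup) : (vars (pureL N ++ redL N)).Nodup :=
  ((List.filter_append_perm (fun x : NumLoop => x.1.pureB) N).map Prod.fst).nodup_iff.2 h

theorem box_of_pureL_redL {N : List NumLoop} (h : (vars N).Nodup) {ρ e e' : Env}
    (he : Box ρ (pureL N) e) (he' : Box e (redL N) e') : Box ρ N e' := by
  refine (Box.congr fun x => ?_).1 (Box.append (nodup_pureL_redL h) he he')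
  rw [List.mem_append, mem_pureL, mem_redL]
  tauto

theorem purePart_of_box_redL {N : List NumLoop} (hl : ∀ v ∈ vars N, v.IsLoop) {e e' : Env}
    (he : Box z.env (pureL N) e) (he' : Box e (redL N) e') : purePart e' = e := by
  funext v
  by_cases hv : v.IsRed
  · rw [purePart_of_isRed _ hv, he.1, z.env_loop hv.isLoop]
    intro h
    exact (mem_vars_pureL.1 h).2.not_isRed hv
  · rw [purePart_of_not_isRed _ hv]
    refine he'.1 v fun h => hv ?_
    obtain ⟨x, hx, rfl⟩ := List.mem_map.1 h
    have hx' := mem_redL.1 hx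
    exact (Var.isLoop_iff.1 (hl _ (List.mem_map_of_mem hx'.1))).resolve_left hx'.2

/-- A trace of the loops of a stage interleaves the threads of the iterations of its pure loops. -/
theorem StageOK.threads (hΓ : Compatible m n Γ) {core tail : Stmt Hole} {Ls₀ Ls : List Hdr}
    {pureOnly strict : Prop} (h : StageOK m n core Ls₀ pureOnly strict Ls tail) {st : Option Stage}
    (hq : ∀ φ, (nest Ls tail).query (holeVal Γ z) φ st z.env) {t : List Act}
    (ht : ((nest Ls tail).fill Γ).Tr z.env t) :
    ∃ (N : List NumLoop) (dec decP : Env → Option Env) (ts : Env → List Act),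
      Sem Γ z core (Ls₀.map (Hdr.nums (holeVal Γ z) z)) N tail strict dec decP ∧ Inter ts t ∧
      (∀ e, ¬ Box z.env (pureL N) e → ts e = []) ∧
      ∀ e, Box z.env (pureL N) e → ∃ E : List Env, Conc (fun ρ t => (core.fill Γ).Tr ρ t) E (ts e) ∧
        (∀ ρ ∈ E, IntOn z.env (vars (Ls₀.map (Hdr.nums (holeVal Γ z) z))) ρ ∧
          decP e = some (purePart ρ) ∧ ∀ φ, core.query (holeVal Γ z) φ st ρ) ∧
        (Nonneg (redL (Ls₀.map (Hdr.nums (holeVal Γ z) z))) →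
          E = (decP e).elim [] (enum (redL (Ls₀.map (Hdr.nums (holeVal Γ z) z))))) := by
  obtain ⟨dec, decP, hsem⟩ := h.sem Γ z hΓ
  have hok := h.ok
  have hqi := fun φ => (nest_query_iff hok.closed hok.nodup (Base.refl z)).1 (hq φ)
  obtain ⟨ts, h1, h2, h3⟩ := nest_tr_inter hΓ hok.closed hok.nodup hok.serial (hqi fun _ _ => 0).1
    (Base.refl z) ht
  set N := Ls.map (Hdr.nums (holeVal Γ z) z) with hN
  have hnd : (vars N).Nodup := by rw [vars_nums]; exact hok.nodup
  have hl : ∀ v ∈ vars N, v.IsLoop := by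
    intro v hv
    rw [vars_nums, List.mem_map] at hv
    obtain ⟨x, hx, rfl⟩ := hv
    exact (hok.closed x hx).2.2
  refine ⟨N, dec, decP, ts, hsem, h1, h3, fun e he => ⟨(enum (redL N) e).filterMap dec, ?_, ?_, ?_⟩⟩
  · refine (conc_filterMap fun e' he' => ?_).1 (h2 e he)
    have hb := box_of_pureL_redL hnd he ((mem_enum (redL_nodup hnd)).1 he')
    have hs := hsem.sim e' hb.intOn
    constructor
    · intro ρ' hρ' t
      rw [hρ'] at hs
      exact hs.1 t
    · intro hn t
      rw [hn] at hs
      exact (hs.1 t).trans Stmt.tr_nop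
  · intro ρ' hρ'
    obtain ⟨e', he', hd⟩ := List.mem_filterMap.1 hρ'
    have hbr := (mem_enum (redL_nodup hnd)).1 he'
    have hb := box_of_pureL_redL hnd he hbr
    obtain ⟨k1, k2⟩ := hsem.dec_int e' hb.intOn ρ' hd
    rw [purePart_of_box_redL hl he hbr] at k2
    refine ⟨k1, k2, fun φ => ?_⟩
    have hs := hsem.sim e' hb.intOn
    rw [hd] at hs
    exact (hs.2 φ st).1 ((hqi φ).2 e' hb)
  · exact fun hnn => hsem.slice hnn e he.intOn

end Threads

section Stages

variable {P : Alg} {pre post : List Func} {F : Func} {i j : ℕ} {U : Update F.arity}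
  {z : Input P.nparams P.out.arity} {η : Hole → ℤ}

/-- The coordinates of the point in the dimensions looped over are the loop variables sought. They
are in range because the loops run over the compute bounds. -/
theorem Func.exists_slice (hP : P.Valid) (hF : F ∈ P.funcs) {v : Ver} {p : List Val}
    (hl : p.length = F.arity) (hp : InBox η (.cpu F.name v) p) (U : Update F.arity) :
    ∃ ρ, Box z.env ((F.pureHdrs v U).map (Hdr.nums η z)) ρ ∧ F.Slice U ρ p := by
  classical
  let ρ : Env := fun x => if ∃ d ∈ F.dims U, x = .pure (F.vars d) then
    F.env z.env (fun _ => .errMem) p x else z.env x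
  have h1 : ∀ d ∈ F.dims U, ∃ h : (d : ℕ) < p.length, ρ (.pure (F.vars d)) = p[(d : ℕ)] := by
    intro d hd
    have h : (d : ℕ) < p.length := by rw [hl]; exact d.2
    refine ⟨h, ?_⟩
    change (if _ then _ else _) = _
    rw [if_pos ⟨d, hd, rfl⟩, Func.env_pure hP hF, List.getD_eq_getElem _ _ h]
  refine ⟨ρ, box_pureHdrs.2 ⟨fun x hx => ?_, fun d hd => ?_⟩, fun d hd => ?_⟩
  · exact if_neg fun ⟨d, hd, h⟩ => hx d hd h
  · obtain ⟨h, e⟩ := h1 d hd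
    rw [e]
    exact hp d h
  · obtain ⟨h, e⟩ := h1 d hd
    rw [e, List.getElem?_eq_getElem h]

/-- Rdom bounds are closed, so their numbers are the same in both languages, and the loops of
lowering run through the points of the rdom in the order of unrolling. Unrolling starts without
values for the reduction variables, hence the condition on `ρ`. -/
theorem Func.update_eq_foldl (hP : P.Valid) (hF : F ∈ P.funcs) (hU : F.stages[i]? = some U)
    (G : ℕ → FunVal) (prev : FunVal) :
    (¬ Nonneg ((F.redHdrs i j U).map (Hdr.nums η z)) ∧ F.update z.env G prev U = fun _ => .errRdom) ∨
    Nonneg ((F.redHdrs i j U).map (Hdr.nums η z)) ∧ ∀ ρ : Env, (∀ r, ρ (.red r) = .errMem) →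
      F.update z.env G prev U = (enum ((F.redHdrs i j U).map (Hdr.nums η z)) ρ).foldl
        (fun g e => F.pointUpdate U z.env G (fun r => e (.red r)) g) prev := by
  have hb : ∀ b ∈ U.rdom, ∀ e, e = b.2.1 ∨ e = b.2.2 →
      (e.lower F.name (.mid (i - 1) j)).num η z = (e.eval z.env G Empty.elim).toInt := by
    intro b hb e he
    have := (hP.rdom hF (Func.stages_mem hU)).2 b hb
    have hc : e.AccFree := by rcases he with rfl | rfl; exacts [this.1.1, this.2.1]
    unfold Expr.num Expr.tval
    rw [hc.eval_lower]
  have hn : (F.redHdrs i j U).map (Hdr.nums η z) =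
      ((U.rdom.map fun b => (b.1, (b.2.1.eval z.env G Empty.elim).toInt,
        (b.2.2.eval z.env G Empty.elim).toInt)).reverse).map fun b => (Var.red b.1, b.2.1, b.2.2) := by
    rw [Func.redHdrs, List.map_reverse, List.map_reverse, List.map_map, List.map_map]
    congr 1
    refine List.map_congr_left fun b hb' => ?_
    simp only [Function.comp, Hdr.nums]
    rw [hb b hb' _ (.inl rfl), hb b hb' _ (.inr rfl)]
  have hneg : Nonneg ((F.redHdrs i j U).map (Hdr.nums η z)) ↔
      ¬ ∃ b ∈ U.rdom.map fun b => (b.1, (b.2.1.eval z.env G Empty.elim).toInt,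
        (b.2.2.eval z.env G Empty.elim).toInt), b.2.2 < 0 := by
    rw [hn]
    simp only [Nonneg, List.forall_mem_map, List.mem_reverse, not_exists, not_and, not_lt]
  by_cases h : Nonneg ((F.redHdrs i j U).map (Hdr.nums η z))
  · refine .inr ⟨h, fun ρ hρ => ?_⟩
    simp only [Func.update]
    rw [if_neg (hneg.1 h), hn, ← unroll_eq_foldl]
    simp only [hρ]
  · refine .inl ⟨h, ?_⟩
    simp only [Func.update]
    rw [if_pos (by rwa [hneg, not_not] at h)]

/-- A point update redefines the func everywhere, but the store of a single thread follows it on one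
slice only. This is enough, since all accesses to the func stay in this slice. -/
theorem Func.foldl_core_run (hP : P.Valid) (hF : P.funcs = pre ++ F :: post)
    {Γ : Hole → Expr Ver Empty} (hU : F.stages[i]? = some U) (hr : U.rdom ≠ []) {G : ℕ → FunVal}
    (hG : ∀ g, (G g).Mono) {ρ₀ : Env} {E : List Env}
    (hE : ∀ ρ ∈ E, IntOn z.env (Halide.vars ((F.hdrs i j U).map (Hdr.nums η z))) ρ ∧ purePart ρ = ρ₀ ∧
      ∀ φ, (F.core i j U).query η φ (some (F.label i j U)) ρ)
    {prev : FunVal} (hprev : prev.Mono) {σ : Store} (hk : Known η G pre σ)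
    {b : Buffer} (hb : σ F.name = some b) (hm : b.AllocAs η F.name F.arity)
    (hI : ∀ c, c.length = F.arity → InBox η (.cpu F.name (F.ver i j)) c → F.Slice U ρ₀ c →
      (prev c).Rel (b.val c)) {t : List Act}
    (ht : Conc (fun ρ t => ((F.core i j U).fill Γ).Tr ρ t) E t) {o : Outcome} (hrun : Run σ t o) :
    ∃ σ' b', o = .done σ' ∧ σ' F.name = some b' ∧
      ∀ c, c.length = F.arity → InBox η (.cpu F.name (F.ver i j)) c → F.Slice U ρ₀ c →
        (E.foldl (fun g e => F.pointUpdate U z.env G (fun r => e (.red r)) g) prev c).Rel (b'.val c) := by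
  induction E generalizing prev σ b t with
  | nil =>
    rw [conc_nil] at ht
    subst ht
    exact ⟨σ, b, run_nil.1 hrun, hb, hI⟩
  | cons ρ E ih =>
    obtain ⟨t₁, t₂, h1, h2, rfl⟩ := conc_cons.1 ht
    obtain ⟨k1, k2, k3⟩ := hE ρ (by simp)
    have hsl : ∀ c, F.Slice U ρ c ↔ F.Slice U ρ₀ c := fun c => by rw [← k2, Func.slice_purePart]
    have step := fun o (ho : Run σ t₁ o) => Func.core_run (w := F.ver i j) hP hF hU k1 hG hprev hk hb hm
      (fun c _ hc => hc) (fun c _ hc => hc hr) (fun c hl hc hs => hI c hl hc ((hsl c).1 hs)) k3 h1 ho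
    rcases run_append.1 hrun with ⟨σ₁, r1, r2⟩ | ⟨k, r1, -⟩
    · obtain ⟨b', e, m', hv⟩ := step _ r1
      cases e
      exact ih (fun ρ hρ => hE ρ (by simp [hρ])) (F.pointUpdate_mono U _ hG _ hprev)
        (hk.congr fun H hH => Function.update_of_ne (hP.not_mem_pre hF hH) _ _)
        (Function.update_self ..) m' (fun c hl hc hs => hv c hl hc ((hsl c).2 hs)) h2 r2
    · obtain ⟨b', e, -⟩ := step _ r1
      cases e

/-- Threads own disjoint slices, so each may be analysed on its own, starting from the values of the
previous stage. Its reduction iterations are those of the algorithm, in the same order. -/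
theorem Func.update_stage_run (hP : P.Valid) (hF : P.funcs = pre ++ F :: post)
    {Γ : Hole → Expr Ver Empty} (hΓ : Compatible P.nparams P.out.arity Γ)
    (hlen : ∀ f v d, 0 ≤ holeVal Γ z (.cpu f v d .len)) (hU : F.stages[i]? = some U)
    {Ls : List Hdr} {tail : Stmt Hole} {pureOnly strict : Prop}
    (hst : StageOK P.nparams P.out.arity (F.core i j U) (F.hdrs i j U) pureOnly strict Ls tail) (hs : strict)
    {G : ℕ → FunVal} (hG : ∀ g, (G g).Mono) {prev : FunVal} (hprev : prev.Mono) {σ : Store}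
    (hk : Known (holeVal Γ z) G pre σ) {b : Buffer} (hb : σ F.name = some b)
    (hm : b.AllocAs (holeVal Γ z) F.name F.arity)
    (hcont : ∀ c : List Val, c.length = F.arity → InBox (holeVal Γ z) (.cpu F.name (F.ver i j)) c →
      InBox (holeVal Γ z) (.cpu F.name (.mid (i - 1) j)) c)
    (hI : ∀ c, c.length = F.arity → InBox (holeVal Γ z) (.cpu F.name (.mid (i - 1) j)) c →
      (prev c).Rel (b.val c))
    (hq : ∀ φ, (nest Ls tail).query (holeVal Γ z) φ (some (F.label i j U)) z.env) {t : List Act}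
    (ht : ((nest Ls tail).fill Γ).Tr z.env t) {o : Outcome} (hr : Run σ t o) :
    ∃ σ' b', o = .done σ' ∧ (∀ g ≠ F.name, σ' g = σ g) ∧ σ' F.name = some b' ∧
      b'.AllocAs (holeVal Γ z) F.name F.arity ∧
      ∀ c, c.length = F.arity → InBox (holeVal Γ z) (.cpu F.name (F.ver i j)) c →
        (F.update z.env G prev U c).Rel (b'.val c) := by
  have hF' : F ∈ P.funcs := by simp [hF]
  obtain ⟨N, dec, decP, ts, hsem, hint, hout, hin⟩ := hst.threads hΓ hq ht
  have hnnP : Nonneg (pureL ((F.hdrs i j U).map (Hdr.nums (holeVal Γ z) z))) := by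
    rw [pureL_hdrs]; exact nonneg_pureHdrs hlen _
  -- A thread owns the slice of the lowered iteration to which it decodes. Strictness makes decoding
  -- injective, so that no slice has two owners.
  refine Exists.elim (Inter.run_disjoint (f := F.name)
    (A := fun e p => Box z.env (pureL N) e ∧ ∃ ρ₀, decP e = some ρ₀ ∧ F.Slice U ρ₀ p)
    (Post := fun e σ' => Box z.env (pureL N) e → ∀ ρ₀, decP e = some ρ₀ → ∃ b', σ' F.name = some b' ∧
      ∀ c, c.length = F.arity → InBox (holeVal Γ z) (.cpu F.name (F.ver i j)) c → F.Slice U ρ₀ c →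
        (F.update z.env G prev U c).Rel (b'.val c))
    ?_ ?_ ?_ hb ?_ hint hr) ?_
  · rintro e e' hne p ⟨he, ρ₀, hd, hsl⟩ ⟨he', ρ₀', hd', hsl'⟩
    have hb := hsem.box hs hnnP e ρ₀ he hd
    have hb' := hsem.box hs hnnP e' ρ₀' he' hd'
    rw [pureL_hdrs] at hb hb'
    have := Func.Slice.eq hb hb' hsl hsl'
    subst this
    exact hne (hsem.inj hs hnnP e e' ρ₀ he he' hd hd')
  · intro e a ha
    by_cases he : Box z.env (pureL N) e
    · obtain ⟨E, c1, c2, -⟩ := hin e he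
      obtain ⟨ρ, hρ, t', ht', ha'⟩ := c1.mem ha
      refine (core_within hP hF' hU ht' a ha').mono fun p hp => ⟨he, _, (c2 ρ hρ).2.1, ?_⟩
      exact Func.slice_purePart.2 hp
    · rw [hout e he] at ha
      cases ha
  · rintro e σ₁ σ₂ ⟨-, b₁, b₂, hb₁, hb₂, -, hv⟩ hpost he ρ₀ hd
    obtain ⟨b'', k1, k2⟩ := hpost he ρ₀ hd
    rw [hb₁] at k1
    cases k1
    refine ⟨b₂, hb₂, fun c hl hc hsl => ?_⟩
    rw [← hv c ⟨he, ρ₀, hd, hsl⟩]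
    exact k2 c hl hc hsl
  · intro e o ho
    by_cases he : Box z.env (pureL N) e
    swap
    · rw [hout e he] at ho
      exact ⟨σ, run_nil.1 ho, fun h => absurd h he⟩
    obtain ⟨E, c1, c2, c3⟩ := hin e he
    rw [redL_hdrs] at c3
    cases hd : decP e with
    | none =>
      have : E = [] := List.eq_nil_iff_forall_not_mem.2 fun ρ hρ => by
        have := (c2 ρ hρ).2.1
        rw [hd] at this
        cases this
      rw [this, conc_nil] at c1
      rw [c1] at ho
      exact ⟨σ, run_nil.1 ho, fun _ ρ₀ h => by cases h⟩
    | some ρ₀ =>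
      -- A decoded pure iteration has no values for reduction variables, like the environment in
      -- which unrolling starts.
      have hred : ∀ r, ρ₀ (.red r) = .errMem := by
        intro r
        rw [(hsem.decP_int e he.intOn ρ₀ hd).1 (.red r), z.env_loop (by simp [Var.IsLoop])]
        intro h
        exact (mem_vars_pureL.1 h).2.not_isRed (by simp [Var.IsRed])
      have hE : ∀ ρ ∈ E, IntOn z.env (Halide.vars ((F.hdrs i j U).map (Hdr.nums (holeVal Γ z) z))) ρ ∧
          purePart ρ = ρ₀ ∧ ∀ φ, (F.core i j U).query (holeVal Γ z) φ (some (F.label i j U)) ρ := by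
        intro ρ hρ
        obtain ⟨k1, k2, k3⟩ := c2 ρ hρ
        rw [hd] at k2
        exact ⟨k1, (Option.some.inj k2).symm, k3⟩
      suffices h : ∃ σ' b', o = .done σ' ∧ σ' F.name = some b' ∧
          ∀ c, c.length = F.arity → InBox (holeVal Γ z) (.cpu F.name (F.ver i j)) c → F.Slice U ρ₀ c →
            (F.update z.env G prev U c).Rel (b'.val c) by
        obtain ⟨σ', b', k1, k2, k3⟩ := h
        exact ⟨σ', k1, fun _ ρ₁ h1 => by cases h1; exact ⟨b', k2, k3⟩⟩
      -- Without an rdom a slice is updated only once, and accesses to the func see the previous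
      -- version, which is known on its own compute bounds. With an rdom they may see points written
      -- earlier in this stage, and contents are tracked on the compute bounds of this stage only;
      -- the query requires such accesses to lie there.
      by_cases hrd : U.rdom = []
      · have hnil : F.redHdrs i j U = [] := by simp [Func.redHdrs, hrd]
        have hEe : E = [ρ₀] := by
          rw [c3 (by simp [hnil, Nonneg]), hd, hnil]; rfl
        rw [hEe, conc_singleton] at c1
        obtain ⟨k1, k2, k3⟩ := hE ρ₀ (by simp [hEe])
        obtain ⟨b', e1, -, e3⟩ := Func.core_run (w := .mid (i - 1) j) hP hF hU k1 hG hprev hk hb hm hcont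
          (fun c hc _ => hc) (fun c hl hc _ => hI c hl hc) k3 c1 ho
        refine ⟨_, b', e1, Function.update_self .., ?_⟩
        rcases Func.update_eq_foldl (i := i) (j := j) (η := holeVal Γ z) hP hF' hU G prev with
          ⟨hn, -⟩ | ⟨-, hu⟩
        · exact absurd (by simp [hnil, Nonneg]) hn
        · rw [hu ρ₀ hred, hnil]
          exact e3
      · obtain ⟨σ', b', e1, e2, e3⟩ := Func.foldl_core_run hP hF hU hrd hG hE hprev hk hb hm
          (fun c hl hc _ => hI c hl (hcont c hl hc)) c1 ho
        refine ⟨σ', b', e1, e2, ?_⟩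
        -- If some rdom length is negative, every value of the algorithm is an error, which any
        -- integer refines; the iterations `E` need not be those of the algorithm then.
        rcases Func.update_eq_foldl (i := i) (j := j) (η := holeVal Γ z) hP hF' hU G prev with
          ⟨-, hu⟩ | ⟨hn, hu⟩
        · rw [hu]
          exact fun c hl hc hsl => ⟨(e3 c hl hc hsl).1, .inl (.inl rfl)⟩
        · rw [hu ρ₀ hred]
          rw [c3 hn, hd] at e3
          exact e3
  · rintro σ' ⟨h1, h2, ⟨b', h3, h4⟩, h5⟩
    refine ⟨σ', b', h1, h2, h3, by unfold Buffer.AllocAs; rw [h4]; exact hm, fun c hl hc => ?_⟩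
    -- Every point within the compute bounds is in the slice of a lowered iteration, and some thread
    -- covers that iteration.
    obtain ⟨ρ₀, hbox, hsl⟩ := Func.exists_slice (z := z) hP hF' hl hc U
    rw [← pureL_hdrs (j := j)] at hbox
    obtain ⟨e, he, hd⟩ := hsem.cover hnnP ρ₀ hbox
    obtain ⟨b'', k1, k2⟩ := h5 e he ρ₀ hd
    rw [h3] at k1
    cases k1
    exact k2 c hl hc hsl

/-- Nothing is assumed about redundant iterations: several threads may write the same point. They
never read the func itself, so each writes a value that depends on the point and on earlier funcs
only, and within the compute bounds it refines that of the algorithm. -/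
theorem Func.pure_stage_run (hP : P.Valid) (hF : P.funcs = pre ++ F :: post)
    {Γ : Hole → Expr Ver Empty} (hΓ : Compatible P.nparams P.out.arity Γ)
    (hlen : ∀ f v d, 0 ≤ holeVal Γ z (.cpu f v d .len)) (hU : F.stages[0]? = some U)
    {Ls : List Hdr} {tail : Stmt Hole} {pureOnly strict : Prop}
    (hst : StageOK P.nparams P.out.arity (F.core 0 j U) (F.hdrs 0 j U) pureOnly strict Ls tail)
    {G : ℕ → FunVal} (hG : ∀ g, (G g).Mono) {σ : Store}
    (hk : Known (holeVal Γ z) G pre σ) {b : Buffer} (hb : σ F.name = some b)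
    (hm : b.AllocAs (holeVal Γ z) F.name F.arity)
    (hq : ∀ φ, (nest Ls tail).query (holeVal Γ z) φ (some (F.label 0 j U)) z.env) {t : List Act}
    (ht : ((nest Ls tail).fill Γ).Tr z.env t) {o : Outcome} (hr : Run σ t o) :
    ∃ σ' b', o = .done σ' ∧ (∀ g ≠ F.name, σ' g = σ g) ∧ σ' F.name = some b' ∧
      b'.AllocAs (holeVal Γ z) F.name F.arity ∧
      ∀ c, c.length = F.arity → InBox (holeVal Γ z) (.cpu F.name (F.ver 0 j)) c →
        (F.stageVal z.env G 0 c).Rel (b'.val c) := by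
  have hF' : F ∈ P.funcs := by simp [hF]
  have hU0 := Func.stages_zero hU
  have hU' := Func.stages_mem hU
  have hdims : ∀ d, d ∈ F.dims U := fun d => Func.mem_dims.2 (by rw [hU0])
  have hnil : F.redHdrs 0 j U = [] := by simp [Func.redHdrs, hU0]
  obtain ⟨N, dec, decP, ts, hsem, hint, hout, hin⟩ := hst.threads hΓ hq ht
  have hnnP : Nonneg (pureL ((F.hdrs 0 j U).map (Hdr.nums (holeVal Γ z) z))) := by
    rw [pureL_hdrs]; exact nonneg_pureHdrs hlen _
  refine Exists.elim (Inter.run_writes (f := F.name)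
    (Good := fun c v => InBox (holeVal Γ z) (.cpu F.name (F.ver 0 j)) c →
      (F.stageVal z.env G 0 c).Rel v)
    (target := fun e p => Box z.env (pureL N) e ∧ ∃ ρ₀, decP e = some ρ₀ ∧ p.length = F.arity ∧
      F.Slice U ρ₀ p) hb ?_ hint hr) ?_
  · intro e
    by_cases he : Box z.env (pureL N) e
    swap
    · exact .inl ⟨hout e he, fun p h => he h.1⟩
    obtain ⟨E, c1, c2, c3⟩ := hin e he
    rw [redL_hdrs, hnil] at c3
    have c3 := c3 (by simp [Nonneg])
    cases hd : decP e with
    | none =>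
      rw [c3, hd, Option.elim_none, conc_nil] at c1
      refine .inl ⟨c1, ?_⟩
      rintro p ⟨-, ρ₀, h, -⟩
      cases h
    | some ρ₀ =>
      have hEe : E = [ρ₀] := by rw [c3, hd]; rfl
      rw [hEe, conc_singleton] at c1
      obtain ⟨k1, -, k3⟩ := c2 ρ₀ (by simp [hEe])
      right
      set ρ := ρ₀
      have hbase := Func.base_of_intOn hP hF' hU k1
      have hmr : U.rhs ∈ U.exprs := by simp [Update.exprs]
      -- The pure stage does not access its own func, so `prev` and `w` are placeholders.
      have hreads := Func.self_reads (ρ := ρ) (j := j) (φ := storeVal σ) (prev := G F.name)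
        (w := .last) hP hF hU hk hb hm (fun h => absurd h (lt_irrefl 0)) (fun h => absurd h (lt_irrefl 0)) hmr
      have hite : ∀ g, (if g = F.name then G F.name else G g) = G g := fun g => by
        split
        · rename_i h; rw [h]
        · rfl
      simp only [hite] at hreads
      have hmem := Func.mem_reads hP hF hU hk hb hm hmr
      have hvi := fun x hx => Func.vars_int hP hF' hU k1 hmr (x := x) hx
      have hlhs : ∀ d, U.lhs d = .var (.pure (F.vars d)) := fun d => Func.mem_dims.1 (hdims d)
      have hpred : U.pred = .const 1 := by rw [hU0]
      obtain ⟨-, hq2, -⟩ := k3 (storeVal σ)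
      -- The predicate of the pure stage is the constant `1`, which makes the query of the
      -- assignment available.
      obtain ⟨qa, qb, qc, qd⟩ := hq2 (by rw [hpred]; simp [Expr.lower, Expr.qval, Expr.eval])
      simp only [Func.core, Stmt.fill] at c1
      obtain ⟨t₁, t₂, v, hv, hte, hs⟩ := Stmt.tr_ite.1 c1
      rw [hpred, Expr.lower, Expr.fill, Expr.tr_const] at hv
      obtain ⟨rfl, rfl⟩ := hv
      rcases hs with ⟨-, hs⟩ | ⟨h, -⟩
      swap
      · simp at h
      obtain ⟨us, vs, t₃, x, hx, hvs, rfl⟩ := Stmt.tr_assign.1 hs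
      have hvs' : ∀ d, us d = [] ∧ vs d = ρ (.pure (F.vars d)) := by
        intro d
        have := hvs d
        rwa [hlhs, Expr.lower, Expr.fill, Expr.tr_var] at this
      have hus : (List.ofFn us).flatten = [] := by
        rw [show us = fun _ => [] from funext fun d => (hvs' d).1]; simp
      have hvse : List.ofFn vs = List.ofFn fun d =>
          ((U.lhs d).lower F.name (.mid (0 - 1) j)).qval (holeVal Γ z) (storeVal σ) ρ := by
        congr 1; funext d
        rw [(hvs' d).2, hlhs]; rfl
      refine ⟨t₃, List.ofFn vs, x, by rw [hte, hus]; simp, ?_, ?_, ?_⟩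
      · exact (expr_within hP hF' hU hmr hx).within fun p hp => absurd (hp rfl).1 (lt_irrefl 0)
      · intro o ho
        -- An iteration added by shift or round may write outside of the compute bounds. There the
        -- right-hand side is merely safe to evaluate, and nothing is claimed about the value.
        refine ⟨U.rhs.lower_run_mem hG hreads hmem hvi qc hx ho, hm.inBounds (by simp) (by rw [hvse]; exact qa),
          fun hc => ?_⟩
        obtain ⟨r1, r2⟩ := U.rhs.lower_run (Γ := Γ) hG hreads hvi (qd (by rw [← hvse]; exact hc))
        rw [(r2 _ _ hx _ ho).2]
        have hsl : F.Slice U ρ (List.ofFn vs) := fun d _ => by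
          rw [List.getElem?_ofFn, dif_pos d.2, (hvs' d).2]
        have hred : ∀ r, ρ (.red r) = .errMem := by
          intro r
          rw [(hsem.decP_int e he.intOn ρ hd).1 (.red r), z.env_loop (by simp [Var.IsLoop])]
          intro h
          exact (mem_vars_pureL.1 h).2.not_isRed (by simp [Var.IsRed])
        have heq : F.stageVal z.env G 0 (List.ofFn vs) = U.rhs.eval ρ G Empty.elim := by
          have := U.rhs.eval_congr (A := G) (η := Empty.elim) fun x hx =>
            Func.env_eq hP hF' hU' hbase hsl hmr hx
          rw [← this]
          simp only [hred]
          rw [hU0]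
          simp [Func.stageVal]
        rw [heq]
        exact r1
      · rintro p ⟨-, ρ₁, h, hl, hsl⟩
        cases h
        refine List.ext_getElem (by simp [hl]) fun d h₁ h₂ => ?_
        have hd : d < F.arity := hl ▸ h₁
        have := hsl ⟨d, hd⟩ (hdims _)
        rw [List.getElem?_eq_getElem h₁] at this
        rw [List.getElem_ofFn, (hvs' _).2]
        exact Option.some.inj this
  · rintro σ' ⟨h1, h2, b', h3, h4, h5⟩
    refine ⟨σ', b', h1, h2, h3, by unfold Buffer.AllocAs; rw [h4]; exact hm, fun c hl hc => ?_⟩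
    obtain ⟨ρ₀, hbox, hsl⟩ := Func.exists_slice (z := z) hP hF' hl hc U
    rw [← pureL_hdrs (j := j)] at hbox
    obtain ⟨e, he, hd⟩ := hsem.cover hnnP ρ₀ hbox
    exact h5 e c ⟨he, ρ₀, hd, hl, hsl⟩ hc

end Stages

end Halide

namespace Halide

/-! ## Programs -/

section Seqs

variable {Γ : Hole → Expr Ver Empty} {ρ : Env}

/-- The invariant is indexed by the number of statements executed, since each stage or func
establishes knowledge of its own. -/
theorem seqs_run {L : List (Stmt Hole)} {Q : ℕ → Store → Prop}
    (hstep : ∀ k s, L[k]? = some s → ∀ t σ o, (s.fill Γ).Tr ρ t → Q k σ → Run σ t o →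
      ∃ σ', o = .done σ' ∧ Q (k + 1) σ') {t : List Act} {σ : Store} {o : Outcome}
    (ht : ((seqs L).fill Γ).Tr ρ t) (hσ : Q 0 σ) (hr : Run σ t o) :
    ∃ σ', o = .done σ' ∧ Q L.length σ' := by
  induction L generalizing Q t σ with
  | nil =>
    rw [show ((seqs []).fill Γ) = Stmt.nop from rfl, Stmt.tr_nop] at ht
    subst ht
    exact ⟨σ, run_nil.1 hr, hσ⟩
  | cons s L ih =>
    obtain ⟨t₁, t₂, h1, h2, rfl⟩ := Stmt.tr_seq.1 ht
    rcases run_append.1 hr with ⟨σ₁, r1, r2⟩ | ⟨k, r1, -⟩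
    · obtain ⟨σ', e, hQ⟩ := hstep 0 s rfl _ _ _ h1 hσ r1
      cases e
      exact ih (Q := fun k => Q (k + 1)) (fun k s hs => hstep (k + 1) s hs) h2 hQ r2
    · obtain ⟨σ', e, -⟩ := hstep 0 s rfl _ _ _ h1 hσ r1
      cases e

theorem seqs_query {η : Hole → ℤ} {φ : ℕ → List Val → ℤ} {st : Option Stage} {L : List (Stmt Hole)}
    (h : (seqs L).query η φ st ρ) : ∀ s ∈ L, s.query η φ st ρ := by
  induction L with
  | nil => simp
  | cons s L ih => exact List.forall_mem_cons.2 ⟨h.1, ih h.2⟩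

end Seqs

/-- The query at the label of an update stage speaks of points with integer coordinates; a point in
a box is of this kind. -/
theorem InBox.eq_ofFn {η : Hole → ℤ} {h : ℕ → Side → Hole} {n : ℕ} {p : List Val} (hl : p.length = n)
    (hp : InBox η h p) : ∃ u : Fin n → ℤ, p = List.ofFn fun d => .int (u d) := by
  subst hl
  choose u hu using fun d : Fin p.length => hp d d.2
  refine ⟨u, List.ext_getElem (by simp) fun d h₁ h₂ => ?_⟩
  rw [List.getElem_ofFn]
  exact (hu ⟨d, h₁⟩).1

section Prog

variable {P : Alg} {ds : List LoopDir} {T : Prog Hole P.nparams P.out.arity}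
  {sp : ℕ → Option (List AExpr)} {B : ℕ → ℕ → ℕ → Stmt Hole} {pre post : List Func} {F : Func}
  {z : Input P.nparams P.out.arity} {Γ : Hole → Expr Ver Empty}

/-- The outcome of the code of `F` on the store `σ`. -/
def Func.Computed (F : Func) (η : Hole → ℤ) (A : FunVal) (σ : Store) (o : Outcome) : Prop :=
  ∃ σ' b, o = .done σ' ∧ (∀ g ≠ F.name, σ' g = σ g) ∧ σ' F.name = some b ∧ b.AllocAs η F.name F.arity ∧
    ∀ c, c.length = F.arity → InBox η (.cpu F.name .last) c → (A c).Rel (b.val c)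

theorem Func.stagesCode_run (hP : P.Valid) (h : Scheduled P ds T sp B)
    (hg : ∀ f i j, GuardsOnly ds f (i + 1) j) (hF : P.funcs = pre ++ F :: post)
    (hΓ : Compatible P.nparams P.out.arity Γ) (hlen : ∀ f v d, 0 ≤ holeVal Γ z (.cpu f v d .len))
    {G : ℕ → FunVal} (hG : ∀ g, (G g).Mono) {σ : Store} (hk : Known (holeVal Γ z) G pre σ) {b : Buffer}
    (hb : σ F.name = some b) (hm : b.AllocAs (holeVal Γ z) F.name F.arity) {j : ℕ}
    (hq : ∀ φ, (F.stagesCode B j).query (holeVal Γ z) φ none z.env) {t : List Act}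
    (ht : ((F.stagesCode B j).fill Γ).Tr z.env t) {o : Outcome} (hr : Run σ t o) :
    F.Computed (holeVal Γ z) (F.val z.env G) σ o := by
  have hF' : F ∈ P.funcs := by simp [hF]
  obtain ⟨σ', e, h1, b', h2, h3, h4⟩ := seqs_run (Γ := Γ) (ρ := z.env)
    -- After stage `i` the count is `i + 1`, and the buffer holds the version of this stage. Before
    -- the first stage nothing is claimed about the fresh contents.
    (Q := fun k σ' => (∀ g ≠ F.name, σ' g = σ g) ∧ ∃ b, σ' F.name = some b ∧
      b.AllocAs (holeVal Γ z) F.name F.arity ∧ ∀ i, k = i + 1 → ∀ c, c.length = F.arity →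
        InBox (holeVal Γ z) (.cpu F.name (F.ver i j)) c → (F.stageVal z.env G i c).Rel (b.val c))
    (fun k s hs t σ₁ o ht hQ hr => by
      obtain ⟨h1, b, hb, hm, hI⟩ := hQ
      have hk₁ : Known (holeVal Γ z) G pre σ₁ := hk.congr fun H hH => h1 _ (hP.not_mem_pre hF hH)
      have hqs := fun φ => seqs_query (hq φ) s (List.mem_of_getElem? hs)
      simp only [List.getElem?_map, List.getElem?_zipIdx, Option.map_map, Option.map_eq_some_iff,
        Function.comp, Nat.zero_add] at hs
      obtain ⟨U, hU, rfl⟩ := hs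
      obtain ⟨Ls, tail, hB, hst⟩ := h.stages F hF' k U hU j
      rw [hB] at hqs ht
      rw [Stmt.fill, Stmt.tr_label] at ht
      suffices hh : ∃ σ' b', o = .done σ' ∧ (∀ g ≠ F.name, σ' g = σ₁ g) ∧ σ' F.name = some b' ∧
          b'.AllocAs (holeVal Γ z) F.name F.arity ∧
          ∀ c, c.length = F.arity → InBox (holeVal Γ z) (.cpu F.name (F.ver k j)) c →
            (F.stageVal z.env G k c).Rel (b'.val c) by
        obtain ⟨σ', b', e1, e2, e3, e4, e5⟩ := hh
        refine ⟨σ', e1, fun g hg => (e2 g hg).trans (h1 g hg), b', e3, e4, ?_⟩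
        rintro i hi
        obtain rfl : k = i := by omega
        exact e5
      cases k with
      | zero => exact Func.pure_stage_run hP hF hΓ hlen hU hst hG hk₁ hb hm (fun φ => (hqs φ).2) ht hr
      | succ i =>
        have hu := Func.stages_succ hU
        have hlt : i < F.updates.length := (List.getElem?_eq_some_iff.1 hu).1
        have hver : F.ver i j = .mid i j := if_neg hlt.ne
        rw [F.stageVal_succ z.env G hu]
        refine Func.update_stage_run hP hF hΓ hlen hU hst (hg _ _ _) hG (F.stageVal_mono z.env hG i) hk₁ hb hm
          (fun c hl hc => ?_) (by rw [Nat.add_sub_cancel, ← hver]; exact hI i rfl) (fun φ => (hqs φ).2) ht hr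
        -- The query at the label says that the compute bounds of the stage are contained in those
        -- of the stage before, whose values are known.
        obtain ⟨u, rfl⟩ := hc.eq_ofFn hl
        exact (hqs fun _ _ => 0).1 i rfl u hc)
    ht ⟨fun _ _ => rfl, b, hb, hm, by simp⟩ hr
  refine ⟨σ', b', e, h1, h2, h3, ?_⟩
  have := h4 F.updates.length (by simp [Func.stages])
  rwa [show F.ver F.updates.length j = .last from if_pos rfl, F.stageVal_length] at this

/-- Conditions of specializations are closed, so the query and the run decide them alike, and the
query of the branch that is executed is at hand. -/
theorem Func.branchCode_ind {C : Outcome → Prop} {σ : Store}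
    (hC : ∀ j, (∀ φ, (F.stagesCode B j).query (holeVal Γ z) φ none z.env) →
      ∀ t, ((F.stagesCode B j).fill Γ).Tr z.env t → ∀ o, Run σ t o → C o)
    (hΓ : Compatible P.nparams P.out.arity Γ) {es : List AExpr}
    (hes : ∀ e ∈ es, e.Closed P.nparams P.out.arity) {j : ℕ}
    (hq : ∀ φ, (F.branchCode B es j).query (holeVal Γ z) φ none z.env) {t : List Act}
    (ht : ((F.branchCode B es j).fill Γ).Tr z.env t) {o : Outcome} (hr : Run σ t o) : C o := by
  induction es generalizing j t with
  | nil => exact hC 0 hq t (Stmt.tr_label.1 ht) o hr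
  | cons e es ih =>
    have hcl : e.toTgt.Closed P.nparams P.out.arity := (hes e (by simp)).lower
    obtain ⟨t₁, t₂, v, hv₀, rfl, hs⟩ := Stmt.tr_ite.1 ht
    obtain ⟨rfl, hv⟩ := (hcl.1.tr_fill hΓ (Base.refl z)).1 hv₀
    have hv' : ∀ φ, e.toTgt.qval (holeVal Γ z) φ z.env = v := fun φ => by rw [hcl.1.qval_eq, hv]
    rcases hs with ⟨h0, hs⟩ | ⟨h0, hs⟩
    · exact hC j (fun φ => (hq φ).2.1 (by rw [hv' φ]; exact h0)) t₂ (Stmt.tr_label.1 hs) o hr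
    · exact ih (fun e he => hes e (by simp [he])) (fun φ => (hq φ).2.2 (by rw [hv' φ]; exact h0)) hs hr

theorem Func.code_run (hP : P.Valid) (h : Scheduled P ds T sp B)
    (hg : ∀ f i j, GuardsOnly ds f (i + 1) j) (hF : P.funcs = pre ++ F :: post)
    (hΓ : Compatible P.nparams P.out.arity Γ) (hlen : ∀ f v d, 0 ≤ holeVal Γ z (.cpu f v d .len))
    {G : ℕ → FunVal} (hG : ∀ g, (G g).Mono) {σ : Store} (hk : Known (holeVal Γ z) G pre σ)
    (hq : ∀ φ, (F.code B (sp F.name)).query (holeVal Γ z) φ none z.env) {t : List Act}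
    (ht : ((F.code B (sp F.name)).fill Γ).Tr z.env t) {o : Outcome} (hr : Run σ t o) :
    F.Computed (holeVal Γ z) (F.val z.env G) σ o := by
  obtain ⟨t₁, t₂, h1, h2, rfl⟩ := Stmt.tr_seq.1 ht
  have h2 := Stmt.tr_label.1 h2
  have ha : t₁ = [.alloc F.name (List.ofFn fun d : Fin F.arity =>
      (.int (holeVal Γ z (.mem F.name d .min)), .int (holeVal Γ z (.mem F.name d .len))))] := by
    have hh : ∀ x t v, ((Expr.hole x : TExpr).fill Γ).Tr z.env t v → t = [] ∧ v = .int (holeVal Γ z x) :=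
      fun x t v hx => (Expr.AccFree.tr_fill (e := .hole x) hΓ (Base.refl z) trivial).1 hx
    rw [Stmt.fill] at h1
    cases h1 with
    | alloc _ _ _ _ u₁ u₂ lo len k1 k2 =>
      have e1 := fun d => hh _ _ _ (k1 d)
      have e2 := fun d => hh _ _ _ (k2 d)
      simp [e1, e2]
  subst ha
  have step : ∀ σ₀, Known (holeVal Γ z) G pre σ₀ → ∀ b, σ₀ F.name = some b →
      b.AllocAs (holeVal Γ z) F.name F.arity → Run σ₀ t₂ o → F.Computed (holeVal Γ z) (F.val z.env G) σ₀ o := by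
    intro σ₀ hk₀ b hb hm hr
    have hC := fun j (hq : ∀ φ, (F.stagesCode B j).query (holeVal Γ z) φ none z.env) t
        (ht : ((F.stagesCode B j).fill Γ).Tr z.env t) o (hr : Run σ₀ t o) =>
      Func.stagesCode_run hP h hg hF hΓ hlen hG hk₀ hb hm hq ht hr
    have hq' : ∀ φ, (F.specCode B (sp F.name)).query (holeVal Γ z) φ none z.env := fun φ => (hq φ).2
    cases hsp : sp F.name with
    | none =>
      rw [hsp] at hq' h2
      exact hC 0 hq' t₂ h2 o hr
    | some es =>
      rw [hsp] at hq' h2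
      exact Func.branchCode_ind hC hΓ (h.spec _ _ hsp) hq' h2 hr
  rw [List.singleton_append, run_cons] at hr
  rcases hr with ⟨σ₁, hs, hr⟩ | ⟨k, hf, -⟩
  swap
  · exact hf.elim
  have hs : σ₁ = Function.update σ F.name _ := hs
  subst hs
  obtain ⟨σ', b, e1, e2, e3⟩ := step _
    (hk.congr fun H hH => Function.update_of_ne (hP.not_mem_pre hF hH) _ _) ⟨_, fun _ => .errMem⟩
    (Function.update_self ..) rfl hr
  exact ⟨σ', b, e1, fun g hg => (e2 g hg).trans (Function.update_of_ne hg _ _), e3⟩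

/-- The code of a func changes no buffer but its own, so what is known about earlier funcs persists
while the later ones are computed. -/
theorem Scheduled.run (hP : P.Valid) (h : Scheduled P ds T sp B)
    (hg : ∀ f i j, GuardsOnly ds f (i + 1) j) (hΓ : Compatible P.nparams P.out.arity Γ)
    (hq : T.QueryAt Γ z) {t : List Act} (ht : (T.body.fill Γ).Tr z.env t) {o : Outcome}
    (hr : Run (fun _ => none) t o) :
    ∃ σ, o = .done σ ∧ Known (holeVal Γ z) (P.vals z.env P.funcs.length) P.funcs σ := by
  obtain ⟨hlen, hq, -⟩ := hq
  rw [h.body] at ht hq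
  obtain ⟨σ, e, hk⟩ := seqs_run (Γ := Γ) (ρ := z.env)
    (Q := fun k σ => Known (holeVal Γ z) (P.vals z.env k) (P.funcs.take k) σ)
    (fun k s hs t σ o ht hQ hr => by
      have hqs := fun φ => seqs_query (hq φ) s (List.mem_of_getElem? hs)
      rw [List.getElem?_map, Option.map_eq_some_iff] at hs
      obtain ⟨F, hF, rfl⟩ := hs
      obtain ⟨hlt, hFe⟩ := List.getElem?_eq_some_iff.1 hF
      have hsplit : P.funcs = P.funcs.take k ++ F :: P.funcs.drop (k + 1) := by
        rw [← hFe, ← List.drop_eq_getElem_cons hlt, List.take_append_drop]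
      obtain ⟨σ', b, e1, e2, e3, e4, e5⟩ := Func.code_run hP h hg hsplit hΓ hlen (P.vals_mono z.env k) hQ
        hqs ht hr
      refine ⟨σ', e1, ?_⟩
      rw [List.take_add_one, hF, Option.toList_some, P.vals_succ z.env hF]
      intro H hH
      rcases List.mem_append.1 hH with hH | hH
      · have hne := hP.not_mem_pre hsplit hH
        rw [e2 _ hne, Function.update_of_ne hne]
        exact hQ H hH
      · rw [List.mem_singleton.1 hH, Function.update_self]
        exact ⟨b, e3, e4, e5⟩)
    ht (by simp [Known]) hr
  refine ⟨σ, e, ?_⟩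
  rwa [List.length_map, List.take_length] at hk

/-- No run of the program fails, so the alternative of a failing assertion is not needed. -/
theorem Scheduled.confluent (hP : P.Valid) (h : Scheduled P ds T sp B)
    (hg : ∀ f i j, GuardsOnly ds f (i + 1) j) : Confluent P T := by
  rintro Q ⟨Γ, hΓ, hq, rfl⟩ z
  by_cases herr : ∃ p, z.Window p ∧ (P.run z p).IsErr
  · exact .inl herr
  refine .inr (.inr ⟨?_, ?_⟩)
  · obtain ⟨t, ht, o, ho⟩ := (T.body.fill Γ).exists_run z.env fun _ => none
    exact ⟨o, t, ht, ho⟩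
  · rintro o ⟨t, ht, hr⟩
    obtain ⟨σ, rfl, hk⟩ := h.run hP hg hΓ (hq z) ht hr
    obtain ⟨b, hb, -, hv⟩ := hk P.out (by simp [Alg.funcs])
    refine ⟨σ, b, rfl, by rw [← hb, ← h.out]; rfl, fun p hp => ?_⟩
    have hw := (hq z).2.2 p hp
    rw [h.out] at hw
    have hrun : P.vals z.env P.funcs.length P.out.name (List.ofFn fun d => .int (p d)) = P.run z p := by
      rw [Alg.vals, List.take_length]; rfl
    -- The window lies in the last compute bounds of the output func, and `P` has no errors there,
    -- so refinement is equality.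
    rcases (hv _ (by simp) hw).2 with h' | h'
    · exact absurd ⟨p, hp, hrun ▸ h'⟩ herr
    · rw [← hrun, h']

end Prog

end Halide

theorem mainTheorem4 (P : Alg) (hP : P.Valid) (S : Schedule) (hS : S.Valid P) (s : LoopDir)
    (hs : s.Valid (S.apply P)) :
    -- the new program is confluent with the algorithm
    Confluent P (s.apply (S.apply P)) ∧
    -- split: bounds queries and statement instances
    (∀ l xo xi fac φ, s = .split l xo xi fac φ →
      ∀ τ lo len b, (S.apply P).LoopAt l τ lo len b →
      ∀ Γ, Compatible P.nparams P.out.arity Γ → ∀ z,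
        (0 ≤ (len.eval z.env (fun _ _ => .errMem) fun h => .int (holeVal Γ z h)).toInt →
          (s.apply (S.apply P)).QueryAt Γ z → (S.apply P).QueryAt Γ z) ∧
        (φ = .guard → (S.apply P).QueryAt Γ z →
          (s.apply (S.apply P)).QueryAt Γ z ∧
          ((s.apply (S.apply P)).fill Γ).traces z ⊆ ((S.apply P).fill Γ).traces z ∧
          (τ = .serial →
            ((s.apply (S.apply P)).fill Γ).traces z = ((S.apply P).fill Γ).traces z))) ∧
    -- fuse: bounds queries and statement instances
    (∀ l y, s = .fuse l y →
      ∀ τ lo len τ' x' lo' len' b, (S.apply P).LoopAt l τ lo len (.loop τ' x' lo' len' b) →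
      ∀ Γ, Compatible P.nparams P.out.arity Γ → ∀ z,
        (0 ≤ (len.eval z.env (fun _ _ => .errMem) fun h => .int (holeVal Γ z h)).toInt →
          0 ≤ (len'.eval z.env (fun _ _ => .errMem) fun h => .int (holeVal Γ z h)).toInt →
          (s.apply (S.apply P)).QueryAt Γ z → (S.apply P).QueryAt Γ z) ∧
        ((S.apply P).QueryAt Γ z →
          (s.apply (S.apply P)).QueryAt Γ z ∧
          ((s.apply (S.apply P)).fill Γ).traces z ⊆ ((S.apply P).fill Γ).traces z ∧
          (τ = .serial → τ' = .serial →
            ((s.apply (S.apply P)).fill Γ).traces z = ((S.apply P).fill Γ).traces z))) ∧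
    -- the iterations of pure loops access disjoint points
    (∀ l : LoopName, l.var.IsPure → S.OnlyGuards l →
      ∀ Q ∈ (S.apply P).BI, ∀ z, Q.DisjointIterations l z) := by
  obtain ⟨sp, B, hsch⟩ := scheduled_apply hP hS
  -- Confluence holds for every program of the scheduled form, which the last directive preserves.
  -- Strictness is needed for update stages only, and there shift and round are not allowed.
  refine ⟨(hsch.apply hs).confluent hP (guardsOnly_update hS hs), ?_, ?_, ?_⟩
  · rintro l xo xi fac φ rfl τ lo len b hl Γ hΓ z
    exact hsch.split hs hl hΓ z
  · rintro l y rfl τ lo len τ' x' lo' len' b hl Γ hΓ z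
    exact hsch.fuse hs hl hΓ z
  · intro l hl hg Q hQ z
    exact hsch.disjointIterations hP hl
      (fun l' xo xi fac φ hm h1 h2 h3 => hg l' xo xi fac φ hm h1 h2 h3) hQ z
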